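/- Let $X$ be a compact Kähler manifold with Kähler metric $g$ and Kähler form $\omega=g(J\cdot,\cdot)$, let $E\to X$ be a complex vector bundle with a Hermitian metric, and let $\tau\in\mathbb R$. For a unitary connection $A$ on $E$ with covariant derivative $\nabla_A=d_A$ and curvature $F_A$, and a smooth section $\phi$ of $E$, put $\Lambda F_A=(F_A,\omega)$ (pointwise inner product with $\omega$) and $J_{A,\phi}=\frac12\big(d_A\phi\otimes\phi^*-\phi\otimes(d_A\phi)^*\big)$. Let $0<T\le+\infty$ and let $(A(t),\phi(t))$ be a smooth solution on $X\times[0,T)$ of the Yang–Mills–Higgs gradient flow $$\frac{\partial A}{\partial t}=-d_A^*F_A-J_{A,\phi},\qquad \frac{\partial\phi}{\partial t}=-d_A^*d_A\phi+\tfrac12\phi\,(\tau-|\phi|^2),$$ whose initial value is a gauged holomorphic map, that is, $F_{A(0)}^{0,2}=F_{A(0)}^{2,0}=0$ and $\bar\partial_{A(0)}\phi(0)=0$. Let $$\hat e=\Big|\Lambda F_A-\frac i2(\phi\otimes\phi^*-\tau I)\Big|^2,$$ where $|B|^2=\operatorname{tr}(BB^*)$ on $\operatorname{End}E$. Then $\hat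 e(t,\cdot)$ is smooth on $X$ for every $t\in[0,T)$, and on $X\times[0,T)$ $$\Big(\frac{\partial}{\partial t}+\Delta\Big)\hat e=-2\Big|\nabla_A\Big(\Lambda F_A-\frac i2\phi\otimes\phi^*\Big)\Big|^2-2\Big|\frac i2(|\phi|^2-\tau)\phi-\Lambda F_A\phi\Big|^2,$$ where $\Delta=\nabla^*\nabla$ is the non-negative Laplacian on functions and the time derivative at $t=0$ is one-sided. Consequently $\sup_X\hat e(t,\cdot)$ is a nonincreasing function of $t\in[0,T)$. -/

import Mathlib

open Set Filter Topology Manifold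
open scoped ContDiff ComplexConjugate

noncomputable section

namespace YMH

/-! ### Model spaces -/

/-- The model space `ℂ^m` of an `m`-dimensional complex manifold. -/
abbrev Cn (m : ℕ) := EuclideanSpace ℂ (Fin m)

/-- The model fibre `ℂ^r` of a Hermitian vector bundle of rank `r`. -/
abbrev Fib (r : ℕ) := EuclideanSpace ℂ (Fin r)

/-- Endomorphisms of the model fibre. -/
abbrev EndF (r : ℕ) := Fib r →L[ℂ] Fib r

/-- A complex manifold is in particular a smooth real manifold. -/
instance realManifold (m : ℕ) (X : Type*) [TopologicalSpace X] [ChartedSpace (Cn m) X]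
    [IsManifold 𝓘(ℂ, Cn m) ω X] : IsManifold 𝓘(ℝ, Cn m) ∞ X := by
  refine isManifold_of_contDiffOn _ _ _ fun e e' he he' => ?_
  have h := HasGroupoid.compatible (G := contDiffGroupoid ω 𝓘(ℂ, Cn m)) he he'
  rw [contDiffGroupoid, mem_groupoid_of_pregroupoid] at h
  replace h := h.1
  simp only [contDiffPregroupoid, modelWithCornersSelf_coe, modelWithCornersSelf_coe_symm, Function.id_comp,
    Function.comp_id, preimage_id_eq, id_eq, range_id, inter_univ] at h ⊢
  exact (h.restrict_scalars ℝ).of_le (by exact_mod_cast le_top)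

/-! ### Calculus in a coordinate patch

An open subset of `ℂ^m` carries real coordinate directions `∂/∂x_j`, `∂/∂y_j`.  Below, `h` is the
coordinate expression of a Riemannian metric, `a` the connection form of a unitary connection in a
unitary frame, `p` the components of a section of the bundle in that frame, and `B` the matrix of
an endomorphism of the bundle. -/

section Patch

variable {m r : ℕ}

/-- Labels of the real coordinates: `(j, 0)` is `x_j` and `(j, 1)` is `y_j`, where
`z_j = x_j + i y_j`. -/
abbrev Idx (m : ℕ) := Fin m × Fin 2

/-- The coordinate vectors `∂/∂x_j` and `∂/∂y_j`. -/
def dir (k : Idx m) : Cn m :=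
  EuclideanSpace.single k.1 (if k.2 = 0 then 1 else Complex.I)

/-- Partial derivative in the `k`-th real coordinate direction. -/
def pd {W : Type*} [NormedAddCommGroup W] [NormedSpace ℝ W] (k : Idx m) (f : Cn m → W)
    (z : Cn m) : W :=
  fderiv ℝ f z (dir k)

/-- The Gram matrix `g_{kl}` of the metric. -/
def gram (h : Cn m → Cn m → Cn m → ℝ) (z : Cn m) : Matrix (Idx m) (Idx m) ℝ :=
  Matrix.of fun k l => h z (dir k) (dir l)

/-- The entries `g^{kl}` of the inverse Gram matrix. -/
def ginv (h : Cn m → Cn m → Cn m → ℝ) (k l : Idx m) (z : Cn m) : ℝ :=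
  (gram h z)⁻¹ k l

/-- The Christoffel symbols `Γ^n_{kl}` of the Levi-Civita connection. -/
def christoffel (h : Cn m → Cn m → Cn m → ℝ) (n k l : Idx m) (z : Cn m) : ℝ :=
  (1 / 2) * ∑ q, ginv h n q z *
    (pd k (fun y => gram h y q l) z + pd l (fun y => gram h y q k) z
      - pd q (fun y => gram h y k l) z)

/-- The fundamental two-form `ω(v, w) = g(J v, w)`, where `J` is multiplication by `i`. -/
def fundForm (h : Cn m → Cn m → Cn m → ℝ) (z v w : Cn m) : ℝ :=
  h z (Complex.I • v) w

/-- The positive Laplacian `Δ f = - g^{kl} (∂_k ∂_l f - Γ^n_{kl} ∂_n f)` on functions. -/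
def laplacian (h : Cn m → Cn m → Cn m → ℝ) (f : Cn m → ℝ) (z : Cn m) : ℝ :=
  -∑ k, ∑ l, ginv h k l z *
    (pd k (fun y => pd l f y) z - ∑ n, christoffel h n k l z * pd n f z)

/-- Covariant derivative `∇_v p = ∂_v p + a(v) p` of a section. -/
def covSec (a : Cn m → Cn m →L[ℝ] EndF r) (p : Cn m → Fib r) (z v : Cn m) : Fib r :=
  fderiv ℝ p z v + a z v (p z)

/-- Covariant derivative `∇_v B = ∂_v B + [a(v), B]` of an endomorphism. -/
def covEnd (a : Cn m → Cn m →L[ℝ] EndF r) (B : Cn m → EndF r) (z v : Cn m) : EndF r :=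
  fderiv ℝ B z v + (a z v ∘L B z - B z ∘L a z v)

/-- Curvature `F(v, w) = (da)(v, w) + [a(v), a(w)]`, for constant vectors `v`, `w`. -/
def curv (a : Cn m → Cn m →L[ℝ] EndF r) (z v w : Cn m) : EndF r :=
  fderiv ℝ a z v w - fderiv ℝ a z w v + (a z v ∘L a z w - a z w ∘L a z v)

/-- The component of type `(0,2)` of the curvature. -/
def curv02 (a : Cn m → Cn m →L[ℝ] EndF r) (z v w : Cn m) : EndF r :=
  (1 / 4 : ℂ) • (curv a z v w + Complex.I • curv a z (Complex.I • v) w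
    + Complex.I • curv a z v (Complex.I • w) - curv a z (Complex.I • v) (Complex.I • w))

/-- The component of type `(2,0)` of the curvature. -/
def curv20 (a : Cn m → Cn m →L[ℝ] EndF r) (z v w : Cn m) : EndF r :=
  (1 / 4 : ℂ) • (curv a z v w - Complex.I • curv a z (Complex.I • v) w
    - Complex.I • curv a z v (Complex.I • w) - curv a z (Complex.I • v) (Complex.I • w))

/-- The `(0,1)`-part `∂̄_A p` of the covariant derivative of a section. -/
def dbarSec (a : Cn m → Cn m →L[ℝ] EndF r) (p : Cn m → Fib r) (z v : Cn m) : Fib r :=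
  (1 / 2 : ℂ) • (covSec a p z v + Complex.I • covSec a p z (Complex.I • v))

/-- `Λ F = (F, ω) = ½ g^{kp} g^{lq} ω_{pq} F_{kl}`, the pointwise inner product of the curvature
with the fundamental form. -/
def lamCurv (h : Cn m → Cn m → Cn m → ℝ) (a : Cn m → Cn m →L[ℝ] EndF r)
    (z : Cn m) : EndF r :=
  (1 / 2 : ℝ) • ∑ k, ∑ l, ∑ p, ∑ q,
    (ginv h k p z * ginv h l q z * fundForm h z (dir p) (dir q)) • curv a z (dir k) (dir l)

/-- `d_A^* d_A p = ∇_A^* ∇_A p = - g^{kl} (∇_k ∇_l p - Γ^n_{kl} ∇_n p)`. -/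
def dstarD (h : Cn m → Cn m → Cn m → ℝ) (a : Cn m → Cn m →L[ℝ] EndF r)
    (p : Cn m → Fib r) (z : Cn m) : Fib r :=
  -∑ k, ∑ l, ginv h k l z •
    (covSec a (fun y => covSec a p y (dir l)) z (dir k)
      - ∑ n, christoffel h n k l z • covSec a p z (dir n))

/-- The `j`-th component of `d_A^* F_A`, that is `- g^{kl} (∇_k F)_{lj}`, where `∇` is the
connection induced by the Levi-Civita connection and `A`. -/
def dstarCurv (h : Cn m → Cn m → Cn m → ℝ) (a : Cn m → Cn m →L[ℝ] EndF r)
    (z : Cn m) (j : Idx m) : EndF r :=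
  -∑ k, ∑ l, ginv h k l z •
    (covEnd a (fun y => curv a y (dir l) (dir j)) z (dir k)
      - ∑ n, christoffel h n k l z • curv a z (dir n) (dir j)
      - ∑ n, christoffel h n k j z • curv a z (dir l) (dir n))

/-- `v ⊗ w^*`, the endomorphism `u ↦ ⟨u, w⟩ v` (linear in `u`). -/
def tensorStar (v w : Fib r) : EndF r := InnerProductSpace.rankOne ℂ v w

/-- `J_{A,φ}(v) = ½ (∇_v φ ⊗ φ^* - φ ⊗ (∇_v φ)^*)`. -/
def current (a : Cn m → Cn m →L[ℝ] EndF r) (p : Cn m → Fib r) (z v : Cn m) : EndF r :=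
  (1 / 2 : ℝ) • (tensorStar (covSec a p z v) (p z) - tensorStar (p z) (covSec a p z v))

/-- `Λ F_A - (i/2) (φ ⊗ φ^* - τ I)`. -/
def moment (h : Cn m → Cn m → Cn m → ℝ) (τ : ℝ) (a : Cn m → Cn m →L[ℝ] EndF r)
    (p : Cn m → Fib r) (z : Cn m) : EndF r :=
  lamCurv h a z - (Complex.I / 2) • (tensorStar (p z) (p z) - (τ : ℂ) • ContinuousLinearMap.id ℂ _)

/-- The real inner product `Re tr(B C^*)` of endomorphisms. -/
def hsInner (B C : EndF r) : ℝ :=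
  ∑ s : Fin r, (inner ℂ (C (EuclideanSpace.single s 1)) (B (EuclideanSpace.single s 1))).re

/-- `|∇_A B|² = g^{kl} ⟨∇_k B, ∇_l B⟩`. -/
def normSqCovEnd (h : Cn m → Cn m → Cn m → ℝ) (a : Cn m → Cn m →L[ℝ] EndF r)
    (B : Cn m → EndF r) (z : Cn m) : ℝ :=
  ∑ k, ∑ l, ginv h k l z * hsInner (covEnd a B z (dir k)) (covEnd a B z (dir l))

end Patch

/-! ### Kähler metrics -/

section Global

variable {m r : ℕ} {X : Type*} [TopologicalSpace X] [ChartedSpace (Cn m) X]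
  [IsManifold 𝓘(ℂ, Cn m) ω X] {ι : Type*}

/-- The holomorphic charts of `X`. -/
abbrev holCharts (m : ℕ) (X : Type*) [TopologicalSpace X] [ChartedSpace (Cn m) X] :
    Set (OpenPartialHomeomorph X (Cn m)) :=
  IsManifold.maximalAtlas 𝓘(ℂ, Cn m) ω X

/-- The differential of the inverse of a chart: it sends a coordinate vector at `z` to a tangent
vector of `X`. -/
def chartVec (e : OpenPartialHomeomorph X (Cn m)) (z : Cn m) :
    Cn m →L[ℝ] TangentSpace 𝓘(ℝ, Cn m) (e.symm z) :=
  mfderiv 𝓘(ℝ, Cn m) 𝓘(ℝ, Cn m) e.symm z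

/-- Smooth Riemannian metrics on `X`. -/
abbrev RMetric (m : ℕ) (X : Type*) [TopologicalSpace X] [ChartedSpace (Cn m) X]
    [IsManifold 𝓘(ℂ, Cn m) ω X] :=
  Bundle.ContMDiffRiemannianMetric 𝓘(ℝ, Cn m) ∞ (Cn m)
    (fun x : X => TangentSpace 𝓘(ℝ, Cn m) x)

/-- The coordinate expression of a Riemannian metric in a chart. -/
def metricIn (g : RMetric m X) (e : OpenPartialHomeomorph X (Cn m))
    (z v w : Cn m) : ℝ :=
  g.inner (e.symm z) (chartVec e z v) (chartVec e z w)

/-- A Riemannian metric on a complex manifold is Kähler if it is invariant under the complex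
structure and its fundamental form is closed. -/
structure IsKahler (g : RMetric m X) : Prop where
  hermitian : ∀ e ∈ holCharts m X, ∀ z ∈ e.target, ∀ v w : Cn m,
    metricIn g e z (Complex.I • v) (Complex.I • w) = metricIn g e z v w
  closed : ∀ e ∈ holCharts m X, ∀ z ∈ e.target, ∀ u v w : Cn m,
    fderiv ℝ (fun y => fundForm (metricIn g e) y v w) z u
      + fderiv ℝ (fun y => fundForm (metricIn g e) y w u) z v
      + fderiv ℝ (fun y => fundForm (metricIn g e) y u v) z w = 0

/-! ### Hermitian vector bundles, unitary connections and sections -/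

variable (m r X ι) in
/-- A smooth complex vector bundle of rank `r` with a smooth Hermitian metric, given by the smooth
unitary transition functions between local unitary frames: if `s_i` are the components of a section
in the frame with index `i`, then `s_j = coordChange i j s_i`. -/
structure HermitianBundle extends VectorBundleCore ℂ X (Fib r) ι where
  smooth_coordChange : ∀ i j, ContMDiffOn 𝓘(ℝ, Cn m) 𝓘(ℝ, EndF r) ∞
    (coordChange i j) (baseSet i ∩ baseSet j)
  unitary_coordChange : ∀ i j, ∀ x ∈ baseSet i ∩ baseSet j, ∀ v, ‖coordChange i j x v‖ = ‖v‖

/-- The fibre of the bundle at a point. -/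
abbrev HermitianBundle.E (Z : HermitianBundle m r X ι) (x : X) : Type _ :=
  Z.toVectorBundleCore.Fiber x

/-- The part of a holomorphic chart `e` over which the frame with index `i` is defined. -/
def HermitianBundle.patch (Z : HermitianBundle m r X ι) (e : OpenPartialHomeomorph X (Cn m))
    (i : ι) : Set (Cn m) :=
  e.target ∩ e.symm ⁻¹' Z.baseSet i

/-- The components of a section in the frame with index `i`, read in the chart `e`. -/
def secIn (Z : HermitianBundle m r X ι) (φ : ∀ x, Z.E x) (e : OpenPartialHomeomorph X (Cn m))
    (i : ι) (z : Cn m) : Fib r :=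
  Z.coordChange (Z.indexAt (e.symm z)) i (e.symm z) (φ (e.symm z))

/-- The pull-back to a chart of a matrix-valued one-form on `X`. -/
def formIn (α : ∀ x : X, TangentSpace 𝓘(ℝ, Cn m) x →L[ℝ] EndF r)
    (e : OpenPartialHomeomorph X (Cn m)) (z : Cn m) : Cn m →L[ℝ] EndF r :=
  (α (e.symm z)) ∘L (chartVec e z)

/-- A smooth unitary connection: connection forms with values in the skew-Hermitian endomorphisms,
one for each local unitary frame, which satisfy the gauge transformation law
`A_j = g A_i g⁻¹ - dg g⁻¹`, where `g = coordChange i j`. -/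
structure UnitaryConnection (Z : HermitianBundle m r X ι) where
  form : ι → ∀ x : X, TangentSpace 𝓘(ℝ, Cn m) x →L[ℝ] EndF r
  skew : ∀ i, ∀ x ∈ Z.baseSet i, ∀ v, ContinuousLinearMap.adjoint (form i x v) = -form i x v
  gauge : ∀ i j, ∀ x ∈ Z.baseSet i ∩ Z.baseSet j, ∀ v : TangentSpace 𝓘(ℝ, Cn m) x,
    form j x v ∘L Z.coordChange i j x
        + mvfderiv 𝓘(ℝ, Cn m) (Z.coordChange i j) x v
      = Z.coordChange i j x ∘L form i x v
  smooth : ∀ i, ∀ e ∈ holCharts m X, ContDiffOn ℝ ∞ (formIn (form i) e) (Z.patch e i)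

/-- The connection form in the frame with index `i`, read in the chart `e`. -/
def UnitaryConnection.formAt {Z : HermitianBundle m r X ι} (A : UnitaryConnection Z)
    (e : OpenPartialHomeomorph X (Cn m)) (i : ι) : Cn m → Cn m →L[ℝ] EndF r :=
  formIn (A.form i) e

/-- The pair `(A, φ)` is a gauged holomorphic map: the curvature of `A` is of type `(1,1)` and
`∂̄_A φ = 0`. -/
structure IsGaugedHolomorphic {Z : HermitianBundle m r X ι} (A : UnitaryConnection Z)
    (φ : ∀ x, Z.E x) : Prop where
  curv02_eq : ∀ e ∈ holCharts m X, ∀ i, ∀ z ∈ Z.patch e i, ∀ v w, curv02 (A.formAt e i) z v w = 0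
  curv20_eq : ∀ e ∈ holCharts m X, ∀ i, ∀ z ∈ Z.patch e i, ∀ v w, curv20 (A.formAt e i) z v w = 0
  dbar_eq : ∀ e ∈ holCharts m X, ∀ i, ∀ z ∈ Z.patch e i, ∀ v,
    dbarSec (A.formAt e i) (secIn Z φ e i) z v = 0

/-! ### The gradient flow -/

/-- The time interval `[0, T)`, with `T ≤ +∞`. -/
def timeInterval (T : EReal) : Set ℝ := {t | 0 ≤ t ∧ (t : EReal) < T}

/-- `(A, φ)` is a smooth solution on `X × [0, T)` of the gradient flow equations
`∂A/∂t = - d_A^* F_A - J_{A,φ}`, `∂φ/∂t = - d_A^* d_A φ + ½ (τ - |φ|²) φ`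
of the Yang–Mills–Higgs functional. -/
structure IsFlow (g : RMetric m X) (Z : HermitianBundle m r X ι) (τ : ℝ) (T : EReal)
    (A : ℝ → UnitaryConnection Z) (φ : ℝ → ∀ x, Z.E x) : Prop where
  smooth_conn : ∀ e ∈ holCharts m X, ∀ i,
    ContDiffOn ℝ ∞ (fun q : ℝ × Cn m => (A q.1).formAt e i q.2) (timeInterval T ×ˢ Z.patch e i)
  smooth_sec : ∀ e ∈ holCharts m X, ∀ i,
    ContDiffOn ℝ ∞ (fun q : ℝ × Cn m => secIn Z (φ q.1) e i q.2) (timeInterval T ×ˢ Z.patch e i)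
  eq_conn : ∀ t ∈ timeInterval T, ∀ e ∈ holCharts m X, ∀ i, ∀ z ∈ Z.patch e i, ∀ j,
    HasDerivWithinAt (fun s => (A s).formAt e i z (dir j))
      (-dstarCurv (metricIn g e) ((A t).formAt e i) z j
        - current ((A t).formAt e i) (secIn Z (φ t) e i) z (dir j)) (timeInterval T) t
  eq_sec : ∀ t ∈ timeInterval T, ∀ e ∈ holCharts m X, ∀ i, ∀ z ∈ Z.patch e i,
    HasDerivWithinAt (fun s => secIn Z (φ s) e i z)
      (-dstarD (metricIn g e) ((A t).formAt e i) (secIn Z (φ t) e i) z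
        + (1 / 2 * (τ - ‖secIn Z (φ t) e i z‖ ^ 2) : ℝ) • secIn Z (φ t) e i z)
      (timeInterval T) t

/-- The function `ê = |Λ F_A - (i/2) (φ ⊗ φ^* - τ I)|²` on `X`, computed at each point in the
preferred chart and the preferred unitary frame of that point. -/
def energyDensity (g : RMetric m X) {Z : HermitianBundle m r X ι} (τ : ℝ)
    (A : UnitaryConnection Z) (φ : ∀ x, Z.E x) (x : X) : ℝ :=
  let e := chartAt (Cn m) x
  let i := Z.indexAt x
  let Ψ := moment (metricIn g e) τ (A.formAt e i) (secIn Z φ e i) (e x)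
  hsInner Ψ Ψ

end Global

end YMH

end

/-! Write `Ψ = ΛF - (i/2)(φ ⊗ φ^* - τ)` (`mom` below), so that the energy density is `|Ψ|²`. The
theorem rests on two facts: the flow keeps `(A, φ)` gauged holomorphic, and on gauged holomorphic
pairs the velocity of the flow is expressed through `Ψ` alone.

For the second fact, let `F^{0,2} = 0` and `∂̄φ = 0`. The `(1,2)`-part of the Bianchi identity shows
that the `(0,1)`-part of `-d_A^*F` is `∂̄` of the metric trace of `F^{1,1}` (`divF_part01`), and
this trace is `iΛF` (`lam_eq`). The current contributes `½ φ ⊗ (∂φ)^*`, so the `(0,1)`-part of the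
velocity of `A` is `∂̄(iΨ)`. Skewness then gives `∂_t A(v) = -∇_{iv}Ψ` (`velocity_eq`). The
Weitzenböck formula `trG_cD_cD` gives `∂_t φ = -iΨφ` (`section_velocity_eq`). Inserting both, `∂_t Ψ
= -∇^*∇Ψ - ½(Ψ φ⊗φ^* + φ⊗φ^* Ψ)`. Pairing with `Ψ` and adding the Laplacian of `|Ψ|²` leaves
`-2|∇Ψ|² - 2|Ψφ|²` (`energy_identity`). The constant `τ` is parallel, and `Ψφ` is, up to sign, the
second vector in the statement.

For the first fact, `F^{0,2}` and `∂̄φ` together satisfy a parabolic system along the flow. The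
leading part is the rough Laplacian, and every other term is linear in `F^{0,2}`, `∂̄φ` and their
first derivatives, with coefficients that are smooth along the given solution (`dcur02_flow`,
`dM_flow`). A Bochner estimate turns this into `(∂_t + Δ)u ≤ C u`, locally in time and space, for `u
= |F^{0,2}|² + |∂̄φ|²` (`IsLocalFlow.exists_obstrNorm_le`). The part `F^{2,0}` is minus the adjoint
of `F^{0,2}` and is not tracked. By compactness one `C` serves on `[0, t] × X`, and the maximum
principle `le_mul_exp_of_deriv_add_laplacian_le` with initial value zero forces `u = 0`. The same
principle with `C = 0`, applied to `|Ψ|²`, gives the monotonicity of the supremum.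

The computations are made in one holomorphic chart and one unitary frame, without normal
coordinates. They use that the Christoffel map of a Kähler metric is complex bilinear
(`gam_I_right`) and that the metric trace kills forms which are complex linear, or antilinear, in
both slots (`trG_eq_zero`). Sections and endomorphisms are handled together: endomorphisms form an
algebra `𝔄` acting on the fibre `W` by `ρ`, and both induced connections are instances of `cD`, with
`dP` and `dM` its parts of type `(1,0)` and `(0,1)`. The passage to `X` uses that `|Ψ|²` and `u` do
not depend on chart and frame (`IsTransition.energy_eq`, `IsTransition.obstrNorm_eq`). -/

noncomputable section

namespace YMH

set_option linter.unusedSectionVars false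
set_option linter.unusedSimpArgs false
set_option linter.unusedVariables false

section

variable {m r : ℕ}

/-! ### Real coordinates on the model space -/

/-- The real coordinates of a vector of `ℂ^m`. -/
def crd (k : Idx m) (v : Cn m) : ℝ := if k.2 = 0 then (v k.1).re else (v k.1).im

theorem sum_crd_smul_dir (v : Cn m) : ∑ k, crd k v • dir k = v := by
  ext j
  rw [Fintype.sum_prod_type]
  simp only [Fin.sum_univ_two, crd, dir]
  simp only [PiLp.add_apply, WithLp.ofLp_sum, WithLp.ofLp_add, WithLp.ofLp_smul, Finset.sum_apply, Pi.add_apply, Pi.smul_apply,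
    EuclideanSpace.single, PiLp.toLp_apply, Pi.single_apply]
  rw [Finset.sum_eq_single j]
  · apply Complex.ext <;> simp
  · intro b _ hb
    simp [Ne.symm hb]
  · simp

theorem crd_add (k : Idx m) (v w : Cn m) : crd k (v + w) = crd k v + crd k w := by
  unfold crd; split_ifs <;> simp

theorem crd_smul (k : Idx m) (c : ℝ) (v : Cn m) : crd k (c • v) = c * crd k v := by
  unfold crd; split_ifs <;> simp

theorem crd_dir (k l : Idx m) : crd k (dir l) = if k = l then 1 else 0 := by
  obtain ⟨k, a⟩ := k
  obtain ⟨l, b⟩ := l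
  fin_cases a <;> fin_cases b <;> by_cases hkl : k = l <;>
    simp [crd, dir, hkl, Prod.ext_iff]

theorem I_smul_dir_zero (j : Fin m) : Complex.I • dir (j, 0) = dir (j, 1) := by
  ext i; by_cases h : i = j <;> simp [dir, h]

theorem I_smul_dir_one (j : Fin m) : Complex.I • dir (j, 1) = -dir (j, 0) := by
  ext i; by_cases h : i = j <;> simp [dir, h]

theorem I_smul_I_smul {W : Type*} [AddCommGroup W] [Module ℂ W] (v : W) :
    Complex.I • Complex.I • v = -v := by
  rw [smul_smul, Complex.I_mul_I, neg_one_smul]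

section Bilin

variable {E W : Type*} [AddCommGroup E] [Module ℝ E] [AddCommGroup W] [Module ℝ W]

theorem _root_.IsBilinearMap.sum_left {B : E → E → W} (hB : IsBilinearMap ℝ B) {κ : Type*}
    (s : Finset κ) (c : κ → ℝ) (f : κ → E) (w : E) :
    B (∑ k ∈ s, c k • f k) w = ∑ k ∈ s, c k • B (f k) w := by
  have h := map_sum (hB.toLinearMap.flip w) (fun k => c k • f k) s
  simp only [map_smul] at h
  exact h

theorem _root_.IsBilinearMap.sum_right {B : E → E → W} (hB : IsBilinearMap ℝ B) {κ : Type*}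
    (s : Finset κ) (c : κ → ℝ) (f : κ → E) (w : E) :
    B w (∑ k ∈ s, c k • f k) = ∑ k ∈ s, c k • B w (f k) := by
  have h := map_sum (hB.toLinearMap w) (fun k => c k • f k) s
  simp only [map_smul] at h
  exact h

theorem _root_.IsBilinearMap.neg_left {B : E → E → W} (hB : IsBilinearMap ℝ B) (v w : E) :
    B (-v) w = -B v w := by
  rw [← neg_one_smul ℝ v, hB.smul_left, neg_one_smul]

theorem _root_.IsBilinearMap.neg_right {B : E → E → W} (hB : IsBilinearMap ℝ B) (v w : E) :
    B v (-w) = -B v w := by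
  rw [← neg_one_smul ℝ w, hB.smul_right, neg_one_smul]

end Bilin

/-! ### Metrics on an open set -/

/-- `h` is the coordinate expression of a smooth Riemannian metric on the open set `U`. -/
structure IsMetricOn (h : Cn m → Cn m → Cn m → ℝ) (U : Set (Cn m)) : Prop where
  isOpen : IsOpen U
  smooth : ∀ v w, ContDiffOn ℝ ∞ (fun y => h y v w) U
  bilin : ∀ z ∈ U, IsBilinearMap ℝ (h z)
  symm : ∀ z ∈ U, ∀ v w, h z v w = h z w v
  pos : ∀ z ∈ U, ∀ v, v ≠ 0 → 0 < h z v v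

/-- `h` is the coordinate expression of a Kähler metric on the open set `U`. -/
structure IsKahlerOn (h : Cn m → Cn m → Cn m → ℝ) (U : Set (Cn m)) : Prop
    extends IsMetricOn h U where
  hermitian : ∀ z ∈ U, ∀ v w, h z (Complex.I • v) (Complex.I • w) = h z v w
  closed : ∀ z ∈ U, ∀ u v w : Cn m,
    fderiv ℝ (fun y => fundForm h y v w) z u + fderiv ℝ (fun y => fundForm h y w u) z v
      + fderiv ℝ (fun y => fundForm h y u v) z w = 0

/-- The metric trace of a bilinear form. -/
def trG {W : Type*} [AddCommGroup W] [Module ℝ W] (h : Cn m → Cn m → Cn m → ℝ) (z : Cn m)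
    (B : Cn m → Cn m → W) : W :=
  ∑ k, ∑ l, ginv h k l z • B (dir k) (dir l)

section Metric

variable {h : Cn m → Cn m → Cn m → ℝ} {U : Set (Cn m)} {z : Cn m}

theorem _root_.IsBilinearMap.eq_sum {W : Type*} [AddCommGroup W] [Module ℝ W] {B : Cn m → Cn m → W}
    (hB : IsBilinearMap ℝ B) (v w : Cn m) :
    B v w = ∑ k, ∑ l, (crd k v * crd l w) • B (dir k) (dir l) := by
  conv_lhs => rw [← sum_crd_smul_dir v, ← sum_crd_smul_dir w]
  rw [hB.sum_left]
  refine Finset.sum_congr rfl fun k _ => ?_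
  rw [hB.sum_right, Finset.smul_sum]
  simp only [smul_smul]

theorem IsMetricOn.posDef (H : IsMetricOn h U) (hz : z ∈ U) : (gram h z).PosDef := by
  refine Matrix.PosDef.of_dotProduct_mulVec_pos ?_ ?_
  · ext k l
    simp [gram, H.symm z hz (dir k) (dir l)]
  · intro x hx
    have h0 : (∑ k, x k • dir k : Cn m) ≠ 0 := by
      intro h0
      apply hx
      ext k
      have : crd k (∑ k, x k • dir k : Cn m) = ∑ l, x l * crd k (dir l) := by
        have := map_sum (⟨⟨crd k, crd_add k⟩, crd_smul k⟩ : Cn m →ₗ[ℝ] ℝ)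
          (fun k => x k • dir k) Finset.univ
        simp only [LinearMap.coe_mk, AddHom.coe_mk, crd_smul] at this
        exact this
      rw [h0] at this
      simp only [crd_dir] at this
      simpa [crd] using this.symm
    have := H.pos z hz _ h0
    rw [(H.bilin z hz).sum_left] at this
    simp only [(H.bilin z hz).sum_right] at this
    simpa [dotProduct, Matrix.mulVec, gram, Finset.mul_sum, mul_comm, mul_left_comm] using this

theorem IsMetricOn.isUnit_det (H : IsMetricOn h U) (hz : z ∈ U) : IsUnit (gram h z).det :=
  (H.posDef hz).det_pos.ne'.isUnit

theorem IsMetricOn.ginv_symm (H : IsMetricOn h U) (hz : z ∈ U) (k l : Idx m) :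
    ginv h k l z = ginv h l k z := by
  have := (H.posDef hz).inv.isHermitian
  simpa [ginv] using (this.apply k l).symm

theorem IsMetricOn.posDef_ginv (H : IsMetricOn h U) (hz : z ∈ U) :
    (Matrix.of fun k l => ginv h k l z).PosDef :=
  (H.posDef hz).inv

theorem IsMetricOn.sum_ginv_mul_right (H : IsMetricOn h U) (hz : z ∈ U) (k : Idx m) (w : Cn m) :
    ∑ l, ginv h k l z * h z (dir l) w = crd k w := by
  have key : ∀ n, ∑ l, ginv h k l z * h z (dir l) (dir n) = if k = n then 1 else 0 := by
    intro n
    have := congrFun₂ (Matrix.nonsing_inv_mul _ (H.isUnit_det hz)) k n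
    simpa [Matrix.mul_apply, gram, ginv, Matrix.one_apply] using this
  have h1 : ∀ l, h z (dir l) w = ∑ n, crd n w * h z (dir l) (dir n) := by
    intro l
    conv_lhs => rw [← sum_crd_smul_dir w]
    rw [(H.bilin z hz).sum_right]; rfl
  simp only [h1, Finset.mul_sum]
  rw [Finset.sum_comm]
  simp only [mul_left_comm, ← Finset.mul_sum, key]
  simp

theorem IsMetricOn.sum_ginv_mul_left (H : IsMetricOn h U) (hz : z ∈ U) (k : Idx m) (w : Cn m) :
    ∑ l, ginv h k l z * h z w (dir l) = crd k w := by
  simp only [H.symm z hz w, H.sum_ginv_mul_right hz]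

theorem IsMetricOn.contDiffOn_gram (H : IsMetricOn h U) (k l : Idx m) :
    ContDiffOn ℝ ∞ (fun y => gram h y k l) U :=
  H.smooth _ _

theorem contDiffOn_det {n : Type*} [Fintype n] [DecidableEq n] {M : Cn m → Matrix n n ℝ}
    (hM : ∀ k l, ContDiffOn ℝ ∞ (fun y => M y k l) U) : ContDiffOn ℝ ∞ (fun y => (M y).det) U := by
  simp only [Matrix.det_apply]
  refine ContDiffOn.sum fun σ _ => ContDiffOn.const_smul _ (contDiffOn_prod fun i _ => hM _ _)

theorem IsMetricOn.contDiffOn_ginv (H : IsMetricOn h U) (k l : Idx m) :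
    ContDiffOn ℝ ∞ (fun y => ginv h k l y) U := by
  -- Cramer's rule: each entry of the inverse is a quotient of determinants, which are polynomials
  -- in the entries.
  have h1 : ∀ y, ginv h k l y = (gram h y).det⁻¹ * ((gram h y).updateRow l (Pi.single k 1)).det := by
    intro y
    simp [ginv, Matrix.inv_def, Matrix.adjugate_apply]
  simp only [h1]
  refine ContDiffOn.mul (ContDiffOn.inv (contDiffOn_det H.contDiffOn_gram)
    fun z hz => (H.posDef hz).det_pos.ne') (contDiffOn_det fun i j => ?_)
  by_cases hi : i = l
  · subst hi; simpa using contDiffOn_const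
  · simpa [Matrix.updateRow_ne hi] using H.contDiffOn_gram i j

/-- The inverse Gram matrix transforms contravariantly. -/
theorem sum_ginv_transform {h' : Cn m → Cn m → Cn m → ℝ} {U' : Set (Cn m)} {z' : Cn m}
    (H : IsMetricOn h U) (hz : z ∈ U) (H' : IsMetricOn h' U') (hz' : z' ∈ U')
    {L : Cn m →ₗ[ℝ] Cn m} (hL : ∀ v w, h' z' v w = h z (L v) (L w)) (p q : Idx m) :
    ∑ k, ∑ l, ginv h' k l z' * (crd p (L (dir k)) * crd q (L (dir l))) = ginv h p q z := by
  set T : Matrix (Idx m) (Idx m) ℝ := Matrix.of fun p k => crd p (L (dir k))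
  have h1 : gram h' z' = T.transpose * gram h z * T := by
    ext k l
    simp only [gram, Matrix.of_apply, hL]
    rw [IsBilinearMap.eq_sum (H.bilin z hz)]
    simp only [Matrix.mul_apply, Matrix.transpose_apply, Matrix.of_apply, T, Finset.sum_mul,
      smul_eq_mul]
    rw [Finset.sum_comm]
    refine Finset.sum_congr rfl fun p _ => Finset.sum_congr rfl fun q _ => by ring
  -- Invertibility of the Jacobian is not assumed: it is forced by the factorisation of the
  -- invertible matrix `gram h' z'`.
  have hT : IsUnit T.det := by
    have := H'.isUnit_det hz'
    rw [h1, Matrix.det_mul] at this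
    exact isUnit_of_mul_isUnit_right this
  have hTt : IsUnit T.transpose.det := by rwa [Matrix.det_transpose]
  have h2 : T * (gram h' z')⁻¹ * T.transpose = (gram h z)⁻¹ := by
    rw [h1, Matrix.mul_inv_rev, Matrix.mul_inv_rev, ← Matrix.mul_assoc,
      Matrix.mul_nonsing_inv _ hT, Matrix.one_mul, Matrix.mul_assoc,
      Matrix.nonsing_inv_mul _ hTt, Matrix.mul_one]
  have h3 := congrFun₂ h2 p q
  simp only [Matrix.mul_apply, Matrix.transpose_apply, Finset.sum_mul] at h3
  rw [Finset.sum_comm]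
  refine Eq.trans ?_ h3
  refine Finset.sum_congr rfl fun p _ => Finset.sum_congr rfl fun q _ => ?_
  simp only [ginv, T, Matrix.of_apply]; ring

theorem trG_transform {W : Type*} [AddCommGroup W] [Module ℝ W]
    {h' : Cn m → Cn m → Cn m → ℝ} {U' : Set (Cn m)} {z' : Cn m}
    (H : IsMetricOn h U) (hz : z ∈ U) (H' : IsMetricOn h' U') (hz' : z' ∈ U')
    {L : Cn m →ₗ[ℝ] Cn m} (hL : ∀ v w, h' z' v w = h z (L v) (L w)) {B : Cn m → Cn m → W}
    (hB : IsBilinearMap ℝ B) :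
    trG h' z' (fun v w => B (L v) (L w)) = trG h z B := by
  unfold trG
  have h1 : ∀ k l, ginv h' k l z' • B (L (dir k)) (L (dir l)) = ∑ p, ∑ q,
      (ginv h' k l z' * (crd p (L (dir k)) * crd q (L (dir l)))) • B (dir p) (dir q) := by
    intro k l
    rw [hB.eq_sum, Finset.smul_sum]
    refine Finset.sum_congr rfl fun p _ => ?_
    rw [Finset.smul_sum]
    simp only [smul_smul]
  simp only [h1, ← sum_ginv_transform H hz H' hz' hL, Finset.sum_smul]
  rw [Finset.sum_congr rfl fun k _ => Finset.sum_comm, Finset.sum_comm]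
  refine Finset.sum_congr rfl fun p _ => ?_
  rw [Finset.sum_congr rfl fun k _ => Finset.sum_comm, Finset.sum_comm]

section Trace

variable {W : Type*} [AddCommGroup W] [Module ℝ W]

theorem trG_add (B C : Cn m → Cn m → W) :
    trG h z (fun v w => B v w + C v w) = trG h z B + trG h z C := by
  simp [trG, Finset.sum_add_distrib]

theorem trG_sub (B C : Cn m → Cn m → W) :
    trG h z (fun v w => B v w - C v w) = trG h z B - trG h z C := by
  simp [trG, Finset.sum_sub_distrib, smul_sub]

theorem trG_neg (B : Cn m → Cn m → W) : trG h z (fun v w => -B v w) = -trG h z B := by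
  simp [trG]

theorem trG_map {V : Type*} [AddCommGroup V] [Module ℝ V] (f : W →ₗ[ℝ] V) (B : Cn m → Cn m → W) :
    trG h z (fun v w => f (B v w)) = f (trG h z B) := by
  simp [trG]

theorem trG_smul {W : Type*} [AddCommGroup W] [Module ℂ W] [Module ℝ W] [IsScalarTower ℝ ℂ W] (c : ℂ) (B : Cn m → Cn m → W) :
    trG h z (fun v w => c • B v w) = c • trG h z B := by
  simp only [trG, Finset.smul_sum]
  refine Finset.sum_congr rfl fun p _ => Finset.sum_congr rfl fun q _ => ?_
  rw [smul_comm]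

theorem trG_congr {B C : Cn m → Cn m → W} (hBC : ∀ k l, B (dir k) (dir l) = C (dir k) (dir l)) :
    trG h z B = trG h z C := by
  simp [trG, hBC]

theorem IsMetricOn.trG_swap (H : IsMetricOn h U) (hz : z ∈ U) (B : Cn m → Cn m → W) :
    trG h z (fun v w => B w v) = trG h z B := by
  unfold trG
  rw [Finset.sum_comm]
  simp only [H.ginv_symm hz]

end Trace

section Kahler

/-- Multiplication by `i` is an isometry of the metric, so the transformation law of the inverse
Gram matrix holds with this map as Jacobian and with the same metric on both sides. Reading it off
on `x` and `y` directions gives the two relations. -/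
theorem IsKahlerOn.ginv_hermitian (H : IsKahlerOn h U) (hz : z ∈ U) (i j : Fin m) :
    ginv h (i, 1) (j, 1) z = ginv h (i, 0) (j, 0) z ∧
      ginv h (i, 1) (j, 0) z = -ginv h (i, 0) (j, 1) z := by
  have key := sum_ginv_transform (L := (LinearMap.lsmul ℂ (Cn m) Complex.I).restrictScalars ℝ)
    H.toIsMetricOn hz H.toIsMetricOn hz (fun v w => (H.hermitian z hz v w).symm)
  have h0 : ∀ (n : Fin m) (c : ℝ), crd (m := m) (n, 1) 0 = 0 := by intros; simp [crd]
  have e := fun p q => key p q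
  simp only [LinearMap.coe_restrictScalars, LinearMap.lsmul_apply, Fintype.sum_prod_type,
    Fin.sum_univ_two, I_smul_dir_zero, I_smul_dir_one] at e
  have hn : ∀ k (v : Cn m), crd k (-v) = -crd k v := by
    intro k v; rw [← neg_one_smul ℝ, crd_smul]; ring
  simp only [hn, crd_dir, Prod.mk.injEq] at e
  constructor
  · rw [← e (i, 1) (j, 1)]; simp
  · rw [← e (i, 1) (j, 0)]; simp

theorem sum_idx {W : Type*} [AddCommMonoid W] (f : Idx m → Idx m → W) :
    ∑ k, ∑ l, f k l = ∑ i, ∑ j, (f (i, 0) (j, 0) + f (i, 0) (j, 1) + (f (i, 1) (j, 0)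
      + f (i, 1) (j, 1))) := by
  simp only [Fintype.sum_prod_type, Fin.sum_univ_two, Finset.sum_add_distrib]
  abel

/-- The metric trace vanishes on forms that are complex linear, or complex antilinear, in both
variables. -/
theorem IsKahlerOn.trG_eq_zero {W : Type*} [AddCommGroup W] [Module ℂ W] [Module ℝ W]
    [IsScalarTower ℝ ℂ W] (H : IsKahlerOn h U) (hz : z ∈ U) {B : Cn m → Cn m → W} {c : ℂ} (hc : c * c = -1)
    (hl : ∀ v w, B (Complex.I • v) w = c • B v w) (hr : ∀ v w, B v (Complex.I • w) = c • B v w) :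
    trG h z B = 0 := by
  unfold trG
  rw [sum_idx]
  refine Finset.sum_eq_zero fun i _ => Finset.sum_eq_zero fun j _ => ?_
  -- In the block of `z_i` and `z_j` the `xx` and `yy` terms cancel because `c² = -1`, and the two
  -- mixed terms cancel because the mixed entries of the inverse metric are opposite.
  simp only [← I_smul_dir_zero, hl, hr, (H.ginv_hermitian hz i j).1, (H.ginv_hermitian hz i j).2,
    smul_smul, hc]
  simp only [smul_comm c, neg_smul, one_smul, smul_neg]
  abel

/-- The metric trace is invariant under the complex structure. -/
theorem IsKahlerOn.trG_I_I {W : Type*} [AddCommGroup W] [Module ℝ W]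
    (H : IsKahlerOn h U) (hz : z ∈ U) {B : Cn m → Cn m → W}
    (hl : ∀ v w, B (-v) w = -B v w) (hr : ∀ v w, B v (-w) = -B v w) :
    trG h z (fun v w => B (Complex.I • v) (Complex.I • w)) = trG h z B := by
  unfold trG
  rw [sum_idx, sum_idx]
  refine Finset.sum_congr rfl fun i _ => Finset.sum_congr rfl fun j _ => ?_
  simp only [I_smul_dir_zero, I_smul_dir_one, hl, hr, (H.ginv_hermitian hz i j).1,
    (H.ginv_hermitian hz i j).2, smul_neg, neg_smul, neg_neg]
  abel

/-- Applying `i` to both slots does not change the trace, and `i² = -1`; hence moving `i` across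
costs a sign. -/
theorem IsKahlerOn.trG_I_right {W : Type*} [AddCommGroup W] [Module ℝ W]
    (H : IsKahlerOn h U) (hz : z ∈ U) {B : Cn m → Cn m → W}
    (hl : ∀ v w, B (-v) w = -B v w) (hr : ∀ v w, B v (-w) = -B v w) :
    trG h z (fun v w => B (Complex.I • v) w) = -trG h z (fun v w => B v (Complex.I • w)) := by
  rw [← H.trG_I_I hz (B := fun v w => B v (Complex.I • w)), ← trG_neg]
  · simp only [I_smul_I_smul, hr, neg_neg]
  · intros; rw [hl]
  · intros; rw [smul_neg, hr]

end Kahler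

end Metric

end

section

variable {m r : ℕ}

/-! ### The Levi-Civita connection of a Kähler metric -/

section Christoffel

variable {h : Cn m → Cn m → Cn m → ℝ} {U : Set (Cn m)} {z : Cn m}

/-- The Christoffel symbols as a vector valued bilinear map. -/
def gam (h : Cn m → Cn m → Cn m → ℝ) (z v w : Cn m) : Cn m :=
  ∑ n, ((1 / 2) * ∑ q, ginv h n q z * (fderiv ℝ (fun y => h y (dir q) w) z v
    + fderiv ℝ (fun y => h y (dir q) v) z w - fderiv ℝ (fun y => h y v w) z (dir q))) • dir n

theorem sum_christoffel_smul_dir (k l : Idx m) :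
    ∑ n, christoffel h n k l z • dir n = gam h z (dir k) (dir l) := rfl

theorem IsMetricOn.differentiableAt (H : IsMetricOn h U) (hz : z ∈ U) (v w : Cn m) :
    DifferentiableAt ℝ (fun y => h y v w) z :=
  ((H.smooth v w).contDiffAt (H.isOpen.mem_nhds hz)).differentiableAt (by simp)

theorem IsMetricOn.bilin_fderiv (H : IsMetricOn h U) (hz : z ∈ U) (u : Cn m) :
    IsBilinearMap ℝ (fun v w => fderiv ℝ (fun y => h y v w) z u) where
  add_left v v' w := by
    rw [← add_apply, ← fderiv_fun_add (H.differentiableAt hz _ _)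
      (H.differentiableAt hz _ _)]
    rw [Filter.EventuallyEq.fderiv_eq]
    filter_upwards [H.isOpen.mem_nhds hz] with y hy using (H.bilin y hy).add_left _ _ _
  add_right v w w' := by
    rw [← add_apply, ← fderiv_fun_add (H.differentiableAt hz _ _)
      (H.differentiableAt hz _ _)]
    rw [Filter.EventuallyEq.fderiv_eq]
    filter_upwards [H.isOpen.mem_nhds hz] with y hy using (H.bilin y hy).add_right _ _ _
  smul_left c v w := by
    rw [← smul_apply, ← fderiv_fun_const_smul (H.differentiableAt hz _ _)]
    rw [Filter.EventuallyEq.fderiv_eq]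
    filter_upwards [H.isOpen.mem_nhds hz] with y hy using (H.bilin y hy).smul_left _ _ _
  smul_right c v w := by
    rw [← smul_apply, ← fderiv_fun_const_smul (H.differentiableAt hz _ _)]
    rw [Filter.EventuallyEq.fderiv_eq]
    filter_upwards [H.isOpen.mem_nhds hz] with y hy using (H.bilin y hy).smul_right _ _ _

theorem IsMetricOn.fderiv_symm (H : IsMetricOn h U) (hz : z ∈ U) (u v w : Cn m) :
    fderiv ℝ (fun y => h y v w) z u = fderiv ℝ (fun y => h y w v) z u := by
  rw [Filter.EventuallyEq.fderiv_eq]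
  filter_upwards [H.isOpen.mem_nhds hz] with y hy using H.symm y hy _ _

/-- Nondegeneracy. The identities for the Christoffel map are obtained by pairing with an arbitrary
vector and inserting the Koszul formula. -/
theorem IsMetricOn.ext (H : IsMetricOn h U) (hz : z ∈ U) {v w : Cn m}
    (hvw : ∀ x, h z v x = h z w x) : v = w := by
  by_contra hne
  have h1 := H.pos z hz (v - w) (sub_ne_zero.2 hne)
  have h2 : h z (v - w) (v - w) = h z v (v - w) - h z w (v - w) := by
    rw [sub_eq_add_neg v w, (H.bilin z hz).add_left, (H.bilin z hz).neg_left, sub_eq_add_neg]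
  rw [h2, hvw, sub_self] at h1
  exact lt_irrefl _ h1

/-- The Koszul formula. -/
theorem IsMetricOn.koszul (H : IsMetricOn h U) (hz : z ∈ U) (v w x : Cn m) :
    h z (gam h z v w) x = (1 / 2) * (fderiv ℝ (fun y => h y x w) z v
      + fderiv ℝ (fun y => h y x v) z w - fderiv ℝ (fun y => h y v w) z x) := by
  set T : Cn m →ₗ[ℝ] ℝ :=
    { toFun := fun x => fderiv ℝ (fun y => h y x w) z v
        + fderiv ℝ (fun y => h y x v) z w - fderiv ℝ (fun y => h y v w) z x
      map_add' := fun x x' => by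
        rw [(H.bilin_fderiv hz v).add_left, (H.bilin_fderiv hz w).add_left, map_add]; ring
      map_smul' := fun c x => by
        simp only [(H.bilin_fderiv hz v).smul_left, (H.bilin_fderiv hz w).smul_left, map_smul,
          smul_eq_mul, RingHom.id_apply]; ring } with hT
  change _ = (1 / 2) * T x
  have h1 : T x = ∑ q, crd q x * T (dir q) := by
    conv_lhs => rw [← sum_crd_smul_dir x, map_sum]
    simp only [map_smul, smul_eq_mul]
  have h2 : gam h z v w = ∑ n, ((1 / 2) * ∑ q, ginv h n q z * T (dir q)) • dir n := rfl
  rw [h2, (H.bilin z hz).sum_left, h1]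
  simp only [smul_eq_mul, ← H.sum_ginv_mul_right hz _ x, Finset.mul_sum, Finset.sum_mul]
  rw [Finset.sum_comm]
  refine Finset.sum_congr rfl fun q _ => Finset.sum_congr rfl fun n _ => ?_
  rw [H.ginv_symm hz q n]; ring

theorem IsMetricOn.gam_symm (H : IsMetricOn h U) (hz : z ∈ U) (v w : Cn m) :
    gam h z v w = gam h z w v := by
  refine H.ext hz fun x => ?_
  rw [H.koszul hz, H.koszul hz, H.fderiv_symm hz x v w]; ring

theorem IsMetricOn.bilin_gam (H : IsMetricOn h U) (hz : z ∈ U) : IsBilinearMap ℝ (gam h z) := by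
  have ha : ∀ v v' w, gam h z (v + v') w = gam h z v w + gam h z v' w := fun v v' w => by
    refine H.ext hz fun x => ?_
    rw [(H.bilin z hz).add_left, H.koszul hz, H.koszul hz, H.koszul hz,
      (H.bilin_fderiv hz w).add_right, (H.bilin_fderiv hz x).add_left, map_add]; ring
  have hs : ∀ (c : ℝ) v w, gam h z (c • v) w = c • gam h z v w := fun c v w => by
    refine H.ext hz fun x => ?_
    rw [(H.bilin z hz).smul_left, H.koszul hz, H.koszul hz,
      (H.bilin_fderiv hz w).smul_right, (H.bilin_fderiv hz x).smul_left, map_smul]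
    simp only [smul_eq_mul]; ring
  exact ⟨ha, hs, fun v w w' => by
    rw [H.gam_symm hz v, ha, H.gam_symm hz w, H.gam_symm hz w'],
    fun c v w => by rw [H.gam_symm hz v, hs, H.gam_symm hz w]⟩

theorem IsKahlerOn.apply_I_left (H : IsKahlerOn h U) (hz : z ∈ U) (v w : Cn m) :
    h z (Complex.I • v) w = -h z v (Complex.I • w) := by
  rw [← H.hermitian z hz v (Complex.I • w), I_smul_I_smul, (H.bilin z hz).neg_right, neg_neg]

/-- On a Kähler manifold the Levi-Civita connection is complex linear. -/
theorem IsKahlerOn.gam_I_right (H : IsKahlerOn h U) (hz : z ∈ U) (v w : Cn m) :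
    gam h z v (Complex.I • w) = Complex.I • gam h z v w := by
  have hI : ∀ u v w, fderiv ℝ (fun y => h y (Complex.I • v) w) z u
      = -fderiv ℝ (fun y => h y v (Complex.I • w)) z u := by
    intro u v w
    rw [← neg_apply, ← fderiv_fun_neg, Filter.EventuallyEq.fderiv_eq]
    filter_upwards [H.isOpen.mem_nhds hz] with y hy using H.apply_I_left hy _ _
  have hb := H.toIsMetricOn.bilin_fderiv hz
  refine H.ext hz fun x => ?_
  rw [H.apply_I_left hz, H.koszul hz, H.koszul hz]
  -- Closedness of the fundamental form on `(x, w, v)` and on `(ix, iw, v)`. Both are linear in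
  -- first derivatives of the metric; once every `i` is moved by the Hermitian symmetry, their
  -- combination is the required equality of Koszul expressions.
  have c1 := H.closed z hz x w v
  have c2 := H.closed z hz (Complex.I • x) (Complex.I • w) v
  simp only [fundForm] at c1 c2
  simp only [hI, I_smul_I_smul, (hb _).neg_right, (hb _).neg_left] at c1 c2
  have s1 := H.fderiv_symm hz
  rw [hI v x w]
  have e1 := s1 (Complex.I • x) v w
  have e2 := s1 x w (Complex.I • v)
  have e3 := s1 (Complex.I • w) x v
  have e4 := hI x v w
  have e5 := hI x w v
  have e6 := hI w x v
  have e7 := s1 x v (Complex.I • w)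
  have e8 := hI w v x
  have e9 := s1 w v (Complex.I • x)
  have e10 := hI v x w
  linarith

theorem IsKahlerOn.gam_I_left (H : IsKahlerOn h U) (hz : z ∈ U) (v w : Cn m) :
    gam h z (Complex.I • v) w = Complex.I • gam h z v w := by
  rw [H.gam_symm hz, H.gam_I_right hz, H.gam_symm hz]

/-- The Christoffel map is complex bilinear, so its trace vanishes. This is why every Laplacian
below is a bare trace of second derivatives in holomorphic coordinates. -/
theorem IsKahlerOn.trG_gam (H : IsKahlerOn h U) (hz : z ∈ U) : trG h z (gam h z) = 0 :=
  H.trG_eq_zero hz Complex.I_mul_I (H.gam_I_left hz) (H.gam_I_right hz)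

/-- Compatibility with the metric: in the sum of the two Koszul expressions all but one of the
derivatives cancel. -/
theorem IsMetricOn.fderiv_eq_gam (H : IsMetricOn h U) (hz : z ∈ U) (u v w : Cn m) :
    fderiv ℝ (fun y => h y v w) z u = h z (gam h z u v) w + h z v (gam h z u w) := by
  rw [H.symm z hz v, H.koszul hz, H.koszul hz, H.fderiv_symm hz u v w, H.fderiv_symm hz w v u,
    H.fderiv_symm hz v u w]
  ring

theorem IsMetricOn.differentiableAt_ginv (H : IsMetricOn h U) (hz : z ∈ U) (k l : Idx m) :
    DifferentiableAt ℝ (ginv h k l) z :=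
  ((H.contDiffOn_ginv k l).contDiffAt (H.isOpen.mem_nhds hz)).differentiableAt (by simp)

/-- Differentiate `g⁻¹ g = 1`, replace the derivative of `g` by Christoffel terms through
compatibility with the metric, and multiply by `g⁻¹` again. -/
theorem IsMetricOn.fderiv_ginv (H : IsMetricOn h U) (hz : z ∈ U) (v : Cn m) (k p : Idx m) :
    fderiv ℝ (ginv h k p) z v = -(∑ l, ginv h k l z * crd p (gam h z v (dir l)))
      - ∑ n, ginv h n p z * crd k (gam h z v (dir n)) := by
  have h1 : ∀ n, ∑ l, (fderiv ℝ (ginv h k l) z v * h z (dir l) (dir n)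
      + ginv h k l z * fderiv ℝ (fun y => h y (dir l) (dir n)) z v) = 0 := by
    intro n
    have e1 : (fun y => ∑ l, ginv h k l y * h y (dir l) (dir n)) =ᶠ[𝓝 z]
        fun _ => crd k (dir n) := by
      filter_upwards [H.isOpen.mem_nhds hz] with y hy using H.sum_ginv_mul_right hy _ _
    have e2 := e1.fderiv_eq (𝕜 := ℝ)
    rw [fderiv_fun_const, fderiv_fun_sum fun l _ =>
      (H.differentiableAt_ginv hz k l).fun_mul (H.differentiableAt hz _ _)] at e2
    have e3 := congrArg (fun L => L v) e2
    simp only [sum_apply, Pi.zero_apply, zero_apply] at e3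
    rw [← e3]
    refine Finset.sum_congr rfl fun l _ => ?_
    rw [fderiv_fun_mul (H.differentiableAt_ginv hz k l) (H.differentiableAt hz _ _)]
    simp; ring
  have h2 : fderiv ℝ (ginv h k p) z v
      = ∑ n, (∑ l, fderiv ℝ (ginv h k l) z v * h z (dir l) (dir n)) * ginv h n p z := by
    simp only [Finset.sum_mul]
    rw [Finset.sum_comm]
    simp only [mul_assoc, ← Finset.mul_sum]
    have : ∀ l, ∑ n, h z (dir l) (dir n) * ginv h n p z = if p = l then 1 else 0 := by
      intro l
      rw [← crd_dir, ← H.sum_ginv_mul_left hz]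
      refine Finset.sum_congr rfl fun n _ => ?_
      rw [H.ginv_symm hz, mul_comm]
    simp [this]
  have h3 : ∀ n, ∑ l, fderiv ℝ (ginv h k l) z v * h z (dir l) (dir n)
      = -∑ l, ginv h k l z * h z (gam h z v (dir l)) (dir n) - crd k (gam h z v (dir n)) := by
    intro n
    have := h1 n
    rw [Finset.sum_add_distrib] at this
    rw [← H.sum_ginv_mul_right hz, eq_neg_of_add_eq_zero_left this]
    simp only [H.fderiv_eq_gam hz v, mul_add, Finset.sum_add_distrib]
    ring
  rw [h2]
  simp only [h3, sub_mul, Finset.sum_sub_distrib, neg_mul, Finset.sum_neg_distrib, Finset.sum_mul]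
  congr 1
  · rw [Finset.sum_comm]
    simp only [mul_assoc, ← Finset.mul_sum]
    congr 1
    refine Finset.sum_congr rfl fun l _ => ?_
    rw [← H.sum_ginv_mul_left hz]
    congr 1
    refine Finset.sum_congr rfl fun n _ => ?_
    rw [H.ginv_symm hz, mul_comm]
  · refine Finset.sum_congr rfl fun n _ => mul_comm _ _

/-- The metric trace is parallel for the Levi-Civita connection. -/
theorem IsMetricOn.fderiv_trG {W : Type*} [NormedAddCommGroup W] [NormedSpace ℝ W]
    (H : IsMetricOn h U) (hz : z ∈ U) {B : Cn m → Cn m → Cn m → W}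
    (hB : ∀ v w, DifferentiableAt ℝ (fun y => B y v w) z) (hb : IsBilinearMap ℝ (B z)) (u : Cn m) :
    fderiv ℝ (fun y => trG h y (B y)) z u = trG h z (fun v w => fderiv ℝ (fun y => B y v w) z u)
      - trG h z (fun v w => B z (gam h z u v) w) - trG h z (fun v w => B z v (gam h z u w)) := by
  have h1 : fderiv ℝ (fun y => trG h y (B y)) z u = ∑ k, ∑ l,
      (ginv h k l z • fderiv ℝ (fun y => B y (dir k) (dir l)) z u
        + fderiv ℝ (ginv h k l) z u • B z (dir k) (dir l)) := by
    unfold trG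
    rw [fderiv_fun_sum]
    · simp only [sum_apply]
      refine Finset.sum_congr rfl fun k _ => ?_
      rw [fderiv_fun_sum]
      · simp only [sum_apply]
        refine Finset.sum_congr rfl fun l _ => ?_
        rw [fderiv_fun_smul (H.differentiableAt_ginv hz k l) (hB _ _)]
        simp
      · exact fun l _ => (H.differentiableAt_ginv hz k l).smul (hB _ _)
    · exact fun k _ => DifferentiableAt.fun_sum fun l _ =>
        (H.differentiableAt_ginv hz k l).smul (hB _ _)
  have h2 : ∀ w u', B z w u' = ∑ l, crd l u' • B z w (dir l) := by
    intro w u'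
    conv_lhs => rw [← sum_crd_smul_dir u', hb.sum_right]
  have h3 : ∀ w u', B z u' w = ∑ l, crd l u' • B z (dir l) w := by
    intro w u'
    conv_lhs => rw [← sum_crd_smul_dir u', hb.sum_left]
  have h4 : trG h z (fun v w => B z v (gam h z u w)) = ∑ k, ∑ l,
      (∑ p, ginv h k p z * crd l (gam h z u (dir p))) • B z (dir k) (dir l) := by
    unfold trG
    refine Finset.sum_congr rfl fun k _ => ?_
    simp only [h2 (dir k) (gam h z u _), Finset.smul_sum, Finset.sum_smul, smul_smul]
    rw [Finset.sum_comm]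
  have h5 : trG h z (fun v w => B z (gam h z u v) w) = ∑ k, ∑ l,
      (∑ p, ginv h p l z * crd k (gam h z u (dir p))) • B z (dir k) (dir l) := by
    unfold trG
    simp only [h3 _ (gam h z u _), Finset.smul_sum, Finset.sum_smul, smul_smul]
    rw [Finset.sum_comm, Finset.sum_comm' (t' := Finset.univ) (s' := fun _ => Finset.univ) (by simp)]
    rw [Finset.sum_comm]
    conv_rhs => rw [Finset.sum_comm]
    refine Finset.sum_congr rfl fun l _ => ?_
    rw [Finset.sum_comm]
  rw [h1, h4, h5]
  simp only [H.fderiv_ginv hz, Finset.sum_add_distrib, sub_smul, neg_smul, Finset.sum_sub_distrib,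
    Finset.sum_neg_distrib]
  unfold trG
  abel

theorem IsKahlerOn.laplacian_eq (H : IsKahlerOn h U) (hz : z ∈ U) (f : Cn m → ℝ) :
    laplacian h f z = -trG h z (fun v w => fderiv ℝ (fun y => fderiv ℝ f y w) z v) := by
  have h1 : ∑ k, ∑ l, ginv h k l z * ∑ n, christoffel h n k l z * pd n f z = 0 := by
    have : ∀ k l, ∑ n, christoffel h n k l z * pd n f z = fderiv ℝ f z (gam h z (dir k) (dir l)) := by
      intro k l
      rw [← sum_christoffel_smul_dir, map_sum]
      simp [pd]
    simp only [this]
    have h2 := trG_map (h := h) (z := z) (fderiv ℝ f z).toLinearMap (gam h z)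
    rw [H.trG_gam hz, map_zero] at h2
    simpa [trG] using h2
  unfold laplacian
  simp only [mul_sub, Finset.sum_sub_distrib, h1]
  simp [trG, pd]

end Christoffel

end

section

variable {m r : ℕ}

/-! ### Covariant derivatives -/

section Smooth

variable {E W : Type*} [NormedAddCommGroup E] [NormedSpace ℝ E] [NormedAddCommGroup W]
  [NormedSpace ℝ W] {U : Set E} {z : E}

theorem _root_.ContDiffOn.differentiableAt_of_isOpen {f : E → W} (hf : ContDiffOn ℝ ∞ f U)
    (hU : IsOpen U) (hz : z ∈ U) : DifferentiableAt ℝ f z :=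
  (hf.contDiffAt (hU.mem_nhds hz)).differentiableAt (by simp)

theorem _root_.ContDiffOn.fderiv_smooth {f : E → W} (hf : ContDiffOn ℝ ∞ f U) (hU : IsOpen U) :
    ContDiffOn ℝ ∞ (fderiv ℝ f) U :=
  hf.fderiv_of_isOpen hU (by simp)

theorem _root_.ContDiffOn.fderiv_apply_smooth {f : E → W} (hf : ContDiffOn ℝ ∞ f U)
    (hU : IsOpen U) (v : E) : ContDiffOn ℝ ∞ (fun y => fderiv ℝ f y v) U :=
  (hf.fderiv_smooth hU).clm_apply contDiffOn_const

theorem fderiv_fderiv_apply {f : E → W} (hf : ContDiffOn ℝ ∞ f U) (hU : IsOpen U) (hz : z ∈ U)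
    (v w : E) : fderiv ℝ (fun y => fderiv ℝ f y w) z v = fderiv ℝ (fderiv ℝ f) z v w := by
  rw [fderiv_clm_apply ((hf.fderiv_smooth hU).differentiableAt_of_isOpen hU hz)
    (differentiableAt_const w)]
  simp

theorem fderiv_fderiv_symm {f : E → W} (hf : ContDiffOn ℝ ∞ f U) (hU : IsOpen U) (hz : z ∈ U)
    (v w : E) : fderiv ℝ (fderiv ℝ f) z v w = fderiv ℝ (fderiv ℝ f) z w v :=
  ((hf.contDiffAt (hU.mem_nhds hz)).isSymmSndFDerivAt
    (by simpa using WithTop.coe_le_coe.2 (le_top : (2 : ℕ∞) ≤ ⊤))).eq v w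

end Smooth

section Conn

variable {W : Type*} [NormedAddCommGroup W] [NormedSpace ℂ W] [NormedSpace ℝ W]
  [IsScalarTower ℝ ℂ W]

/-- The covariant derivative `∂_v f + A(v) f`. -/
def cD (A : Cn m → Cn m →L[ℝ] W →L[ℝ] W) (f : Cn m → W) (z v : Cn m) : W :=
  fderiv ℝ f z v + A z v (f z)

/-- The part of type `(1,0)` of the covariant derivative. -/
def dP (A : Cn m → Cn m →L[ℝ] W →L[ℝ] W) (f : Cn m → W) (z v : Cn m) : W :=
  (1 / 2 : ℂ) • (cD A f z v - Complex.I • cD A f z (Complex.I • v))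

/-- The part of type `(0,1)` of the covariant derivative. -/
def dM (A : Cn m → Cn m →L[ℝ] W →L[ℝ] W) (f : Cn m → W) (z v : Cn m) : W :=
  (1 / 2 : ℂ) • (cD A f z v + Complex.I • cD A f z (Complex.I • v))

/-- The curvature of a connection. -/
def cCurv (A : Cn m → Cn m →L[ℝ] W →L[ℝ] W) (z v w : Cn m) : W →L[ℝ] W :=
  fderiv ℝ A z v w - fderiv ℝ A z w v + (A z v ∘L A z w - A z w ∘L A z v)

/-- A smooth complex linear connection form on an open set. -/
structure IsConnOn (A : Cn m → Cn m →L[ℝ] W →L[ℝ] W) (U : Set (Cn m)) : Prop where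
  isOpen : IsOpen U
  smooth : ContDiffOn ℝ ∞ A U
  clinear : ∀ z v (c : ℂ) x, A z v (c • x) = c • A z v x

variable {A : Cn m → Cn m →L[ℝ] W →L[ℝ] W} {U : Set (Cn m)} {z : Cn m} {f g : Cn m → W}

theorem cD_congr (hU : IsOpen U) (hz : z ∈ U) (hfg : ∀ y ∈ U, f y = g y) (v : Cn m) :
    cD A f z v = cD A g z v := by
  have : f =ᶠ[𝓝 z] g := by filter_upwards [hU.mem_nhds hz] with y hy using hfg y hy
  rw [cD, cD, this.fderiv_eq, hfg z hz]

theorem cD_add_right (v w : Cn m) : cD A f z (v + w) = cD A f z v + cD A f z w := by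
  simp only [cD, map_add, add_apply]; abel

theorem cD_smul_right (c : ℝ) (v : Cn m) : cD A f z (c • v) = c • cD A f z v := by
  simp only [cD, map_smul, smul_apply, smul_add]

theorem cD_neg_right (v : Cn m) : cD A f z (-v) = -cD A f z v := by
  rw [← neg_one_smul ℝ, cD_smul_right, neg_one_smul]

theorem cD_zero (v : Cn m) : cD A (fun _ => 0) z v = 0 := by simp [cD]

theorem cD_add (hf : DifferentiableAt ℝ f z) (hg : DifferentiableAt ℝ g z) (v : Cn m) :
    cD A (fun y => f y + g y) z v = cD A f z v + cD A g z v := by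
  simp only [cD, fderiv_fun_add hf hg, add_apply, map_add]; abel

theorem cD_neg (v : Cn m) :
    cD A (fun y => -f y) z v = -cD A f z v := by
  simp only [cD, fderiv_fun_neg, neg_apply, map_neg]; abel

theorem cD_sub (hf : DifferentiableAt ℝ f z) (hg : DifferentiableAt ℝ g z) (v : Cn m) :
    cD A (fun y => f y - g y) z v = cD A f z v - cD A g z v := by
  simp only [cD, fderiv_fun_sub hf hg, sub_apply, map_sub]; abel

theorem cD_sum {κ : Type*} (s : Finset κ) {F : κ → Cn m → W}
    (hF : ∀ i ∈ s, DifferentiableAt ℝ (F i) z) (v : Cn m) :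
    cD A (fun y => ∑ i ∈ s, F i y) z v = ∑ i ∈ s, cD A (F i) z v := by
  simp only [cD, fderiv_fun_sum hF, sum_apply, map_sum, Finset.sum_add_distrib]

theorem cD_real_smul {c : Cn m → ℝ} (hc : DifferentiableAt ℝ c z) (hf : DifferentiableAt ℝ f z)
    (v : Cn m) : cD A (fun y => c y • f y) z v = c z • cD A f z v + fderiv ℝ c z v • f z := by
  simp only [cD, fderiv_fun_smul hc hf, add_apply, smul_apply, ContinuousLinearMap.smulRight_apply,
    map_smul, smul_add]; abel

section

variable (hA : IsConnOn A U)
include hA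

theorem IsConnOn.cD_smul (hf : DifferentiableAt ℝ f z) (c : ℂ) (v : Cn m) :
    cD A (fun y => c • f y) z v = c • cD A f z v := by
  simp only [cD, fderiv_fun_const_smul hf, smul_apply, hA.clinear, smul_add]

theorem IsConnOn.contDiffOn_cD (hf : ContDiffOn ℝ ∞ f U) (v : Cn m) :
    ContDiffOn ℝ ∞ (fun y => cD A f y v) U :=
  (hf.fderiv_apply_smooth hA.isOpen v).add ((hA.smooth.clm_apply contDiffOn_const).clm_apply hf)

theorem IsConnOn.contDiffOn_dP (hf : ContDiffOn ℝ ∞ f U) (v : Cn m) :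
    ContDiffOn ℝ ∞ (fun y => dP A f y v) U :=
  ContDiffOn.const_smul _ ((hA.contDiffOn_cD hf v).sub
    (ContDiffOn.const_smul _ (hA.contDiffOn_cD hf _)))

theorem IsConnOn.contDiffOn_dM (hf : ContDiffOn ℝ ∞ f U) (v : Cn m) :
    ContDiffOn ℝ ∞ (fun y => dM A f y v) U :=
  ContDiffOn.const_smul _ ((hA.contDiffOn_cD hf v).add
    (ContDiffOn.const_smul _ (hA.contDiffOn_cD hf _)))

theorem IsConnOn.differentiableAt_cD (hf : ContDiffOn ℝ ∞ f U) (hz : z ∈ U) (v : Cn m) :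
    DifferentiableAt ℝ (fun y => cD A f y v) z :=
  (hA.contDiffOn_cD hf v).differentiableAt_of_isOpen hA.isOpen hz

/-- The commutator of covariant derivatives is the curvature. -/
theorem IsConnOn.commutator (hf : ContDiffOn ℝ ∞ f U) (hz : z ∈ U) (v w : Cn m) :
    cD A (fun y => cD A f y w) z v - cD A (fun y => cD A f y v) z w = cCurv A z v w (f z) := by
  have h1 : ∀ v w, fderiv ℝ (fun y => cD A f y w) z v = fderiv ℝ (fderiv ℝ f) z v w
      + (fderiv ℝ A z v w (f z) + A z w (fderiv ℝ f z v)) := by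
    intro v w
    have hAd := hA.smooth.differentiableAt_of_isOpen hA.isOpen hz
    have hfd := hf.differentiableAt_of_isOpen hA.isOpen hz
    have hAw : DifferentiableAt ℝ (fun y => A y w) z := hAd.clm_apply (differentiableAt_const w)
    unfold cD
    rw [fderiv_fun_add ((hf.fderiv_apply_smooth hA.isOpen w).differentiableAt_of_isOpen hA.isOpen hz)
      (hAw.clm_apply hfd), add_apply, fderiv_fderiv_apply hf hA.isOpen hz, fderiv_clm_apply hAw hfd,
      fderiv_clm_apply hAd (differentiableAt_const w)]
    simp [add_comm]
  have h2 : ∀ v w, cD A (fun y => cD A f y w) z v = fderiv ℝ (fun y => cD A f y w) z v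
      + A z v (cD A f z w) := fun v w => rfl
  rw [h2, h2, h1, h1, fderiv_fderiv_symm hf hA.isOpen hz v w]
  simp only [cD, cCurv, map_add, sub_apply, add_apply, ContinuousLinearMap.comp_apply]
  abel

end

theorem dP_I (v : Cn m) : dP A f z (Complex.I • v) = Complex.I • dP A f z v := by
  rw [dP, I_smul_I_smul, cD_neg_right, dP]
  linear_combination (norm := module) (1 / 2 : ℂ) • I_smul_I_smul (cD A f z (Complex.I • v))

theorem dM_I (v : Cn m) : dM A f z (Complex.I • v) = -Complex.I • dM A f z v := by
  rw [dM, I_smul_I_smul, cD_neg_right, dM]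
  linear_combination (norm := module) (1 / 2 : ℂ) • I_smul_I_smul (cD A f z (Complex.I • v))

theorem dP_add_dM (v : Cn m) : dP A f z v + dM A f z v = cD A f z v := by
  simp only [dP, dM]; module

theorem dP_congr (hU : IsOpen U) (hz : z ∈ U) (hfg : ∀ y ∈ U, f y = g y) (v : Cn m) :
    dP A f z v = dP A g z v := by
  simp only [dP, cD_congr hU hz hfg]

theorem dM_congr (hU : IsOpen U) (hz : z ∈ U) (hfg : ∀ y ∈ U, f y = g y) (v : Cn m) :
    dM A f z v = dM A g z v := by
  simp only [dM, cD_congr hU hz hfg]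

theorem dP_zero (v : Cn m) : dP A (fun _ => 0) z v = 0 := by simp [dP, cD_zero]

theorem dP_add (hf : DifferentiableAt ℝ f z) (hg : DifferentiableAt ℝ g z) (v : Cn m) :
    dP A (fun y => f y + g y) z v = dP A f z v + dP A g z v := by
  simp only [dP, cD_add hf hg]; module

theorem dP_sub (hf : DifferentiableAt ℝ f z) (hg : DifferentiableAt ℝ g z) (v : Cn m) :
    dP A (fun y => f y - g y) z v = dP A f z v - dP A g z v := by
  simp only [dP, cD_sub hf hg]; module

theorem dM_add (hf : DifferentiableAt ℝ f z) (hg : DifferentiableAt ℝ g z) (v : Cn m) :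
    dM A (fun y => f y + g y) z v = dM A f z v + dM A g z v := by
  simp only [dM, cD_add hf hg]; module

theorem dM_sub (hf : DifferentiableAt ℝ f z) (hg : DifferentiableAt ℝ g z) (v : Cn m) :
    dM A (fun y => f y - g y) z v = dM A f z v - dM A g z v := by
  simp only [dM, cD_sub hf hg]; module

theorem IsConnOn.dM_smul (hA : IsConnOn A U) (hf : DifferentiableAt ℝ f z) (c : ℂ) (v : Cn m) :
    dM A (fun y => c • f y) z v = c • dM A f z v := by
  simp only [dM, hA.cD_smul hf]; module

theorem IsConnOn.dP_smul (hA : IsConnOn A U) (hf : DifferentiableAt ℝ f z) (c : ℂ) (v : Cn m) :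
    dP A (fun y => c • f y) z v = c • dP A f z v := by
  simp only [dP, hA.cD_smul hf]; module

/-- Expansion of a second derivative of type `(0,1)` after `(1,0)`, and similar. -/
theorem IsConnOn.cD_dP (hA : IsConnOn A U) (hf : ContDiffOn ℝ ∞ f U) (hz : z ∈ U) (v w : Cn m) :
    cD A (fun y => dP A f y w) z v = (1 / 2 : ℂ) • (cD A (fun y => cD A f y w) z v
      - Complex.I • cD A (fun y => cD A f y (Complex.I • w)) z v) := by
  have h := fun v => hA.differentiableAt_cD hf hz v
  unfold dP
  rw [hA.cD_smul ((h w).fun_sub ((h _).fun_const_smul Complex.I)), cD_sub (h w) ((h _).fun_const_smul Complex.I),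
    hA.cD_smul (h _)]

theorem IsConnOn.cD_dM (hA : IsConnOn A U) (hf : ContDiffOn ℝ ∞ f U) (hz : z ∈ U) (v w : Cn m) :
    cD A (fun y => dM A f y w) z v = (1 / 2 : ℂ) • (cD A (fun y => cD A f y w) z v
      + Complex.I • cD A (fun y => cD A f y (Complex.I • w)) z v) := by
  have h := fun v => hA.differentiableAt_cD hf hz v
  unfold dM
  rw [hA.cD_smul ((h w).fun_add ((h _).fun_const_smul Complex.I)), cD_add (h w) ((h _).fun_const_smul Complex.I),
    hA.cD_smul (h _)]

/-- The `(0,2)`-part of the curvature of a connection, applied to a vector. -/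
def cCurv02 (A : Cn m → Cn m →L[ℝ] W →L[ℝ] W) (z v w : Cn m) (x : W) : W :=
  (1 / 4 : ℂ) • (cCurv A z v w x + Complex.I • cCurv A z (Complex.I • v) w x
    + Complex.I • cCurv A z v (Complex.I • w) x - cCurv A z (Complex.I • v) (Complex.I • w) x)

/-- The part of the curvature which is complex linear in the first and antilinear in the second
variable, applied to a vector. -/
def cCurv11 (A : Cn m → Cn m →L[ℝ] W →L[ℝ] W) (z v w : Cn m) (x : W) : W :=
  (1 / 4 : ℂ) • (cCurv A z v w x - Complex.I • cCurv A z (Complex.I • v) w x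
    + Complex.I • cCurv A z v (Complex.I • w) x + cCurv A z (Complex.I • v) (Complex.I • w) x)

/-- The commutator identity, projected to the antilinear part in both directions. The directions are
constant vectors, so no bracket or Christoffel term appears. -/
theorem IsConnOn.dM_dM (hA : IsConnOn A U) (hf : ContDiffOn ℝ ∞ f U) (hz : z ∈ U) (v w : Cn m) :
    dM A (fun y => dM A f y w) z v - dM A (fun y => dM A f y v) z w = cCurv02 A z v w (f z) := by
  simp only [cCurv02, ← hA.commutator hf hz]
  rw [dM, dM]
  simp only [hA.cD_dM hf hz, smul_add, smul_sub, smul_smul]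
  rw [show (1 / 2 * (Complex.I * (1 / 2 * Complex.I)) : ℂ) = (1 / 4) * (Complex.I * Complex.I) by
    ring, Complex.I_mul_I]
  module

/-- The same projection for mixed types: linear in `v`, antilinear in `w`. It is the source of the
curvature term in the Weitzenböck formula. -/
theorem IsConnOn.dP_dM (hA : IsConnOn A U) (hf : ContDiffOn ℝ ∞ f U) (hz : z ∈ U) (v w : Cn m) :
    dP A (fun y => dM A f y w) z v - dM A (fun y => dP A f y v) z w = cCurv11 A z v w (f z) := by
  simp only [cCurv11, ← hA.commutator hf hz]
  rw [dM, dP]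
  simp only [hA.cD_dM hf hz, hA.cD_dP hf hz, smul_add, smul_sub, smul_smul]
  rw [show (1 / 2 * (Complex.I * (1 / 2 * Complex.I)) : ℂ) = (1 / 4) * (Complex.I * Complex.I) by
    ring, Complex.I_mul_I]
  module

variable {h : Cn m → Cn m → Cn m → ℝ}

/-- The rough Laplacian in terms of the operators of type `(1,0)` and `(0,1)`. -/
theorem IsConnOn.trG_cD_cD (hA : IsConnOn A U) (H : IsKahlerOn h U) (hf : ContDiffOn ℝ ∞ f U)
    (hz : z ∈ U) :
    trG h z (fun v w => cD A (fun y => cD A f y w) z v)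
      = (2 : ℂ) • trG h z (fun v w => dP A (fun y => dM A f y w) z v)
        - trG h z (fun v w => cCurv11 A z v w (f z)) := by
  have e1 : ∀ v w, cD A (fun y => cD A f y w) z v = dP A (fun y => dP A f y w) z v
      + dM A (fun y => dM A f y w) z v
      + (dP A (fun y => dM A f y w) z v + dM A (fun y => dP A f y w) z v) := by
    intro v w
    have h1 := (hA.contDiffOn_dP hf w).differentiableAt_of_isOpen hA.isOpen hz
    have h2 := (hA.contDiffOn_dM hf w).differentiableAt_of_isOpen hA.isOpen hz
    rw [cD_congr hA.isOpen hz (fun y _ => (dP_add_dM w).symm), ← dP_add_dM, dP_add h1 h2,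
      dM_add h1 h2]
    abel
  have e5 : trG h z (fun v w => cD A (fun y => cD A f y w) z v)
      = trG h z (fun v w => dP A (fun y => dP A f y w) z v)
        + trG h z (fun v w => dM A (fun y => dM A f y w) z v)
        + (trG h z (fun v w => dP A (fun y => dM A f y w) z v)
          + trG h z (fun v w => dM A (fun y => dP A f y w) z v)) := by
    rw [← trG_add, ← trG_add, ← trG_add]
    exact trG_congr fun k l => e1 _ _
  -- Second derivatives of pure type are complex linear, or antilinear, in both directions and are
  -- therefore traceless.
  have e2 : trG h z (fun v w => dP A (fun y => dP A f y w) z v) = 0 := by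
    refine H.trG_eq_zero hz Complex.I_mul_I (fun v w => dP_I v) fun v w => ?_
    simp only [dP_I]
    exact hA.dP_smul ((hA.contDiffOn_dP hf w).differentiableAt_of_isOpen hA.isOpen hz) _ _
  have e3 : trG h z (fun v w => dM A (fun y => dM A f y w) z v) = 0 := by
    refine H.trG_eq_zero (c := -Complex.I) hz (by simp) (fun v w => dM_I v) fun v w => ?_
    simp only [dM_I]
    exact hA.dM_smul ((hA.contDiffOn_dM hf w).differentiableAt_of_isOpen hA.isOpen hz) _ _
  -- Both mixed orders are reduced to `∂∂̄`, the order that vanishes when `∂̄f = 0`; the exchange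
  -- costs the trace of the `(1,1)`-curvature.
  have e4 : trG h z (fun v w => dM A (fun y => dP A f y w) z v)
      = trG h z (fun v w => dP A (fun y => dM A f y w) z v)
        - trG h z (fun v w => cCurv11 A z v w (f z)) := by
    rw [← H.trG_swap hz (fun v w => dM A (fun y => dP A f y w) z v), ← trG_sub]
    refine trG_congr fun k l => ?_
    rw [← hA.dP_dM hf hz]; abel
  rw [e5, e2, e3, e4]
  module

end Conn

end

section

variable {m : ℕ}

/-! ### Connections with values in an algebra -/

section

variable {𝔄 : Type*} [NormedRing 𝔄] [NormedSpace ℂ 𝔄] [NormedSpace ℝ 𝔄] [IsScalarTower ℝ ℂ 𝔄]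
  [IsScalarTower ℂ 𝔄 𝔄] [SMulCommClass ℂ 𝔄 𝔄] [IsScalarTower ℝ 𝔄 𝔄] [SMulCommClass ℝ 𝔄 𝔄]
  {W : Type*} [NormedAddCommGroup W] [NormedSpace ℂ W] [NormedSpace ℝ W] [IsScalarTower ℝ ℂ W]

variable (𝔄) in
/-- Multiplication as a real bilinear map. -/
def mulL : 𝔄 →L[ℝ] 𝔄 →L[ℝ] 𝔄 :=
  LinearMap.mkContinuous₂ (LinearMap.mk₂ ℝ (fun (B C : 𝔄) => B * C) (fun _ _ _ => add_mul _ _ _)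
    (fun _ _ _ => smul_mul_assoc _ _ _) (fun _ _ _ => mul_add _ _ _)
    (fun _ _ _ => mul_smul_comm _ _ _)) 1 fun B C => by simpa using norm_mul_le B C

@[simp] theorem mulL_apply (B C : 𝔄) : mulL 𝔄 B C = B * C := rfl

variable (𝔄) in
/-- The commutator as a real bilinear map. -/
def adL : 𝔄 →L[ℝ] 𝔄 →L[ℝ] 𝔄 := mulL 𝔄 - (mulL 𝔄).flip

@[simp] theorem adL_apply (B C : 𝔄) : adL 𝔄 B C = B * C - C * B := rfl

/-- The connection induced on the algebra. -/
def endA (a : Cn m → Cn m →L[ℝ] 𝔄) (z : Cn m) : Cn m →L[ℝ] 𝔄 →L[ℝ] 𝔄 :=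
  adL 𝔄 ∘L a z

/-- The connection induced on a module. -/
def secA (ρ : 𝔄 →L[ℝ] W →L[ℝ] W) (a : Cn m → Cn m →L[ℝ] 𝔄) (z : Cn m) : Cn m →L[ℝ] W →L[ℝ] W :=
  ρ ∘L a z

/-- A complex linear representation of an algebra. -/
structure IsRep (ρ : 𝔄 →L[ℝ] W →L[ℝ] W) : Prop where
  one : ∀ x, ρ 1 x = x
  mul : ∀ B C x, ρ (B * C) x = ρ B (ρ C x)
  smul_left : ∀ (c : ℂ) B x, ρ (c • B) x = c • ρ B x
  smul_right : ∀ (c : ℂ) B x, ρ B (c • x) = c • ρ B x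

variable {a : Cn m → Cn m →L[ℝ] 𝔄} {ρ : 𝔄 →L[ℝ] W →L[ℝ] W} {U : Set (Cn m)} {z : Cn m}

/-- The curvature. -/
def cur (a : Cn m → Cn m →L[ℝ] 𝔄) (z v w : Cn m) : 𝔄 :=
  fderiv ℝ a z v w - fderiv ℝ a z w v + (a z v * a z w - a z w * a z v)

/-- The `(0,2)`-part of the curvature. -/
def cur02 (a : Cn m → Cn m →L[ℝ] 𝔄) (z v w : Cn m) : 𝔄 :=
  (1 / 4 : ℂ) • (cur a z v w + Complex.I • cur a z (Complex.I • v) w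
    + Complex.I • cur a z v (Complex.I • w) - cur a z (Complex.I • v) (Complex.I • w))

/-- The part of the curvature which is complex linear in the first and antilinear in the second
variable. -/
def cur11 (a : Cn m → Cn m →L[ℝ] 𝔄) (z v w : Cn m) : 𝔄 :=
  (1 / 4 : ℂ) • (cur a z v w - Complex.I • cur a z (Complex.I • v) w
    + Complex.I • cur a z v (Complex.I • w) + cur a z (Complex.I • v) (Complex.I • w))

theorem isConnOn_secA (hρ : IsRep ρ) (hU : IsOpen U) (ha : ContDiffOn ℝ ∞ a U) :
    IsConnOn (secA ρ a) U where
  isOpen := hU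
  smooth := contDiffOn_const.clm_comp ha
  clinear z v c x := hρ.smul_right _ _ _

theorem isConnOn_endA (hU : IsOpen U) (ha : ContDiffOn ℝ ∞ a U) : IsConnOn (endA a) U where
  isOpen := hU
  smooth := contDiffOn_const.clm_comp ha
  clinear z v c x := by
    simp only [endA, ContinuousLinearMap.comp_apply, adL_apply, smul_mul_assoc, mul_smul_comm,
      smul_sub]

theorem bilin_cur : IsBilinearMap ℝ (cur a z) where
  add_left v v' w := by simp only [cur, map_add, add_apply, add_mul, mul_add]; abel
  add_right v w w' := by simp only [cur, map_add, add_apply, add_mul, mul_add]; abel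
  smul_left c v w := by
    simp only [cur, map_smul, smul_apply, smul_mul_assoc, mul_smul_comm]; module
  smul_right c v w := by
    simp only [cur, map_smul, smul_apply, smul_mul_assoc, mul_smul_comm]; module

theorem cur_antisymm (v w : Cn m) : cur a z v w = -cur a z w v := by
  simp only [cur]; abel

theorem fderiv_comp_clm {V : Type*} [NormedAddCommGroup V] [NormedSpace ℝ V] (T : 𝔄 →L[ℝ] V)
    (ha : DifferentiableAt ℝ a z) (v w : Cn m) :
    fderiv ℝ (fun y => T ∘L a y) z v w = T (fderiv ℝ a z v w) := by
  have : HasFDerivAt (fun y => T ∘L a y) _ z :=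
    ((ContinuousLinearMap.compL ℝ (Cn m) 𝔄 V T).hasFDerivAt).comp z ha.hasFDerivAt
  rw [this.fderiv]; rfl

theorem cCurv_secA (hρ : IsRep ρ) (ha : DifferentiableAt ℝ a z) (v w : Cn m) (x : W) :
    cCurv (secA ρ a) z v w x = ρ (cur a z v w) x := by
  have h := fderiv_comp_clm ρ ha
  simp only [cCurv, cur, map_add, map_sub, sub_apply, add_apply, hρ.mul]
  rw [← h, ← h]
  rfl

theorem cCurv_endA (ha : DifferentiableAt ℝ a z) (v w : Cn m) (B : 𝔄) :
    cCurv (endA a) z v w B = cur a z v w * B - B * cur a z v w := by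
  have h := fderiv_comp_clm (adL 𝔄) ha
  have h1 : ∀ v w, fderiv ℝ (endA a) z v w = adL 𝔄 (fderiv ℝ a z v w) := h
  simp only [cCurv, h1]
  simp only [endA, cur, add_apply, sub_apply, ContinuousLinearMap.comp_apply, adL_apply]
  noncomm_ring

theorem cCurv02_secA (hρ : IsRep ρ) (ha : DifferentiableAt ℝ a z) (v w : Cn m) (x : W) :
    cCurv02 (secA ρ a) z v w x = ρ (cur02 a z v w) x := by
  simp only [cCurv02, cCurv_secA hρ ha, cur02, hρ.smul_left, map_add, map_sub, sub_apply, add_apply]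

theorem cCurv11_secA (hρ : IsRep ρ) (ha : DifferentiableAt ℝ a z) (v w : Cn m) (x : W) :
    cCurv11 (secA ρ a) z v w x = ρ (cur11 a z v w) x := by
  simp only [cCurv11, cCurv_secA hρ ha, cur11, hρ.smul_left, map_add, map_sub, sub_apply, add_apply]

theorem cCurv02_endA (ha : DifferentiableAt ℝ a z) (v w : Cn m) (B : 𝔄) :
    cCurv02 (endA a) z v w B = cur02 a z v w * B - B * cur02 a z v w := by
  simp only [cCurv02, cCurv_endA ha, cur02, smul_mul_assoc, mul_smul_comm, add_mul, sub_mul,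
    mul_add, mul_sub]
  module

theorem cCurv11_endA (ha : DifferentiableAt ℝ a z) (v w : Cn m) (B : 𝔄) :
    cCurv11 (endA a) z v w B = cur11 a z v w * B - B * cur11 a z v w := by
  simp only [cCurv11, cCurv_endA ha, cur11, smul_mul_assoc, mul_smul_comm, add_mul, sub_mul,
    mul_add, mul_sub]
  module

theorem isBilinearMap_sum4 {B : Cn m → Cn m → 𝔄} (hB : IsBilinearMap ℝ B) (c₁ c₂ c₃ c₄ : ℂ) :
    IsBilinearMap ℝ (fun v w => c₁ • B v w + c₂ • B (Complex.I • v) w + c₃ • B v (Complex.I • w)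
      + c₄ • B (Complex.I • v) (Complex.I • w)) where
  add_left v v' w := by simp only [smul_add, hB.add_left]; abel
  add_right v v' w := by simp only [smul_add, hB.add_right]; abel
  smul_left c v w := by
    simp only [smul_add, smul_comm Complex.I c, hB.smul_left, smul_comm _ c]
  smul_right c v w := by
    simp only [smul_add, smul_comm Complex.I c, hB.smul_right, smul_comm _ c]

theorem cur02_expand (v w : Cn m) : cur02 a z v w = (1 / 4 : ℂ) • cur a z v w
    + (Complex.I / 4) • cur a z (Complex.I • v) w + (Complex.I / 4) • cur a z v (Complex.I • w)
    + (-1 / 4 : ℂ) • cur a z (Complex.I • v) (Complex.I • w) := by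
  simp only [cur02]; module

theorem cur11_expand (v w : Cn m) : cur11 a z v w = (1 / 4 : ℂ) • cur a z v w
    + (-Complex.I / 4) • cur a z (Complex.I • v) w + (Complex.I / 4) • cur a z v (Complex.I • w)
    + (1 / 4 : ℂ) • cur a z (Complex.I • v) (Complex.I • w) := by
  simp only [cur11]; module

theorem bilin_cur02 : IsBilinearMap ℝ (cur02 a z) := by
  have := isBilinearMap_sum4 (bilin_cur (a := a) (z := z)) (1 / 4) (Complex.I / 4)
    (Complex.I / 4) (-1 / 4)
  simpa only [← cur02_expand] using this

theorem bilin_cur11 : IsBilinearMap ℝ (cur11 a z) := by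
  have := isBilinearMap_sum4 (bilin_cur (a := a) (z := z)) (1 / 4) (-Complex.I / 4)
    (Complex.I / 4) (1 / 4)
  simpa only [← cur11_expand] using this

theorem cur02_I_right (v w : Cn m) :
    cur02 a z v (Complex.I • w) = -Complex.I • cur02 a z v w := by
  simp only [cur02, I_smul_I_smul, bilin_cur.neg_right, smul_neg]
  linear_combination (norm := module) (-1 / 4 : ℂ) • (-I_smul_I_smul (cur a z v (Complex.I • w))
    - I_smul_I_smul (cur a z (Complex.I • v) w))

theorem cur02_antisymm (v w : Cn m) : cur02 a z v w = -cur02 a z w v := by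
  simp only [cur02, cur_antisymm (a := a) v, cur_antisymm (a := a) (Complex.I • v)]; module

theorem cur02_I_left (v w : Cn m) :
    cur02 a z (Complex.I • v) w = -Complex.I • cur02 a z v w := by
  rw [cur02_antisymm, cur02_I_right, cur02_antisymm v w, smul_neg]

theorem cur11_I_right (v w : Cn m) :
    cur11 a z v (Complex.I • w) = -Complex.I • cur11 a z v w := by
  simp only [cur11, I_smul_I_smul, bilin_cur.neg_right, smul_neg]
  linear_combination (norm := module) (1 / 4 : ℂ) • (I_smul_I_smul (cur a z v (Complex.I • w))
    - I_smul_I_smul (cur a z (Complex.I • v) w))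

theorem cur11_I_left (v w : Cn m) :
    cur11 a z (Complex.I • v) w = Complex.I • cur11 a z v w := by
  simp only [cur11, I_smul_I_smul, bilin_cur.neg_left, smul_neg]
  linear_combination (norm := module) (1 / 4 : ℂ) • (I_smul_I_smul (cur a z (Complex.I • v) w)
    - I_smul_I_smul (cur a z v (Complex.I • w)))

/-- The part of the curvature antilinear in the second slot, split by type in the first. The
`(0,1)`-part of the divergence only sees this half. -/
theorem cur02_add_cur11 (v w : Cn m) : cur02 a z v w + cur11 a z v w
    = (1 / 2 : ℂ) • (cur a z v w + Complex.I • cur a z v (Complex.I • w)) := by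
  simp only [cur02, cur11]; module

section

variable (hU : IsOpen U) (ha : ContDiffOn ℝ ∞ a U)
include hU ha

theorem contDiffOn_cur (v w : Cn m) : ContDiffOn ℝ ∞ (fun y => cur a y v w) U := by
  have h0 := fun v => ha.clm_apply (contDiffOn_const (c := v))
  have h1 := fun v w => ((ha.fderiv_smooth hU).clm_apply (contDiffOn_const (c := v))).clm_apply
    (contDiffOn_const (c := w))
  have h2 := fun v w => ((contDiffOn_const (c := mulL 𝔄)).clm_apply (h0 v)).clm_apply (h0 w)
  exact ((h1 v w).sub (h1 w v)).add ((h2 v w).sub (h2 w v))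

theorem contDiffOn_cur02 (v w : Cn m) : ContDiffOn ℝ ∞ (fun y => cur02 a y v w) U := by
  have h := contDiffOn_cur hU ha
  exact ContDiffOn.const_smul _ ((((h _ _).add ((h _ _).const_smul _)).add
    ((h _ _).const_smul _)).sub (h _ _))

theorem contDiffOn_cur11 (v w : Cn m) : ContDiffOn ℝ ∞ (fun y => cur11 a y v w) U := by
  have h := contDiffOn_cur hU ha
  exact ContDiffOn.const_smul _ ((((h _ _).sub ((h _ _).const_smul _)).add
    ((h _ _).const_smul _)).add (h _ _))

/-- The Bianchi identity. -/
theorem bianchi (hz : z ∈ U) (u v w : Cn m) :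
    cD (endA a) (fun y => cur a y v w) z u + cD (endA a) (fun y => cur a y w u) z v
      + cD (endA a) (fun y => cur a y u v) z w = 0 := by
  have had := ha.differentiableAt_of_isOpen hU hz
  have hd : ∀ v w u, fderiv ℝ (fun y => cur a y v w) z u
      = fderiv ℝ (fderiv ℝ a) z u v w - fderiv ℝ (fderiv ℝ a) z u w v
        + (fderiv ℝ a z u v * a z w + a z v * fderiv ℝ a z u w
          - (fderiv ℝ a z u w * a z v + a z w * fderiv ℝ a z u v)) := by
    intro v w u
    have h2 : ∀ v w, HasFDerivAt (fun y => fderiv ℝ a y v w)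
        (((ContinuousLinearMap.apply ℝ 𝔄 w) ∘L (ContinuousLinearMap.apply ℝ (Cn m →L[ℝ] 𝔄) v)) ∘L
          (fderiv ℝ (fderiv ℝ a) z)) z := by
      intro v w
      have h := HasFDerivAt.comp z (((ContinuousLinearMap.apply ℝ 𝔄 w) ∘L
        (ContinuousLinearMap.apply ℝ (Cn m →L[ℝ] 𝔄) v)).hasFDerivAt)
          ((ha.fderiv_smooth hU).differentiableAt_of_isOpen hU hz).hasFDerivAt
      exact h
    have h1 : ∀ v, HasFDerivAt (fun y => a y v)
        ((ContinuousLinearMap.apply ℝ 𝔄 v) ∘L (fderiv ℝ a z)) z := fun v =>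
      ((ContinuousLinearMap.apply ℝ 𝔄 v).hasFDerivAt (x := a z)).comp z had.hasFDerivAt
    have h3 := fun v w => (mulL 𝔄).hasFDerivAt_of_bilinear (h1 v) (h1 w)
    have h4 : HasFDerivAt (fun y => cur a y v w) _ z :=
      ((h2 v w).sub (h2 w v)).add ((h3 v w).sub (h3 w v))
    rw [h4.fderiv]
    simp only [add_apply, sub_apply, ContinuousLinearMap.comp_apply, ContinuousLinearMap.apply_apply,
      ContinuousLinearMap.precompR_apply, ContinuousLinearMap.precompL_apply,
      ContinuousLinearMap.compL_apply, mulL_apply]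
    abel
  have hs := fderiv_fderiv_symm ha hU hz
  unfold cD
  -- After the second derivatives of `a` are symmetrised, they cancel in the cyclic sum; so do the
  -- terms with one derivative, and the cubic terms cancel by the Jacobi identity.
  rw [hd, hd, hd, hs v u, hs w u, hs w v]
  simp only [endA, ContinuousLinearMap.comp_apply, adL_apply, cur]
  noncomm_ring

theorem cD_cur02 (hz : z ∈ U) (u v w : Cn m) :
    cD (endA a) (fun y => cur02 a y v w) z u = (1 / 4 : ℂ) • (cD (endA a) (fun y => cur a y v w) z u
      + Complex.I • cD (endA a) (fun y => cur a y (Complex.I • v) w) z u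
      + Complex.I • cD (endA a) (fun y => cur a y v (Complex.I • w)) z u
      - cD (endA a) (fun y => cur a y (Complex.I • v) (Complex.I • w)) z u) := by
  have h : ∀ v w, DifferentiableAt ℝ (fun y => cur a y v w) z := fun v w =>
    (contDiffOn_cur hU ha v w).differentiableAt_of_isOpen hU hz
  have hA := isConnOn_endA hU ha
  unfold cur02
  rw [hA.cD_smul (((h _ _).fun_add ((h _ _).fun_const_smul _)).fun_add ((h _ _).fun_const_smul _)
    |>.fun_sub (h _ _)), cD_sub (((h _ _).fun_add ((h _ _).fun_const_smul _)).fun_add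
    ((h _ _).fun_const_smul _)) (h _ _), cD_add ((h _ _).fun_add ((h _ _).fun_const_smul _))
    ((h _ _).fun_const_smul _), cD_add (h _ _) ((h _ _).fun_const_smul _), hA.cD_smul (h _ _),
    hA.cD_smul (h _ _)]

theorem cD_cur11 (hz : z ∈ U) (u v w : Cn m) :
    cD (endA a) (fun y => cur11 a y v w) z u = (1 / 4 : ℂ) • (cD (endA a) (fun y => cur a y v w) z u
      - Complex.I • cD (endA a) (fun y => cur a y (Complex.I • v) w) z u
      + Complex.I • cD (endA a) (fun y => cur a y v (Complex.I • w)) z u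
      + cD (endA a) (fun y => cur a y (Complex.I • v) (Complex.I • w)) z u) := by
  have h : ∀ v w, DifferentiableAt ℝ (fun y => cur a y v w) z := fun v w =>
    (contDiffOn_cur hU ha v w).differentiableAt_of_isOpen hU hz
  have hA := isConnOn_endA hU ha
  unfold cur11
  rw [hA.cD_smul (((h _ _).fun_sub ((h _ _).fun_const_smul _)).fun_add ((h _ _).fun_const_smul _)
    |>.fun_add (h _ _)), cD_add (((h _ _).fun_sub ((h _ _).fun_const_smul _)).fun_add
    ((h _ _).fun_const_smul _)) (h _ _), cD_add ((h _ _).fun_sub ((h _ _).fun_const_smul _))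
    ((h _ _).fun_const_smul _), cD_sub (h _ _) ((h _ _).fun_const_smul _), hA.cD_smul (h _ _),
    hA.cD_smul (h _ _)]

/-- The `(0,3)`-part of the Bianchi identity. -/
theorem bianchi03 (hz : z ∈ U) (u v w : Cn m) :
    dM (endA a) (fun y => cur02 a y v w) z u + dM (endA a) (fun y => cur02 a y w u) z v
      + dM (endA a) (fun y => cur02 a y u v) z w = 0 := by
  have b := bianchi hU ha hz
  simp only [dM, cD_cur02 hU ha hz]
  -- Each argument `x` of the Bianchi identity is replaced by `½(x + i·Ix)`, the projection to the
  -- antilinear part, and the product is expanded.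
  linear_combination (norm := skip) (1 / 8 : ℂ) • (b u v w + Complex.I • b (Complex.I • u) v w
    + Complex.I • b u (Complex.I • v) w + Complex.I • b u v (Complex.I • w)
    - b (Complex.I • u) (Complex.I • v) w - b (Complex.I • u) v (Complex.I • w)
    - b u (Complex.I • v) (Complex.I • w)
    - Complex.I • b (Complex.I • u) (Complex.I • v) (Complex.I • w))
  match_scalars <;> ring_nf <;> simp only [Complex.I_sq, Complex.I_pow_three] <;> ring

/-- The `(1,2)`-part of the Bianchi identity. -/
theorem bianchi12 (hz : z ∈ U) (u v w : Cn m) :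
    dM (endA a) (fun y => cur11 a y w v) z u + dP (endA a) (fun y => cur02 a y v u) z w
      - dM (endA a) (fun y => cur11 a y w u) z v = 0 := by
  have b := bianchi hU ha hz
  have c : ∀ v w u, cD (endA a) (fun y => cur a y v w) z u
      = -cD (endA a) (fun y => cur a y w v) z u := by
    intro v w u
    rw [← cD_neg]; simp only [← cur_antisymm]
  simp only [dM, dP, cD_cur02 hU ha hz, cD_cur11 hU ha hz, c w v, c (Complex.I • w) v,
    c w (Complex.I • v), c (Complex.I • w) (Complex.I • v), c v u, c (Complex.I • v) u,
    c v (Complex.I • u), c (Complex.I • v) (Complex.I • u)]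
  -- The projection is antilinear in `u` and `v` and linear in `w`. The overall sign comes from
  -- writing each curvature with its arguments exchanged, so that `w` comes first.
  linear_combination (norm := skip) (-1 / 8 : ℂ) • (b u v w + Complex.I • b (Complex.I • u) v w
    + Complex.I • b u (Complex.I • v) w - Complex.I • b u v (Complex.I • w)
    - b (Complex.I • u) (Complex.I • v) w + b (Complex.I • u) v (Complex.I • w)
    + b u (Complex.I • v) (Complex.I • w)
    + Complex.I • b (Complex.I • u) (Complex.I • v) (Complex.I • w))
  match_scalars <;> ring_nf <;> simp only [Complex.I_sq, Complex.I_pow_three] <;> ring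

end

end

end

/-! ### Differentiating metric traces by type -/

section

variable {m : ℕ}

section

variable {W : Type*} [NormedAddCommGroup W] [NormedSpace ℂ W] [NormedSpace ℝ W]
  [IsScalarTower ℝ ℂ W] {A : Cn m → Cn m →L[ℝ] W →L[ℝ] W} {U : Set (Cn m)} {z : Cn m}
  {f : Cn m → W} {h : Cn m → Cn m → Cn m → ℝ}

theorem IsMetricOn.contDiffOn_trG (H : IsMetricOn h U)
    {B : Cn m → Cn m → Cn m → W} (hB : ∀ v w, ContDiffOn ℝ ∞ (fun y => B y v w) U) :
    ContDiffOn ℝ ∞ (fun y => trG h y (B y)) U :=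
  ContDiffOn.sum fun k _ => ContDiffOn.sum fun l _ => (H.contDiffOn_ginv k l).smul (hB _ _)

theorem IsMetricOn.cD_trG (H : IsMetricOn h U) (hz : z ∈ U)
    {B : Cn m → Cn m → Cn m → W} (hB : ∀ v w, DifferentiableAt ℝ (fun y => B y v w) z)
    (hb : IsBilinearMap ℝ (B z)) (u : Cn m) :
    cD A (fun y => trG h y (B y)) z u = trG h z (fun v w => cD A (fun y => B y v w) z u)
      - trG h z (fun v w => B z (gam h z u v) w) - trG h z (fun v w => B z v (gam h z u w)) := by
  have h1 : trG h z (fun v w => cD A (fun y => B y v w) z u)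
      = trG h z (fun v w => fderiv ℝ (fun y => B y v w) z u) + trG h z (fun v w => A z u (B z v w)) :=
    trG_add _ _
  have h2 : trG h z (fun v w => A z u (B z v w)) = A z u (trG h z (B z)) :=
    trG_map (A z u).toLinearMap (B z)
  rw [h1, cD, H.fderiv_trG hz hB hb, h2]
  abel

/-- The `(0,1)`-derivative of a real function. -/
def dbar (c : Cn m → ℝ) (z u : Cn m) : ℂ :=
  (1 / 2 : ℂ) * ((fderiv ℝ c z u : ℂ) + Complex.I * (fderiv ℝ c z (Complex.I • u) : ℂ))

theorem dM_real_smul {c : Cn m → ℝ} (hc : DifferentiableAt ℝ c z) (hf : DifferentiableAt ℝ f z)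
    (v : Cn m) : dM A (fun y => c y • f y) z v = c z • dM A f z v + dbar c z v • f z := by
  simp only [dM, cD_real_smul hc hf, dbar]
  module

theorem dM_sum {κ : Type*} (s : Finset κ) {F : κ → Cn m → W}
    (hF : ∀ i ∈ s, DifferentiableAt ℝ (F i) z) (v : Cn m) :
    dM A (fun y => ∑ i ∈ s, F i y) z v = ∑ i ∈ s, dM A (F i) z v := by
  simp only [dM, cD_sum s hF, Finset.smul_sum, ← Finset.sum_add_distrib]

/-- A bare product rule. The derivatives of the inverse metric are kept as they stand: where this is
applied they multiply terms of lower order, so a covariant form is not needed. -/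
theorem dM_trG (H : IsMetricOn h U) (hz : z ∈ U)
    {B : Cn m → Cn m → Cn m → W} (hB : ∀ v w, DifferentiableAt ℝ (fun y => B y v w) z)
    (u : Cn m) :
    dM A (fun y => trG h y (B y)) z u = trG h z (fun v w => dM A (fun y => B y v w) z u)
      + ∑ k, ∑ l, dbar (ginv h k l) z u • B z (dir k) (dir l) := by
  have h1 := fun k l => (H.differentiableAt_ginv hz k l).fun_smul (hB (dir k) (dir l))
  unfold trG
  rw [dM_sum _ fun k _ => DifferentiableAt.fun_sum fun l _ => h1 k l, ← Finset.sum_add_distrib]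
  refine Finset.sum_congr rfl fun k _ => ?_
  rw [dM_sum _ fun l _ => h1 k l, ← Finset.sum_add_distrib]
  refine Finset.sum_congr rfl fun l _ => ?_
  rw [dM_real_smul (H.differentiableAt_ginv hz k l) (hB _ _)]

/-- The metric trace of a form which is complex linear in the first and antilinear in the second
variable is parallel. -/
theorem IsKahlerOn.dM_trG_parallel (H : IsKahlerOn h U) (hz : z ∈ U)
    {B : Cn m → Cn m → Cn m → W} (hB : ∀ v w, DifferentiableAt ℝ (fun y => B y v w) z)
    (hb : IsBilinearMap ℝ (B z)) (hl : ∀ v w, B z (Complex.I • v) w = Complex.I • B z v w)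
    (hr : ∀ v w, B z v (Complex.I • w) = -Complex.I • B z v w) (u : Cn m) :
    dM A (fun y => trG h y (B y)) z u = trG h z (fun v w => dM A (fun y => B y v w) z u)
      - trG h z (fun v w => B z v (gam h z u w)) := by
  have h1 : trG h z (fun v w => dM A (fun y => B y v w) z u)
      = (1 / 2 : ℂ) • (trG h z (fun v w => cD A (fun y => B y v w) z u)
        + Complex.I • trG h z (fun v w => cD A (fun y => B y v w) z (Complex.I • u))) := by
    rw [← trG_smul, ← trG_add, ← trG_smul]; rfl
  rw [h1, dM, H.cD_trG hz hB hb, H.cD_trG hz hB hb]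
  -- Combining the directions `u` and `iu`, the Christoffel term in the linear slot drops out and
  -- the one in the antilinear slot survives with coefficient one.
  simp only [H.gam_I_left hz, hl, hr, trG_smul]
  linear_combination (norm := module)
    (1 / 2 : ℂ) • (-I_smul_I_smul (trG h z (fun v w => B z (gam h z u v) w))
     + I_smul_I_smul (trG h z (fun v w => B z v (gam h z u w))))

/-- The `(2,0)`-part of the curvature of a connection, applied to a vector. -/
def cCurv20 (A : Cn m → Cn m →L[ℝ] W →L[ℝ] W) (z v w : Cn m) (x : W) : W :=
  (1 / 4 : ℂ) • (cCurv A z v w x - Complex.I • cCurv A z (Complex.I • v) w x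
    - Complex.I • cCurv A z v (Complex.I • w) x - cCurv A z (Complex.I • v) (Complex.I • w) x)

theorem IsConnOn.dP_dP (hA : IsConnOn A U) (hf : ContDiffOn ℝ ∞ f U) (hz : z ∈ U) (v w : Cn m) :
    dP A (fun y => dP A f y w) z v - dP A (fun y => dP A f y v) z w = cCurv20 A z v w (f z) := by
  simp only [cCurv20, ← hA.commutator hf hz]
  rw [dP, dP]
  simp only [hA.cD_dP hf hz, smul_add, smul_sub, smul_smul]
  rw [show (1 / 2 * (Complex.I * (1 / 2 * Complex.I)) : ℂ) = (1 / 4) * (Complex.I * Complex.I) by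
    ring, Complex.I_mul_I]
  module

end

section

variable {𝔄 : Type*} [NormedRing 𝔄] [NormedSpace ℂ 𝔄] [NormedSpace ℝ 𝔄] [IsScalarTower ℝ ℂ 𝔄]
  [IsScalarTower ℂ 𝔄 𝔄] [SMulCommClass ℂ 𝔄 𝔄] [IsScalarTower ℝ 𝔄 𝔄] [SMulCommClass ℝ 𝔄 𝔄]
  {W : Type*} [NormedAddCommGroup W] [NormedSpace ℂ W] [NormedSpace ℝ W] [IsScalarTower ℝ ℂ W]
  {a : Cn m → Cn m →L[ℝ] 𝔄} {ρ : 𝔄 →L[ℝ] W →L[ℝ] W} {U : Set (Cn m)} {z : Cn m}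
  {h : Cn m → Cn m → Cn m → ℝ}

/-! ### The divergence of the curvature -/

/-- The divergence of the curvature on a Kähler manifold. -/
def divF (h : Cn m → Cn m → Cn m → ℝ) (a : Cn m → Cn m →L[ℝ] 𝔄) (z v : Cn m) : 𝔄 :=
  trG h z (fun k l => cD (endA a) (fun y => cur a y l v) z k)
    - trG h z (fun k l => cur a z l (gam h z k v))

/-- The metric trace of the `(1,1)`-part of the curvature. -/
def trCur (h : Cn m → Cn m → Cn m → ℝ) (a : Cn m → Cn m →L[ℝ] 𝔄) (z : Cn m) : 𝔄 :=
  trG h z (cur11 a z)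

/-- A Kähler identity. Split the derivative and the curvature by type; the traces of pure type
vanish, leaving `∂` of `F^{0,2}` and `∂̄` of `F^{1,1}`. The Bianchi identity moves `v` into the
position of the derivative in the latter. The remaining Christoffel term is, by the symmetry of
`gam`, exactly the one that completes the trace of `∂̄F^{1,1}` to `∂̄` of the trace. -/
theorem divF_part01 (H : IsKahlerOn h U) (ha : ContDiffOn ℝ ∞ a U) (hz : z ∈ U) (v : Cn m) :
    (1 / 2 : ℂ) • (divF h a z v + Complex.I • divF h a z (Complex.I • v))
      = (2 : ℂ) • trG h z (fun k l => dP (endA a) (fun y => cur02 a y l v) z k)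
        + dM (endA a) (trCur h a) z v := by
  have hU := H.isOpen
  have hA := isConnOn_endA hU ha
  have d : ∀ v w, DifferentiableAt ℝ (fun y => cur a y v w) z := fun v w =>
    (contDiffOn_cur hU ha v w).differentiableAt_of_isOpen hU hz
  have d02 : ∀ v w, DifferentiableAt ℝ (fun y => cur02 a y v w) z := fun v w =>
    (contDiffOn_cur02 hU ha v w).differentiableAt_of_isOpen hU hz
  have d11 : ∀ v w, DifferentiableAt ℝ (fun y => cur11 a y v w) z := fun v w =>
    (contDiffOn_cur11 hU ha v w).differentiableAt_of_isOpen hU hz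
  -- the trace of `∇F`
  have e1 : (1 / 2 : ℂ) • (trG h z (fun k l => cD (endA a) (fun y => cur a y l v) z k)
      + Complex.I • trG h z (fun k l => cD (endA a) (fun y => cur a y l (Complex.I • v)) z k))
      = trG h z (fun k l => dP (endA a) (fun y => cur02 a y l v) z k)
        + trG h z (fun k l => dM (endA a) (fun y => cur02 a y l v) z k)
        + (trG h z (fun k l => dP (endA a) (fun y => cur11 a y l v) z k)
          + trG h z (fun k l => dM (endA a) (fun y => cur11 a y l v) z k)) := by
    rw [← trG_smul, ← trG_add, ← trG_smul, ← trG_add, ← trG_add, ← trG_add]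
    refine trG_congr fun k l => ?_
    simp only [dP_add_dM]
    rw [← cD_add (d02 _ _) (d11 _ _)]
    simp only [cur02_add_cur11]
    rw [hA.cD_smul ((d _ _).fun_add ((d _ _).fun_const_smul _)),
      cD_add (d _ _) ((d _ _).fun_const_smul _), hA.cD_smul (d _ _)]
  have e2 : trG h z (fun k l => dM (endA a) (fun y => cur02 a y l v) z k) = 0 := by
    refine H.trG_eq_zero (c := -Complex.I) hz (by simp) (fun v w => dM_I v) fun u w => ?_
    simp only [cur02_I_left]
    exact hA.dM_smul (d02 _ _) _ _
  have e3 : trG h z (fun k l => dP (endA a) (fun y => cur11 a y l v) z k) = 0 := by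
    refine H.trG_eq_zero hz Complex.I_mul_I (fun v w => dP_I v) fun u w => ?_
    simp only [cur11_I_left]
    exact hA.dP_smul (d11 _ _) _ _
  -- The `(1,2)`-part of the Bianchi identity exchanges `v` with the direction of `∂̄`. The
  -- correction is a second copy of the trace of `∂F^{0,2}`, whence the factor `2`.
  have e4 : trG h z (fun k l => dM (endA a) (fun y => cur11 a y l v) z k)
      = trG h z (fun k l => dM (endA a) (fun y => cur11 a y k l) z v)
        + trG h z (fun k l => dP (endA a) (fun y => cur02 a y l v) z k) := by
    rw [← H.trG_swap hz (fun k l => dM (endA a) (fun y => cur11 a y l v) z k),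
      ← trG_add]
    refine trG_congr fun k l => ?_
    have b := bianchi12 hU ha hz (dir l) v (dir k)
    have b1 : dP (endA a) (fun y => cur02 a y v (dir l)) z (dir k)
        = -dP (endA a) (fun y => cur02 a y (dir l) v) z (dir k) := by
      simp only [dP, ← smul_neg, neg_sub, ← sub_eq_neg_add]
      simp only [cur02_antisymm v, cD_neg]
      module
    rw [b1] at b
    rw [← sub_eq_zero, ← b]
    abel
  -- the Christoffel terms
  have e5 : (1 / 2 : ℂ) • (trG h z (fun k l => cur a z l (gam h z k v))
      + Complex.I • trG h z (fun k l => cur a z l (gam h z k (Complex.I • v))))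
      = trG h z (fun k l => cur02 a z l (gam h z k v))
        + trG h z (fun k l => cur11 a z l (gam h z k v)) := by
    rw [← trG_smul, ← trG_add, ← trG_smul, ← trG_add]
    refine trG_congr fun k l => ?_
    rw [cur02_add_cur11, H.gam_I_right hz]
  have e6 : trG h z (fun k l => cur02 a z l (gam h z k v)) = 0 := by
    refine H.trG_eq_zero (c := -Complex.I) hz (by simp) (fun u w => ?_) fun u w => ?_
    · rw [H.gam_I_left hz, cur02_I_right]
    · rw [cur02_I_left]
  have e7 : trG h z (fun k l => cur11 a z l (gam h z k v))
      = trG h z (fun k l => cur11 a z k (gam h z v l)) := by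
    rw [← H.trG_swap hz]
    simp only [H.gam_symm hz v]
  have e8 := H.dM_trG_parallel (A := endA a) hz d11 bilin_cur11 cur11_I_left cur11_I_right v
  have e9 : dM (endA a) (trCur h a) z v = dM (endA a) (fun y => trG h y (cur11 a y)) z v := rfl
  rw [e9, e8, ← e7, divF, divF]
  rw [e2, e3, e4] at e1
  rw [e6] at e5
  linear_combination (norm := module) e1 - e5

end

end

/-! ### Hermitian representations, adjoints and the current -/

section

variable {m : ℕ}

section

variable {𝔄 : Type*} [NormedRing 𝔄] [NormedSpace ℂ 𝔄] [NormedSpace ℝ 𝔄] [IsScalarTower ℝ ℂ 𝔄]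
  [IsScalarTower ℂ 𝔄 𝔄] [SMulCommClass ℂ 𝔄 𝔄] [IsScalarTower ℝ 𝔄 𝔄] [SMulCommClass ℝ 𝔄 𝔄]
  {W : Type*} [NormedAddCommGroup W] [NormedSpace ℂ W] [NormedSpace ℝ W] [IsScalarTower ℝ ℂ W]
  {a : Cn m → Cn m →L[ℝ] 𝔄} {ρ : 𝔄 →L[ℝ] W →L[ℝ] W} {U : Set (Cn m)} {z : Cn m}
  {h : Cn m → Cn m → Cn m → ℝ} {ts : W →L[ℝ] W →L[ℝ] 𝔄} {st : 𝔄 →L[ℝ] 𝔄}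
  {p : Cn m → W} {τ : ℝ}

/-- The algebraic properties of the map `(x, y) ↦ x ⊗ y^*` and of the adjoint. -/
structure IsHermRep (ρ : 𝔄 →L[ℝ] W →L[ℝ] W) (ts : W →L[ℝ] W →L[ℝ] 𝔄) (st : 𝔄 →L[ℝ] 𝔄) : Prop
    extends IsRep ρ where
  ts_smul_left : ∀ (c : ℂ) x y, ts (c • x) y = c • ts x y
  ts_smul_right : ∀ (c : ℂ) x y, ts x (c • y) = conj c • ts x y
  mul_ts : ∀ B x y, B * ts x y = ts (ρ B x) y
  ts_mul : ∀ B x y, ts x y * B = ts x (ρ (st B) y)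
  st_mul : ∀ B C, st (B * C) = st C * st B
  st_smul : ∀ (c : ℂ) B, st (c • B) = conj c • st B
  st_ts : ∀ x y, st (ts x y) = ts y x
  st_st : ∀ B, st (st B) = B

/-- The commutator with `a v` distributes over the two slots because `a v` is skew: `(x ⊗ y^*) a = x
⊗ (a^* y)^*`. -/
theorem cD_ts (hρ : IsHermRep ρ ts st) (ha : ∀ v, st (a z v) = -a z v) {f g : Cn m → W}
    (hf : DifferentiableAt ℝ f z) (hg : DifferentiableAt ℝ g z) (v : Cn m) :
    cD (endA a) (fun y => ts (f y) (g y)) z v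
      = ts (cD (secA ρ a) f z v) (g z) + ts (f z) (cD (secA ρ a) g z v) := by
  simp only [cD, ts.fderiv_of_bilinear hf hg, add_apply, ContinuousLinearMap.precompR_apply,
    ContinuousLinearMap.precompL_apply, ContinuousLinearMap.compL_apply, endA, secA,
    ContinuousLinearMap.comp_apply, adL_apply, hρ.mul_ts, hρ.ts_mul, ha, map_neg, map_add,
    neg_apply]
  abel

/-- `x ⊗ y^*` is antilinear in `y`, so `∂̄` acts on the second slot as `∂`. -/
theorem dM_ts (hρ : IsHermRep ρ ts st) (ha : ∀ v, st (a z v) = -a z v) {f g : Cn m → W}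
    (hf : DifferentiableAt ℝ f z) (hg : DifferentiableAt ℝ g z) (v : Cn m) :
    dM (endA a) (fun y => ts (f y) (g y)) z v
      = ts (dM (secA ρ a) f z v) (g z) + ts (f z) (dP (secA ρ a) g z v) := by
  simp only [dM, dP, cD_ts hρ ha hf hg, hρ.ts_smul_left, hρ.ts_smul_right, map_add, map_sub,
    add_apply, sub_apply, map_div₀, map_one, Complex.conj_I, Complex.conj_ofNat]
  module

theorem cD_rho (hρ : IsRep ρ) {B : Cn m → 𝔄} {f : Cn m → W}
    (hB : DifferentiableAt ℝ B z) (hf : DifferentiableAt ℝ f z) (v : Cn m) :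
    cD (secA ρ a) (fun y => ρ (B y) (f y)) z v
      = ρ (cD (endA a) B z v) (f z) + ρ (B z) (cD (secA ρ a) f z v) := by
  simp only [cD, ρ.fderiv_of_bilinear hB hf, add_apply, ContinuousLinearMap.precompR_apply,
    ContinuousLinearMap.precompL_apply, ContinuousLinearMap.compL_apply, endA, secA,
    ContinuousLinearMap.comp_apply, adL_apply, map_add, map_sub, sub_apply, hρ.mul]
  abel

theorem dM_rho (hρ : IsRep ρ) {B : Cn m → 𝔄} {f : Cn m → W}
    (hB : DifferentiableAt ℝ B z) (hf : DifferentiableAt ℝ f z) (v : Cn m) :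
    dM (secA ρ a) (fun y => ρ (B y) (f y)) z v
      = ρ (dM (endA a) B z v) (f z) + ρ (B z) (dM (secA ρ a) f z v) := by
  simp only [dM, cD_rho hρ hB hf, hρ.smul_left, hρ.smul_right, map_add, add_apply]
  module

theorem dP_rho (hρ : IsRep ρ) {B : Cn m → 𝔄} {f : Cn m → W}
    (hB : DifferentiableAt ℝ B z) (hf : DifferentiableAt ℝ f z) (v : Cn m) :
    dP (secA ρ a) (fun y => ρ (B y) (f y)) z v
      = ρ (dP (endA a) B z v) (f z) + ρ (B z) (dP (secA ρ a) f z v) := by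
  simp only [dP, cD_rho hρ hB hf, hρ.smul_left, hρ.smul_right, map_add, add_apply, map_sub,
    sub_apply]
  module

/-- The connection form takes values in the skew-adjoint elements. -/
def IsSkewOn (st : 𝔄 →L[ℝ] 𝔄) (a : Cn m → Cn m →L[ℝ] 𝔄) (U : Set (Cn m)) : Prop :=
  ∀ z ∈ U, ∀ v, st (a z v) = -a z v

theorem st_cur (hρ : IsHermRep ρ ts st) (hU : IsOpen U) (ha : ContDiffOn ℝ ∞ a U)
    (hs : IsSkewOn st a U) (hz : z ∈ U) (v w : Cn m) : st (cur a z v w) = -cur a z v w := by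
  have had := ha.differentiableAt_of_isOpen hU hz
  have h1 : ∀ v w, st (fderiv ℝ a z v w) = -fderiv ℝ a z v w := by
    intro v w
    rw [← fderiv_comp_clm st had, Filter.EventuallyEq.fderiv_eq (f₁ := fun y => st ∘L a y)
      (f := fun y => -a y)]
    · rw [fderiv_fun_neg]; rfl
    · filter_upwards [hU.mem_nhds hz] with y hy
      ext v; exact hs y hy v
  simp only [cur, map_add, map_sub, hρ.st_mul, h1, hs z hz]
  noncomm_ring

/-- The `(2,0)`-part of the curvature. -/
def cur20 (a : Cn m → Cn m →L[ℝ] 𝔄) (z v w : Cn m) : 𝔄 :=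
  (1 / 4 : ℂ) • (cur a z v w - Complex.I • cur a z (Complex.I • v) w
    - Complex.I • cur a z v (Complex.I • w) - cur a z (Complex.I • v) (Complex.I • w))

theorem cCurv20_secA (hρ : IsRep ρ) (ha : DifferentiableAt ℝ a z) (v w : Cn m) (x : W) :
    cCurv20 (secA ρ a) z v w x = ρ (cur20 a z v w) x := by
  simp only [cCurv20, cCurv_secA hρ ha, cur20, hρ.smul_left, map_add, map_sub, sub_apply, add_apply]

/-- The adjoint conjugates the coefficients and so exchanges the two types. For a unitary connection
the `(2,0)`-part carries no further information, and only `F^{0,2}` is followed along the flow. -/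
theorem st_cur20 (hρ : IsHermRep ρ ts st) (hU : IsOpen U) (ha : ContDiffOn ℝ ∞ a U)
    (hs : IsSkewOn st a U) (hz : z ∈ U) (v w : Cn m) : st (cur20 a z v w) = -cur02 a z v w := by
  simp only [cur20, cur02, hρ.st_smul, map_add, map_sub, st_cur hρ hU ha hs hz, map_div₀, map_one,
    Complex.conj_I, Complex.conj_ofNat]
  module

/-- The current of a section. -/
def curr (ρ : 𝔄 →L[ℝ] W →L[ℝ] W) (ts : W →L[ℝ] W →L[ℝ] 𝔄) (a : Cn m → Cn m →L[ℝ] 𝔄)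
    (p : Cn m → W) (z v : Cn m) : 𝔄 :=
  (1 / 2 : ℝ) • (ts (cD (secA ρ a) p z v) (p z) - ts (p z) (cD (secA ρ a) p z v))

theorem half_smul (x : 𝔄) : (1 / 2 : ℝ) • x = (1 / 2 : ℂ) • x := by
  rw [← algebraMap_smul ℂ (1 / 2 : ℝ) x]
  simp

theorem curr_part01 (hρ : IsHermRep ρ ts st) (v : Cn m) :
    (1 / 2 : ℂ) • (curr ρ ts a p z v + Complex.I • curr ρ ts a p z (Complex.I • v))
      = (1 / 2 : ℂ) • (ts (dM (secA ρ a) p z v) (p z) - ts (p z) (dP (secA ρ a) p z v)) := by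
  simp only [curr, half_smul, dM, dP, hρ.ts_smul_left, hρ.ts_smul_right, map_add, map_sub,
    add_apply, sub_apply, map_div₀, map_one, Complex.conj_I, Complex.conj_ofNat]
  module

/-- After antisymmetrisation the second derivatives of the section occur only as commutators, that
is as `F^{0,2}φ` and as `F^{2,0}φ` in the conjugate slot. The first order products that survive each
contain a factor `∂̄φ`, so the whole expression is linear in the obstruction. -/
theorem dM_curr (hρ : IsHermRep ρ ts st) (hU : IsOpen U) (ha : ContDiffOn ℝ ∞ a U)
    (hs : IsSkewOn st a U) (hp : ContDiffOn ℝ ∞ p U) (hz : z ∈ U) (u w : Cn m) :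
    dM (endA a) (fun y => (1 / 2 : ℂ) •
        (ts (dM (secA ρ a) p y w) (p y) - ts (p y) (dP (secA ρ a) p y w))) z u
      - dM (endA a) (fun y => (1 / 2 : ℂ) •
        (ts (dM (secA ρ a) p y u) (p y) - ts (p y) (dP (secA ρ a) p y u))) z w
      = (1 / 2 : ℂ) • (cur02 a z u w * ts (p z) (p z) + ts (p z) (p z) * cur02 a z u w)
        + ts (dM (secA ρ a) p z w) (dP (secA ρ a) p z u)
        - ts (dM (secA ρ a) p z u) (dP (secA ρ a) p z w) := by
  have hS := isConnOn_secA hρ.toIsRep hU ha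
  have hA := isConnOn_endA hU ha
  have dp := hp.differentiableAt_of_isOpen hU hz
  have had := ha.differentiableAt_of_isOpen hU hz
  have d1 := fun v => (hS.contDiffOn_dM hp v).differentiableAt_of_isOpen hU hz
  have d2 := fun v => (hS.contDiffOn_dP hp v).differentiableAt_of_isOpen hU hz
  have dts : ∀ {f g : Cn m → W}, DifferentiableAt ℝ f z → DifferentiableAt ℝ g z →
      DifferentiableAt ℝ (fun y => ts (f y) (g y)) z := fun hf hg =>
    (ts.hasFDerivAt_of_bilinear hf.hasFDerivAt hg.hasFDerivAt).differentiableAt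
  have e1 : ∀ u w, dM (endA a) (fun y => (1 / 2 : ℂ) •
        (ts (dM (secA ρ a) p y w) (p y) - ts (p y) (dP (secA ρ a) p y w))) z u
      = (1 / 2 : ℂ) • (ts (dM (secA ρ a) (fun y => dM (secA ρ a) p y w) z u) (p z)
        + ts (dM (secA ρ a) p z w) (dP (secA ρ a) p z u)
        - ts (dM (secA ρ a) p z u) (dP (secA ρ a) p z w)
        - ts (p z) (dP (secA ρ a) (fun y => dP (secA ρ a) p y w) z u)) := by
    intro u w
    rw [hA.dM_smul ((dts (d1 w) dp).fun_sub (dts dp (d2 w))), dM_sub (dts (d1 w) dp) (dts dp (d2 w)),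
      dM_ts hρ (hs z hz) (d1 w) dp, dM_ts hρ (hs z hz) dp (d2 w)]
    module
  have c1 : cur02 a z u w * ts (p z) (p z)
      = ts (dM (secA ρ a) (fun y => dM (secA ρ a) p y w) z u) (p z)
        - ts (dM (secA ρ a) (fun y => dM (secA ρ a) p y u) z w) (p z) := by
    rw [hρ.mul_ts, ← cCurv02_secA hρ.toIsRep had, ← hS.dM_dM hp hz, map_sub, sub_apply]
  have c2 : ts (p z) (p z) * cur02 a z u w
      = -(ts (p z) (dP (secA ρ a) (fun y => dP (secA ρ a) p y w) z u)
        - ts (p z) (dP (secA ρ a) (fun y => dP (secA ρ a) p y u) z w)) := by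
    rw [hρ.ts_mul, ← neg_neg (cur02 a z u w), ← st_cur20 hρ hU ha hs hz, map_neg, hρ.st_st,
      ← map_sub, hS.dP_dP hp hz, cCurv20_secA hρ.toIsRep had, map_neg, neg_apply, map_neg]
  rw [e1, e1, c1, c2]
  module

/-! ### The linearised equations -/

/-- The linearisation of the curvature. -/
def dcur (a b : Cn m → Cn m →L[ℝ] 𝔄) (z v w : Cn m) : 𝔄 :=
  cD (endA a) (fun y => b y w) z v - cD (endA a) (fun y => b y v) z w

/-- The linearisation of the `(0,2)`-part of the curvature. -/
def dcur02 (a b : Cn m → Cn m →L[ℝ] 𝔄) (z v w : Cn m) : 𝔄 :=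
  (1 / 4 : ℂ) • (dcur a b z v w + Complex.I • dcur a b z (Complex.I • v) w
    + Complex.I • dcur a b z v (Complex.I • w) - dcur a b z (Complex.I • v) (Complex.I • w))

/-- The variation of `F^{0,2}` depends only on the `(0,1)`-part of the variation of the connection,
which is the part computed by `divF_part01`. -/
theorem dcur02_eq {b : Cn m → Cn m →L[ℝ] 𝔄} (hU : IsOpen U) (ha : ContDiffOn ℝ ∞ a U)
    (hb : DifferentiableAt ℝ b z) (v w : Cn m) :
    dcur02 a b z v w
      = dM (endA a) (fun y => (1 / 2 : ℂ) • (b y w + Complex.I • b y (Complex.I • w))) z v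
        - dM (endA a) (fun y => (1 / 2 : ℂ) • (b y v + Complex.I • b y (Complex.I • v))) z w := by
  have hA := isConnOn_endA hU ha
  have d : ∀ v, DifferentiableAt ℝ (fun y => b y v) z := fun v =>
    hb.clm_apply (differentiableAt_const v)
  have e1 : ∀ v w, cD (endA a) (fun y => (1 / 2 : ℂ) • (b y w + Complex.I • b y (Complex.I • w))) z v
      = (1 / 2 : ℂ) • (cD (endA a) (fun y => b y w) z v
        + Complex.I • cD (endA a) (fun y => b y (Complex.I • w)) z v) := by
    intro v w
    rw [hA.cD_smul ((d _).fun_add ((d _).fun_const_smul _)),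
      cD_add (d _) ((d _).fun_const_smul _), hA.cD_smul (d _)]
  simp only [dM, e1, dcur02, dcur]
  simp only [smul_add, smul_sub, smul_smul]
  rw [show (1 / 2 * (Complex.I * (1 / 2 * Complex.I)) : ℂ) = (1 / 4) * (Complex.I * Complex.I) by
    ring, Complex.I_mul_I]
  module

section Evolution

variable (H : IsKahlerOn h U) (hρ : IsHermRep ρ ts st) (ha : ContDiffOn ℝ ∞ a U)
  (hs : IsSkewOn st a U) (hp : ContDiffOn ℝ ∞ p U) {b : Cn m → Cn m →L[ℝ] 𝔄}
  (hb : ContDiffOn ℝ ∞ b U) (hflow : ∀ y ∈ U, ∀ v, b y v = divF h a y v - curr ρ ts a p y v)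
include H hρ ha hs hp hb hflow

/-- The `(0,1)`-part of the velocity of the connection. -/
theorem velocity_part01 (hz : z ∈ U) (v : Cn m) :
    (1 / 2 : ℂ) • (b z v + Complex.I • b z (Complex.I • v))
      = (2 : ℂ) • trG h z (fun k l => dP (endA a) (fun y => cur02 a y l v) z k)
        + dM (endA a) (trCur h a) z v
        - (1 / 2 : ℂ) • (ts (dM (secA ρ a) p z v) (p z) - ts (p z) (dP (secA ρ a) p z v)) := by
  rw [hflow z hz, hflow z hz, ← divF_part01 H ha hz, ← curr_part01 hρ]
  module

omit hρ hs hp hb hflow in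
theorem contDiffOn_trCur : ContDiffOn ℝ ∞ (trCur h a) U :=
  H.contDiffOn_trG (contDiffOn_cur11 H.isOpen ha)

omit hρ hs hp hb hflow in
theorem contDiffOn_trG_dP_cur02 (v : Cn m) :
    ContDiffOn ℝ ∞ (fun x => trG h x (fun k l => dP (endA a) (fun y => cur02 a y l v) x k)) U :=
  H.contDiffOn_trG fun k l => (isConnOn_endA H.isOpen ha).contDiffOn_dP
    (contDiffOn_cur02 H.isOpen ha l v) k

/-- The evolution of the `(0,2)`-part of the curvature. -/
theorem dcur02_flow (hz : z ∈ U) (u w : Cn m) :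
    dcur02 a b z u w = trG h z (fun k l => cD (endA a) (fun y =>
        cD (endA a) (fun x => cur02 a x u w) y l) z k)
      + (trG h z (fun k l => cur11 a z k l * cur02 a z u w - cur02 a z u w * cur11 a z k l)
      - (2 : ℂ) • (trG h z (fun k l => cur11 a z k u * cur02 a z l w - cur02 a z l w * cur11 a z k u)
        - trG h z (fun k l => cur11 a z k w * cur02 a z l u - cur02 a z l u * cur11 a z k w))
      + (2 : ℂ) • (∑ k, ∑ l, dbar (ginv h k l) z u • dP (endA a) (fun y => cur02 a y (dir l) w) z (dir k)
        - ∑ k, ∑ l, dbar (ginv h k l) z w • dP (endA a) (fun y => cur02 a y (dir l) u) z (dir k))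
      + (cur02 a z u w * trCur h a z - trCur h a z * cur02 a z u w)
      - ((1 / 2 : ℂ) • (cur02 a z u w * ts (p z) (p z) + ts (p z) (p z) * cur02 a z u w)
        + ts (dM (secA ρ a) p z w) (dP (secA ρ a) p z u)
        - ts (dM (secA ρ a) p z u) (dP (secA ρ a) p z w))) := by
  have hU := H.isOpen
  have hA := isConnOn_endA hU ha
  have hS := isConnOn_secA hρ.toIsRep hU ha
  have had := ha.differentiableAt_of_isOpen hU hz
  have hbd := hb.differentiableAt_of_isOpen hU hz
  have dQ := (contDiffOn_trCur H ha)
  have dT := contDiffOn_trG_dP_cur02 H ha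
  have d02 := contDiffOn_cur02 hU ha
  have dJ : ∀ w, DifferentiableAt ℝ (fun y => (1 / 2 : ℂ) •
      (ts (dM (secA ρ a) p y w) (p y) - ts (p y) (dP (secA ρ a) p y w))) z := by
    intro w
    have dp := hp.differentiableAt_of_isOpen hU hz
    have d1 := (hS.contDiffOn_dM hp w).differentiableAt_of_isOpen hU hz
    have d2 := (hS.contDiffOn_dP hp w).differentiableAt_of_isOpen hU hz
    exact ((ts.hasFDerivAt_of_bilinear d1.hasFDerivAt dp.hasFDerivAt).differentiableAt.fun_sub
      (ts.hasFDerivAt_of_bilinear dp.hasFDerivAt d2.hasFDerivAt).differentiableAt).fun_const_smul _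
  have e1 : ∀ u w, dM (endA a) (fun y => (1 / 2 : ℂ) • (b y w + Complex.I • b y (Complex.I • w))) z u
      = (2 : ℂ) • dM (endA a) (fun x =>
          trG h x (fun k l => dP (endA a) (fun y => cur02 a y l w) x k)) z u
        + dM (endA a) (fun x => dM (endA a) (trCur h a) x w) z u
        - dM (endA a) (fun y => (1 / 2 : ℂ) •
          (ts (dM (secA ρ a) p y w) (p y) - ts (p y) (dP (secA ρ a) p y w))) z u := by
    intro u w
    have d1 := (dT w).differentiableAt_of_isOpen hU hz
    have d2 := (hA.contDiffOn_dM dQ w).differentiableAt_of_isOpen hU hz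
    rw [dM_congr hU hz fun y hy => velocity_part01 H hρ ha hs hp hb hflow hy w,
      dM_sub ((d1.fun_const_smul _).fun_add d2) (dJ w), dM_add (d1.fun_const_smul _) d2,
      hA.dM_smul d1]
  -- Moving `∂̄_u` inside the trace and past `∂` costs a commutator with `F^{1,1}` and derivatives
  -- of the inverse metric; both corrections are of order at most one in `F^{0,2}`.
  have e2 : ∀ u w, dM (endA a) (fun x =>
        trG h x (fun k l => dP (endA a) (fun y => cur02 a y l w) x k)) z u
      = trG h z (fun k l => dP (endA a) (fun y => dM (endA a) (fun x => cur02 a x l w) y u) z k)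
        - trG h z (fun k l => cur11 a z k u * cur02 a z l w - cur02 a z l w * cur11 a z k u)
        + ∑ k, ∑ l, dbar (ginv h k l) z u • dP (endA a) (fun y => cur02 a y (dir l) w) z (dir k) := by
    intro u w
    rw [dM_trG H.toIsMetricOn hz fun k l =>
      (hA.contDiffOn_dP (d02 l w) k).differentiableAt_of_isOpen hU hz, ← trG_sub]
    congr 1
    refine trG_congr fun k l => ?_
    rw [← cCurv11_endA had, ← hA.dP_dM (d02 _ _) hz]
    abel
  -- The `(0,3)`-part of the Bianchi identity turns the antisymmetrised second derivatives into
  -- `∂∂̄` of the single component `F^{0,2}(u, w)`. Twice its trace is the leading part of the rough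
  -- Laplacian.
  have e3 : trG h z (fun k l => dP (endA a) (fun y => dM (endA a) (fun x => cur02 a x l w) y u) z k)
      - trG h z (fun k l => dP (endA a) (fun y => dM (endA a) (fun x => cur02 a x l u) y w) z k)
      = trG h z (fun k l => dP (endA a) (fun y => dM (endA a) (fun x => cur02 a x u w) y l) z k) := by
    rw [← trG_sub]
    refine trG_congr fun k l => ?_
    rw [← dP_sub ((hA.contDiffOn_dM (d02 _ _) _).differentiableAt_of_isOpen hU hz)
      ((hA.contDiffOn_dM (d02 _ _) _).differentiableAt_of_isOpen hU hz)]
    refine dP_congr hU hz (fun y hy => ?_) _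
    have b03 := bianchi03 hU ha hy (dir l) u w
    have b1 : dM (endA a) (fun x => cur02 a x w (dir l)) y u
        = -dM (endA a) (fun x => cur02 a x (dir l) w) y u := by
      simp only [cur02_antisymm w, dM, cD_neg]
      module
    rw [b1] at b03
    rw [sub_eq_iff_eq_add, ← sub_eq_zero, ← neg_eq_zero, ← b03]
    abel
  have e4 := hA.trG_cD_cD H (d02 u w) hz
  simp only [cCurv11_endA had] at e4
  -- The second derivatives of the trace of `F^{1,1}` enter only through `∂̄∂̄`, which is a
  -- commutator with `F^{0,2}`.
  have e5 := hA.dM_dM dQ hz u w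
  rw [cCurv02_endA had] at e5
  rw [dcur02_eq hU ha hbd, e1, e1, e2, e2, e4, ← e5, ← e3, ← dM_curr hρ hU ha hs hp hz]
  module

/-- The evolution of `∂̄_A φ`. -/
theorem dM_flow (hz : z ∈ U) {q : Cn m → W}
    (hq : ∀ y ∈ U, q y = trG h y (fun k l => cD (secA ρ a) (fun x => cD (secA ρ a) p x l) y k)
      + (1 / 2 : ℂ) • ((τ : ℂ) • p y - ρ (ts (p y) (p y)) (p y))) (v : Cn m) :
    dM (secA ρ a) q z v + ρ ((1 / 2 : ℂ) • (b z v + Complex.I • b z (Complex.I • v))) (p z)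
      = trG h z (fun k l => cD (secA ρ a) (fun x => cD (secA ρ a)
          (fun y => dM (secA ρ a) p y v) x l) z k)
        + (trG h z (fun k l => ρ (cur11 a z k l) (dM (secA ρ a) p z v))
        + (2 : ℂ) • ∑ k, ∑ l, dbar (ginv h k l) z v • dP (secA ρ a)
            (fun y => dM (secA ρ a) p y (dir l)) z (dir k)
        - (2 : ℂ) • trG h z (fun k l => ρ (cur11 a z k v) (dM (secA ρ a) p z l))
        + (2 : ℂ) • trG h z (fun k l => ρ (cur02 a z v l) (dP (secA ρ a) p z k))
        - ρ (trCur h a z) (dM (secA ρ a) p z v)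
        + (1 / 2 : ℂ) • ((τ : ℂ) • dM (secA ρ a) p z v)
        - ρ (ts (dM (secA ρ a) p z v) (p z)) (p z)
        - (1 / 2 : ℂ) • ρ (ts (p z) (p z)) (dM (secA ρ a) p z v)) := by
  have hU := H.isOpen
  have hA := isConnOn_endA hU ha
  have hS := isConnOn_secA hρ.toIsRep hU ha
  have had := ha.differentiableAt_of_isOpen hU hz
  have dQ := (contDiffOn_trCur H ha)
  have d02 := contDiffOn_cur02 hU ha
  have dp := hp.differentiableAt_of_isOpen hU hz
  have dts := (ts.hasFDerivAt_of_bilinear dp.hasFDerivAt dp.hasFDerivAt).differentiableAt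
  have cβ := hS.contDiffOn_dM hp
  -- The Weitzenböck form of the equation, in which the only second derivatives of the section are
  -- `∂∂̄φ`.
  have e0 : ∀ y ∈ U, q y = (2 : ℂ) • trG h y (fun k l => dP (secA ρ a)
        (fun x => dM (secA ρ a) p x l) y k) - ρ (trCur h a y) (p y)
      + (1 / 2 : ℂ) • ((τ : ℂ) • p y - ρ (ts (p y) (p y)) (p y)) := by
    intro y hy
    have h1 : trG h y (fun k l => cCurv11 (secA ρ a) y k l (p y)) = ρ (trCur h a y) (p y) := by
      simp only [cCurv11_secA hρ.toIsRep (ha.differentiableAt_of_isOpen hU hy)]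
      exact trG_map (ρ.flip (p y)).toLinearMap (cur11 a y)
    rw [hq y hy, hS.trG_cD_cD H hp hy, h1]
  have cT : ContDiffOn ℝ ∞ (fun y => trG h y (fun k l => dP (secA ρ a)
        (fun x => dM (secA ρ a) p x l) y k)) U :=
    H.contDiffOn_trG fun k l => hS.contDiffOn_dP (cβ l) k
  have dT := cT.differentiableAt_of_isOpen hU hz
  have dQp := (ρ.hasFDerivAt_of_bilinear (dQ.differentiableAt_of_isOpen hU hz).hasFDerivAt
    dp.hasFDerivAt).differentiableAt
  have dtsp := (ρ.hasFDerivAt_of_bilinear dts.hasFDerivAt dp.hasFDerivAt).differentiableAt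
  have e1 : dM (secA ρ a) q z v = (2 : ℂ) • dM (secA ρ a) (fun y => trG h y (fun k l => dP (secA ρ a)
        (fun x => dM (secA ρ a) p x l) y k)) z v
      - (ρ (dM (endA a) (trCur h a) z v) (p z) + ρ (trCur h a z) (dM (secA ρ a) p z v))
      + (1 / 2 : ℂ) • ((τ : ℂ) • dM (secA ρ a) p z v
        - (ρ (ts (dM (secA ρ a) p z v) (p z) + ts (p z) (dP (secA ρ a) p z v)) (p z)
          + ρ (ts (p z) (p z)) (dM (secA ρ a) p z v))) := by
    rw [dM_congr hU hz e0, dM_add ((dT.fun_const_smul _).fun_sub dQp)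
      (((dp.fun_const_smul _).fun_sub dtsp).fun_const_smul _), dM_sub (dT.fun_const_smul _) dQp,
      hS.dM_smul dT, dM_rho hρ.toIsRep (dQ.differentiableAt_of_isOpen hU hz) dp,
      hS.dM_smul ((dp.fun_const_smul _).fun_sub dtsp), dM_sub (dp.fun_const_smul _) dtsp,
      hS.dM_smul dp, dM_rho hρ.toIsRep dts dp, dM_ts hρ (hs z hz) dp dp]
  -- `∂̄_v` is brought next to the section. Passing `∂_k` costs `F^{1,1}` acting on `∂̄φ`; passing
  -- `∂̄_l` costs `F^{0,2}φ`, whose `∂`-derivative is then expanded by the product rule.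
  have e2 : dM (secA ρ a) (fun y => trG h y (fun k l => dP (secA ρ a)
        (fun x => dM (secA ρ a) p x l) y k)) z v
      = trG h z (fun k l => dP (secA ρ a) (fun y => dM (secA ρ a)
          (fun x => dM (secA ρ a) p x v) y l) z k)
        + (trG h z (fun k l => ρ (dP (endA a) (fun y => cur02 a y v l) z k) (p z))
        + trG h z (fun k l => ρ (cur02 a z v l) (dP (secA ρ a) p z k)))
        - trG h z (fun k l => ρ (cur11 a z k v) (dM (secA ρ a) p z l))
        + ∑ k, ∑ l, dbar (ginv h k l) z v • dP (secA ρ a)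
            (fun y => dM (secA ρ a) p y (dir l)) z (dir k) := by
    rw [dM_trG H.toIsMetricOn hz fun k l =>
      (hS.contDiffOn_dP (cβ l) k).differentiableAt_of_isOpen hU hz, ← trG_add, ← trG_add, ← trG_sub]
    congr 1
    refine trG_congr fun k l => ?_
    have d1 := (hS.contDiffOn_dM (cβ v) (dir l)).differentiableAt_of_isOpen hU hz
    have d2 := (d02 v (dir l)).differentiableAt_of_isOpen hU hz
    have h1 : dP (secA ρ a) (fun y => dM (secA ρ a) (fun x => dM (secA ρ a) p x (dir l)) y v) z (dir k)
        = dP (secA ρ a) (fun y => dM (secA ρ a) (fun x => dM (secA ρ a) p x v) y (dir l)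
          + ρ (cur02 a y v (dir l)) (p y)) z (dir k) := by
      refine dP_congr hU hz (fun y hy => ?_) _
      rw [← cCurv02_secA hρ.toIsRep (ha.differentiableAt_of_isOpen hU hy), ← hS.dM_dM hp hy]
      abel
    rw [dP_add d1 (ρ.hasFDerivAt_of_bilinear d2.hasFDerivAt dp.hasFDerivAt).differentiableAt,
      dP_rho hρ.toIsRep d2 dp] at h1
    have h2 := hS.dP_dM (cβ (dir l)) hz (dir k) v
    rw [cCurv11_secA hρ.toIsRep had] at h2
    rw [← h1, ← h2]
    abel
  have e3 : trG h z (fun k l => ρ (dP (endA a) (fun y => cur02 a y v l) z k) (p z))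
      = -ρ (trG h z (fun k l => dP (endA a) (fun y => cur02 a y l v) z k)) (p z) := by
    have h1 := trG_map (h := h) (z := z) (ρ.flip (p z)).toLinearMap
      (fun k l => dP (endA a) (fun y => cur02 a y v l) z k)
    refine h1.trans ?_
    change ρ (trG h z (fun k l => dP (endA a) (fun y => cur02 a y v l) z k)) (p z) = _
    rw [← neg_apply, ← map_neg, ← trG_neg]
    congr 2
    refine trG_congr fun k l => ?_
    simp only [cur02_antisymm v, dP, cD_neg]
    module
  have e4 := hS.trG_cD_cD H (cβ v) hz
  simp only [cCurv11_secA hρ.toIsRep had] at e4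
  -- The terms with `∂F^{0,2}`, with `∂̄` of the trace of the curvature and with `φ ⊗ (∂φ)^*` cancel
  -- against the velocity of the connection. Beyond the rough Laplacian only terms linear in
  -- `F^{0,2}`, `∂̄φ` and first derivatives of `∂̄φ` remain.
  rw [e1, e2, e3, e4, velocity_part01 H hρ ha hs hp hb hflow hz]
  simp only [map_sub, map_add, sub_apply, add_apply, hρ.smul_left]
  module

end Evolution

end

end

/-! ### The moment map and the energy identity for pairs of holomorphic type -/

section

variable {m : ℕ}

section

variable {𝔄 : Type*} [NormedRing 𝔄] [NormedSpace ℂ 𝔄] [NormedSpace ℝ 𝔄] [IsScalarTower ℝ ℂ 𝔄]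
  [IsScalarTower ℂ 𝔄 𝔄] [SMulCommClass ℂ 𝔄 𝔄] [IsScalarTower ℝ 𝔄 𝔄] [SMulCommClass ℝ 𝔄 𝔄]
  {W : Type*} [NormedAddCommGroup W] [NormedSpace ℂ W] [NormedSpace ℝ W] [IsScalarTower ℝ ℂ W]
  {a : Cn m → Cn m →L[ℝ] 𝔄} {ρ : 𝔄 →L[ℝ] W →L[ℝ] W} {U : Set (Cn m)} {z : Cn m}
  {h : Cn m → Cn m → Cn m → ℝ} {ts : W →L[ℝ] W →L[ℝ] 𝔄} {st : 𝔄 →L[ℝ] 𝔄}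
  {p : Cn m → W} {τ : ℝ} {hs : 𝔄 →L[ℝ] 𝔄 →L[ℝ] ℝ} {ip : W →L[ℝ] W →L[ℝ] ℝ}

/-- The algebraic properties of the inner products on endomorphisms and on the fibre. -/
structure IsHermInner (ρ : 𝔄 →L[ℝ] W →L[ℝ] W) (ts : W →L[ℝ] W →L[ℝ] 𝔄) (st : 𝔄 →L[ℝ] 𝔄)
    (hs : 𝔄 →L[ℝ] 𝔄 →L[ℝ] ℝ) (ip : W →L[ℝ] W →L[ℝ] ℝ) : Prop where
  hs_symm : ∀ B C, hs B C = hs C B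
  hs_mul_left : ∀ B C D, hs (B * C) D = hs C (st B * D)
  hs_mul_right : ∀ B C D, hs (C * B) D = hs C (D * st B)
  hs_ts : ∀ x y B, hs (ts x y) B = ip x (ρ B y)
  ip_rho : ∀ B x y, ip (ρ B x) y = ip x (ρ (st B) y)

/-- `Λ F`, the contraction of the curvature with the fundamental form. -/
def lam (h : Cn m → Cn m → Cn m → ℝ) (a : Cn m → Cn m →L[ℝ] 𝔄) (z : Cn m) : 𝔄 :=
  (1 / 2 : ℝ) • trG h z (fun k l => cur a z k (Complex.I • l))

/-- The trace of the antisymmetric form `F` vanishes, as does that of `F(i·, i·)`, and the traces of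
`F(i·, ·)` and `F(·, i·)` are opposite. Hence the trace of `F^{1,1}` is `(i/2)` times the trace of
`F(·, i·)`. -/
theorem lam_eq (H : IsKahlerOn h U) (hz : z ∈ U) : lam h a z = -Complex.I • trCur h a z := by
  have e1 : trG h z (cur a z) = 0 := by
    have h1 := H.trG_swap hz (cur a z)
    have h2 : trG h z (fun v w => cur a z w v) = -trG h z (cur a z) := by
      rw [← trG_neg]; exact trG_congr fun k l => cur_antisymm _ _
    rw [h2] at h1
    have h3 : (2 : ℝ) • trG h z (cur a z) = 0 := by
      rw [two_smul]; nth_rewrite 1 [← h1]; abel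
    exact (smul_eq_zero.1 h3).resolve_left two_ne_zero
  have e2 : trG h z (fun v w => cur a z (Complex.I • v) (Complex.I • w)) = 0 := by
    rw [H.trG_I_I hz bilin_cur.neg_left bilin_cur.neg_right]
    exact e1
  have e3 := H.trG_I_right hz (B := cur a z) bilin_cur.neg_left bilin_cur.neg_right
  have e4 : trCur h a z = (1 / 4 : ℂ) • (trG h z (cur a z)
      - Complex.I • trG h z (fun v w => cur a z (Complex.I • v) w)
      + Complex.I • trG h z (fun v w => cur a z v (Complex.I • w))
      + trG h z (fun v w => cur a z (Complex.I • v) (Complex.I • w))) := by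
    rw [← trG_smul, ← trG_smul, ← trG_sub, ← trG_add, ← trG_add, ← trG_smul]
    rfl
  rw [e4, e1, e2, e3, lam, half_smul]
  linear_combination (norm := module) (1 / 2 : ℂ) •
    I_smul_I_smul (trG h z (fun v w => cur a z v (Complex.I • w)))

/-- The moment map expression `Λ F - (i/2) (φ ⊗ φ^* - τ)`. -/
def mom (h : Cn m → Cn m → Cn m → ℝ) (ts : W →L[ℝ] W →L[ℝ] 𝔄) (τ : ℝ)
    (a : Cn m → Cn m →L[ℝ] 𝔄) (p : Cn m → W) (z : Cn m) : 𝔄 :=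
  lam h a z - (Complex.I / 2) • (ts (p z) (p z) - (τ : ℂ) • (1 : 𝔄))

theorem IsHermRep.st_one (hρ : IsHermRep ρ ts st) : st 1 = 1 := by
  have := hρ.st_mul 1 (st 1)
  rwa [one_mul, hρ.st_st, one_mul, eq_comm] at this

theorem st_trG (B : Cn m → Cn m → 𝔄) :
    st (trG h z B) = trG h z (fun v w => st (B v w)) :=
  (trG_map st.toLinearMap B).symm

section Evolution

variable (H : IsKahlerOn h U) (hρ : IsHermRep ρ ts st) (ha : ContDiffOn ℝ ∞ a U)
  (hsk : IsSkewOn st a U) (hp : ContDiffOn ℝ ∞ p U)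
include H hρ ha hsk hp

theorem contDiffOn_lam : ContDiffOn ℝ ∞ (lam h a) U :=
  ContDiffOn.const_smul _ (H.contDiffOn_trG fun _ _ => contDiffOn_cur H.isOpen ha _ _)

theorem contDiffOn_mom : ContDiffOn ℝ ∞ (mom h ts τ a p) U :=
  (contDiffOn_lam H hρ ha hsk hp).sub (ContDiffOn.const_smul _
    (((contDiffOn_const.clm_apply hp).clm_apply hp).sub contDiffOn_const))

theorem st_mom (hz : z ∈ U) : st (mom h ts τ a p z) = -mom h ts τ a p z := by
  have h1 : st (lam h a z) = -lam h a z := by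
    rw [lam, map_smul, st_trG, ← smul_neg, ← trG_neg]
    congr 1
    exact trG_congr fun k l => st_cur hρ H.isOpen ha hsk hz _ _
  simp only [mom, map_sub, h1, hρ.st_smul, hρ.st_ts, hρ.st_one, Complex.conj_ofReal, map_div₀,
    Complex.conj_I, Complex.conj_ofNat]
  module

theorem st_cD {B : Cn m → 𝔄} (hB : ContDiffOn ℝ ∞ B U) (hBs : ∀ y ∈ U, st (B y) = -B y)
    (hz : z ∈ U) (v : Cn m) : st (cD (endA a) B z v) = -cD (endA a) B z v := by
  have h1 : st (fderiv ℝ B z v) = -fderiv ℝ B z v := by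
    have h2 : HasFDerivAt (fun y => st (B y)) (st ∘L fderiv ℝ B z) z :=
      st.hasFDerivAt.comp z (hB.differentiableAt_of_isOpen H.isOpen hz).hasFDerivAt
    have h3 : (fun y => st (B y)) =ᶠ[𝓝 z] fun y => -B y := by
      filter_upwards [H.isOpen.mem_nhds hz] with y hy using hBs y hy
    have h4 := h2.fderiv.symm.trans (h3.fderiv_eq (𝕜 := ℝ))
    rw [fderiv_fun_neg] at h4
    exact congrArg (fun L => L v) h4
  simp only [cD, endA, ContinuousLinearMap.comp_apply, adL_apply, map_add, map_sub, hρ.st_mul, h1,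
    hBs z hz, hsk z hz]
  noncomm_ring

variable {b : Cn m → Cn m →L[ℝ] 𝔄}
  (hb : ContDiffOn ℝ ∞ b U) (hbs : IsSkewOn st b U)
  (hflow : ∀ y ∈ U, ∀ v, b y v = divF h a y v - curr ρ ts a p y v)
  (h02 : ∀ y ∈ U, ∀ v w, cur02 a y v w = 0) (h01 : ∀ y ∈ U, ∀ v, dM (secA ρ a) p y v = 0)
include hb hbs hflow h02 h01

/-- On a solution of type `(1,1)` the velocity of the connection is determined by the moment map. -/
theorem velocity_eq (τ : ℝ) (hz : z ∈ U) (v : Cn m) :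
    b z v = -cD (endA a) (mom h ts τ a p) z (Complex.I • v) := by
  have hU := H.isOpen
  have hA := isConnOn_endA hU ha
  have cm := contDiffOn_mom (τ := τ) H hρ ha hsk hp
  have dm := cm.differentiableAt_of_isOpen hU hz
  have dp := hp.differentiableAt_of_isOpen hU hz
  have dQ := (contDiffOn_trCur H ha).differentiableAt_of_isOpen hU hz
  have dts := (ts.hasFDerivAt_of_bilinear dp.hasFDerivAt dp.hasFDerivAt).differentiableAt
  have e1 := velocity_part01 H hρ ha hsk hp hb hflow hz v
  have e2 : trG h z (fun k l => dP (endA a) (fun y => cur02 a y l v) z k) = 0 := by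
    unfold trG
    refine Finset.sum_eq_zero fun k _ => Finset.sum_eq_zero fun l _ => ?_
    simp only []
    rw [dP_congr hU hz (fun y hy => h02 y hy _ _), dP_zero, smul_zero]
  -- `iΨ` is the trace of `F^{1,1}` plus `½(φ⊗φ^* - τ)`. Since `∂̄φ = 0`, only the conjugate slot of
  -- `φ⊗φ^*` is differentiated, and this reproduces the contribution of the current.
  have e3 : dM (endA a) (fun y => Complex.I • mom h ts τ a p y) z v
      = dM (endA a) (trCur h a) z v + (1 / 2 : ℂ) • ts (p z) (dP (secA ρ a) p z v) := by
    have h1 : ∀ y ∈ U, Complex.I • mom h ts τ a p y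
        = trCur h a y + (1 / 2 : ℂ) • (ts (p y) (p y) - (τ : ℂ) • (1 : 𝔄)) := by
      intro y hy
      rw [mom, lam_eq H hy]
      linear_combination (norm := module) -I_smul_I_smul (trCur h a y)
        - (1 / 2 : ℂ) • I_smul_I_smul (ts (p y) (p y) - (τ : ℂ) • (1 : 𝔄))
    have h2 : dM (endA a) (fun _ => (τ : ℂ) • (1 : 𝔄)) z v = 0 := by
      have : ∀ v, cD (endA a) (fun _ => (τ : ℂ) • (1 : 𝔄)) z v = 0 := by
        intro v
        simp only [cD, fderiv_fun_const, Pi.zero_apply, zero_apply, endA,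
          ContinuousLinearMap.comp_apply, adL_apply, mul_smul_comm, smul_mul_assoc, mul_one, one_mul,
          sub_self, add_zero]
      simp only [dM, this, smul_zero, add_zero]
    rw [dM_congr hU hz h1, dM_add dQ ((dts.fun_sub (differentiableAt_const _)).fun_const_smul _),
      hA.dM_smul (dts.fun_sub (differentiableAt_const _)), dM_sub dts (differentiableAt_const _), h2,
      dM_ts hρ (hsk z hz) dp dp, h01 z hz]
    simp
  rw [e2, h01 z hz] at e1
  have e4 : (1 / 2 : ℂ) • (b z v + Complex.I • b z (Complex.I • v))
      = (1 / 2 : ℂ) • (Complex.I • cD (endA a) (mom h ts τ a p) z v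
        + Complex.I • Complex.I • cD (endA a) (mom h ts τ a p) z (Complex.I • v)) := by
    rw [e1, ← hA.cD_smul dm, ← hA.cD_smul dm]
    change _ = dM (endA a) (fun y => Complex.I • mom h ts τ a p y) z v
    rw [e3]
    simp only [map_zero, zero_apply]
    module
  rw [I_smul_I_smul] at e4
  have s := st_cD H hρ ha hsk hp cm (fun y hy => st_mom H hρ ha hsk hp hy) hz
  -- Both `b` and `∇Ψ` are skew, so the adjoint of the `(0,1)` identity is its conjugate.
  -- Subtracting the two isolates `b z v`.
  have e5 := congrArg st e4
  simp only [hρ.st_smul, map_add, map_neg, hbs z hz, s, Complex.conj_I, map_div₀, map_one,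
    Complex.conj_ofNat] at e5
  linear_combination (norm := module) e4 - e5

/-- The velocity of the section on a solution of type `(1,1)`. -/
theorem section_velocity_eq (τ : ℝ) (hz : z ∈ U) :
    trG h z (fun k l => cD (secA ρ a) (fun x => cD (secA ρ a) p x l) z k)
      + (1 / 2 : ℂ) • ((τ : ℂ) • p z - ρ (ts (p z) (p z)) (p z))
      = -Complex.I • ρ (mom h ts τ a p z) (p z) := by
  have hU := H.isOpen
  have hS := isConnOn_secA hρ.toIsRep hU ha
  have had := ha.differentiableAt_of_isOpen hU hz
  have h1 : trG h z (fun k l => cCurv11 (secA ρ a) z k l (p z)) = ρ (trCur h a z) (p z) := by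
    simp only [cCurv11_secA hρ.toIsRep had]
    exact trG_map (ρ.flip (p z)).toLinearMap (cur11 a z)
  have h2 : trG h z (fun v w => dP (secA ρ a) (fun y => dM (secA ρ a) p y w) z v) = 0 := by
    unfold trG
    refine Finset.sum_eq_zero fun k _ => Finset.sum_eq_zero fun l _ => ?_
    simp only []
    rw [dP_congr hU hz (fun y hy => h01 y hy _), dP_zero, smul_zero]
  -- With `∂̄φ = 0` the rough Laplacian reduces to the curvature term, minus the trace of `F^{1,1}`
  -- on `φ`, which is `-iΛFφ`.
  rw [hS.trG_cD_cD H hp hz, h1, h2, mom, lam_eq H hz]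
  simp only [map_sub, sub_apply, hρ.smul_left, hρ.one]
  linear_combination (norm := module) -I_smul_I_smul (ρ (trCur h a z) (p z))
    + (-1 / 2 : ℂ) • I_smul_I_smul (ρ (ts (p z) (p z)) (p z))
    + (τ / 2 : ℂ) • I_smul_I_smul (p z)

/-- The evolution of `Λ F` on a solution of type `(1,1)`. -/
theorem dlam_eq (τ : ℝ) (hz : z ∈ U) :
    (1 / 2 : ℝ) • trG h z (fun k l => dcur a b z k (Complex.I • l))
      = trG h z (fun k l => cD (endA a) (fun y => cD (endA a) (mom h ts τ a p) y l) z k) := by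
  have hU := H.isOpen
  have hA := isConnOn_endA hU ha
  have cm := contDiffOn_mom (τ := τ) H hρ ha hsk hp
  have dD := fun v => hA.differentiableAt_cD cm hz v
  have e1 : ∀ k l, dcur a b z k (Complex.I • l)
      = cD (endA a) (fun y => cD (endA a) (mom h ts τ a p) y l) z k
        + cD (endA a) (fun y => cD (endA a) (mom h ts τ a p) y (Complex.I • k)) z (Complex.I • l) := by
    intro k l
    have h1 : ∀ v w, cD (endA a) (fun y => b y w) z v
        = -cD (endA a) (fun y => cD (endA a) (mom h ts τ a p) y (Complex.I • w)) z v := by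
      intro v w
      rw [cD_congr hU hz fun y hy => velocity_eq H hρ ha hsk hp hb hbs hflow h02 h01 τ hy w, cD_neg]
    rw [dcur, h1, h1, I_smul_I_smul]
    simp only [cD_neg_right]
    rw [cD_neg]
    abel
  -- The second term is the Hessian of `Ψ` with its directions exchanged and multiplied by `i`. The
  -- trace ignores both operations, so the two terms agree and absorb the factor `½` of `Λ`.
  have e2 : trG h z (fun k l => cD (endA a) (fun y => cD (endA a) (mom h ts τ a p) y
      (Complex.I • k)) z (Complex.I • l))
      = trG h z (fun k l => cD (endA a) (fun y => cD (endA a) (mom h ts τ a p) y l) z k) := by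
    rw [← H.trG_swap hz (fun k l => cD (endA a) (fun y => cD (endA a) (mom h ts τ a p) y l) z k)]
    refine H.trG_I_I hz (B := fun v w => cD (endA a) (fun y => cD (endA a) (mom h ts τ a p) y v) z w)
      (fun v w => ?_) (fun v w => cD_neg_right _)
    simp only [cD_neg_right]
    rw [cD_neg]
  have e3 : trG h z (fun k l => dcur a b z k (Complex.I • l))
      = trG h z (fun k l => cD (endA a) (fun y => cD (endA a) (mom h ts τ a p) y l) z k)
        + trG h z (fun k l => cD (endA a) (fun y => cD (endA a) (mom h ts τ a p) y
          (Complex.I • k)) z (Complex.I • l)) := by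
    rw [← trG_add]; exact trG_congr fun k l => e1 _ _
  rw [e3, e2, half_smul]
  module

-- A skew connection form acts by commutators that are infinitesimal isometries of the trace form,
-- so the connection terms cancel and the inner product is parallel.
omit H hρ hsk hp hb hbs hflow h02 h01 ha in
theorem fderiv_hs (hi : IsHermInner ρ ts st hs ip) (hsk : ∀ v, st (a z v) = -a z v) {B C : Cn m → 𝔄}
    (hB : DifferentiableAt ℝ B z) (hC : DifferentiableAt ℝ C z) (v : Cn m) :
    fderiv ℝ (fun y => hs (B y) (C y)) z v
      = hs (cD (endA a) B z v) (C z) + hs (B z) (cD (endA a) C z v) := by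
  have h1 := hi.hs_mul_left (a z v) (B z) (C z)
  have h2 := hi.hs_mul_right (a z v) (C z) (B z)
  rw [hsk, neg_mul, map_neg] at h1
  rw [hsk, mul_neg, map_neg, hi.hs_symm, hi.hs_symm (C z)] at h2
  simp only [cD, endA, hs.fderiv_of_bilinear hB hC, add_apply, ContinuousLinearMap.precompR_apply,
    ContinuousLinearMap.precompL_apply, ContinuousLinearMap.compL_apply,
    ContinuousLinearMap.comp_apply, adL_apply, map_add, map_sub, sub_apply, h1]
  rw [h2]
  have h3 := hi.hs_mul_right (a z v) (B z) (C z)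
  rw [hsk, mul_neg, map_neg] at h3
  rw [h3, hi.hs_symm (B z * a z v)] at *
  linarith

/-- The evolution of the energy density on a solution of type `(1,1)`. -/
theorem energy_identity (hi : IsHermInner ρ ts st hs ip) (τ : ℝ) (hz : z ∈ U) {q : W}
    (hq : q = trG h z (fun k l => cD (secA ρ a) (fun x => cD (secA ρ a) p x l) z k)
      + (1 / 2 : ℂ) • ((τ : ℂ) • p z - ρ (ts (p z) (p z)) (p z))) :
    2 * hs ((1 / 2 : ℝ) • trG h z (fun k l => dcur a b z k (Complex.I • l))
        - (Complex.I / 2) • (ts q (p z) + ts (p z) q)) (mom h ts τ a p z)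
      + laplacian h (fun y => hs (mom h ts τ a p y) (mom h ts τ a p y)) z
      = -2 * trG h z (fun k l => hs (cD (endA a) (mom h ts τ a p) z k)
          (cD (endA a) (mom h ts τ a p) z l))
        - 2 * ip (ρ (mom h ts τ a p z) (p z)) (ρ (mom h ts τ a p z) (p z)) := by
  have hU := H.isOpen
  have hA := isConnOn_endA hU ha
  have cm := contDiffOn_mom (τ := τ) H hρ ha hsk hp
  have e1 := dlam_eq H hρ ha hsk hp hb hbs hflow h02 h01 τ hz
  rw [section_velocity_eq H hρ ha hsk hp hb hbs hflow h02 h01 τ hz] at hq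
  have hst := st_mom (τ := τ) H hρ ha hsk hp hz
  rw [e1, H.laplacian_eq hz]
  set Ψ := mom h ts τ a p
  have dD := fun v => hA.differentiableAt_cD cm hz v
  have e2 : ∀ v w, fderiv ℝ (fun y => fderiv ℝ (fun y => hs (Ψ y) (Ψ y)) y w) z v
      = 2 * hs (cD (endA a) (fun y => cD (endA a) Ψ y w) z v) (Ψ z)
        + 2 * hs (cD (endA a) Ψ z v) (cD (endA a) Ψ z w) := by
    intro v w
    have h1 : (fun y => fderiv ℝ (fun y => hs (Ψ y) (Ψ y)) y w)
        =ᶠ[𝓝 z] fun y => 2 * hs (cD (endA a) Ψ y w) (Ψ y) := by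
      filter_upwards [hU.mem_nhds hz] with y hy
      have dy := cm.differentiableAt_of_isOpen hU hy
      rw [fderiv_hs hi (hsk y hy) dy dy, hi.hs_symm (Ψ y)]
      ring
    have dy := cm.differentiableAt_of_isOpen hU hz
    have h2 := (hs.hasFDerivAt_of_bilinear (dD w).hasFDerivAt dy.hasFDerivAt).differentiableAt
    rw [h1.fderiv_eq, fderiv_const_mul h2, smul_apply, fderiv_hs hi (hsk z hz) (dD w) dy,
      hi.hs_symm (cD (endA a) Ψ z v)]
    simp only [smul_eq_mul]
    ring
  have e3 : trG h z (fun v w => fderiv ℝ (fun y => fderiv ℝ (fun y => hs (Ψ y) (Ψ y)) y w) z v)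
      = 2 * hs (trG h z (fun k l => cD (endA a) (fun y => cD (endA a) Ψ y l) z k)) (Ψ z)
        + 2 * trG h z (fun k l => hs (cD (endA a) Ψ z k) (cD (endA a) Ψ z l)) := by
    have h1 : hs (trG h z (fun k l => cD (endA a) (fun y => cD (endA a) Ψ y l) z k)) (Ψ z)
        = trG h z (fun k l => hs (cD (endA a) (fun y => cD (endA a) Ψ y l) z k) (Ψ z)) :=
      (trG_map (hs.flip (Ψ z)).toLinearMap _).symm
    rw [h1]
    simp only [trG, e2, Finset.mul_sum, ← Finset.sum_add_distrib, smul_eq_mul]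
    refine Finset.sum_congr rfl fun k _ => Finset.sum_congr rfl fun l _ => by ring
  -- Insertion of `q = -iΨφ`: conjugation in the second slot turns the sum into a difference. As `Ψ`
  -- is skew, its two terms pair with `Ψ` to `±|Ψφ|²`, so the halves add up.
  have e4 : (Complex.I / 2) • (ts q (p z) + ts (p z) q)
      = (1 / 2 : ℂ) • (ts (ρ (Ψ z) (p z)) (p z) - ts (p z) (ρ (Ψ z) (p z))) := by
    rw [hq, hρ.ts_smul_left, hρ.ts_smul_right, map_neg, Complex.conj_I, neg_neg]
    linear_combination (norm := module) (-1 / 2 : ℂ) • I_smul_I_smul (ts (ρ (Ψ z) (p z)) (p z))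
      + (1 / 2 : ℂ) • I_smul_I_smul (ts (p z) (ρ (Ψ z) (p z)))
  have e5 : hs (ts (ρ (Ψ z) (p z)) (p z)) (Ψ z) = ip (ρ (Ψ z) (p z)) (ρ (Ψ z) (p z)) :=
    hi.hs_ts _ _ _
  have e6 : hs (ts (p z) (ρ (Ψ z) (p z))) (Ψ z) = -ip (ρ (Ψ z) (p z)) (ρ (Ψ z) (p z)) := by
    rw [hi.hs_ts, hi.ip_rho, hst, map_neg, neg_apply, map_neg, neg_neg]
  rw [e4, e3, ← half_smul]
  simp only [map_sub, sub_apply, map_smul, smul_apply, e5, e6, smul_eq_mul]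
  ring

end Evolution

end

end

section

variable {m : ℕ}

/-! ### Functions of time and space -/

section

variable {E V V' V'' : Type*} [NormedAddCommGroup E] [NormedSpace ℝ E] [NormedAddCommGroup V]
  [NormedSpace ℝ V] [NormedAddCommGroup V'] [NormedSpace ℝ V'] [NormedAddCommGroup V'']
  [NormedSpace ℝ V'']

/-- Smoothness of a function of time and space on `I × U`. -/
def SmoothIn (I : Set ℝ) (U : Set E) (f : ℝ → E → V) : Prop :=
  ContDiffOn ℝ ∞ (fun q : ℝ × E => f q.1 q.2) (I ×ˢ U)

/-- A time domain on which one-sided derivatives make sense. -/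
structure IsTimeDomain (I : Set ℝ) : Prop where
  uniqueDiffOn : UniqueDiffOn ℝ I
  subset_closure : I ⊆ closure (interior I)

variable {I : Set ℝ} {U : Set E} {f : ℝ → E → V} {t : ℝ} {z : E}

theorem SmoothIn.slice (hf : SmoothIn I U f) (ht : t ∈ I) : ContDiffOn ℝ ∞ (f t) U :=
  hf.comp (f := fun z => (t, z)) (contDiffOn_const.prodMk contDiffOn_id) fun z hz => ⟨ht, hz⟩

theorem SmoothIn.const_time {g : E → V} (hg : ContDiffOn ℝ ∞ g U) :
    SmoothIn I U (fun _ => g) :=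
  hg.comp contDiffOn_snd fun q hq => hq.2

theorem SmoothIn.const (c : V) : SmoothIn I U (fun _ _ => c) := contDiffOn_const

theorem SmoothIn.add (hf : SmoothIn I U f) {g : ℝ → E → V} (hg : SmoothIn I U g) :
    SmoothIn I U (fun t z => f t z + g t z) :=
  ContDiffOn.add hf hg

theorem SmoothIn.sub (hf : SmoothIn I U f) {g : ℝ → E → V} (hg : SmoothIn I U g) :
    SmoothIn I U (fun t z => f t z - g t z) :=
  ContDiffOn.sub hf hg

theorem SmoothIn.sum {κ : Type*} (s : Finset κ) {F : κ → ℝ → E → V}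
    (hF : ∀ i ∈ s, SmoothIn I U (F i)) : SmoothIn I U (fun t z => ∑ i ∈ s, F i t z) :=
  ContDiffOn.sum hF

theorem SmoothIn.bilin (B : V →L[ℝ] V' →L[ℝ] V'') (hf : SmoothIn I U f) {g : ℝ → E → V'}
    (hg : SmoothIn I U g) : SmoothIn I U (fun t z => B (f t z) (g t z)) :=
  (contDiffOn_const.clm_apply hf).clm_apply hg

theorem SmoothIn.clm_apply {T : ℝ → E → V →L[ℝ] V'} (hT : SmoothIn I U T) (hf : SmoothIn I U f) :
    SmoothIn I U (fun t z => T t z (f t z)) :=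
  ContDiffOn.clm_apply hT hf

theorem SmoothIn.smul {c : ℝ → E → ℝ} (hc : SmoothIn I U c) (hf : SmoothIn I U f) :
    SmoothIn I U (fun t z => c t z • f t z) :=
  ContDiffOn.smul hc hf

theorem SmoothIn.const_smul {R : Type*} [Semiring R] [Module R V] [SMulCommClass ℝ R V]
    [ContinuousConstSMul R V] (c : R) (hf : SmoothIn I U f) : SmoothIn I U (fun t z => c • f t z) :=
  ContDiffOn.const_smul c hf

section Deriv

variable (hI : IsTimeDomain I) (hU : IsOpen U) (hf : SmoothIn I U f)
include hI hU hf

theorem SmoothIn.hasFDerivWithinAt (ht : t ∈ I) (hz : z ∈ U) :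
    HasFDerivWithinAt (fun q : ℝ × E => f q.1 q.2)
      (fderivWithin ℝ (fun q : ℝ × E => f q.1 q.2) (I ×ˢ U) (t, z)) (I ×ˢ U) (t, z) :=
  ((hf.differentiableOn (by simp)) (t, z) ⟨ht, hz⟩).hasFDerivWithinAt

theorem SmoothIn.hasFDerivAt_space (ht : t ∈ I) (hz : z ∈ U) :
    HasFDerivAt (f t) (fderivWithin ℝ (fun q : ℝ × E => f q.1 q.2) (I ×ˢ U) (t, z) ∘L
      ContinuousLinearMap.inr ℝ ℝ E) z := by
  have h1 : HasFDerivWithinAt (fun y : E => (t, y)) (ContinuousLinearMap.inr ℝ ℝ E) U z :=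
    (hasFDerivAt_prodMk_right t z).hasFDerivWithinAt
  exact ((hf.hasFDerivWithinAt hI hU ht hz).comp z h1 fun y hy => ⟨ht, hy⟩).hasFDerivAt
    (hU.mem_nhds hz)

theorem SmoothIn.hasDerivWithinAt_time (ht : t ∈ I) (hz : z ∈ U) :
    HasDerivWithinAt (fun s => f s z)
      (fderivWithin ℝ (fun q : ℝ × E => f q.1 q.2) (I ×ˢ U) (t, z) (1, 0)) I t := by
  have h1 : HasFDerivWithinAt (fun s : ℝ => (s, z)) (ContinuousLinearMap.inl ℝ ℝ E) I t :=
    (hasFDerivAt_prodMk_left t z).hasFDerivWithinAt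
  have hm : MapsTo (fun s : ℝ => (s, z)) I (I ×ˢ U) := fun s hs => ⟨hs, hz⟩
  have h2 : HasFDerivWithinAt (fun s => f s z)
      (fderivWithin ℝ (fun q : ℝ × E => f q.1 q.2) (I ×ˢ U) (t, z) ∘L
        ContinuousLinearMap.inl ℝ ℝ E) I t :=
    HasFDerivWithinAt.comp (g := fun q : ℝ × E => f q.1 q.2) t
      (hf.hasFDerivWithinAt hI hU ht hz) h1 hm
  exact h2.hasDerivWithinAt.congr_deriv (by simp)

theorem SmoothIn.fderiv_smooth : SmoothIn I U (fun t z => fderiv ℝ (f t) z) := by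
  have h1 : ContDiffOn ℝ ∞ (fderivWithin ℝ (fun q : ℝ × E => f q.1 q.2) (I ×ˢ U)) (I ×ˢ U) :=
    ContDiffOn.fderivWithin hf (hI.uniqueDiffOn.prod hU.uniqueDiffOn) (by simp)
  have h2 : ContDiffOn ℝ ∞ (fun q => fderivWithin ℝ (fun q : ℝ × E => f q.1 q.2) (I ×ˢ U) q ∘L
      ContinuousLinearMap.inr ℝ ℝ E) (I ×ˢ U) := h1.clm_comp contDiffOn_const
  exact h2.congr fun q hq => (hf.hasFDerivAt_space hI hU hq.1 hq.2).fderiv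

theorem SmoothIn.fderiv_apply (v : E) : SmoothIn I U (fun t z => fderiv ℝ (f t) z v) :=
  (hf.fderiv_smooth hI hU).clm_apply (SmoothIn.const v)

theorem SmoothIn.derivWithin_eq (ht : t ∈ I) (hz : z ∈ U) : derivWithin (fun s => f s z) I t
    = fderivWithin ℝ (fun q : ℝ × E => f q.1 q.2) (I ×ˢ U) (t, z) (1, 0) :=
  (hf.hasDerivWithinAt_time hI hU ht hz).derivWithin (hI.uniqueDiffOn t ht)

theorem SmoothIn.hasDerivWithinAt (ht : t ∈ I) (hz : z ∈ U) :
    HasDerivWithinAt (fun s => f s z) (derivWithin (fun s => f s z) I t) I t := by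
  rw [hf.derivWithin_eq hI hU ht hz]
  exact hf.hasDerivWithinAt_time hI hU ht hz

theorem SmoothIn.derivWithin_smooth : SmoothIn I U (fun t z => derivWithin (fun s => f s z) I t) := by
  have h1 : ContDiffOn ℝ ∞ (fderivWithin ℝ (fun q : ℝ × E => f q.1 q.2) (I ×ˢ U)) (I ×ˢ U) :=
    ContDiffOn.fderivWithin hf (hI.uniqueDiffOn.prod hU.uniqueDiffOn) (by simp)
  have h2 : ContDiffOn ℝ ∞ (fun q => fderivWithin ℝ (fun q : ℝ × E => f q.1 q.2) (I ×ˢ U) q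
      ((1 : ℝ), (0 : E))) (I ×ˢ U) := h1.clm_apply contDiffOn_const
  exact h2.congr fun q hq => hf.derivWithin_eq hI hU hq.1 hq.2

/-- Time and space derivatives commute. -/
theorem SmoothIn.hasDerivWithinAt_fderiv (ht : t ∈ I) (hz : z ∈ U) (v : E) :
    HasDerivWithinAt (fun s => fderiv ℝ (f s) z v)
      (fderiv ℝ (fun y => derivWithin (fun s => f s y) I t) z v) I t := by
  set F := fun q : ℝ × E => f q.1 q.2
  set S := I ×ˢ U
  have hS : UniqueDiffOn ℝ S := hI.uniqueDiffOn.prod hU.uniqueDiffOn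
  have h1 : ContDiffOn ℝ ∞ (fderivWithin ℝ F S) S := ContDiffOn.fderivWithin hf hS (by simp)
  -- Symmetry of the second derivative also holds at boundary times such as `t = 0`, because each
  -- point of the time domain is a limit of interior points.
  have hsym : IsSymmSndFDerivWithinAt ℝ F S (t, z) := by
    refine (hf (t, z) ⟨ht, hz⟩).isSymmSndFDerivWithinAt
      (by simpa using WithTop.coe_le_coe.2 (le_top : (2 : ℕ∞) ≤ ⊤)) hS ?_ ⟨ht, hz⟩
    rw [interior_prod_eq, closure_prod_eq, hU.interior_eq]
    exact ⟨hI.subset_closure ht, subset_closure hz⟩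
  have h2 : SmoothIn I U (fun s y => fderivWithin ℝ F S (s, y)) := h1
  have e1 := h2.hasDerivWithinAt_time hI hU ht hz
  have e2 := h2.hasFDerivAt_space hI hU ht hz
  have e3 : HasDerivWithinAt (fun s => fderivWithin ℝ F S (s, z) (0, v))
      (fderivWithin ℝ (fderivWithin ℝ F S) S (t, z) (1, 0) (0, v)) I t := by
    have := e1.clm_apply (hasDerivWithinAt_const t I ((0 : ℝ), v))
    simpa using this
  have e4 : fderiv ℝ (fun y => derivWithin (fun s => f s y) I t) z v
      = fderivWithin ℝ (fderivWithin ℝ F S) S (t, z) (0, v) (1, 0) := by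
    have h3 : (fun y => derivWithin (fun s => f s y) I t)
        =ᶠ[𝓝 z] fun y => fderivWithin ℝ F S (t, y) ((1 : ℝ), (0 : E)) := by
      filter_upwards [hU.mem_nhds hz] with y hy using hf.derivWithin_eq hI hU ht hy
    have h4 := e2.clm_apply (hasFDerivAt_const ((1 : ℝ), (0 : E)) z)
    rw [h3.fderiv_eq, h4.fderiv]
    simp
    rfl
  rw [e4, hsym.eq]
  refine e3.congr (fun s hs => ?_) ?_
  · rw [(hf.hasFDerivAt_space hI hU hs hz).fderiv]; simp; rfl
  · rw [(hf.hasFDerivAt_space hI hU ht hz).fderiv]; simp; rfl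

end Deriv

/-- A convex set with nonempty interior has unique one-sided derivatives and lies in the closure of
its interior. For `T ≤ 0` the interval is empty. -/
theorem isTimeDomain_timeInterval (T : EReal) : IsTimeDomain (timeInterval T) := by
  have hconv : Convex ℝ (timeInterval T) := by
    refine Set.OrdConnected.convex ⟨fun x hx y hy z hz => ⟨hx.1.trans hz.1, ?_⟩⟩
    exact lt_of_le_of_lt (EReal.coe_le_coe_iff.2 hz.2) hy.2
  by_cases hT : (0 : EReal) < T
  · have hne : (interior (timeInterval T)).Nonempty := by
      obtain ⟨s, hs0, hsT⟩ := EReal.lt_iff_exists_real_btwn.1 hT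
      have hs0' : (0 : ℝ) < s := by exact_mod_cast hs0
      refine ⟨s / 2, mem_interior.2 ⟨Set.Ioo 0 s, fun x hx => ⟨hx.1.le, ?_⟩, isOpen_Ioo, ?_⟩⟩
      · exact lt_trans (EReal.coe_lt_coe_iff.2 hx.2) hsT
      · constructor <;> linarith
    refine ⟨uniqueDiffOn_convex hconv hne, ?_⟩
    rw [hconv.closure_interior_eq_closure_of_nonempty_interior hne]
    exact subset_closure
  · have : timeInterval T = ∅ := by
      ext t
      simp only [timeInterval, mem_ofPred_eq, mem_empty_iff_false, iff_false, not_and, not_lt]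
      intro h0
      exact (not_lt.1 hT).trans (by exact_mod_cast h0)
    rw [this]
    exact ⟨uniqueDiffOn_empty, empty_subset _⟩

end

section

variable {𝔄 : Type*} [NormedRing 𝔄] [NormedSpace ℂ 𝔄] [NormedSpace ℝ 𝔄] [IsScalarTower ℝ ℂ 𝔄]
  [IsScalarTower ℂ 𝔄 𝔄] [SMulCommClass ℂ 𝔄 𝔄] [IsScalarTower ℝ 𝔄 𝔄] [SMulCommClass ℝ 𝔄 𝔄]
  {W : Type*} [NormedAddCommGroup W] [NormedSpace ℂ W] [NormedSpace ℝ W] [IsScalarTower ℝ ℂ W]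
  {a : ℝ → Cn m → Cn m →L[ℝ] 𝔄} {ρ : 𝔄 →L[ℝ] W →L[ℝ] W} {U : Set (Cn m)} {z : Cn m}
  {h : Cn m → Cn m → Cn m → ℝ} {I : Set ℝ} {p : ℝ → Cn m → W} {t : ℝ}
  {A : ℝ → Cn m → Cn m →L[ℝ] W →L[ℝ] W}

variable (hI : IsTimeDomain I) (hU : IsOpen U)
include hI hU

theorem SmoothIn.cD (hA : SmoothIn I U A) (hp : SmoothIn I U p) (v : Cn m) :
    SmoothIn I U (fun t z => cD (A t) (p t) z v) :=
  (hp.fderiv_apply hI hU v).add ((hA.clm_apply (SmoothIn.const v)).clm_apply hp)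

theorem SmoothIn.dP (hA : SmoothIn I U A) (hp : SmoothIn I U p) (v : Cn m) :
    SmoothIn I U (fun t z => dP (A t) (p t) z v) :=
  ((hA.cD hI hU hp v).sub ((hA.cD hI hU hp _).const_smul _)).const_smul _

theorem SmoothIn.dM (hA : SmoothIn I U A) (hp : SmoothIn I U p) (v : Cn m) :
    SmoothIn I U (fun t z => dM (A t) (p t) z v) :=
  ((hA.cD hI hU hp v).add ((hA.cD hI hU hp _).const_smul _)).const_smul _

omit hI hU in
theorem SmoothIn.secA (ha : SmoothIn I U a) : SmoothIn I U (fun t => secA ρ (a t)) :=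
  contDiffOn_const.clm_comp ha

omit hI hU in
theorem SmoothIn.endA (ha : SmoothIn I U a) : SmoothIn I U (fun t => endA (a t)) :=
  contDiffOn_const.clm_comp ha

theorem SmoothIn.cur (ha : SmoothIn I U a) (v w : Cn m) : SmoothIn I U (fun t z => cur (a t) z v w) := by
  have h0 := fun v => ha.clm_apply (SmoothIn.const v)
  have h1 := fun v w => (ha.fderiv_apply hI hU v).clm_apply (SmoothIn.const w)
  have h2 := fun v w => (h0 v).bilin (mulL 𝔄) (h0 w)
  exact ((h1 v w).sub (h1 w v)).add ((h2 v w).sub (h2 w v))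

theorem SmoothIn.cur02 (ha : SmoothIn I U a) (v w : Cn m) :
    SmoothIn I U (fun t z => cur02 (a t) z v w) := by
  have h := ha.cur hI hU
  exact SmoothIn.const_smul _ ((((h _ _).add ((h _ _).const_smul _)).add
    ((h _ _).const_smul _)).sub (h _ _))

theorem SmoothIn.cur11 (ha : SmoothIn I U a) (v w : Cn m) :
    SmoothIn I U (fun t z => cur11 (a t) z v w) := by
  have h := ha.cur hI hU
  exact SmoothIn.const_smul _ ((((h _ _).sub ((h _ _).const_smul _)).add
    ((h _ _).const_smul _)).add (h _ _))

omit hI hU in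
theorem SmoothIn.trG (H : IsMetricOn h U) {B : ℝ → Cn m → Cn m → Cn m → W}
    (hB : ∀ v w, SmoothIn I U (fun t z => B t z v w)) :
    SmoothIn I U (fun t z => trG h z (B t z)) :=
  SmoothIn.sum _ fun k _ => SmoothIn.sum _ fun l _ =>
    (SmoothIn.const_time (H.contDiffOn_ginv k l)).smul (hB _ _)

theorem SmoothIn.trCur (H : IsMetricOn h U) (ha : SmoothIn I U a) :
    SmoothIn I U (fun t => trCur h (a t)) :=
  SmoothIn.trG H (ha.cur11 hI hU)

theorem SmoothIn.lam (H : IsMetricOn h U) (ha : SmoothIn I U a) :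
    SmoothIn I U (fun t => lam h (a t)) :=
  (SmoothIn.trG H fun _ _ => ha.cur hI hU _ _).const_smul _

theorem SmoothIn.mom (H : IsMetricOn h U) {ts : W →L[ℝ] W →L[ℝ] 𝔄} {τ : ℝ} (ha : SmoothIn I U a)
    (hp : SmoothIn I U p) : SmoothIn I U (fun t => mom h ts τ (a t) (p t)) :=
  (ha.lam hI hU H).sub (((hp.bilin ts hp).sub (SmoothIn.const _)).const_smul _)

/-- The time derivative of the curvature is its linearisation. -/
theorem SmoothIn.hasDerivWithinAt_cur (ha : SmoothIn I U a) {b : Cn m → Cn m →L[ℝ] 𝔄}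
    (ht : t ∈ I) (hb : ∀ y ∈ U, b y = derivWithin (fun s => a s y) I t) (hz : z ∈ U) (v w : Cn m) :
    HasDerivWithinAt (fun s => YMH.cur (a s) z v w) (dcur (a t) b z v w) I t := by
  have had := ha.hasDerivWithinAt hI hU ht hz
  rw [← hb z hz] at had
  have h0 : ∀ v, HasDerivWithinAt (fun s => a s z v) (b z v) I t := fun v => by
    simpa using had.clm_apply (hasDerivWithinAt_const t I v)
  have hbe : fderiv ℝ b z = fderiv ℝ (fun y => derivWithin (fun s => a s y) I t) z := by
    apply Filter.EventuallyEq.fderiv_eq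
    filter_upwards [hU.mem_nhds hz] with y hy using hb y hy
  have hbd : DifferentiableAt ℝ b z :=
    (((ha.derivWithin_smooth hI hU).slice ht).congr hb).differentiableAt_of_isOpen hU hz
  have h1 : ∀ v w, HasDerivWithinAt (fun s => fderiv ℝ (a s) z v w) (fderiv ℝ b z v w) I t := by
    intro v w
    have := (ha.hasDerivWithinAt_fderiv hI hU ht hz v).clm_apply (hasDerivWithinAt_const t I w)
    simpa [hbe] using this
  have h2 : ∀ v w, HasDerivWithinAt (fun s => a s z v * a s z w)
      (a t z v * b z w + b z v * a t z w) I t := by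
    intro v w
    exact (mulL 𝔄).hasDerivWithinAt_of_bilinear (h0 v) (h0 w)
  have h3 := ((h1 v w).sub (h1 w v)).add ((h2 v w).sub (h2 w v))
  have h4 : ∀ v w, fderiv ℝ (fun y => b y w) z v = fderiv ℝ b z v w := by
    intro v w
    rw [fderiv_clm_apply hbd (differentiableAt_const w)]
    simp
  refine h3.congr_deriv ?_
  simp only [dcur, YMH.cD, h4, YMH.endA, ContinuousLinearMap.comp_apply, adL_apply]
  abel

theorem SmoothIn.hasDerivWithinAt_cur02 (ha : SmoothIn I U a) {b : Cn m → Cn m →L[ℝ] 𝔄}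
    (ht : t ∈ I) (hb : ∀ y ∈ U, b y = derivWithin (fun s => a s y) I t) (hz : z ∈ U) (v w : Cn m) :
    HasDerivWithinAt (fun s => YMH.cur02 (a s) z v w) (dcur02 (a t) b z v w) I t := by
  have h := ha.hasDerivWithinAt_cur hI hU ht hb hz
  exact ((((h _ _).add ((h _ _).const_smul Complex.I)).add
    ((h _ _).const_smul Complex.I)).sub (h _ _)).const_smul _

/-- The time derivative of the covariant derivative. -/
theorem SmoothIn.hasDerivWithinAt_cD (ha : SmoothIn I U a) (hp : SmoothIn I U p)
    {b : Cn m → Cn m →L[ℝ] 𝔄} {q : Cn m → W}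
    (ht : t ∈ I) (hb : ∀ y ∈ U, b y = derivWithin (fun s => a s y) I t)
    (hq : ∀ y ∈ U, q y = derivWithin (fun s => p s y) I t) (hz : z ∈ U) (v : Cn m) :
    HasDerivWithinAt (fun s => YMH.cD (YMH.secA ρ (a s)) (p s) z v)
      (YMH.cD (YMH.secA ρ (a t)) q z v + ρ (b z v) (p t z)) I t := by
  have had := ha.hasDerivWithinAt hI hU ht hz
  rw [← hb z hz] at had
  have hpd := hp.hasDerivWithinAt hI hU ht hz
  rw [← hq z hz] at hpd
  have h0 : HasDerivWithinAt (fun s => a s z v) (b z v) I t := by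
    simpa using had.clm_apply (hasDerivWithinAt_const t I v)
  have hqe : fderiv ℝ q z = fderiv ℝ (fun y => derivWithin (fun s => p s y) I t) z := by
    apply Filter.EventuallyEq.fderiv_eq
    filter_upwards [hU.mem_nhds hz] with y hy using hq y hy
  have h1 := hp.hasDerivWithinAt_fderiv hI hU ht hz v
  rw [← hqe] at h1
  have h2 := ρ.hasDerivWithinAt_of_bilinear h0 hpd
  refine (h1.add h2).congr_deriv ?_
  simp only [YMH.cD, YMH.secA, ContinuousLinearMap.comp_apply]
  abel

theorem SmoothIn.hasDerivWithinAt_dM (hρ : IsRep ρ) (ha : SmoothIn I U a) (hp : SmoothIn I U p)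
    {b : Cn m → Cn m →L[ℝ] 𝔄} {q : Cn m → W}
    (ht : t ∈ I) (hb : ∀ y ∈ U, b y = derivWithin (fun s => a s y) I t)
    (hq : ∀ y ∈ U, q y = derivWithin (fun s => p s y) I t) (hz : z ∈ U) (v : Cn m) :
    HasDerivWithinAt (fun s => YMH.dM (YMH.secA ρ (a s)) (p s) z v)
      (YMH.dM (YMH.secA ρ (a t)) q z v
        + ρ ((1 / 2 : ℂ) • (b z v + Complex.I • b z (Complex.I • v))) (p t z)) I t := by
  have h := ha.hasDerivWithinAt_cD (ρ := ρ) hI hU hp ht hb hq hz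
  refine (((h v).add ((h (Complex.I • v)).const_smul Complex.I)).const_smul (1 / 2 : ℂ)).congr_deriv ?_
  simp only [YMH.dM, map_add, add_apply, hρ.smul_left]
  module

end

end

section

variable {m : ℕ}

/-! ### Positivity of the metric traces -/

section

variable {h : Cn m → Cn m → Cn m → ℝ} {U : Set (Cn m)} {z : Cn m}
  {V : Type*} [NormedAddCommGroup V] [NormedSpace ℝ V]

open scoped Matrix.Norms.L2Operator MatrixOrder in
/-- A positive semidefinite matrix paired with a positive semidefinite form is positive. -/
theorem sum_posSemidef_nonneg {κ : Type*} [Fintype κ] {M : Matrix κ κ ℝ} (hM : M.PosSemidef)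
    (S : V →L[ℝ] V →L[ℝ] ℝ) (hS : ∀ x, 0 ≤ S x x) (x : κ → V) :
    0 ≤ ∑ k, ∑ l, M k l * S (x k) (x l) := by
  classical
  -- The factorisation `M = Bᵗ B` rewrites the double sum as a sum of values `S y y`.
  obtain ⟨B, rfl⟩ : ∃ B : Matrix κ κ ℝ, M = B.conjTranspose * B :=
    CStarAlgebra.nonneg_iff_eq_star_mul_self.mp hM.nonneg
  have : ∑ k, ∑ l, (B.conjTranspose * B) k l * S (x k) (x l)
      = ∑ q, S (∑ k, B q k • x k) (∑ l, B q l • x l) := by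
    simp only [Matrix.mul_apply, Matrix.conjTranspose_apply, star_trivial, map_sum, map_smul,
      sum_apply, smul_apply, smul_eq_mul, Finset.sum_mul,
      Finset.mul_sum]
    rw [Finset.sum_congr rfl fun k _ => Finset.sum_comm, Finset.sum_comm]
    refine Finset.sum_congr rfl fun q _ => ?_
    rw [Finset.sum_comm]
    refine Finset.sum_congr rfl fun k _ => Finset.sum_congr rfl fun l _ => ?_
    ring
  rw [this]
  exact Finset.sum_nonneg fun q _ => hS _

theorem sum_ginv_nonneg (H : IsMetricOn h U) (hz : z ∈ U)
    (S : V →L[ℝ] V →L[ℝ] ℝ) (hS : ∀ x, 0 ≤ S x x) (x : Idx m → V) :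
    0 ≤ ∑ k, ∑ l, ginv h k l z * S (x k) (x l) :=
  sum_posSemidef_nonneg (H.posDef_ginv hz).posSemidef S hS x

/-- The inverse metric is locally bounded below by a multiple of the Euclidean one. -/
theorem IsMetricOn.exists_ginv_lower (H : IsMetricOn h U) (hz : z ∈ U) :
    ∃ c > (0 : ℝ), ∀ᶠ y in 𝓝 z,
      (Matrix.of (fun k l => ginv h k l y) - c • (1 : Matrix (Idx m) (Idx m) ℝ)).PosSemidef := by
  classical
  set n : ℝ := ((Fintype.card (Idx m) : ℕ) : ℝ) with hn
  let q : Cn m → (Idx m → ℝ) → ℝ := fun y x => ∑ k, ∑ l, ginv h k l y * (x k * x l)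
  have hq0 : ∀ x, x ≠ 0 → 0 < q z x := by
    intro x hx
    have := (H.posDef_ginv hz).dotProduct_mulVec_pos hx
    simp only [dotProduct, Matrix.mulVec, star_trivial, Pi.star_apply, Finset.mul_sum,
      Matrix.of_apply] at this
    refine this.trans_eq (Finset.sum_congr rfl fun k _ => Finset.sum_congr rfl fun l _ => ?_)
    ring
  have hqc : Continuous (q z) := by fun_prop
  -- The minimum over the compact unit sphere, extended by homogeneity. The sphere is empty when `m
  -- = 0`, and then any constant will do.
  obtain ⟨c, hc, hcq⟩ : ∃ c > 0, ∀ x, c * ‖x‖ ^ 2 ≤ q z x := by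
    rcases (Metric.sphere (0 : Idx m → ℝ) 1).eq_empty_or_nonempty with he | hne
    · refine ⟨1, one_pos, fun x => ?_⟩
      have hx : x = 0 := by
        by_contra hx
        have : (‖x‖⁻¹ • x) ∈ Metric.sphere (0 : Idx m → ℝ) 1 := by
          simp [norm_smul, inv_mul_cancel₀ (norm_ne_zero_iff.2 hx)]
        simp [he] at this
      simp [hx, q]
    · obtain ⟨x0, hx0, hmin⟩ := (isCompact_sphere (0 : Idx m → ℝ) 1).exists_isMinOn hne
        hqc.continuousOn
      have hx0' : x0 ≠ 0 := by
        rintro rfl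
        simp at hx0
      refine ⟨q z x0, hq0 x0 hx0', fun x => ?_⟩
      by_cases hx : x = 0
      · simp [hx, q]
      have hxn := norm_ne_zero_iff.2 hx
      have h1 : q z x0 ≤ q z (‖x‖⁻¹ • x) := hmin (by simp [norm_smul, inv_mul_cancel₀ hxn])
      have h2 : q z (‖x‖⁻¹ • x) * ‖x‖ ^ 2 = q z x := by
        simp only [q, Finset.sum_mul, Pi.smul_apply, smul_eq_mul]
        refine Finset.sum_congr rfl fun k _ => Finset.sum_congr rfl fun l _ => ?_
        field_simp
      calc q z x0 * ‖x‖ ^ 2 ≤ q z (‖x‖⁻¹ • x) * ‖x‖ ^ 2 := by gcongr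
        _ = q z x := h2
  have hn0 : 0 ≤ n := by positivity
  -- The bound `c‖x‖²` at `z` is spent in two halves. Perturbing the `n²` entries by `ε` costs at
  -- most `c/2`, and subtracting `c/(2(n+1))` times the identity costs at most `c/2`, since `∑ x_k²
  -- ≤ n‖x‖²` for the sup norm. The added ones keep the denominators positive when `n = 0`.
  set ε := c / (2 * (n ^ 2 + 1)) with hε
  have hε0 : 0 < ε := by positivity
  refine ⟨c / (2 * (n + 1)), by positivity, ?_⟩
  have hev : ∀ᶠ y in 𝓝 z, ∀ k l, |ginv h k l y - ginv h k l z| ≤ ε := by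
    rw [eventually_all]
    intro k
    rw [eventually_all]
    intro l
    have hcont := ((H.contDiffOn_ginv k l).continuousOn.continuousAt (H.isOpen.mem_nhds hz))
    have := Metric.tendsto_nhds.1 hcont.tendsto ε hε0
    filter_upwards [this] with y hy
    exact (Real.dist_eq _ _ ▸ hy).le
  filter_upwards [hev, H.isOpen.mem_nhds hz] with y hy hyU
  refine Matrix.PosSemidef.of_dotProduct_mulVec_nonneg ?_ fun x => ?_
  · ext k l
    simp [H.ginv_symm hyU l k, Matrix.one_apply, eq_comm]
  · have e1 : star x ⬝ᵥ (Matrix.of (fun k l => ginv h k l y)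
        - (c / (2 * (n + 1))) • (1 : Matrix (Idx m) (Idx m) ℝ)).mulVec x
        = q y x - c / (2 * (n + 1)) * ∑ k, x k ^ 2 := by
      rw [Matrix.sub_mulVec, dotProduct_sub, Matrix.smul_mulVec, Matrix.one_mulVec]
      congr 1
      · simp only [dotProduct, Matrix.mulVec, star_trivial, Pi.star_apply, Finset.mul_sum,
          Matrix.of_apply, q]
        refine (Finset.sum_congr rfl fun k _ => Finset.sum_congr rfl fun l _ => ?_)
        ring
      · simp [dotProduct, Finset.mul_sum]
        exact Finset.sum_congr rfl fun k _ => by ring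
    rw [e1]
    have hxk : ∀ k, |x k| ≤ ‖x‖ := fun k => norm_le_pi_norm x k
    have e2 : |q y x - q z x| ≤ n ^ 2 * (ε * ‖x‖ ^ 2) := by
      have : q y x - q z x = ∑ k, ∑ l, (ginv h k l y - ginv h k l z) * (x k * x l) := by
        simp only [q, ← Finset.sum_sub_distrib, sub_mul]
      rw [this]
      calc _ ≤ ∑ k : Idx m, ∑ l : Idx m, ε * ‖x‖ ^ 2 := by
            refine (Finset.abs_sum_le_sum_abs _ _).trans (Finset.sum_le_sum fun k _ => ?_)
            refine (Finset.abs_sum_le_sum_abs _ _).trans (Finset.sum_le_sum fun l _ => ?_)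
            rw [abs_mul, abs_mul, sq]
            have := hy k l
            have := hxk k
            have := hxk l
            gcongr
        _ = _ := by simp [hn]; ring
    have e3 : ∑ k, x k ^ 2 ≤ n * ‖x‖ ^ 2 := by
      calc _ ≤ ∑ k : Idx m, ‖x‖ ^ 2 := Finset.sum_le_sum fun k _ => by
            rw [← sq_abs]; have := hxk k; gcongr
        _ = _ := by simp [hn]
    have e4 := hcq x
    have e5 : c / (2 * (n + 1)) * ∑ k, x k ^ 2 ≤ c / 2 * ‖x‖ ^ 2 := by
      calc _ ≤ c / (2 * (n + 1)) * (n * ‖x‖ ^ 2) := by gcongr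
        _ = c / 2 * ‖x‖ ^ 2 * (n / (n + 1)) := by field_simp
        _ ≤ c / 2 * ‖x‖ ^ 2 * 1 := by gcongr; rw [div_le_one (by positivity)]; linarith
        _ = _ := mul_one _
    have e6 : n ^ 2 * (ε * ‖x‖ ^ 2) ≤ c / 2 * ‖x‖ ^ 2 := by
      calc n ^ 2 * (ε * ‖x‖ ^ 2) = c / 2 * ‖x‖ ^ 2 * (n ^ 2 / (n ^ 2 + 1)) := by
            rw [hε]; field_simp
        _ ≤ c / 2 * ‖x‖ ^ 2 * 1 := by gcongr; rw [div_le_one (by positivity)]; linarith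
        _ = _ := mul_one _
    have := abs_le.1 e2
    linarith [this.1]

theorem sum_ginv_lower {c : ℝ}
    (hc : (Matrix.of (fun k l => ginv h k l z) - c • (1 : Matrix (Idx m) (Idx m) ℝ)).PosSemidef)
    (S : V →L[ℝ] V →L[ℝ] ℝ) (hS : ∀ x, 0 ≤ S x x) (x : Idx m → V) :
    c * ∑ k, S (x k) (x k) ≤ ∑ k, ∑ l, ginv h k l z * S (x k) (x l) := by
  classical
  have := sum_posSemidef_nonneg hc S hS x
  simp only [Matrix.sub_apply, Matrix.of_apply, Matrix.smul_apply, Matrix.one_apply, smul_eq_mul,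
    sub_mul, Finset.sum_sub_distrib, mul_ite, mul_one, mul_zero, ite_mul, zero_mul,
    Finset.sum_ite_eq, Finset.mem_univ, if_true, ← Finset.mul_sum] at this
  linarith

end

end

section

variable {m : ℕ}

/-! ### Parabolic differential inequalities -/

section

variable {h : Cn m → Cn m → Cn m → ℝ} {U : Set (Cn m)} {z : Cn m}
  {V : Type*} [NormedAddCommGroup V] [NormedSpace ℝ V] {I : Set ℝ} {t : ℝ}

theorem fderiv_form_apply {S : Cn m → V →L[ℝ] V →L[ℝ] ℝ} {f g : Cn m → V}
    (hS : DifferentiableAt ℝ S z) (hf : DifferentiableAt ℝ f z) (hg : DifferentiableAt ℝ g z)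
    (v : Cn m) : fderiv ℝ (fun y => S y (f y) (g y)) z v
      = fderiv ℝ S z v (f z) (g z) + S z (fderiv ℝ f z v) (g z) + S z (f z) (fderiv ℝ g z v) := by
  rw [((hS.hasFDerivAt.clm_apply hf.hasFDerivAt).clm_apply hg.hasFDerivAt).fderiv]
  simp
  abel

theorem fderiv_fderiv_form_apply {S : Cn m → V →L[ℝ] V →L[ℝ] ℝ} {f : Cn m → V} (hU : IsOpen U)
    (hz : z ∈ U) (hS : ContDiffOn ℝ ∞ S U) (hsym : ∀ z ∈ U, ∀ x y, S z x y = S z y x)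
    (hf : ContDiffOn ℝ ∞ f U) (v w : Cn m) :
    fderiv ℝ (fun y => fderiv ℝ (fun x => S x (f x) (f x)) y w) z v
      = fderiv ℝ (fun y => fderiv ℝ S y w) z v (f z) (f z)
        + 2 * fderiv ℝ S z w (fderiv ℝ f z v) (f z) + 2 * fderiv ℝ S z v (fderiv ℝ f z w) (f z)
        + 2 * S z (fderiv ℝ (fun y => fderiv ℝ f y w) z v) (f z)
        + 2 * S z (fderiv ℝ f z v) (fderiv ℝ f z w) := by
  have dS := hS.differentiableAt_of_isOpen hU hz
  have df := hf.differentiableAt_of_isOpen hU hz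
  have dS' := (hS.fderiv_apply_smooth hU w).differentiableAt_of_isOpen hU hz
  have df' := (hf.fderiv_apply_smooth hU w).differentiableAt_of_isOpen hU hz
  have hsym' : ∀ v x y, fderiv ℝ S z v x y = fderiv ℝ S z v y x := by
    intro v x y
    have e : ∀ x y, fderiv ℝ S z v x y = fderiv ℝ (fun y' => S y' x y) z v := by
      intro x y
      rw [fderiv_form_apply dS (differentiableAt_const x) (differentiableAt_const y)]
      simp
    rw [e, e]
    congr 1
    apply Filter.EventuallyEq.fderiv_eq
    filter_upwards [hU.mem_nhds hz] with y' hy' using hsym y' hy' x y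
  have e1 : (fun y => fderiv ℝ (fun x => S x (f x) (f x)) y w)
      =ᶠ[𝓝 z] fun y => fderiv ℝ S y w (f y) (f y) + 2 * S y (fderiv ℝ f y w) (f y) := by
    filter_upwards [hU.mem_nhds hz] with y hy
    rw [fderiv_form_apply (hS.differentiableAt_of_isOpen hU hy)
      (hf.differentiableAt_of_isOpen hU hy) (hf.differentiableAt_of_isOpen hU hy),
      hsym y hy (f y)]
    ring
  have d1 : DifferentiableAt ℝ (fun y => fderiv ℝ S y w (f y) (f y)) z :=
    (dS'.clm_apply df).clm_apply df
  have d2 : DifferentiableAt ℝ (fun y => S y (fderiv ℝ f y w) (f y)) z :=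
    (dS.clm_apply df').clm_apply df
  rw [e1.fderiv_eq, fderiv_fun_add d1 (d2.const_mul 2), fderiv_const_mul d2, add_apply,
    smul_apply, fderiv_form_apply dS' df df, fderiv_form_apply dS df' df, hsym' w (f z),
    hsym z hz (fderiv ℝ f z w)]
  simp only [smul_eq_mul]
  ring

/-- A Bochner formula for a form with variable coefficients: the second derivatives of `f` cancel
between time derivative and Laplacian. What remains is the reaction term, the terms in which `S` is
differentiated, and a gradient term with the favourable sign. -/
theorem hasDerivWithinAt_form_add_laplacian {S : Cn m → V →L[ℝ] V →L[ℝ] ℝ} {f : ℝ → Cn m → V}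
    {R : V} {f' : V} (H : IsKahlerOn h U) (ht : t ∈ I) (hz : z ∈ U)
    (hS : ContDiffOn ℝ ∞ S U) (hsym : ∀ z ∈ U, ∀ x y, S z x y = S z y x)
    (hf : ContDiffOn ℝ ∞ (f t) U) (hf' : HasDerivWithinAt (fun s => f s z) f' I t)
    (heq : f' = trG h z (fun k l => fderiv ℝ (fun y => fderiv ℝ (f t) y l) z k) + R) :
    HasDerivWithinAt (fun s => S z (f s z) (f s z)) (2 * S z f' (f t z)) I t ∧
      2 * S z f' (f t z) + laplacian h (fun y => S y (f t y) (f t y)) z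
        = 2 * S z R (f t z)
          - ∑ k, ∑ l, ginv h k l z * (fderiv ℝ (fun y => fderiv ℝ S y (dir l)) z (dir k) (f t z) (f t z)
            + 2 * fderiv ℝ S z (dir l) (fderiv ℝ (f t) z (dir k)) (f t z)
            + 2 * fderiv ℝ S z (dir k) (fderiv ℝ (f t) z (dir l)) (f t z))
          - 2 * ∑ k, ∑ l, ginv h k l z * S z (fderiv ℝ (f t) z (dir k)) (fderiv ℝ (f t) z (dir l)) := by
  constructor
  · have := (S z).hasDerivWithinAt_of_bilinear hf' hf'
    refine this.congr_deriv ?_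
    rw [hsym z hz (f t z)]
    ring
  · have e : ∀ x, S z (trG h z (fun k l => fderiv ℝ (fun y => fderiv ℝ (f t) y l) z k)) x
        = ∑ k, ∑ l, ginv h k l z * S z (fderiv ℝ (fun y => fderiv ℝ (f t) y (dir l)) z (dir k)) x := by
      intro x
      simp [trG, map_sum, sum_apply]
    rw [H.laplacian_eq hz, heq, map_add, add_apply, e, trG]
    simp only [fderiv_fderiv_form_apply H.isOpen hz hS hsym hf, smul_eq_mul]
    simp only [mul_add, Finset.sum_add_distrib, Finset.mul_sum]
    simp only [mul_left_comm _ (2 : ℝ)]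
    ring

theorem exists_eventually_norm_le {W : Type*} [NormedAddCommGroup W] {F : Cn m → W} (hU : IsOpen U)
    (hz : z ∈ U) (hF : ContinuousOn F U) : ∃ M : ℝ, ∀ᶠ y in 𝓝 z, ‖F y‖ ≤ M := by
  have := (hF.continuousAt (hU.mem_nhds hz)).norm
  exact ⟨‖F z‖ + 1, (this.eventually_lt continuousAt_const (by linarith)).mono fun y hy => hy.le⟩

/-- A weighted Young inequality. Here `a` stands for the size of the solution, `b` for the sum of
the norms of its derivatives and `e` for the sum of their squares; the products `a b` are absorbed
by `-δ e` through `b² ≤ n e`. -/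
theorem quadratic_absorb {a b e n M K δ : ℝ} (hn0 : 0 ≤ n) (hδ : 0 < δ) (he0 : 0 ≤ e)
    (hb : b ^ 2 ≤ n * e) :
    2 * (M * (K * (a + b)) * a) + (n ^ 2 * M ^ 2 * a ^ 2 + 4 * n * M ^ 2 * b * a) - δ * e
      ≤ (2 * M * K + n ^ 2 * M ^ 2 + n * (2 * M * K + 4 * n * M ^ 2) ^ 2 / δ) * a ^ 2 := by
  obtain ⟨B, hB⟩ : ∃ B, B = 2 * M * K + 4 * n * M ^ 2 := ⟨_, rfl⟩
  have key : B * b * a - δ * e ≤ n * B ^ 2 / δ * a ^ 2 := by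
    have h1 : B * b * a * δ ≤ δ ^ 2 * e + n * B ^ 2 * a ^ 2 := by
      by_cases hn' : n = 0
      · have : b ^ 2 ≤ 0 := by rw [hn', zero_mul] at hb; exact hb
        have hb : b = 0 := by nlinarith
        rw [hb, mul_zero, zero_mul, zero_mul]
        positivity
      · have hnp : 0 < n := lt_of_le_of_ne hn0 (Ne.symm hn')
        have h2 : δ ^ 2 * b ^ 2 ≤ δ ^ 2 * (n * e) := by gcongr
        have h3 : n * (B * b * a * δ) ≤ n * (δ ^ 2 * e + n * B ^ 2 * a ^ 2) := by
          nlinarith [sq_nonneg (δ * b - n * (B * a)), sq_nonneg (δ * b), sq_nonneg (n * (B * a))]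
        exact le_of_mul_le_mul_left h3 hnp
    rw [div_mul_eq_mul_div, le_div_iff₀ hδ]
    linarith
  rw [← hB]
  calc _ = (2 * M * K + n ^ 2 * M ^ 2) * a ^ 2 + (B * b * a - δ * e) := by rw [hB]; ring
    _ ≤ (2 * M * K + n ^ 2 * M ^ 2) * a ^ 2 + n * B ^ 2 / δ * a ^ 2 := by gcongr
    _ = _ := by ring

theorem form_terms_le {V : Type*} [NormedAddCommGroup V] [NormedSpace ℝ V] {κ : Type*} [Fintype κ]
    {M : ℝ} (hM0 : 0 ≤ M) {G : κ → κ → ℝ} (hG : ∀ k l, |G k l| ≤ M)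
    {S₁ : κ → V →L[ℝ] V →L[ℝ] ℝ} {S₂ : κ → κ → V →L[ℝ] V →L[ℝ] ℝ} (h₁ : ∀ k, ‖S₁ k‖ ≤ M)
    (h₂ : ∀ k l, ‖S₂ k l‖ ≤ M) (x : V) (D : κ → V) :
    -(∑ k, ∑ l, G k l * (S₂ k l x x + 2 * S₁ l (D k) x + 2 * S₁ k (D l) x))
      ≤ (Fintype.card κ : ℝ) ^ 2 * M ^ 2 * ‖x‖ ^ 2
        + 4 * (Fintype.card κ : ℝ) * M ^ 2 * (∑ k, ‖D k‖) * ‖x‖ := by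
  have bil : ∀ (T : V →L[ℝ] V →L[ℝ] ℝ) x x', ‖T‖ ≤ M → |T x x'| ≤ M * ‖x‖ * ‖x'‖ := by
    intro T x x' hT
    refine (T.le_opNorm₂ x x').trans ?_
    gcongr
  have i2 : -(∑ k, ∑ l, G k l * (S₂ k l x x + 2 * S₁ l (D k) x + 2 * S₁ k (D l) x))
      ≤ ∑ k, ∑ l, (M * (M * ‖x‖ * ‖x‖) + 2 * (M * (M * ‖D k‖ * ‖x‖)) + 2 * (M * (M * ‖D l‖ * ‖x‖))) := by
    rw [← Finset.sum_neg_distrib]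
    refine Finset.sum_le_sum fun k _ => ?_
    rw [← Finset.sum_neg_distrib]
    refine Finset.sum_le_sum fun l _ => ?_
    refine (neg_le_abs _).trans ?_
    rw [abs_mul]
    have j1 := bil _ x x (h₂ k l)
    have j2 := bil _ (D k) x (h₁ l)
    have j3 := bil _ (D l) x (h₁ k)
    have j4 : |S₂ k l x x + 2 * S₁ l (D k) x + 2 * S₁ k (D l) x|
        ≤ M * ‖x‖ * ‖x‖ + 2 * (M * ‖D k‖ * ‖x‖) + 2 * (M * ‖D l‖ * ‖x‖) := by
      refine (abs_add_three _ _ _).trans ?_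
      rw [abs_mul, abs_mul, abs_two]
      gcongr
    calc _ ≤ M * (M * ‖x‖ * ‖x‖ + 2 * (M * ‖D k‖ * ‖x‖) + 2 * (M * ‖D l‖ * ‖x‖)) := by
          gcongr
          exact hG k l
      _ = _ := by ring
  refine i2.trans_eq ?_
  simp only [Finset.sum_add_distrib, ← Finset.mul_sum, ← Finset.sum_mul, Finset.sum_const,
    Finset.card_univ, nsmul_eq_mul]
  ring

-- Near a point all coefficients are bounded, while both the inverse metric and `S` are bounded
-- below. The favourable gradient term therefore dominates the squares of the first derivatives and
-- absorbs every other occurrence of them. What is left is a multiple of `‖f‖²`, hence of `S(f, f)`.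
set_option maxHeartbeats 1000000 in
theorem exists_deriv_add_laplacian_le {S : Cn m → V →L[ℝ] V →L[ℝ] ℝ} {f : ℝ → Cn m → V}
    {R : ℝ → Cn m → V} (H : IsKahlerOn h U) (hI : IsTimeDomain I) (ht : t ∈ I) (hz : z ∈ U)
    (hS : ContDiffOn ℝ ∞ S U) (hsym : ∀ z ∈ U, ∀ x y, S z x y = S z y x)
    (hpos : ∃ c > (0 : ℝ), ∀ᶠ y in 𝓝 z, ∀ x, c * ‖x‖ ^ 2 ≤ S y x x)
    (hf : SmoothIn I U f)
    (heq : ∀ s ∈ I, ∀ y ∈ U, HasDerivWithinAt (fun s => f s y)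
      (trG h y (fun k l => fderiv ℝ (fun x => fderiv ℝ (f s) x l) y k) + R s y) I s)
    (hR : (fun q : ℝ × Cn m => R q.1 q.2) =O[𝓝[I ×ˢ U] (t, z)]
      fun q => ‖f q.1 q.2‖ + ∑ k, ‖fderiv ℝ (f q.1) q.2 (dir k)‖) :
    ∃ C : ℝ, ∀ᶠ q in 𝓝[I ×ˢ U] (t, z), ∃ d,
      HasDerivWithinAt (fun s => S q.2 (f s q.2) (f s q.2)) d I q.1 ∧
      d + laplacian h (fun y => S y (f q.1 y) (f q.1 y)) q.2
        ≤ C * S q.2 (f q.1 q.2) (f q.1 q.2) := by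
  have hU := H.isOpen
  obtain ⟨c, hc, hpos⟩ := hpos
  obtain ⟨c₁, hc₁, hlow⟩ := H.exists_ginv_lower hz
  obtain ⟨K, hK0, hK⟩ := hR.exists_pos
  have hsnd : Tendsto (fun q : ℝ × Cn m => q.2) (𝓝[I ×ˢ U] (t, z)) (𝓝 z) :=
    (continuous_snd.tendsto (t, z)).mono_left nhdsWithin_le_nhds
  obtain ⟨M₀, hM₀⟩ := exists_eventually_norm_le hU hz hS.continuousOn
  choose M₁ hM₁ using fun k : Idx m => exists_eventually_norm_le hU hz (hS.fderiv_apply_smooth hU (dir k)).continuousOn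
  choose M₂ hM₂ using fun k l : Idx m =>
    exists_eventually_norm_le hU hz ((hS.fderiv_apply_smooth hU (dir l)).fderiv_apply_smooth hU (dir k)).continuousOn
  choose M₃ hM₃ using fun k l : Idx m => exists_eventually_norm_le hU hz (H.contDiffOn_ginv k l).continuousOn
  -- A single bound for `S`, its first and second coordinate derivatives and the entries of the
  -- inverse metric near `z`.
  set M : ℝ := |M₀| + ∑ k, |M₁ k| + ∑ k, ∑ l, |M₂ k l| + ∑ k, ∑ l, |M₃ k l| with hM
  have s2 : ∀ (F : Idx m → Idx m → ℝ) k l, |F k l| ≤ ∑ k, ∑ l, |F k l| := fun F k l =>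
    (Finset.single_le_sum (f := fun l => |F k l|) (fun _ _ => abs_nonneg _) (Finset.mem_univ l)).trans
      (Finset.single_le_sum (f := fun k => ∑ l, |F k l|)
        (fun _ _ => Finset.sum_nonneg fun _ _ => abs_nonneg _) (Finset.mem_univ k))
  have s1 : ∀ k, |M₁ k| ≤ ∑ k, |M₁ k| := fun k =>
    Finset.single_le_sum (f := fun k => |M₁ k|) (fun _ _ => abs_nonneg _) (Finset.mem_univ k)
  have p1 : 0 ≤ ∑ k, |M₁ k| := by positivity
  have p2 : 0 ≤ ∑ k, ∑ l, |M₂ k l| := by positivity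
  have p3 : 0 ≤ ∑ k, ∑ l, |M₃ k l| := by positivity
  have hM0 : 0 ≤ M := add_nonneg (add_nonneg (add_nonneg (abs_nonneg _) p1) p2) p3
  clear_value M
  set n : ℝ := ((Fintype.card (Idx m) : ℕ) : ℝ) with hn
  have hn0 : 0 ≤ n := by positivity
  -- The coefficient of the favourable gradient term: the factor `2` of the Bochner formula times
  -- the lower bounds of the inverse metric and of `S`.
  set δ : ℝ := 2 * c₁ * c with hδ
  have hδ0 : 0 < δ := by positivity
  set C₀ : ℝ := 2 * M * K + n ^ 2 * M ^ 2 + n * (2 * M * K + 4 * n * M ^ 2) ^ 2 / δ with hC₀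
  have hC₀0 : 0 ≤ C₀ := by positivity
  refine ⟨C₀ / c, ?_⟩
  filter_upwards [hK.bound, self_mem_nhdsWithin, hsnd.eventually hpos, hsnd.eventually hlow,
    hsnd.eventually hM₀, hsnd.eventually (eventually_all.2 hM₁),
    hsnd.eventually (eventually_all.2 fun k => eventually_all.2 (hM₂ k)),
    hsnd.eventually (eventually_all.2 fun k => eventually_all.2 (hM₃ k))] with
    ⟨s, y⟩ hqR hq hqpos hqlow hq0 hq1 hq2 hq3
  obtain ⟨hs, hy⟩ := hq
  simp only at hqR hqpos hqlow hq0 hq1 hq2 hq3 hs hy ⊢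
  obtain ⟨hd, hid⟩ := hasDerivWithinAt_form_add_laplacian H hs hy hS hsym (hf.slice hs)
    (heq s hs y hy) rfl
  refine ⟨_, hd, ?_⟩
  rw [hid]
  set a := ‖f s y‖
  set D : Idx m → V := fun k => fderiv ℝ (f s) y (dir k)
  set b := ∑ k, ‖D k‖
  have ha0 : 0 ≤ a := norm_nonneg _
  have hb0 : 0 ≤ b := by positivity
  have hDb : ∀ k, ‖D k‖ ≤ b := fun k =>
    Finset.single_le_sum (f := fun k => ‖D k‖) (fun _ _ => norm_nonneg _) (Finset.mem_univ k)
  have hR' : ‖R s y‖ ≤ K * (a + b) := by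
    rwa [Real.norm_of_nonneg (by positivity)] at hqR
  have hS0 : ‖S y‖ ≤ M := by linarith [le_abs_self M₀]
  have hS1 : ∀ k, ‖fderiv ℝ S y (dir k)‖ ≤ M := fun k => by
    linarith [hq1 k, le_abs_self (M₁ k), s1 k, abs_nonneg M₀]
  have hS2 : ∀ k l, ‖fderiv ℝ (fun y => fderiv ℝ S y (dir l)) y (dir k)‖ ≤ M := fun k l => by
    linarith [hq2 k l, le_abs_self (M₂ k l), s2 M₂ k l, abs_nonneg M₀]
  have hg : ∀ k l, |ginv h k l y| ≤ M := fun k l => by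
    have := hq3 k l
    rw [Real.norm_eq_abs] at this
    linarith [le_abs_self (M₃ k l), s2 M₃ k l, abs_nonneg M₀]
  have i1 : 2 * S y (R s y) (f s y) ≤ 2 * (M * (K * (a + b)) * a) := by
    have h1 : |S y (R s y) (f s y)| ≤ M * (K * (a + b)) * a := by
      refine ((S y).le_opNorm₂ _ _).trans ?_
      gcongr
    linarith [le_abs_self (S y (R s y) (f s y))]
  have i2 := form_terms_le hM0 hg hS1 hS2 (f s y) D
  have i3 : c₁ * c * ∑ k, ‖D k‖ ^ 2 ≤ ∑ k, ∑ l, ginv h k l y * S y (D k) (D l) := by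
    refine le_trans ?_ (sum_ginv_lower hqlow (S y) (fun x => le_trans (by positivity) (hqpos x)) D)
    rw [mul_assoc, Finset.mul_sum]
    gcongr with k
    exact hqpos _
  have i4 : b ^ 2 ≤ n * ∑ k, ‖D k‖ ^ 2 := by
    exact sq_sum_le_card_mul_sum_sq (s := Finset.univ) (f := fun k => ‖D k‖)
  set e := ∑ k, ‖D k‖ ^ 2
  have he0 : 0 ≤ e := by positivity
  have fin : C₀ * a ^ 2 ≤ C₀ / c * S y (f s y) (f s y) := by
    have := hqpos (f s y)
    calc C₀ * a ^ 2 = C₀ / c * (c * a ^ 2) := by field_simp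
      _ ≤ _ := by gcongr
  refine le_trans ?_ fin
  have key := quadratic_absorb (a := a) (M := M) (K := K) hn0 hδ0 he0 i4
  have i3' : δ * e ≤ 2 * ∑ k, ∑ l, ginv h k l y * S y (D k) (D l) := by
    rw [hδ, mul_assoc, mul_assoc]
    exact mul_le_mul_of_nonneg_left (by rw [← mul_assoc]; exact i3) two_pos.le
  exact (sub_le_sub (add_le_add i1 i2) i3').trans key

end

end

section

variable {m : ℕ}

/-! ### The obstruction to being a gauged holomorphic map, and its evolution -/

section BigO

variable {V V' V'' : Type*} [NormedAddCommGroup V] [NormedSpace ℝ V] [NormedAddCommGroup V']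
  [NormedSpace ℝ V'] [NormedAddCommGroup V''] [NormedSpace ℝ V'']
  {l : Filter (ℝ × Cn m)} {g : ℝ × Cn m → ℝ}

/-- The function `X` of time and space is bounded by a multiple of `g` along the filter `l`. -/
def OIn (l : Filter (ℝ × Cn m)) (g : ℝ × Cn m → ℝ) (X : ℝ → Cn m → V) : Prop :=
  (fun q : ℝ × Cn m => X q.1 q.2) =O[l] g

theorem OIn.add {X Y : ℝ → Cn m → V} (hX : OIn l g X) (hY : OIn l g Y) :
    OIn l g (fun t z => X t z + Y t z) := Asymptotics.IsBigO.add hX hY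

theorem OIn.sub {X Y : ℝ → Cn m → V} (hX : OIn l g X) (hY : OIn l g Y) :
    OIn l g (fun t z => X t z - Y t z) := Asymptotics.IsBigO.sub hX hY

theorem OIn.sum {κ : Type*} (s : Finset κ) {X : κ → ℝ → Cn m → V} (hX : ∀ i ∈ s, OIn l g (X i)) :
    OIn l g (fun t z => ∑ i ∈ s, X i t z) := Asymptotics.IsBigO.fun_sum hX

theorem OIn.const_smul [NormedSpace ℂ V] (c : ℂ) {X : ℝ → Cn m → V} (hX : OIn l g X) :
    OIn l g (fun t z => c • X t z) := Asymptotics.IsBigO.const_smul_left hX c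

theorem OIn.const_real_smul (c : ℝ) {X : ℝ → Cn m → V} (hX : OIn l g X) :
    OIn l g (fun t z => c • X t z) := Asymptotics.IsBigO.const_smul_left hX c

theorem OIn.smul {𝕜 : Type*} [NormedField 𝕜] [NormedSpace 𝕜 V] {c : ℝ → Cn m → 𝕜}
    (hc : OIn l (fun _ => 1) c) {X : ℝ → Cn m → V} (hX : OIn l g X) :
    OIn l g (fun t z => c t z • X t z) := by
  have := Asymptotics.IsBigO.smul hc hX
  simpa [OIn] using this

theorem OIn.bilin (B : V →L[ℝ] V' →L[ℝ] V'') {X : ℝ → Cn m → V} {Y : ℝ → Cn m → V'}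
    (hX : OIn l (fun _ => 1) X) (hY : OIn l g Y) : OIn l g (fun t z => B (X t z) (Y t z)) := by
  have h1 : (fun q : ℝ × Cn m => B (X q.1 q.2) (Y q.1 q.2)) =O[l]
      fun q => ‖X q.1 q.2‖ * ‖Y q.1 q.2‖ :=
    Asymptotics.IsBigO.of_bound ‖B‖ (Eventually.of_forall fun q => by
      simpa [mul_assoc] using B.le_opNorm₂ _ _)
  have h2 := h1.trans (hX.norm_left.mul hY.norm_left)
  simpa [OIn] using h2

theorem OIn.bilin_flip (B : V →L[ℝ] V' →L[ℝ] V'') {X : ℝ → Cn m → V} {Y : ℝ → Cn m → V'}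
    (hX : OIn l g X) (hY : OIn l (fun _ => 1) Y) : OIn l g (fun t z => B (X t z) (Y t z)) :=
  hY.bilin B.flip hX

theorem OIn.clm_apply {A : ℝ → Cn m → V →L[ℝ] V'} {X : ℝ → Cn m → V}
    (hA : OIn l (fun _ => 1) A) (hX : OIn l g X) : OIn l g (fun t z => A t z (X t z)) :=
  hA.bilin (ContinuousLinearMap.id ℝ _) hX

theorem OIn.pi {κ : Type*} [Fintype κ] {X : ℝ → Cn m → κ → V}
    (hX : ∀ k, OIn l g (fun t z => X t z k)) : OIn l g X :=
  Asymptotics.isBigO_pi.2 hX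

theorem OIn.prodMk {X : ℝ → Cn m → V} {Y : ℝ → Cn m → V'}
    (hX : OIn l g X) (hY : OIn l g Y) : OIn l g (fun t z => (X t z, Y t z)) :=
  Asymptotics.IsBigO.prod_left hX hY

theorem SmoothIn.oIn {I : Set ℝ} {U : Set (Cn m)} {X : ℝ → Cn m → V} {t : ℝ} {z : Cn m}
    (hX : SmoothIn I U X) (ht : t ∈ I) (hz : z ∈ U) :
    OIn (𝓝[I ×ˢ U] (t, z)) (fun _ => 1) X :=
  (hX.continuousOn (t, z) ⟨ht, hz⟩).tendsto.isBigO_one ℝ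

theorem OIn.trG {h : Cn m → Cn m → Cn m → ℝ} {B : ℝ → Cn m → Cn m → Cn m → V}
    (hg : ∀ k k', OIn l (fun _ => 1) (fun _ => ginv h k k'))
    (hB : ∀ k k', OIn l g (fun t z => B t z (dir k) (dir k'))) :
    OIn l g (fun t z => trG h z (B t z)) :=
  OIn.sum _ fun k _ => OIn.sum _ fun k' _ => (hg k k').smul (hB k k')

theorem OIn.fderiv_of_dir {X : ℝ → Cn m → V}
    (hX : ∀ k, OIn l g (fun t z => fderiv ℝ (X t) z (dir k))) (v : Cn m) :
    OIn l g (fun t z => fderiv ℝ (X t) z v) := by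
  have : (fun t z => fderiv ℝ (X t) z v) = fun t z => ∑ k, crd k v • fderiv ℝ (X t) z (dir k) := by
    funext t z
    conv_lhs => rw [← sum_crd_smul_dir v]
    simp [map_sum]
  rw [this]
  exact OIn.sum _ fun k _ => (hX k).const_real_smul _

end BigO

section

variable {W : Type*} [NormedAddCommGroup W] [NormedSpace ℂ W] [NormedSpace ℝ W]
  [IsScalarTower ℝ ℂ W] {l : Filter (ℝ × Cn m)} {g : ℝ × Cn m → ℝ}
  {A : ℝ → Cn m → Cn m →L[ℝ] W →L[ℝ] W} {X : ℝ → Cn m → W}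

theorem OIn.cD (hA : ∀ v, OIn l (fun _ => 1) (fun t z => A t z v)) (hX : OIn l g X)
    (hdX : ∀ v, OIn l g (fun t z => fderiv ℝ (X t) z v)) (v : Cn m) :
    OIn l g (fun t z => cD (A t) (X t) z v) :=
  (hdX v).add ((hA v).clm_apply hX)

theorem OIn.dP (hA : ∀ v, OIn l (fun _ => 1) (fun t z => A t z v)) (hX : OIn l g X)
    (hdX : ∀ v, OIn l g (fun t z => fderiv ℝ (X t) z v)) (v : Cn m) :
    OIn l g (fun t z => dP (A t) (X t) z v) :=
  ((hX.cD hA hdX v).sub ((hX.cD hA hdX _).const_smul _)).const_smul _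

theorem cD_cD_sub_fderiv_fderiv {A : Cn m → Cn m →L[ℝ] W →L[ℝ] W} {U : Set (Cn m)} {z : Cn m}
    {f : Cn m → W} (hU : IsOpen U) (hz : z ∈ U) (hA : ContDiffOn ℝ ∞ A U)
    (hf : ContDiffOn ℝ ∞ f U) (v w : Cn m) :
    YMH.cD A (fun y => YMH.cD A f y w) z v - fderiv ℝ (fun y => fderiv ℝ f y w) z v
      = fderiv ℝ (fun y => A y w) z v (f z) + A z w (fderiv ℝ f z v) + A z v (YMH.cD A f z w) := by
  have d1 := (hf.fderiv_apply_smooth hU w).differentiableAt_of_isOpen hU hz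
  have d2 := (hA.clm_apply contDiffOn_const).differentiableAt_of_isOpen (f := fun y => A y w) hU hz
  have d3 := hf.differentiableAt_of_isOpen hU hz
  have d4 : DifferentiableAt ℝ (fun y => A y w (f y)) z := d2.clm_apply d3
  have e : fderiv ℝ (fun y => YMH.cD A f y w) z v = fderiv ℝ (fun y => fderiv ℝ f y w) z v
      + (fderiv ℝ (fun y => A y w) z v (f z) + A z w (fderiv ℝ f z v)) := by
    simp only [YMH.cD]
    rw [fderiv_fun_add d1 d4, fderiv_clm_apply d2 d3]
    simp
    abel
  rw [YMH.cD, e]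
  abel

/-- The rough Laplacian and the trace of coordinate second derivatives share their leading part. The
difference is of first order in `X`, so it counts as a remainder. -/
theorem OIn.trG_cD_cD_sub {h : Cn m → Cn m → Cn m → ℝ} {I : Set ℝ} {U : Set (Cn m)} {t : ℝ}
    {z : Cn m} (hI : IsTimeDomain I) (H : IsKahlerOn h U) (hA : SmoothIn I U A)
    (hX' : SmoothIn I U X) (ht : t ∈ I) (hz : z ∈ U) (hX : OIn (𝓝[I ×ˢ U] (t, z)) g X)
    (hdX : ∀ v, OIn (𝓝[I ×ˢ U] (t, z)) g (fun t z => fderiv ℝ (X t) z v)) :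
    OIn (𝓝[I ×ˢ U] (t, z)) g (fun t z =>
      YMH.trG h z (fun k l => YMH.cD (A t) (fun y => YMH.cD (A t) (X t) y l) z k)
        - YMH.trG h z (fun k l => fderiv ℝ (fun y => fderiv ℝ (X t) y l) z k)) := by
  have hU := H.isOpen
  have hAv : ∀ v, SmoothIn I U (fun t z => A t z v) := fun v => hA.clm_apply (SmoothIn.const v)
  have hA1 := fun v => (hAv v).oIn ht hz
  have hg := fun k l => (SmoothIn.const_time (I := I) (H.contDiffOn_ginv k l)).oIn ht hz
  have h1 : OIn (𝓝[I ×ˢ U] (t, z)) g (fun t z => YMH.trG h z (fun v w =>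
      fderiv ℝ (fun y => A t y w) z v (X t z) + A t z w (fderiv ℝ (X t) z v)
        + A t z v (YMH.cD (A t) (X t) z w))) := by
    refine OIn.trG hg fun k k' => ?_
    exact ((((hAv _).fderiv_apply hI hU _).oIn ht hz).clm_apply hX).add
      ((hA1 _).clm_apply (hdX _)) |>.add ((hA1 _).clm_apply (hX.cD hA1 hdX _))
  refine Asymptotics.IsBigO.congr' h1 ?_ EventuallyEq.rfl
  filter_upwards [self_mem_nhdsWithin] with q hq
  rw [← trG_sub]
  exact trG_congr fun k l => (cD_cD_sub_fderiv_fderiv hU hq.2 (hA.slice hq.1) (hX'.slice hq.1) _ _).symm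

end

section

variable {𝔄 : Type*} [NormedRing 𝔄] [NormedSpace ℂ 𝔄] [NormedSpace ℝ 𝔄] [IsScalarTower ℝ ℂ 𝔄]
  [IsScalarTower ℂ 𝔄 𝔄] [SMulCommClass ℂ 𝔄 𝔄] [IsScalarTower ℝ 𝔄 𝔄] [SMulCommClass ℝ 𝔄 𝔄]
  {W : Type*} [NormedAddCommGroup W] [NormedSpace ℂ W] [NormedSpace ℝ W] [IsScalarTower ℝ ℂ W]
  {ρ : 𝔄 →L[ℝ] W →L[ℝ] W} {U : Set (Cn m)} {z : Cn m}
  {h : Cn m → Cn m → Cn m → ℝ} {ts : W →L[ℝ] W →L[ℝ] 𝔄} {st : 𝔄 →L[ℝ] 𝔄}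
  {hs : 𝔄 →L[ℝ] 𝔄 →L[ℝ] ℝ} {ip : W →L[ℝ] W →L[ℝ] ℝ}

/-- The components of `F^{0,2}` and of `∂̄_A φ`. -/
def obstr (ρ : 𝔄 →L[ℝ] W →L[ℝ] W) (a : Cn m → Cn m →L[ℝ] 𝔄) (p : Cn m → W) (z : Cn m) :
    (Idx m × Idx m → 𝔄) × (Idx m → W) :=
  (fun k => cur02 a z (dir k.1) (dir k.2), fun k => dM (secA ρ a) p z (dir k))

/-- The inner product on the components of `F^{0,2}` and of `∂̄_A φ`. -/
def obstrForm (h : Cn m → Cn m → Cn m → ℝ) (hs : 𝔄 →L[ℝ] 𝔄 →L[ℝ] ℝ) (ip : W →L[ℝ] W →L[ℝ] ℝ)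
    (z : Cn m) : (Idx m × Idx m → 𝔄) × (Idx m → W) →L[ℝ] (Idx m × Idx m → 𝔄) × (Idx m → W) →L[ℝ] ℝ :=
  (∑ k, ∑ l, ∑ k', ∑ l', (ginv h k l z * ginv h k' l' z) • hs.bilinearComp
      (ContinuousLinearMap.proj (k, k') ∘L ContinuousLinearMap.fst ℝ _ _)
      (ContinuousLinearMap.proj (l, l') ∘L ContinuousLinearMap.fst ℝ _ _))
    + ∑ k, ∑ l, ginv h k l z • ip.bilinearComp
      (ContinuousLinearMap.proj k ∘L ContinuousLinearMap.snd ℝ _ _)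
      (ContinuousLinearMap.proj l ∘L ContinuousLinearMap.snd ℝ _ _)

/-- The square norm of `F^{0,2}` plus that of `∂̄_A φ`. -/
def obstrNorm (h : Cn m → Cn m → Cn m → ℝ) (hs : 𝔄 →L[ℝ] 𝔄 →L[ℝ] ℝ) (ip : W →L[ℝ] W →L[ℝ] ℝ)
    (ρ : 𝔄 →L[ℝ] W →L[ℝ] W) (a : Cn m → Cn m →L[ℝ] 𝔄) (p : Cn m → W) (z : Cn m) : ℝ :=
  trG h z (fun k l => trG h z (fun k' l' => hs (cur02 a z k k') (cur02 a z l l')))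
    + trG h z (fun k l => ip (dM (secA ρ a) p z k) (dM (secA ρ a) p z l))

theorem obstrForm_apply (x y : (Idx m × Idx m → 𝔄) × (Idx m → W)) :
    obstrForm h hs ip z x y
      = (∑ k, ∑ l, ginv h k l z * ∑ k', ∑ l', ginv h k' l' z * hs (x.1 (k, k')) (y.1 (l, l')))
        + ∑ k, ∑ l, ginv h k l z * ip (x.2 k) (y.2 l) := by
  simp [obstrForm, sum_apply, Finset.mul_sum, mul_assoc]

theorem obstrForm_obstr (a : Cn m → Cn m →L[ℝ] 𝔄) (p : Cn m → W) :
    obstrForm h hs ip z (obstr ρ a p z) (obstr ρ a p z) = obstrNorm h hs ip ρ a p z := by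
  simp [obstrForm_apply, obstrNorm, obstr, trG]

theorem contDiffOn_smul_const {V : Type*} [NormedAddCommGroup V] [NormedSpace ℝ V] {c : Cn m → ℝ}
    (hc : ContDiffOn ℝ ∞ c U) (x : V) : ContDiffOn ℝ ∞ (fun z => c z • x) U :=
  hc.smul contDiffOn_const

theorem contDiffOn_obstrForm (H : IsMetricOn h U) :
    ContDiffOn ℝ ∞ (obstrForm h hs ip) U := by
  refine ContDiffOn.add ?_ ?_
  · exact ContDiffOn.sum fun k _ => ContDiffOn.sum fun l _ => ContDiffOn.sum fun k' _ =>
      ContDiffOn.sum fun l' _ => contDiffOn_smul_const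
        ((H.contDiffOn_ginv k l).mul (H.contDiffOn_ginv k' l')) _
  · exact ContDiffOn.sum fun k _ => ContDiffOn.sum fun l _ => contDiffOn_smul_const (H.contDiffOn_ginv k l) _

theorem obstrForm_symm (H : IsMetricOn h U) (hz : z ∈ U) (hhs : ∀ B C, hs B C = hs C B)
    (hip : ∀ x y, ip x y = ip y x) (x y : (Idx m × Idx m → 𝔄) × (Idx m → W)) :
    obstrForm h hs ip z x y = obstrForm h hs ip z y x := by
  rw [obstrForm_apply, obstrForm_apply, Finset.sum_comm]
  congr 1
  · refine Finset.sum_congr rfl fun k _ => Finset.sum_congr rfl fun l _ => ?_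
    rw [Finset.sum_comm, H.ginv_symm hz l k]
    congr 1
    refine Finset.sum_congr rfl fun k' _ => Finset.sum_congr rfl fun l' _ => ?_
    rw [H.ginv_symm hz l' k', hhs]
  · rw [Finset.sum_comm]
    refine Finset.sum_congr rfl fun k _ => Finset.sum_congr rfl fun l _ => ?_
    rw [H.ginv_symm hz l k, hip]

/-- The local lower bound of the inverse metric is used once for each index, hence twice on the
curvature components and once on the section components. A sup norm is attained at one component,
and the other components contribute nonnegatively. -/
theorem exists_obstrForm_lower (H : IsMetricOn h U) (hz : z ∈ U)
    (hhs : ∃ c > (0 : ℝ), ∀ B, c * ‖B‖ ^ 2 ≤ hs B B) (hip : ∃ c > (0 : ℝ), ∀ x, c * ‖x‖ ^ 2 ≤ ip x x) :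
    ∃ c > (0 : ℝ), ∀ᶠ y in 𝓝 z, ∀ x, c * ‖x‖ ^ 2 ≤ obstrForm h hs ip y x x := by
  obtain ⟨c₀, hc₀, hlow⟩ := H.exists_ginv_lower hz
  obtain ⟨c₁, hc₁, hhs⟩ := hhs
  obtain ⟨c₂, hc₂, hip⟩ := hip
  refine ⟨min (c₀ * (c₀ * c₁)) (c₀ * c₂), by positivity, ?_⟩
  filter_upwards [hlow] with y hy ⟨x₁, x₂⟩
  have hs0 : ∀ B, 0 ≤ hs B B := fun B => le_trans (by positivity) (hhs B)
  have ip0 : ∀ x, 0 ≤ ip x x := fun x => le_trans (by positivity) (hip x)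
  let S : (Idx m → 𝔄) →L[ℝ] (Idx m → 𝔄) →L[ℝ] ℝ := ∑ k', ∑ l', ginv h k' l' y • hs.bilinearComp
      (ContinuousLinearMap.proj k') (ContinuousLinearMap.proj l')
  have hS : ∀ x x', S x x' = ∑ k', ∑ l', ginv h k' l' y * hs (x k') (x' l') := by
    intro x x'
    simp [S, sum_apply]
  have hSl : ∀ x, c₀ * ∑ k, hs (x k) (x k) ≤ S x x := fun x => by
    rw [hS]; exact sum_ginv_lower hy hs hs0 x
  have hS0 : ∀ x, 0 ≤ S x x := fun x => le_trans
    (mul_nonneg hc₀.le (Finset.sum_nonneg fun k _ => hs0 _)) (hSl x)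
  have i1 := sum_ginv_lower hy S hS0 (fun k k' => x₁ (k, k'))
  have i2 := sum_ginv_lower hy ip ip0 x₂
  rw [obstrForm_apply]
  simp only [hS] at i1
  have j1 : c₀ * (c₀ * c₁) * ‖x₁‖ ^ 2 ≤ c₀ * ∑ k, ∑ k', ∑ l', ginv h k' l' y *
      hs (x₁ (k, k')) (x₁ (k, l')) := by
    rw [mul_assoc]
    refine mul_le_mul_of_nonneg_left ?_ hc₀.le
    have j2 : ∀ k, c₀ * ∑ k', hs (x₁ (k, k')) (x₁ (k, k')) ≤ ∑ k', ∑ l', ginv h k' l' y *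
      hs (x₁ (k, k')) (x₁ (k, l')) := fun k => sum_ginv_lower hy hs hs0 fun k' => x₁ (k, k')
    refine le_trans ?_ (Finset.sum_le_sum fun k _ => j2 k)
    rw [← Finset.mul_sum, mul_assoc]
    refine mul_le_mul_of_nonneg_left ?_ hc₀.le
    rcases isEmpty_or_nonempty (Idx m) with he | he
    · have : x₁ = 0 := Subsingleton.elim _ _
      simp [this]
    · obtain ⟨⟨k, k'⟩, hk⟩ := Finite.exists_max (fun k => ‖x₁ k‖)
      have hn : ‖x₁‖ ≤ ‖x₁ (k, k')‖ := (pi_norm_le_iff_of_nonneg (norm_nonneg _)).2 hk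
      calc c₁ * ‖x₁‖ ^ 2 ≤ c₁ * ‖x₁ (k, k')‖ ^ 2 := by gcongr
        _ ≤ hs (x₁ (k, k')) (x₁ (k, k')) := hhs _
        _ ≤ ∑ k', hs (x₁ (k, k')) (x₁ (k, k')) :=
          Finset.single_le_sum (f := fun k' => hs (x₁ (k, k')) (x₁ (k, k')))
            (fun _ _ => hs0 _) (Finset.mem_univ k')
        _ ≤ _ := Finset.single_le_sum (f := fun k => ∑ k', hs (x₁ (k, k')) (x₁ (k, k')))
            (fun _ _ => Finset.sum_nonneg fun _ _ => hs0 _) (Finset.mem_univ k)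
  have j2 : c₀ * c₂ * ‖x₂‖ ^ 2 ≤ c₀ * ∑ k, ip (x₂ k) (x₂ k) := by
    rw [mul_assoc]
    refine mul_le_mul_of_nonneg_left ?_ hc₀.le
    rcases isEmpty_or_nonempty (Idx m) with he | he
    · have : x₂ = 0 := Subsingleton.elim _ _
      simp [this]
    · obtain ⟨k, hk⟩ := Finite.exists_max (fun k => ‖x₂ k‖)
      have hn : ‖x₂‖ ≤ ‖x₂ k‖ := (pi_norm_le_iff_of_nonneg (norm_nonneg _)).2 hk
      calc c₂ * ‖x₂‖ ^ 2 ≤ c₂ * ‖x₂ k‖ ^ 2 := by gcongr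
        _ ≤ ip (x₂ k) (x₂ k) := hip _
        _ ≤ _ := Finset.single_le_sum (f := fun k => ip (x₂ k) (x₂ k))
            (fun _ _ => ip0 _) (Finset.mem_univ k)
  have n1 : 0 ≤ c₀ * (c₀ * c₁) * ‖x₁‖ ^ 2 := by positivity
  have n2 : 0 ≤ c₀ * c₂ * ‖x₂‖ ^ 2 := by positivity
  have : min (c₀ * (c₀ * c₁)) (c₀ * c₂) * ‖(x₁, x₂)‖ ^ 2
      ≤ c₀ * (c₀ * c₁) * ‖x₁‖ ^ 2 + c₀ * c₂ * ‖x₂‖ ^ 2 := by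
    rw [Prod.norm_mk]
    rcases le_total ‖x₁‖ ‖x₂‖ with hle | hle
    · rw [max_eq_right hle]
      have : min (c₀ * (c₀ * c₁)) (c₀ * c₂) * ‖x₂‖ ^ 2 ≤ c₀ * c₂ * ‖x₂‖ ^ 2 := by
        gcongr; exact min_le_right _ _
      linarith
    · rw [max_eq_left hle]
      have : min (c₀ * (c₀ * c₁)) (c₀ * c₂) * ‖x₁‖ ^ 2 ≤ c₀ * (c₀ * c₁) * ‖x₁‖ ^ 2 := by
        gcongr; exact min_le_left _ _
      linarith
  linarith

end

end

/-! ### Local solutions of the flow and the parabolic inequality for the obstruction -/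

section

variable {m : ℕ}

section

variable {V V' κ κ' : Type*} [NormedAddCommGroup V] [NormedSpace ℝ V] [NormedAddCommGroup V']
  [NormedSpace ℝ V'] [Fintype κ] [Fintype κ'] {U : Set (Cn m)} {z : Cn m} {I : Set ℝ} {t : ℝ}
  {X : κ → ℝ → Cn m → V} {Y : κ' → ℝ → Cn m → V'}

theorem SmoothIn.prod_pi (hX : ∀ k, SmoothIn I U (X k)) (hY : ∀ k, SmoothIn I U (Y k)) :
    SmoothIn I U (fun t z => ((fun k => X k t z), (fun k => Y k t z))) :=
  ContDiffOn.prodMk (contDiffOn_pi.2 hX) (contDiffOn_pi.2 hY)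

theorem fderiv_prod_pi {X : κ → Cn m → V} {Y : κ' → Cn m → V'} (hX : ∀ k, DifferentiableAt ℝ (X k) z)
    (hY : ∀ k, DifferentiableAt ℝ (Y k) z) (v : Cn m) :
    fderiv ℝ (fun z => ((fun k => X k z), (fun k => Y k z))) z v
      = ((fun k => fderiv ℝ (X k) z v), (fun k => fderiv ℝ (Y k) z v)) := by
  have h1 := hasFDerivAt_pi.2 fun k => (hX k).hasFDerivAt
  have h2 := hasFDerivAt_pi.2 fun k => (hY k).hasFDerivAt
  rw [(h1.prodMk h2).fderiv]
  rfl

theorem HasDerivWithinAt.prod_pi {X : κ → ℝ → V} {Y : κ' → ℝ → V'} {x : κ → V} {y : κ' → V'}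
    (hX : ∀ k, HasDerivWithinAt (X k) (x k) I t) (hY : ∀ k, HasDerivWithinAt (Y k) (y k) I t) :
    HasDerivWithinAt (fun s => ((fun k => X k s), (fun k => Y k s))) (x, y) I t :=
  (hasDerivWithinAt_pi.2 hX).prodMk (hasDerivWithinAt_pi.2 hY)

end

section

variable {𝔄 : Type*} [NormedRing 𝔄] [NormedSpace ℂ 𝔄] [NormedSpace ℝ 𝔄] [IsScalarTower ℝ ℂ 𝔄]
  [IsScalarTower ℂ 𝔄 𝔄] [SMulCommClass ℂ 𝔄 𝔄] [IsScalarTower ℝ 𝔄 𝔄] [SMulCommClass ℝ 𝔄 𝔄]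
  {W : Type*} [NormedAddCommGroup W] [NormedSpace ℂ W] [NormedSpace ℝ W] [IsScalarTower ℝ ℂ W]
  {ρ : 𝔄 →L[ℝ] W →L[ℝ] W} {U : Set (Cn m)} {z : Cn m}
  {h : Cn m → Cn m → Cn m → ℝ} {ts : W →L[ℝ] W →L[ℝ] 𝔄} {st : 𝔄 →L[ℝ] 𝔄}
  {hs : 𝔄 →L[ℝ] 𝔄 →L[ℝ] ℝ} {ip : W →L[ℝ] W →L[ℝ] ℝ}
  {a : ℝ → Cn m → Cn m →L[ℝ] 𝔄} {p : ℝ → Cn m → W} {I : Set ℝ} {t : ℝ} {τ : ℝ}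

/-- A local solution of the gradient flow. -/
structure IsLocalFlow (h : Cn m → Cn m → Cn m → ℝ) (ρ : 𝔄 →L[ℝ] W →L[ℝ] W)
    (ts : W →L[ℝ] W →L[ℝ] 𝔄) (st : 𝔄 →L[ℝ] 𝔄) (τ : ℝ) (I : Set ℝ) (U : Set (Cn m))
    (a : ℝ → Cn m → Cn m →L[ℝ] 𝔄) (p : ℝ → Cn m → W) : Prop where
  smooth_conn : SmoothIn I U a
  smooth_sec : SmoothIn I U p
  skew : ∀ t ∈ I, IsSkewOn st (a t) U
  eq_conn : ∀ t ∈ I, ∀ z ∈ U, ∀ v, HasDerivWithinAt (fun s => a s z v)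
    (divF h (a t) z v - curr ρ ts (a t) (p t) z v) I t
  eq_sec : ∀ t ∈ I, ∀ z ∈ U, HasDerivWithinAt (fun s => p s z)
    (trG h z (fun k l => cD (secA ρ (a t)) (fun x => cD (secA ρ (a t)) (p t) x l) z k)
      + (1 / 2 : ℂ) • ((τ : ℂ) • p t z - ρ (ts (p t z) (p t z)) (p t z))) I t

theorem IsLocalFlow.derivWithin_conn (hI : IsTimeDomain I) (hU : IsOpen U)
    (hf : IsLocalFlow h ρ ts st τ I U a p) (ht : t ∈ I) (hz : z ∈ U) (v : Cn m) :
    derivWithin (fun s => a s z) I t v = divF h (a t) z v - curr ρ ts (a t) (p t) z v := by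
  have h1 : HasDerivWithinAt (fun s => a s z v) (derivWithin (fun s => a s z) I t v) I t := by
    simpa using (hf.smooth_conn.hasDerivWithinAt hI hU ht hz).clm_apply
      (hasDerivWithinAt_const t I v)
  exact (hI.uniqueDiffOn t ht).eq_deriv _ h1 (hf.eq_conn t ht z hz v)

theorem IsLocalFlow.derivWithin_sec (hI : IsTimeDomain I)
    (hf : IsLocalFlow h ρ ts st τ I U a p) (ht : t ∈ I) (hz : z ∈ U) :
    derivWithin (fun s => p s z) I t
      = trG h z (fun k l => cD (secA ρ (a t)) (fun x => cD (secA ρ (a t)) (p t) x l) z k)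
      + (1 / 2 : ℂ) • ((τ : ℂ) • p t z - ρ (ts (p t z) (p t z)) (p t z)) :=
  (hf.eq_sec t ht z hz).derivWithin (hI.uniqueDiffOn t ht)

/-- The lower order terms in the evolution of `F^{0,2}`. -/
def lower02 (h : Cn m → Cn m → Cn m → ℝ) (ρ : 𝔄 →L[ℝ] W →L[ℝ] W) (ts : W →L[ℝ] W →L[ℝ] 𝔄)
    (a : Cn m → Cn m →L[ℝ] 𝔄) (p : Cn m → W) (z u w : Cn m) : 𝔄 :=
  (trG h z (fun k l => cur11 a z k l * cur02 a z u w - cur02 a z u w * cur11 a z k l)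
      - (2 : ℂ) • (trG h z (fun k l => cur11 a z k u * cur02 a z l w - cur02 a z l w * cur11 a z k u)
        - trG h z (fun k l => cur11 a z k w * cur02 a z l u - cur02 a z l u * cur11 a z k w))
      + (2 : ℂ) • (∑ k, ∑ l, dbar (ginv h k l) z u • dP (endA a) (fun y => cur02 a y (dir l) w) z (dir k)
        - ∑ k, ∑ l, dbar (ginv h k l) z w • dP (endA a) (fun y => cur02 a y (dir l) u) z (dir k))
      + (cur02 a z u w * trCur h a z - trCur h a z * cur02 a z u w)
      - ((1 / 2 : ℂ) • (cur02 a z u w * ts (p z) (p z) + ts (p z) (p z) * cur02 a z u w)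
        + ts (dM (secA ρ a) p z w) (dP (secA ρ a) p z u)
        - ts (dM (secA ρ a) p z u) (dP (secA ρ a) p z w)))

/-- The lower order terms in the evolution of `∂̄_A φ`. -/
def lowerM (h : Cn m → Cn m → Cn m → ℝ) (ρ : 𝔄 →L[ℝ] W →L[ℝ] W) (ts : W →L[ℝ] W →L[ℝ] 𝔄) (τ : ℝ)
    (a : Cn m → Cn m →L[ℝ] 𝔄) (p : Cn m → W) (z v : Cn m) : W :=
  (trG h z (fun k l => ρ (cur11 a z k l) (dM (secA ρ a) p z v))
        + (2 : ℂ) • ∑ k, ∑ l, dbar (ginv h k l) z v • dP (secA ρ a)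
            (fun y => dM (secA ρ a) p y (dir l)) z (dir k)
        - (2 : ℂ) • trG h z (fun k l => ρ (cur11 a z k v) (dM (secA ρ a) p z l))
        + (2 : ℂ) • trG h z (fun k l => ρ (cur02 a z v l) (dP (secA ρ a) p z k))
        - ρ (trCur h a z) (dM (secA ρ a) p z v)
        + (1 / 2 : ℂ) • ((τ : ℂ) • dM (secA ρ a) p z v)
        - ρ (ts (dM (secA ρ a) p z v) (p z)) (p z)
        - (1 / 2 : ℂ) • ρ (ts (p z) (p z)) (dM (secA ρ a) p z v))

variable (hI : IsTimeDomain I) (H : IsKahlerOn h U) (hρ : IsHermRep ρ ts st)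
  (hf : IsLocalFlow h ρ ts st τ I U a p)
include hI H hρ hf

theorem IsLocalFlow.hasDerivWithinAt_cur02 (ht : t ∈ I) (hz : z ∈ U) (u w : Cn m) :
    HasDerivWithinAt (fun s => cur02 (a s) z u w)
      (trG h z (fun k l => cD (endA (a t)) (fun y => cD (endA (a t))
        (fun x => cur02 (a t) x u w) y l) z k) + lower02 h ρ ts (a t) (p t) z u w) I t := by
  have h1 := hf.smooth_conn.hasDerivWithinAt_cur02 hI H.isOpen ht (fun y _ => rfl) hz u w
  rwa [dcur02_flow H hρ (hf.smooth_conn.slice ht) (hf.skew t ht) (hf.smooth_sec.slice ht)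
    ((hf.smooth_conn.derivWithin_smooth hI H.isOpen).slice ht)
    (fun y hy v => hf.derivWithin_conn hI H.isOpen ht hy v) hz] at h1

theorem IsLocalFlow.hasDerivWithinAt_dM (ht : t ∈ I) (hz : z ∈ U) (v : Cn m) :
    HasDerivWithinAt (fun s => dM (secA ρ (a s)) (p s) z v)
      (trG h z (fun k l => cD (secA ρ (a t)) (fun y => cD (secA ρ (a t))
        (fun x => dM (secA ρ (a t)) (p t) x v) y l) z k) + lowerM h ρ ts τ (a t) (p t) z v) I t := by
  have h1 := hf.smooth_conn.hasDerivWithinAt_dM hI H.isOpen hρ.toIsRep hf.smooth_sec ht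
    (fun y _ => rfl) (fun y _ => rfl) hz v
  rwa [dM_flow H hρ (hf.smooth_conn.slice ht) (hf.skew t ht) (hf.smooth_sec.slice ht)
    ((hf.smooth_conn.derivWithin_smooth hI H.isOpen).slice ht)
    (fun y hy v => hf.derivWithin_conn hI H.isOpen ht hy v) hz (τ := τ)
    (fun y hy => hf.derivWithin_sec hI ht hy)] at h1

/-- Each summand contains a component of `F^{0,2}` or `∂̄φ`, or a first derivative of one; the other
factors are smooth, hence bounded near the point. -/
theorem IsLocalFlow.lower_oIn (ht : t ∈ I) (hz : z ∈ U) {g : ℝ × Cn m → ℝ}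
    (hα : ∀ k l : Idx m, OIn (𝓝[I ×ˢ U] (t, z)) g (fun t z => cur02 (a t) z (dir k) (dir l)))
    (hdα : ∀ (k l : Idx m) v, OIn (𝓝[I ×ˢ U] (t, z)) g
      (fun t z => fderiv ℝ (fun y => cur02 (a t) y (dir k) (dir l)) z v))
    (hβ : ∀ k : Idx m, OIn (𝓝[I ×ˢ U] (t, z)) g (fun t z => dM (secA ρ (a t)) (p t) z (dir k)))
    (hdβ : ∀ (k : Idx m) v, OIn (𝓝[I ×ˢ U] (t, z)) g
      (fun t z => fderiv ℝ (fun y => dM (secA ρ (a t)) (p t) y (dir k)) z v)) :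
    (∀ k l : Idx m, OIn (𝓝[I ×ˢ U] (t, z)) g
      (fun t z => lower02 h ρ ts (a t) (p t) z (dir k) (dir l))) ∧
    ∀ k : Idx m, OIn (𝓝[I ×ˢ U] (t, z)) g (fun t z => lowerM h ρ ts τ (a t) (p t) z (dir k)) := by
  have hU := H.isOpen
  have hg := fun k l => (SmoothIn.const_time (I := I) (H.contDiffOn_ginv k l)).oIn ht hz
  have hθ := fun v w => (hf.smooth_conn.cur11 hI hU v w).oIn ht hz
  have hQ := (hf.smooth_conn.trCur hI hU H.toIsMetricOn).oIn ht hz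
  have hA : SmoothIn I U (fun t => endA (a t)) := hf.smooth_conn.endA
  have hS : SmoothIn I U (fun t => secA ρ (a t)) := hf.smooth_conn.secA
  have hA1 := fun v => (hA.clm_apply (SmoothIn.const v)).oIn ht hz
  have hS1 := fun v => (hS.clm_apply (SmoothIn.const v)).oIn ht hz
  have hp := hf.smooth_sec.oIn ht hz
  have hPp := fun v => (hS.dP hI hU hf.smooth_sec v).oIn ht hz
  have hts := (hf.smooth_sec.bilin ts hf.smooth_sec).oIn ht hz
  have hdb : ∀ k l v, OIn (𝓝[I ×ˢ U] (t, z)) (fun _ => 1) (fun _ y => dbar (ginv h k l) y v) := by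
    intro k l v
    have h1 : ∀ v, SmoothIn I U (fun _ y => ((fderiv ℝ (ginv h k l) y v : ℝ) : ℂ)) := fun v =>
      Complex.ofRealCLM.contDiff.comp_contDiffOn
        (SmoothIn.const_time (I := I) ((H.contDiffOn_ginv k l).fderiv_apply_smooth hU v))
    have h2 : SmoothIn I U (fun _ y => dbar (ginv h k l) y v) :=
      SmoothIn.const_smul (1 / 2 : ℂ) ((h1 _).add (SmoothIn.const_smul Complex.I (h1 _)))
    exact h2.oIn ht hz
  have mul : ∀ {x y : ℝ → Cn m → 𝔄}, OIn (𝓝[I ×ˢ U] (t, z)) (fun _ => 1) x →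
      OIn (𝓝[I ×ˢ U] (t, z)) g y → OIn (𝓝[I ×ˢ U] (t, z)) g (fun t z => x t z * y t z) :=
    fun hx hy => hx.bilin (mulL 𝔄) hy
  have mul' : ∀ {x y : ℝ → Cn m → 𝔄}, OIn (𝓝[I ×ˢ U] (t, z)) g x →
      OIn (𝓝[I ×ˢ U] (t, z)) (fun _ => 1) y → OIn (𝓝[I ×ˢ U] (t, z)) g (fun t z => x t z * y t z) :=
    fun hx hy => hx.bilin_flip (mulL 𝔄) hy
  constructor
  · intro u w
    refine OIn.sub (OIn.add (OIn.add (OIn.sub ?_ ?_) ?_) ?_) ?_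
    · exact OIn.trG hg fun k k' => (mul (hθ _ _) (hα _ _)).sub (mul' (hα _ _) (hθ _ _))
    · exact OIn.const_smul _ ((OIn.trG hg fun k k' =>
        (mul (hθ _ _) (hα _ _)).sub (mul' (hα _ _) (hθ _ _))).sub (OIn.trG hg fun k k' =>
        (mul (hθ _ _) (hα _ _)).sub (mul' (hα _ _) (hθ _ _))))
    · exact OIn.const_smul _ (OIn.sub (OIn.sum _ fun k _ => OIn.sum _ fun k' _ => OIn.smul (hdb _ _ _)
        ((hα _ _).dP hA1 (hdα _ _) _)) (OIn.sum _ fun k _ => OIn.sum _ fun k' _ => OIn.smul (hdb _ _ _)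
        ((hα _ _).dP hA1 (hdα _ _) _)))
    · exact (mul' (hα _ _) hQ).sub (mul hQ (hα _ _))
    · exact OIn.sub (OIn.add (OIn.const_smul _ ((mul' (hα _ _) hts).add (mul hts (hα _ _))))
        ((hβ _).bilin_flip ts (hPp _))) ((hβ _).bilin_flip ts (hPp _))
  · intro v
    refine OIn.sub (OIn.sub (OIn.add (OIn.sub (OIn.add (OIn.sub (OIn.add ?_ ?_) ?_) ?_) ?_) ?_) ?_) ?_
    · exact OIn.trG hg fun k k' => (hθ _ _).bilin ρ (hβ _)
    · exact OIn.const_smul _ (OIn.sum _ fun k _ => OIn.sum _ fun k' _ => OIn.smul (hdb _ _ _)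
        ((hβ _).dP hS1 (hdβ _) _))
    · exact OIn.const_smul _ (OIn.trG hg fun k k' => (hθ _ _).bilin ρ (hβ _))
    · exact OIn.const_smul _ (OIn.trG hg fun k k' => (hα _ _).bilin_flip ρ (hPp _))
    · exact hQ.bilin ρ (hβ _)
    · exact OIn.const_smul _ (OIn.const_smul _ (hβ _))
    · exact ((hβ _).bilin_flip ts hp).bilin_flip ρ hp
    · exact OIn.const_smul _ (hts.bilin ρ (hβ _))

set_option maxHeartbeats 1000000 in
/-- The parabolic inequality for the obstruction to being a gauged holomorphic map. -/
theorem IsLocalFlow.exists_obstrNorm_le (hhs : ∀ B C, hs B C = hs C B)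
    (hip : ∀ x y, ip x y = ip y x) (hhs0 : ∃ c > (0 : ℝ), ∀ B, c * ‖B‖ ^ 2 ≤ hs B B)
    (hip0 : ∃ c > (0 : ℝ), ∀ x, c * ‖x‖ ^ 2 ≤ ip x x) (ht : t ∈ I) (hz : z ∈ U) :
    ∃ C : ℝ, ∀ᶠ q in 𝓝[I ×ˢ U] (t, z), ∃ d,
      HasDerivWithinAt (fun s => obstrNorm h hs ip ρ (a s) (p s) q.2) d I q.1 ∧
      d + laplacian h (obstrNorm h hs ip ρ (a q.1) (p q.1)) q.2
        ≤ C * obstrNorm h hs ip ρ (a q.1) (p q.1) q.2 := by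
  have hU := H.isOpen
  have hα := hf.smooth_conn.cur02 hI hU
  have hS : SmoothIn I U (fun t => secA ρ (a t)) := hf.smooth_conn.secA
  have hA : SmoothIn I U (fun t => endA (a t)) := hf.smooth_conn.endA
  have hβ := hS.dM hI hU hf.smooth_sec
  have hF : SmoothIn I U (fun t z => obstr ρ (a t) (p t) z) :=
    SmoothIn.prod_pi (fun k => hα _ _) fun k => hβ _
  let F : ℝ → Cn m → (Idx m × Idx m → 𝔄) × (Idx m → W) := fun t z => obstr ρ (a t) (p t) z
  have hdF : ∀ s ∈ I, ∀ y ∈ U, ∀ v, fderiv ℝ (F s) y v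
      = ((fun k : Idx m × Idx m => fderiv ℝ (fun x => cur02 (a s) x (dir k.1) (dir k.2)) y v),
        (fun k : Idx m => fderiv ℝ (fun x => dM (secA ρ (a s)) (p s) x (dir k)) y v)) := by
    intro s hs y hy v
    exact fderiv_prod_pi (fun k => ((hα _ _).slice hs).differentiableAt_of_isOpen hU hy)
      (fun k => ((hβ _).slice hs).differentiableAt_of_isOpen hU hy) v
  have hddF : ∀ s ∈ I, ∀ y ∈ U, ∀ v w, fderiv ℝ (fun x => fderiv ℝ (F s) x w) y v
      = ((fun k : Idx m × Idx m => fderiv ℝ (fun x => fderiv ℝ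
          (fun x => cur02 (a s) x (dir k.1) (dir k.2)) x w) y v),
        (fun k : Idx m => fderiv ℝ (fun x => fderiv ℝ
          (fun x => dM (secA ρ (a s)) (p s) x (dir k)) x w) y v)) := by
    intro s hs y hy v w
    have : (fun x => fderiv ℝ (F s) x w) =ᶠ[𝓝 y] fun x =>
        ((fun k : Idx m × Idx m => fderiv ℝ (fun x => cur02 (a s) x (dir k.1) (dir k.2)) x w),
        (fun k : Idx m => fderiv ℝ (fun x => dM (secA ρ (a s)) (p s) x (dir k)) x w)) := by
      filter_upwards [hU.mem_nhds hy] with x hx using hdF s hs x hx w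
    rw [this.fderiv_eq]
    exact fderiv_prod_pi
      (fun k => (((hα _ _).slice hs).fderiv_apply_smooth hU w).differentiableAt_of_isOpen hU hy)
      (fun k => (((hβ _).slice hs).fderiv_apply_smooth hU w).differentiableAt_of_isOpen hU hy) v
  -- The remainders collect the lower order terms and the difference between the rough and the
  -- coordinate Laplacian.
  let R₁ : ℝ → Cn m → Idx m × Idx m → 𝔄 := fun s y k =>
    (trG h y (fun v w => cD (endA (a s)) (fun y => cD (endA (a s))
        (fun x => cur02 (a s) x (dir k.1) (dir k.2)) y w) y v)
      - trG h y (fun v w => fderiv ℝ (fun x => fderiv ℝ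
          (fun x => cur02 (a s) x (dir k.1) (dir k.2)) x w) y v))
      + lower02 h ρ ts (a s) (p s) y (dir k.1) (dir k.2)
  let R₂ : ℝ → Cn m → Idx m → W := fun s y k =>
    (trG h y (fun v w => cD (secA ρ (a s)) (fun y => cD (secA ρ (a s))
        (fun x => dM (secA ρ (a s)) (p s) x (dir k)) y w) y v)
      - trG h y (fun v w => fderiv ℝ (fun x => fderiv ℝ
          (fun x => dM (secA ρ (a s)) (p s) x (dir k)) x w) y v))
      + lowerM h ρ ts τ (a s) (p s) y (dir k)
  -- The quantity against which the remainders are measured: the obstruction together with all its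
  -- first coordinate derivatives.
  set g : ℝ × Cn m → ℝ := fun q => ‖F q.1 q.2‖ + ∑ k, ‖fderiv ℝ (F q.1) q.2 (dir k)‖ with hg
  have hg0 : ∀ q, 0 ≤ g q := fun q => by positivity
  have hgF : ∀ q, ‖F q.1 q.2‖ ≤ g q := fun q =>
    le_add_of_nonneg_right (Finset.sum_nonneg fun _ _ => norm_nonneg _)
  have hgdF : ∀ q k, ‖fderiv ℝ (F q.1) q.2 (dir k)‖ ≤ g q := fun q k =>
    le_trans (Finset.single_le_sum (f := fun k => ‖fderiv ℝ (F q.1) q.2 (dir k)‖)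
      (fun _ _ => norm_nonneg _) (Finset.mem_univ k)) (le_add_of_nonneg_left (norm_nonneg _))
  have of_le : ∀ {V : Type _} [NormedAddCommGroup V] {f : ℝ × Cn m → V},
      (∀ q ∈ I ×ˢ U, ‖f q‖ ≤ g q) → f =O[𝓝[I ×ˢ U] (t, z)] g := by
    intro V _ f hfg
    refine Asymptotics.IsBigO.of_bound 1 ?_
    filter_upwards [self_mem_nhdsWithin] with q hq
    rw [one_mul, Real.norm_of_nonneg (hg0 q)]
    exact hfg q hq
  have of_le' : ∀ {V : Type _} [NormedAddCommGroup V] {f : ℝ × Cn m → V},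
      (∀ q ∈ I ×ˢ U, ‖f q‖ ≤ g q) → f =O[𝓝[I ×ˢ U] (t, z)] g := by
    intro V _ f hfg
    refine Asymptotics.IsBigO.of_bound 1 ?_
    filter_upwards [self_mem_nhdsWithin] with q hq
    rw [one_mul, Real.norm_of_nonneg (hg0 q)]
    exact hfg q hq
  have oα : ∀ k l : Idx m, OIn (𝓝[I ×ˢ U] (t, z)) g (fun t z => cur02 (a t) z (dir k) (dir l)) :=
    fun k l => of_le fun q hq => (norm_le_pi_norm (F q.1 q.2).1 (k, l)).trans
      ((norm_fst_le _).trans (hgF q))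
  have oβ : ∀ k : Idx m, OIn (𝓝[I ×ˢ U] (t, z)) g (fun t z => dM (secA ρ (a t)) (p t) z (dir k)) :=
    fun k => of_le' fun q hq => (norm_le_pi_norm (F q.1 q.2).2 k).trans
      ((norm_snd_le _).trans (hgF q))
  have odα : ∀ (k l : Idx m) v, OIn (𝓝[I ×ˢ U] (t, z)) g
      (fun t z => fderiv ℝ (fun y => cur02 (a t) y (dir k) (dir l)) z v) := by
    intro k l v
    refine OIn.fderiv_of_dir (X := fun t y => cur02 (a t) y (dir k) (dir l)) (fun n => ?_) v
    refine of_le fun q hq => ?_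
    have := hgdF q n
    rw [hdF q.1 hq.1 q.2 hq.2] at this
    exact (norm_le_pi_norm (fun k : Idx m × Idx m => fderiv ℝ (fun x =>
      cur02 (a q.1) x (dir k.1) (dir k.2)) q.2 (dir n)) (k, l)).trans ((le_max_left _ _).trans this)
  have odβ : ∀ (k : Idx m) v, OIn (𝓝[I ×ˢ U] (t, z)) g
      (fun t z => fderiv ℝ (fun y => dM (secA ρ (a t)) (p t) y (dir k)) z v) := by
    intro k v
    refine OIn.fderiv_of_dir (X := fun t y => dM (secA ρ (a t)) (p t) y (dir k)) (fun n => ?_) v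
    refine of_le' fun q hq => ?_
    have := hgdF q n
    rw [hdF q.1 hq.1 q.2 hq.2] at this
    exact (norm_le_pi_norm (fun k : Idx m => fderiv ℝ (fun x =>
      dM (secA ρ (a q.1)) (p q.1) x (dir k)) q.2 (dir n)) k).trans ((le_max_right _ _).trans this)
  obtain ⟨l1, l2⟩ := hf.lower_oIn hI H hρ ht hz oα odα oβ odβ
  have hR : OIn (𝓝[I ×ˢ U] (t, z)) g (fun s y => (R₁ s y, R₂ s y)) := by
    have h1 : ∀ k, OIn (𝓝[I ×ˢ U] (t, z)) g (fun s y => R₁ s y k) := fun k =>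
      (OIn.trG_cD_cD_sub hI H hA (hα (dir k.1) (dir k.2)) ht hz (oα k.1 k.2) (odα k.1 k.2)).add
        (l1 k.1 k.2)
    have h2 : ∀ k, OIn (𝓝[I ×ˢ U] (t, z)) g (fun s y => R₂ s y k) := fun k =>
      (OIn.trG_cD_cD_sub hI H hS (hβ (dir k)) ht hz (oβ k) (odβ k)).add (l2 k)
    exact OIn.prodMk (OIn.pi h1) (OIn.pi h2)
  have heq : ∀ s ∈ I, ∀ y ∈ U, HasDerivWithinAt (fun s => F s y)
      (trG h y (fun k l => fderiv ℝ (fun x => fderiv ℝ (F s) x l) y k) + (R₁ s y, R₂ s y)) I s := by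
    intro s hs y hy
    have h1 : ∀ k : Idx m × Idx m, HasDerivWithinAt (fun s => cur02 (a s) y (dir k.1) (dir k.2))
        (trG h y (fun v w => fderiv ℝ (fun x => fderiv ℝ
          (fun x => cur02 (a s) x (dir k.1) (dir k.2)) x w) y v) + R₁ s y k) I s := fun k =>
      (hf.hasDerivWithinAt_cur02 hI H hρ hs hy (dir k.1) (dir k.2)).congr_deriv (by
        simp only [R₁]; abel)
    have h2 : ∀ k : Idx m, HasDerivWithinAt (fun s => dM (secA ρ (a s)) (p s) y (dir k))
        (trG h y (fun v w => fderiv ℝ (fun x => fderiv ℝ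
          (fun x => dM (secA ρ (a s)) (p s) x (dir k)) x w) y v) + R₂ s y k) I s := fun k =>
      (hf.hasDerivWithinAt_dM hI H hρ hs hy (dir k)).congr_deriv (by
        simp only [R₂]; abel)
    refine (HasDerivWithinAt.prod_pi h1 h2).congr_deriv ?_
    simp only [hddF s hs y hy, trG]
    refine Prod.ext (funext fun k => ?_) (funext fun k => ?_)
    · simp [Prod.fst_sum]
    · simp [Prod.snd_sum]
  have := exists_deriv_add_laplacian_le H hI ht hz (contDiffOn_obstrForm (hs := hs) (ip := ip)
    H.toIsMetricOn) (fun y hy => obstrForm_symm H.toIsMetricOn hy hhs hip)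
    (exists_obstrForm_lower H.toIsMetricOn hz hhs0 hip0) hF heq hR
  simpa only [F, obstrForm_obstr] using this

end

end

section

variable {m : ℕ}

/-! ### The parabolic maximum principle -/

/-- A positive second derivative would make the point a local minimum too, so `f` would be locally
constant with second derivative zero. -/
theorem deriv_deriv_nonpos_of_isLocalMax {f : ℝ → ℝ} {x : ℝ} (hf : IsLocalMax f x)
    (hc : ContinuousAt f x) : deriv (deriv f) x ≤ 0 := by
  by_contra! hpos
  have hmin := isLocalMin_of_deriv_deriv_pos hpos hf.deriv_eq_zero hc
  have hconst : f =ᶠ[𝓝 x] fun _ => f x := by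
    filter_upwards [hf, hmin] with y h1 h2 using le_antisymm h1 h2
  have h2 : deriv f =ᶠ[𝓝 x] fun _ => 0 := by
    simpa using hconst.deriv
  rw [h2.deriv_eq] at hpos
  simp at hpos

theorem fderiv_fderiv_nonpos_of_isLocalMax {E : Type*} [NormedAddCommGroup E] [NormedSpace ℝ E]
    {f : E → ℝ} {U : Set E} {z : E} (hU : IsOpen U) (hz : z ∈ U) (hf : ContDiffOn ℝ ∞ f U)
    (hmax : IsLocalMax f z) (v : E) : fderiv ℝ (fderiv ℝ f) z v v ≤ 0 := by
  let c : ℝ → E := fun s => z + s • v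
  have hc : ∀ s, HasDerivAt c v s := fun s => by
    simpa [c] using ((hasDerivAt_id s).smul_const v).const_add z
  have hc0 : c 0 = z := by simp [c]
  have hct : Tendsto c (𝓝 0) (𝓝 z) := by
    have := (hc 0).continuousAt.tendsto
    rwa [hc0] at this
  have hev : ∀ᶠ s in 𝓝 (0 : ℝ), c s ∈ U := hct.eventually (hU.mem_nhds hz)
  have h1 : deriv (f ∘ c) =ᶠ[𝓝 0] fun s => fderiv ℝ f (c s) v := by
    filter_upwards [hev] with s hs
    exact ((hf.differentiableAt_of_isOpen hU hs).hasFDerivAt.comp_hasDerivAt s (hc s)).deriv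
  have h2 : deriv (deriv (f ∘ c)) 0 = fderiv ℝ (fderiv ℝ f) z v v := by
    rw [h1.deriv_eq, ← fderiv_fderiv_apply hf hU hz]
    have hd := (hf.fderiv_apply_smooth hU v).differentiableAt_of_isOpen hU hz
    rw [← hc0] at hd
    have := (hd.hasFDerivAt.comp_hasDerivAt 0 (hc 0)).deriv
    rwa [hc0] at this
  rw [← h2]
  refine deriv_deriv_nonpos_of_isLocalMax ?_ ?_
  · have : ∀ᶠ s in 𝓝 (0 : ℝ), f (c s) ≤ f z := hct.eventually hmax
    simpa [IsLocalMax, IsMaxFilter, hc0] using this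
  · refine ContinuousAt.comp ?_ (hc 0).continuousAt
    rw [hc0]
    exact (hf.differentiableAt_of_isOpen hU hz).continuousAt

/-- At a maximum minus the Hessian is positive semidefinite and pairs nonnegatively with the inverse
metric. The Laplacian has no Christoffel term to interfere. -/
theorem IsKahlerOn.laplacian_nonneg_of_isLocalMax {h : Cn m → Cn m → Cn m → ℝ} {U : Set (Cn m)}
    {z : Cn m} (H : IsKahlerOn h U) (hz : z ∈ U) {f : Cn m → ℝ} (hf : ContDiffOn ℝ ∞ f U)
    (hmax : IsLocalMax f z) : 0 ≤ laplacian h f z := by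
  have h1 := sum_ginv_nonneg H.toIsMetricOn hz (-fderiv ℝ (fderiv ℝ f) z)
    (fun v => by simpa using fderiv_fderiv_nonpos_of_isLocalMax H.isOpen hz hf hmax v) dir
  rw [H.laplacian_eq hz, trG]
  simp only [fderiv_fderiv_apply hf H.isOpen hz, smul_eq_mul]
  simpa using h1

theorem nonneg_deriv_of_forall_le {f : ℝ → ℝ} {d a b : ℝ} (hab : a < b)
    (hf : HasDerivWithinAt f d (Icc a b) b) (hmax : ∀ s ∈ Icc a b, f s ≤ f b) : 0 ≤ d := by
  have h1 : IsLocalMaxOn f (Icc a b) b := eventually_nhdsWithin_of_forall hmax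
  have h2 : a - b ∈ posTangentConeAt (Icc a b) b := sub_mem_posTangentConeAt_of_segment_subset
    ((convex_Icc a b).segment_subset (right_mem_Icc.2 hab.le) (left_mem_Icc.2 hab.le))
  have h3 := h1.hasFDerivWithinAt_nonpos hf.hasFDerivWithinAt h2
  simp only [ContinuousLinearMap.toSpanSingleton_apply, smul_eq_mul] at h3
  nlinarith

/-- The maximum principle for subsolutions of the heat equation on a compact Kähler manifold, whose
charts and metric are given locally around each point. -/
theorem le_mul_exp_of_deriv_add_laplacian_le {X : Type*} [TopologicalSpace X] [CompactSpace X]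
    {a b C M : ℝ} {u : ℝ → X → ℝ} (hu : ContinuousOn (fun q : ℝ × X => u q.1 q.2) (Icc a b ×ˢ univ))
    (hloc : ∀ t ∈ Ioc a b, ∀ x, ∃ (e : OpenPartialHomeomorph X (Cn m))
      (h : Cn m → Cn m → Cn m → ℝ) (U : Set (Cn m)), x ∈ e.source ∧ e x ∈ U ∧ IsKahlerOn h U ∧
      ContDiffOn ℝ ∞ (fun z => u t (e.symm z)) U ∧
      ∃ d, HasDerivWithinAt (fun s => u s x) d (Icc a b) t ∧
        d + laplacian h (fun z => u t (e.symm z)) (e x) ≤ C * u t x)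
    (hM : ∀ x, u a x ≤ M) {t : ℝ} (ht : t ∈ Icc a b) (x : X) :
    u t x ≤ M * Real.exp (C * (t - a)) := by
  -- The exponential weight removes the term `C u` from the inequality.
  let v : ℝ → X → ℝ := fun t x => Real.exp (-(C * (t - a))) * u t x
  suffices hv : v t x ≤ M by
    have h1 := mul_le_mul_of_nonneg_right hv (Real.exp_pos (C * (t - a))).le
    simp only [v] at h1
    rwa [mul_right_comm, ← Real.exp_add, neg_add_cancel, Real.exp_zero, one_mul] at h1
  refine le_of_forall_pos_le_add fun δ hδ => ?_
  -- The correction `ε(t - a)` makes the inequality strict; with this `ε` it stays below `δ` on `[a,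
  -- b]`, also when `a = b`.
  set ε := δ / (b - a + 1) with hε
  have hab : a ≤ b := ht.1.trans ht.2
  have hε0 : 0 < ε := by have : 0 < b - a + 1 := by linarith
                         positivity
  let w : ℝ × X → ℝ := fun q => v q.1 q.2 - ε * (q.1 - a)
  have hw : ContinuousOn w (Icc a b ×ˢ univ) := by
    refine ContinuousOn.sub (ContinuousOn.mul (Continuous.continuousOn ?_) hu)
      (Continuous.continuousOn ?_) <;> fun_prop
  obtain ⟨⟨t₀, x₀⟩, ⟨ht₀, -⟩, hmax⟩ := (isCompact_Icc.prod isCompact_univ).exists_isMaxOn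
    ⟨(t, x), ht, mem_univ x⟩ hw
  have hmax' : ∀ s ∈ Icc a b, ∀ y, w (s, y) ≤ w (t₀, x₀) := fun s hs y => hmax ⟨hs, mem_univ y⟩
  have key : w (t₀, x₀) ≤ M := by
    rcases eq_or_lt_of_le ht₀.1 with h0 | h0
    · have h1 : w (t₀, x₀) = u a x₀ := by
        simp only at h0
        simp only [w, v, ← h0, sub_self, mul_zero, neg_zero, Real.exp_zero, one_mul, sub_zero]
      exact h1.trans_le (hM x₀)
    -- At a maximum with `t₀ > a` the left time derivative of `w` and the Laplacian are nonnegative,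
    -- whereas the differential inequality makes that derivative at most `-ε`.
    exfalso
    obtain ⟨e, h, U, hx₀, hxU, H, hcd, d, hd, hle⟩ := hloc t₀ ⟨h0, ht₀.2⟩ x₀
    have hE : 0 < Real.exp (-(C * (t₀ - a))) := Real.exp_pos _
    -- A maximum over all of `X` remains one after composition with any map into `X`, so points
    -- outside the target of the chart do no harm.
    have hlmax : IsLocalMax (fun z => u t₀ (e.symm z)) (e x₀) := by
      refine Eventually.of_forall fun z => ?_
      have := hmax' t₀ ht₀ (e.symm z)
      simp only [w, v] at this
      beta_reduce
      rw [e.left_inv hx₀]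
      exact le_of_mul_le_mul_left (by linarith) hE
    have hΔ := H.laplacian_nonneg_of_isLocalMax hxU hcd hlmax
    have hd' : HasDerivWithinAt (fun s => w (s, x₀))
        (Real.exp (-(C * (t₀ - a))) * (-C) * u t₀ x₀ + Real.exp (-(C * (t₀ - a))) * d - ε)
        (Icc a t₀) t₀ := by
      have h1 : HasDerivAt (fun s => -(C * (s - a))) (-C) t₀ := by
        simpa using (((hasDerivAt_id t₀).sub_const a).const_mul C).fun_neg
      have h2 := h1.exp.hasDerivWithinAt (s := Icc a t₀)
      have h3 : HasDerivWithinAt (fun s => ε * (s - a)) ε (Icc a t₀) t₀ := by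
        simpa using (((hasDerivAt_id t₀).sub_const a).const_mul ε).hasDerivWithinAt
      exact (h2.mul (hd.mono (Icc_subset_Icc_right ht₀.2))).sub h3
    have hn := nonneg_deriv_of_forall_le h0 hd' fun s hs =>
      hmax' s ⟨hs.1, hs.2.trans ht₀.2⟩ x₀
    have : Real.exp (-(C * (t₀ - a))) * (d - C * u t₀ x₀) ≤ 0 :=
      mul_nonpos_of_nonneg_of_nonpos hE.le (by linarith)
    linarith
  have h1 := (hmax' t ht x).trans key
  have h2 : ε * (t - a) ≤ δ := by
    rw [hε, div_mul_eq_mul_div, div_le_iff₀ (by linarith)]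
    exact mul_le_mul_of_nonneg_left (by linarith [ht.2]) hδ.le
  simp only [w] at h1
  linarith

end

section

variable {m : ℕ}

/-! ### Changes of charts and of unitary frames -/

section

variable {𝔄 : Type*} [NormedRing 𝔄] [NormedSpace ℂ 𝔄] [NormedSpace ℝ 𝔄] [IsScalarTower ℝ ℂ 𝔄]
  [IsScalarTower ℂ 𝔄 𝔄] [SMulCommClass ℂ 𝔄 𝔄] [IsScalarTower ℝ 𝔄 𝔄] [SMulCommClass ℝ 𝔄 𝔄]
  {W : Type*} [NormedAddCommGroup W] [NormedSpace ℂ W] [NormedSpace ℝ W] [IsScalarTower ℝ ℂ W]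
  {ρ : 𝔄 →L[ℝ] W →L[ℝ] W} {U U' : Set (Cn m)} {z : Cn m}
  {h h' : Cn m → Cn m → Cn m → ℝ} {ts : W →L[ℝ] W →L[ℝ] 𝔄} {st : 𝔄 →L[ℝ] 𝔄}
  {hs : 𝔄 →L[ℝ] 𝔄 →L[ℝ] ℝ} {ip : W →L[ℝ] W →L[ℝ] ℝ}
  {a a' : Cn m → Cn m →L[ℝ] 𝔄} {p p' : Cn m → W} {τ : ℝ} {ψ : Cn m → Cn m} {γ : Cn m → 𝔄}

/-- The local data `(h', a', p')` on `U'` arise from the data `(h, a, p)` on `U` by the holomorphic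
change of coordinates `ψ` and the unitary change of frames `γ`. -/
structure IsTransition (ρ : 𝔄 →L[ℝ] W →L[ℝ] W) (st : 𝔄 →L[ℝ] 𝔄) (U U' : Set (Cn m))
    (h h' : Cn m → Cn m → Cn m → ℝ) (a a' : Cn m → Cn m →L[ℝ] 𝔄) (p p' : Cn m → W)
    (ψ : Cn m → Cn m) (γ : Cn m → 𝔄) : Prop where
  isOpen : IsOpen U'
  mapsTo : MapsTo ψ U' U
  smooth_coord : ContDiffOn ℝ ∞ ψ U'
  holomorphic : ∀ z ∈ U', ∀ v, fderiv ℝ ψ z (Complex.I • v) = Complex.I • fderiv ℝ ψ z v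
  smooth_frame : ContDiffOn ℝ ∞ γ U'
  st_mul_self : ∀ z ∈ U', st (γ z) * γ z = 1
  mul_st_self : ∀ z ∈ U', γ z * st (γ z) = 1
  metric : ∀ z ∈ U', ∀ v w, h' z v w = h (ψ z) (fderiv ℝ ψ z v) (fderiv ℝ ψ z w)
  conn : ∀ z ∈ U', ∀ v, a' z v * γ z + fderiv ℝ γ z v = γ z * a (ψ z) (fderiv ℝ ψ z v)
  sec : ∀ z ∈ U', p' z = ρ (γ z) (p (ψ z))

variable (hT : IsTransition ρ st U U' h h' a a' p p' ψ γ) (hz : z ∈ U') (hU : IsOpen U)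
include hT hz hU

omit hT hz hU in
theorem hasFDerivAt_comp_fun {F : Type*} [NormedAddCommGroup F] [NormedSpace ℝ F] {f : Cn m → F}
    (hf : DifferentiableAt ℝ f (ψ z)) (hψ : DifferentiableAt ℝ ψ z) :
    HasFDerivAt (fun y => f (ψ y)) (fderiv ℝ f (ψ z) ∘L fderiv ℝ ψ z) z :=
  hf.hasFDerivAt.comp z hψ.hasFDerivAt

theorem IsTransition.cD_sec (hρ : IsRep ρ) (hp : ContDiffOn ℝ ∞ p U) (v : Cn m) :
    cD (secA ρ a') p' z v = ρ (γ z) (cD (secA ρ a) p (ψ z) (fderiv ℝ ψ z v)) := by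
  have dψ := hT.smooth_coord.differentiableAt_of_isOpen hT.isOpen hz
  have dγ := hT.smooth_frame.differentiableAt_of_isOpen hT.isOpen hz
  have dp := hp.differentiableAt_of_isOpen hU (hT.mapsTo hz)
  have e1 : fderiv ℝ p' z = fderiv ℝ (fun y => ρ (γ y) (p (ψ y))) z := by
    apply Filter.EventuallyEq.fderiv_eq
    filter_upwards [hT.isOpen.mem_nhds hz] with y hy using hT.sec y hy
  have e2 : fderiv ℝ (fun y => p (ψ y)) z v = fderiv ℝ p (ψ z) (fderiv ℝ ψ z v) := by
    rw [(hasFDerivAt_comp_fun dp dψ).fderiv]; rfl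
  have e3 := hT.conn z hz v
  rw [cD, e1, ρ.fderiv_of_bilinear dγ (hasFDerivAt_comp_fun dp dψ).differentiableAt]
  simp only [add_apply, ContinuousLinearMap.precompR_apply,
    ContinuousLinearMap.precompL_apply, ContinuousLinearMap.compL_apply, secA,
    ContinuousLinearMap.comp_apply, cD, e2, map_add, hT.sec z hz, ← hρ.mul, ← e3]
  abel

/-- Differentiate the gauge law `a'γ + dγ = γ ψ^*a` and antisymmetrise. The second derivatives of
`γ` and of `ψ` disappear by symmetry, and the gauge law eliminates the first derivatives of `γ`. -/
theorem IsTransition.cur_mul (ha : ContDiffOn ℝ ∞ a U) (ha' : ContDiffOn ℝ ∞ a' U') (v w : Cn m) :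
    cur a' z v w * γ z = γ z * cur a (ψ z) (fderiv ℝ ψ z v) (fderiv ℝ ψ z w) := by
  have hU' := hT.isOpen
  have dψ := hT.smooth_coord.differentiableAt_of_isOpen hU' hz
  have dγ := hT.smooth_frame.differentiableAt_of_isOpen hU' hz
  have da := ha.differentiableAt_of_isOpen hU (hT.mapsTo hz)
  have da' := ha'.differentiableAt_of_isOpen hU' hz
  have dψ' := fun w => (hT.smooth_coord.fderiv_apply_smooth hU' w).differentiableAt_of_isOpen hU' hz
  have dγ' := fun w => (hT.smooth_frame.fderiv_apply_smooth hU' w).differentiableAt_of_isOpen hU' hz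
  let c : Cn m → Cn m → 𝔄 := fun y w => a (ψ y) (fderiv ℝ ψ y w)
  have dc : ∀ w, DifferentiableAt ℝ (fun y => c y w) z := fun w =>
    (hasFDerivAt_comp_fun da dψ).differentiableAt.clm_apply (dψ' w)
  have dcv : ∀ v w, fderiv ℝ (fun y => c y w) z v
      = fderiv ℝ a (ψ z) (fderiv ℝ ψ z v) (fderiv ℝ ψ z w)
        + a (ψ z) (fderiv ℝ (fderiv ℝ ψ) z v w) := by
    intro v w
    have h1 : fderiv ℝ (fun y => a (ψ y)) z v = fderiv ℝ a (ψ z) (fderiv ℝ ψ z v) := by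
      rw [(hasFDerivAt_comp_fun da dψ).fderiv]; rfl
    simp only [c]
    rw [fderiv_clm_apply (hasFDerivAt_comp_fun da dψ).differentiableAt (dψ' w)]
    simp [h1, ← fderiv_fderiv_apply hT.smooth_coord hU' hz]
    abel
  have da'w : ∀ w, DifferentiableAt ℝ (fun y => a' y w) z := fun w =>
    da'.clm_apply (differentiableAt_const w)
  have da'v : ∀ v w, fderiv ℝ (fun y => a' y w) z v = fderiv ℝ a' z v w := by
    intro v w
    rw [fderiv_clm_apply da' (differentiableAt_const w)]
    simp
  have key : ∀ v w, fderiv ℝ a' z v w * γ z + a' z w * fderiv ℝ γ z v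
      + fderiv ℝ (fderiv ℝ γ) z v w
      = fderiv ℝ γ z v * c z w + γ z * fderiv ℝ (fun y => c y w) z v := by
    intro v w
    have h1 : (fun y => mulL 𝔄 (a' y w) (γ y) + fderiv ℝ γ y w)
        =ᶠ[𝓝 z] fun y => mulL 𝔄 (γ y) (c y w) := by
      filter_upwards [hU'.mem_nhds hz] with y hy using hT.conn y hy w
    have h2 := congrArg (fun T : Cn m →L[ℝ] 𝔄 => T v) h1.fderiv_eq
    have d1 := ((mulL 𝔄).hasFDerivAt_of_bilinear (da'w w).hasFDerivAt dγ.hasFDerivAt).differentiableAt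
    rw [fderiv_fun_add d1 (dγ' w), (mulL 𝔄).fderiv_of_bilinear (da'w w) dγ,
      (mulL 𝔄).fderiv_of_bilinear dγ (dc w)] at h2
    simp only [add_apply, ContinuousLinearMap.precompR_apply,
      ContinuousLinearMap.precompL_apply, ContinuousLinearMap.compL_apply,
      ContinuousLinearMap.comp_apply, mulL_apply, da'v,
      fderiv_fderiv_apply hT.smooth_frame hU' hz] at h2
    rw [add_comm (fderiv ℝ a' z v w * γ z)]
    exact h2.trans (add_comm _ _)
  have k1 := key v w
  have k2 := key w v
  have g1 : ∀ v, fderiv ℝ γ z v = γ z * c z v - a' z v * γ z := fun v =>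
    eq_sub_of_add_eq' (hT.conn z hz v)
  rw [fderiv_fderiv_symm hT.smooth_frame hU' hz w v] at k2
  have k3 : (fderiv ℝ a' z v w - fderiv ℝ a' z w v) * γ z
      = fderiv ℝ γ z v * c z w - fderiv ℝ γ z w * c z v + a' z v * fderiv ℝ γ z w
        - a' z w * fderiv ℝ γ z v
        + γ z * (fderiv ℝ (fun y => c y w) z v - fderiv ℝ (fun y => c y v) z w) := by
    rw [sub_mul, mul_sub]
    linear_combination (norm := abel) k1 - k2
  have k4 : fderiv ℝ (fun y => c y w) z v - fderiv ℝ (fun y => c y v) z w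
      = fderiv ℝ a (ψ z) (fderiv ℝ ψ z v) (fderiv ℝ ψ z w)
        - fderiv ℝ a (ψ z) (fderiv ℝ ψ z w) (fderiv ℝ ψ z v) := by
    rw [dcv, dcv, fderiv_fderiv_symm hT.smooth_coord hU' hz w v]
    abel
  rw [cur, add_mul, k3, k4, cur, g1, g1]
  simp only [c]
  noncomm_ring

theorem IsTransition.cur_eq (ha : ContDiffOn ℝ ∞ a U) (ha' : ContDiffOn ℝ ∞ a' U') (v w : Cn m) :
    cur a' z v w = γ z * cur a (ψ z) (fderiv ℝ ψ z v) (fderiv ℝ ψ z w) * st (γ z) := by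
  rw [← hT.cur_mul hz hU ha ha', mul_assoc, hT.mul_st_self z hz, mul_one]

theorem IsTransition.cur02_eq (ha : ContDiffOn ℝ ∞ a U) (ha' : ContDiffOn ℝ ∞ a' U') (v w : Cn m) :
    cur02 a' z v w = γ z * cur02 a (ψ z) (fderiv ℝ ψ z v) (fderiv ℝ ψ z w) * st (γ z) := by
  simp only [cur02, hT.cur_eq hz hU ha ha', hT.holomorphic z hz, mul_smul_comm, smul_mul_assoc,
    mul_add, add_mul, mul_sub, sub_mul]

theorem IsTransition.dM_eq (hρ : IsRep ρ) (hp : ContDiffOn ℝ ∞ p U) (v : Cn m) :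
    dM (secA ρ a') p' z v = ρ (γ z) (dM (secA ρ a) p (ψ z) (fderiv ℝ ψ z v)) := by
  simp only [dM, hT.cD_sec hz hU hρ hp, hT.holomorphic z hz, hρ.smul_right, map_add]

theorem IsTransition.lam_eq (H : IsMetricOn h U) (H' : IsMetricOn h' U') (ha : ContDiffOn ℝ ∞ a U)
    (ha' : ContDiffOn ℝ ∞ a' U') : lam h' a' z = γ z * lam h a (ψ z) * st (γ z) := by
  have h1 := trG_map (h := h') (z := z)
    (((mulL 𝔄).flip (st (γ z)) ∘L mulL 𝔄 (γ z)) : 𝔄 →L[ℝ] 𝔄).toLinearMap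
    (fun v w => cur a (ψ z) (fderiv ℝ ψ z v) (Complex.I • fderiv ℝ ψ z w))
  have hB : IsBilinearMap ℝ (fun v w => cur a (ψ z) v (Complex.I • w)) := by
    have b := bilin_cur (a := a) (z := ψ z)
    exact ⟨fun v v' w => b.add_left _ _ _, fun c v w => b.smul_left _ _ _,
      fun v w w' => by rw [smul_add, b.add_right], fun c v w => by
        rw [smul_comm, b.smul_right]⟩
  have h2 := trG_transform H (hT.mapsTo hz) H' hz (L := (fderiv ℝ ψ z).toLinearMap)
    (hT.metric z hz) hB
  simp only [ContinuousLinearMap.coe_coe] at h2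
  rw [h2] at h1
  simp only [lam, hT.cur_eq hz hU ha ha', hT.holomorphic z hz, mul_smul_comm, smul_mul_assoc]
  exact congrArg _ h1

theorem IsTransition.mom_eq (hρ : IsHermRep ρ ts st) (H : IsMetricOn h U) (H' : IsMetricOn h' U')
    (ha : ContDiffOn ℝ ∞ a U) (ha' : ContDiffOn ℝ ∞ a' U') :
    mom h' ts τ a' p' z = γ z * mom h ts τ a p (ψ z) * st (γ z) := by
  have h1 : ts (ρ (γ z) (p (ψ z))) (ρ (γ z) (p (ψ z)))
      = γ z * ts (p (ψ z)) (p (ψ z)) * st (γ z) := by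
    rw [hρ.mul_ts, hρ.ts_mul, hρ.st_st]
  simp only [mom, hT.lam_eq hz hU H H' ha ha', hT.sec z hz, h1, mul_sub, sub_mul, mul_smul_comm,
    smul_mul_assoc, mul_one, hT.mul_st_self z hz]

omit hU in
theorem IsTransition.hs_conj (hi : IsHermInner ρ ts st hs ip) (hρ : IsHermRep ρ ts st) (B C : 𝔄) :
    hs (γ z * B * st (γ z)) (γ z * C * st (γ z)) = hs B C := by
  rw [hi.hs_mul_right, hρ.st_st, mul_assoc (γ z * C), hT.st_mul_self z hz, mul_one,
    hi.hs_mul_left, ← mul_assoc, hT.st_mul_self z hz, one_mul]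

omit hU in
theorem IsTransition.ip_rho (hi : IsHermInner ρ ts st hs ip) (hρ : IsRep ρ) (x y : W) :
    ip (ρ (γ z) x) (ρ (γ z) y) = ip x y := by
  rw [hi.ip_rho, ← hρ.mul, hT.st_mul_self z hz, hρ.one]

/-- The energy density does not depend on the coordinates and the frame. -/
theorem IsTransition.energy_eq (hi : IsHermInner ρ ts st hs ip) (hρ : IsHermRep ρ ts st)
    (H : IsMetricOn h U) (H' : IsMetricOn h' U')
    (ha : ContDiffOn ℝ ∞ a U) (ha' : ContDiffOn ℝ ∞ a' U') :
    hs (mom h' ts τ a' p' z) (mom h' ts τ a' p' z)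
      = hs (mom h ts τ a p (ψ z)) (mom h ts τ a p (ψ z)) := by
  rw [hT.mom_eq hz hU hρ H H' ha ha', hT.hs_conj hz hi hρ]

/-- The norm of the obstruction does not depend on the coordinates and the frame. -/
theorem IsTransition.obstrNorm_eq (hi : IsHermInner ρ ts st hs ip) (hρ : IsHermRep ρ ts st)
    (H : IsMetricOn h U) (H' : IsMetricOn h' U')
    (ha : ContDiffOn ℝ ∞ a U) (ha' : ContDiffOn ℝ ∞ a' U') (hp : ContDiffOn ℝ ∞ p U) :
    obstrNorm h' hs ip ρ a' p' z = obstrNorm h hs ip ρ a p (ψ z) := by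
  have hzU := hT.mapsTo hz
  have bc := bilin_cur02 (a := a) (z := ψ z)
  have tr : ∀ {B : Cn m → Cn m → ℝ}, IsBilinearMap ℝ B →
      trG h' z (fun v w => B (fderiv ℝ ψ z v) (fderiv ℝ ψ z w)) = trG h (ψ z) B := fun hB =>
    trG_transform H hzU H' hz (L := (fderiv ℝ ψ z).toLinearMap) (hT.metric z hz) hB
  have b1 : ∀ k l, IsBilinearMap ℝ (fun k' l' => hs (cur02 a (ψ z) k k') (cur02 a (ψ z) l l')) :=
    fun k l => ⟨fun v v' w => by simp [bc.add_right], fun c v w => by simp [bc.smul_right],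
      fun v w w' => by simp [bc.add_right], fun c v w => by simp [bc.smul_right]⟩
  have b2 : IsBilinearMap ℝ (fun k l => trG h (ψ z)
      (fun k' l' => hs (cur02 a (ψ z) k k') (cur02 a (ψ z) l l'))) :=
    ⟨fun v v' w => by simp [trG, bc.add_left, mul_add, Finset.sum_add_distrib],
      fun c v w => by simp [trG, bc.smul_left, mul_left_comm, Finset.mul_sum],
      fun v w w' => by simp [trG, bc.add_left, mul_add, Finset.sum_add_distrib],
      fun c v w => by simp [trG, bc.smul_left, mul_left_comm, Finset.mul_sum]⟩
  have b3 : IsBilinearMap ℝ (fun k l => ip (dM (secA ρ a) p (ψ z) k) (dM (secA ρ a) p (ψ z) l)) := by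
    have e : ∀ v w, dM (secA ρ a) p (ψ z) (v + w) = dM (secA ρ a) p (ψ z) v + dM (secA ρ a) p (ψ z) w := by
      intro v w
      simp only [dM, smul_add, cD_add_right]
      abel
    have e' : ∀ (c : ℝ) v, dM (secA ρ a) p (ψ z) (c • v) = c • dM (secA ρ a) p (ψ z) v := by
      intro c v
      simp only [dM, smul_comm _ c, cD_smul_right, ← smul_add]
    exact ⟨fun v v' w => by simp [e], fun c v w => by simp [e'],
      fun v w w' => by simp [e], fun c v w => by simp [e']⟩
  simp only [obstrNorm, hT.cur02_eq hz hU ha ha', hT.hs_conj hz hi hρ,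
    hT.dM_eq hz hU hρ.toIsRep hp, hT.ip_rho hz hi hρ.toIsRep]
  rw [← tr b2, ← tr b3]
  congr 2
  funext k l
  exact tr (b1 _ _)

end

end

/-! ### Holomorphic charts -/

section Charts

variable {m r : ℕ} {X : Type*} [TopologicalSpace X] [ChartedSpace (Cn m) X]
  [IsManifold 𝓘(ℂ, Cn m) ω X] {ι : Type*} {e e' : OpenPartialHomeomorph X (Cn m)}

theorem contDiffGroupoid_restrictScalars :
    contDiffGroupoid ω 𝓘(ℂ, Cn m) ≤ contDiffGroupoid ∞ 𝓘(ℝ, Cn m) := by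
  intro f hf
  simp only [contDiffGroupoid, contDiffPregroupoid,
    modelWithCornersSelf_coe, modelWithCornersSelf_coe_symm, Function.id_comp,
    Function.comp_id, preimage_id_eq, id_eq, range_id, inter_univ] at hf ⊢
  exact ⟨(hf.1.restrict_scalars ℝ).of_le (by exact_mod_cast le_top),
    (hf.2.restrict_scalars ℝ).of_le (by exact_mod_cast le_top)⟩

theorem mem_maximalAtlas_of_holCharts (he : e ∈ holCharts m X) :
    e ∈ IsManifold.maximalAtlas 𝓘(ℝ, Cn m) ∞ X := by
  exact StructureGroupoid.maximalAtlas_mono contDiffGroupoid_restrictScalars he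

/-- Changes between holomorphic charts are holomorphic. -/
theorem contDiffOn_transition (he : e ∈ holCharts m X) (he' : e' ∈ holCharts m X) :
    ContDiffOn ℂ ω (e ∘ e'.symm) (e'.target ∩ e'.symm ⁻¹' e.source) := by
  have h := StructureGroupoid.compatible_of_mem_maximalAtlas he' he
  rw [contDiffGroupoid, mem_groupoid_of_pregroupoid] at h
  simpa [contDiffPregroupoid] using h.1

/-- A coordinate vector field is the image of a constant field under the tangent map of the inverse
chart. -/
theorem contMDiffOn_chartVec (he : e ∈ holCharts m X) (v : Cn m) :
    ContMDiffOn 𝓘(ℝ, Cn m) (𝓘(ℝ, Cn m).prod 𝓘(ℝ, Cn m)) ∞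
      (fun z => Bundle.TotalSpace.mk' (Cn m) (E := fun x : X => TangentSpace 𝓘(ℝ, Cn m) x)
        (e.symm z) (chartVec e z v)) e.target := by
  have h1 := contMDiffOn_symm_of_mem_maximalAtlas (mem_maximalAtlas_of_holCharts he)
  have h2 := h1.contMDiffOn_tangentMapWithin (m := ∞) le_rfl e.open_target.uniqueMDiffOn
  have h3 : ContMDiff 𝓘(ℝ, Cn m) (𝓘(ℝ, Cn m).prod 𝓘(ℝ, Cn m)) ∞
      (fun z : Cn m => (⟨z, v⟩ : TangentBundle 𝓘(ℝ, Cn m) (Cn m))) :=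
    contMDiff_vectorSpace_iff_contDiff.2 contDiff_const
  refine (h2.comp h3.contMDiffOn fun z hz => hz).congr fun z hz => ?_
  simp only [Function.comp, tangentMapWithin, chartVec]
  rw [mfderivWithin_of_isOpen e.open_target hz]
  rfl

theorem contDiffOn_metricIn (g : RMetric m X) (he : e ∈ holCharts m X) (v w : Cn m) :
    ContDiffOn ℝ ∞ (fun z => metricIn g e z v w) e.target := by
  have h1 := contMDiffOn_symm_of_mem_maximalAtlas (mem_maximalAtlas_of_holCharts he)
  have : ContMDiffOn 𝓘(ℝ, Cn m) (𝓘(ℝ, Cn m).prod 𝓘(ℝ)) ∞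
      (fun z ↦ Bundle.TotalSpace.mk' ℝ (E := Bundle.Trivial X ℝ) (e.symm z) (metricIn g e z v w))
      e.target := by
    apply ContMDiffOn.clm_bundle_apply₂ (F₁ := Cn m) (F₂ := Cn m)
    · exact g.contMDiff.comp_contMDiffOn h1
    · exact contMDiffOn_chartVec he v
    · exact contMDiffOn_chartVec he w
  intro z hz
  have h2 := this z hz
  rw [Bundle.contMDiffWithinAt_totalSpace] at h2
  exact h2.2.contDiffWithinAt

theorem mdifferentiableAt_symm (he : e ∈ holCharts m X) {z : Cn m} (hz : z ∈ e.target) :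
    MDifferentiableAt 𝓘(ℝ, Cn m) 𝓘(ℝ, Cn m) e.symm z :=
  (contMDiffAt_symm_of_mem_maximalAtlas (mem_maximalAtlas_of_holCharts he) hz).mdifferentiableAt
    (by simp)

theorem mdifferentiableAt_chart (he : e ∈ holCharts m X) {x : X} (hx : x ∈ e.source) :
    MDifferentiableAt 𝓘(ℝ, Cn m) 𝓘(ℝ, Cn m) e x :=
  (contMDiffAt_of_mem_maximalAtlas (mem_maximalAtlas_of_holCharts he) hx).mdifferentiableAt
    (by simp)

/-- The differential of the chart is a left inverse, by the chain rule. Injectivity is what makes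
the coordinate metric positive definite. -/
theorem chartVec_injective (he : e ∈ holCharts m X) {z : Cn m} (hz : z ∈ e.target) :
    Function.Injective (chartVec e z) := by
  have h1 : mfderiv 𝓘(ℝ, Cn m) 𝓘(ℝ, Cn m) (e ∘ e.symm) z
      = (mfderiv 𝓘(ℝ, Cn m) 𝓘(ℝ, Cn m) e (e.symm z)).comp (chartVec e z) :=
    mfderiv_comp z (mdifferentiableAt_chart he (e.map_target hz)) (mdifferentiableAt_symm he hz)
  have h2 : mfderiv 𝓘(ℝ, Cn m) 𝓘(ℝ, Cn m) (e ∘ e.symm) z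
      = mfderiv 𝓘(ℝ, Cn m) 𝓘(ℝ, Cn m) (id : Cn m → Cn m) z := by
    apply Filter.EventuallyEq.mfderiv_eq
    filter_upwards [e.open_target.mem_nhds hz] with y hy using e.right_inv hy
  rw [h2, mfderiv_id] at h1
  intro v w hvw
  have h3 : ∀ v : Cn m, (mfderiv 𝓘(ℝ, Cn m) 𝓘(ℝ, Cn m) e (e.symm z)) (chartVec e z v) = v := fun v =>
    (congrArg (fun T : Cn m →L[ℝ] Cn m => T v) h1).symm
  rw [← h3 v, hvw, h3 w]

theorem isKahlerOn_metricIn (g : RMetric m X) (hg : IsKahler g) (he : e ∈ holCharts m X) :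
    IsKahlerOn (metricIn g e) e.target where
  isOpen := e.open_target
  smooth := contDiffOn_metricIn g he
  bilin z hz := by
    constructor <;> intros <;> simp [metricIn]
  symm z hz v w := g.symm _ _ _
  pos z hz v hv := g.pos _ _ fun h => hv (chartVec_injective he hz (by rw [h, map_zero]))
  hermitian := hg.hermitian e he
  closed := hg.closed e he

theorem chartVec_transition (he : e ∈ holCharts m X) (he' : e' ∈ holCharts m X) {z : Cn m}
    (hz : z ∈ e'.target) (hz' : e'.symm z ∈ e.source) :
    ∀ (v : Cn m), (chartVec e' z v : Cn m) = chartVec e (e (e'.symm z)) (fderiv ℝ (fun y => e (e'.symm y)) z v) := by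
  intro v
  have hψ : DifferentiableAt ℝ (fun y => e (e'.symm y)) z := by
    have := ((mdifferentiableAt_chart he hz').comp z (mdifferentiableAt_symm he' hz))
    exact this.differentiableAt
  have h1 : e'.symm =ᶠ[𝓝 z] e.symm ∘ fun y => e (e'.symm y) := by
    have := (e'.continuousAt_symm hz).eventually (e.open_source.mem_nhds hz')
    filter_upwards [this] with y hy
    exact (e.left_inv hy).symm
  have h2 := mfderiv_comp (I := 𝓘(ℝ, Cn m)) (I' := 𝓘(ℝ, Cn m)) (I'' := 𝓘(ℝ, Cn m)) z (f := fun y => e (e'.symm y)) (g := e.symm)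
    (mdifferentiableAt_symm he (e.map_source hz')) hψ.mdifferentiableAt
  have h3 := h1.mfderiv_eq (I := 𝓘(ℝ, Cn m)) (I' := 𝓘(ℝ, Cn m))
  rw [mfderiv_eq_fderiv] at h2
  have h4 : (chartVec e' z : Cn m →L[ℝ] Cn m) = (mfderiv 𝓘(ℝ, Cn m) 𝓘(ℝ, Cn m) (e.symm ∘ fun y => e (e'.symm y)) z : Cn m →L[ℝ] Cn m) := h3
  rw [h4, h2]
  rfl

end Charts

section

variable {m r : ℕ}

/-! ### Endomorphisms of the model fibre -/

instance isScalarTower_endF (r : ℕ) : IsScalarTower ℝ (EndF r) (EndF r) :=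
  ⟨fun c A B => by ext x; simp⟩

instance smulCommClass_endF (r : ℕ) : SMulCommClass ℝ (EndF r) (EndF r) :=
  ⟨fun c A B => by ext x; simp⟩

/-- The evaluation `(B, x) ↦ B x`. -/
def evalL (r : ℕ) : EndF r →L[ℝ] Fib r →L[ℝ] Fib r :=
  (LinearMap.mk₂ ℝ (fun (B : EndF r) (x : Fib r) => B x) (by simp) (by simp) (by simp)
    (by intro c B x; exact B.map_smul_of_tower c x)).toContinuousBilinearMap

@[simp] theorem evalL_apply (B : EndF r) (x : Fib r) : evalL r B x = B x := rfl

/-- The map `(x, y) ↦ x ⊗ y^*`. -/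
def tensorL (r : ℕ) : Fib r →L[ℝ] Fib r →L[ℝ] EndF r :=
  (LinearMap.mk₂ ℝ (fun (x y : Fib r) => tensorStar x y) (by simp [tensorStar])
    (by intro c x y; ext1 z; simp [tensorStar, smul_comm c]) (by simp [tensorStar])
    (by
      intro c x y
      have : c • y = (c : ℂ) • y := by simp
      rw [this, tensorStar, map_smulₛₗ]
      ext1 z
      simp [tensorStar])).toContinuousBilinearMap

@[simp] theorem tensorL_apply (x y : Fib r) : tensorL r x y = tensorStar x y := rfl

/-- The adjoint as a real linear map. -/
def adjL (r : ℕ) : EndF r →L[ℝ] EndF r :=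
  LinearMap.toContinuousLinearMap
    { toFun := fun B => ContinuousLinearMap.adjoint B
      map_add' := by intro B C; simp
      map_smul' := by
        intro c B
        have : c • B = (c : ℂ) • B := by ext x; simp
        rw [this, map_smulₛₗ]
        ext x
        simp }

@[simp] theorem adjL_apply (B : EndF r) : adjL r B = ContinuousLinearMap.adjoint B := rfl

/-- The inner product of endomorphisms as a bilinear map. -/
def hsL (r : ℕ) : EndF r →L[ℝ] EndF r →L[ℝ] ℝ :=
  (LinearMap.mk₂ ℝ (fun (B C : EndF r) => hsInner B C)
    (by intro B B' C; simp [hsInner, Finset.sum_add_distrib])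
    (by intro c B C; simp [hsInner, Finset.mul_sum])
    (by intro B B' C; simp [hsInner, Finset.sum_add_distrib])
    (by intro c B C; simp [hsInner, Finset.mul_sum])).toContinuousBilinearMap

@[simp] theorem hsL_apply (B C : EndF r) : hsL r B C = hsInner B C := rfl

/-- The real part of the Hermitian inner product of the model fibre. -/
def reInnerL (r : ℕ) : Fib r →L[ℝ] Fib r →L[ℝ] ℝ :=
  (LinearMap.mk₂ ℝ (fun (x y : Fib r) => (inner ℂ x y).re)
    (by intro x y z; simp) (by intro c x y; simp)
    (by intro x y z; simp) (by intro c x y; simp)).toContinuousBilinearMap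

@[simp] theorem reInnerL_apply (x y : Fib r) : reInnerL r x y = (inner ℂ x y).re := rfl

/-- The trace form gives independence of the basis; right invariance then follows from cyclicity. -/
theorem hsInner_eq_trace (B C : EndF r) :
    hsInner B C = (LinearMap.trace ℂ (Fib r) (ContinuousLinearMap.adjoint C * B : EndF r).toLinearMap).re := by
  rw [LinearMap.trace_eq_sum_inner _ (EuclideanSpace.basisFun (Fin r) ℂ), Complex.re_sum]
  simp [hsInner, ContinuousLinearMap.adjoint_inner_right]

theorem isHermRep_evalL (r : ℕ) : IsHermRep (evalL r) (tensorL r) (adjL r) where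
  one x := rfl
  mul B C x := rfl
  smul_left c B x := rfl
  smul_right c B x := map_smul B c x
  ts_smul_left c x y := by simp [tensorStar]
  ts_smul_right c x y := by simp [tensorStar]
  mul_ts B x y := by simp [tensorStar, ContinuousLinearMap.mul_def, InnerProductSpace.comp_rankOne]
  ts_mul B x y := by
    simp [tensorStar, ContinuousLinearMap.mul_def, InnerProductSpace.rankOne_comp]
  st_mul B C := by simp [ContinuousLinearMap.mul_def, ContinuousLinearMap.adjoint_comp]
  st_smul c B := map_smulₛₗ ContinuousLinearMap.adjoint c B
  st_ts x y := by simp [tensorStar]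
  st_st B := by simp

theorem isHermInner_hsL (r : ℕ) :
    IsHermInner (evalL r) (tensorL r) (adjL r) (hsL r) (reInnerL r) where
  hs_symm B C := by
    simp only [hsL_apply, hsInner]
    exact Finset.sum_congr rfl fun s _ => by rw [← inner_conj_symm, Complex.conj_re]
  hs_mul_left B C D := by
    simp [hsInner, ContinuousLinearMap.adjoint_inner_left]
  hs_mul_right B C D := by
    simp only [hsL_apply, adjL_apply, hsInner_eq_trace]
    have : ContinuousLinearMap.adjoint (D * ContinuousLinearMap.adjoint B)
        = B * ContinuousLinearMap.adjoint D := by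
      simp [ContinuousLinearMap.mul_def, ContinuousLinearMap.adjoint_comp]
    rw [this, ← mul_assoc, mul_assoc B]
    exact congrArg Complex.re (LinearMap.trace_mul_comm ℂ
      (ContinuousLinearMap.adjoint D * C : EndF r).toLinearMap B.toLinearMap)
  hs_ts x y B := by
    simp only [hsL_apply, tensorL_apply, reInnerL_apply, evalL_apply, hsInner_eq_trace, tensorStar]
    rw [ContinuousLinearMap.mul_def, InnerProductSpace.comp_rankOne,
      InnerProductSpace.trace_rankOne, ContinuousLinearMap.adjoint_inner_right,
      ← inner_conj_symm, Complex.conj_re]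
  ip_rho B x y := by simp [ContinuousLinearMap.adjoint_inner_right]

/-- The operator norm is at most the Hilbert–Schmidt norm: expand in the standard basis and apply
the Cauchy–Schwarz inequality. -/
theorem norm_sq_le_hsInner (B : EndF r) : ‖B‖ ^ 2 ≤ hsInner B B := by
  have hB : hsInner B B = ∑ s, ‖B (EuclideanSpace.single s 1)‖ ^ 2 := by
    refine Finset.sum_congr rfl fun s _ => ?_
    rw [inner_self_eq_norm_sq_to_K]
    norm_cast
  have h0 : 0 ≤ hsInner B B := by rw [hB]; positivity
  have h1 : ‖B‖ ≤ Real.sqrt (hsInner B B) := by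
    refine B.opNorm_le_bound (Real.sqrt_nonneg _) fun x => ?_
    have hx : B x = ∑ s, x s • B (EuclideanSpace.single s 1) := by
      conv_lhs => rw [← (EuclideanSpace.basisFun (Fin r) ℂ).sum_repr x]
      simp
    rw [hx]
    calc ‖∑ s, x s • B (EuclideanSpace.single s 1)‖
        ≤ ∑ s, ‖B (EuclideanSpace.single s 1)‖ * ‖x s‖ :=
          (norm_sum_le _ _).trans (Finset.sum_le_sum fun s _ => by rw [norm_smul, mul_comm])
      _ ≤ Real.sqrt (∑ s, ‖B (EuclideanSpace.single s 1)‖ ^ 2) * Real.sqrt (∑ s, ‖x s‖ ^ 2) :=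
          Real.sum_mul_le_sqrt_mul_sqrt _ _ _
      _ = _ := by rw [hB, EuclideanSpace.norm_eq]
  calc ‖B‖ ^ 2 ≤ Real.sqrt (hsInner B B) ^ 2 := by gcongr
    _ = _ := Real.sq_sqrt h0

theorem exists_hsL_lower (r : ℕ) : ∃ c > (0 : ℝ), ∀ B, c * ‖B‖ ^ 2 ≤ hsL r B B :=
  ⟨1, one_pos, fun B => by simpa using norm_sq_le_hsInner B⟩

theorem reInner_self (x : Fib r) : (inner ℂ x x).re = ‖x‖ ^ 2 := by
  rw [inner_self_eq_norm_sq_to_K]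
  norm_cast

theorem exists_reInnerL_lower (r : ℕ) : ∃ c > (0 : ℝ), ∀ x, c * ‖x‖ ^ 2 ≤ reInnerL r x x :=
  ⟨1, one_pos, fun x => by rw [reInnerL_apply, reInner_self, one_mul]⟩

theorem reInnerL_symm (x y : Fib r) : reInnerL r x y = reInnerL r y x := by
  rw [reInnerL_apply, reInnerL_apply, ← inner_conj_symm, Complex.conj_re]

/-! ### The definitions in a patch -/

section Patch

variable {h : Cn m → Cn m → Cn m → ℝ} {U : Set (Cn m)} {z : Cn m}
  {a : Cn m → Cn m →L[ℝ] EndF r} {p : Cn m → Fib r} {τ : ℝ}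

theorem dbarSec_eq (v : Cn m) : dbarSec a p z v = dM (secA (evalL r) a) p z v := rfl

theorem current_eq (v : Cn m) : current a p z v = curr (evalL r) (tensorL r) a p z v := rfl

/-- Raising the second index of `ω(∂_p, ·) = g(i∂_p, ·)` gives the coordinates of `i∂_p`.
Contraction with the fundamental form is thus the metric trace with `i` inserted in the second slot.
-/
theorem sum_fundForm_smul {V : Type*} [AddCommGroup V] [Module ℝ V] (H : IsKahlerOn h U) (hz : z ∈ U)
    {B : Cn m → Cn m → V} (hB : IsBilinearMap ℝ B) :
    ∑ k, ∑ l, ∑ p, ∑ q, (ginv h k p z * ginv h l q z * fundForm h z (dir p) (dir q)) •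
      B (dir k) (dir l) = trG h z (fun k l => B k (Complex.I • l)) := by
  have h1 : ∀ k p : Idx m, ∑ l, crd l (Complex.I • dir p : Cn m) • B (dir k) (dir l)
      = B (dir k) (Complex.I • dir p) := by
    intro k p
    conv_rhs => rw [← sum_crd_smul_dir (Complex.I • dir p : Cn m)]
    rw [hB.sum_right]
  rw [trG]
  refine Finset.sum_congr rfl fun k _ => ?_
  rw [Finset.sum_comm]
  refine Finset.sum_congr rfl fun p _ => ?_
  rw [← h1, Finset.smul_sum]
  refine Finset.sum_congr rfl fun l _ => ?_
  rw [← H.sum_ginv_mul_left hz, smul_smul, Finset.mul_sum, Finset.sum_smul]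
  refine Finset.sum_congr rfl fun q _ => ?_
  rw [mul_assoc]
  rfl

theorem lamCurv_eq (H : IsKahlerOn h U) (hz : z ∈ U) : lamCurv h a z = lam h a z :=
  congrArg (fun B : EndF r => (1 / 2 : ℝ) • B)
    (sum_fundForm_smul H hz (bilin_cur (a := a) (z := z)))

theorem moment_eq (H : IsKahlerOn h U) (hz : z ∈ U) :
    moment h τ a p z = mom h (tensorL r) τ a p z := by
  rw [moment, mom, lamCurv_eq H hz]
  rfl

theorem dstarD_eq (H : IsKahlerOn h U) (hz : z ∈ U) : dstarD h a p z
    = -trG h z (fun k l => cD (secA (evalL r) a) (fun x => cD (secA (evalL r) a) p x l) z k) := by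
  have h1 : ∀ k l : Idx m, ∑ n, christoffel h n k l z • covSec a p z (dir n)
      = cD (secA (evalL r) a) p z (gam h z (dir k) (dir l)) := by
    intro k l
    rw [← sum_christoffel_smul_dir]
    simp only [covSec, cD, map_sum, map_smul, sum_apply, smul_apply, Finset.sum_add_distrib,
      smul_add]
    rfl
  have h2 : trG h z (fun k l => cD (secA (evalL r) a) p z (gam h z k l)) = 0 := by
    have := trG_map (h := h) (z := z)
      (fderiv ℝ p z + (secA (evalL r) a z).flip (p z) : Cn m →L[ℝ] Fib r).toLinearMap (gam h z)
    rw [H.trG_gam hz, map_zero] at this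
    exact this
  rw [dstarD]
  simp only [h1, smul_sub, Finset.sum_sub_distrib]
  have h3 : ∑ k : Idx m, ∑ l : Idx m, ginv h k l z • cD (secA (evalL r) a) p z
      (gam h z (dir k) (dir l)) = 0 := h2
  rw [h3, sub_zero]
  rfl

/-- Of the two Christoffel terms, the one contracted with the inverse metric vanishes on a Kähler
manifold; the other is the one kept in `divF`. -/
theorem dstarCurv_eq (H : IsKahlerOn h U) (hz : z ∈ U) (j : Idx m) :
    dstarCurv h a z j = -divF h a z (dir j) := by
  have bc := bilin_cur (a := a) (z := z)
  have h1 : ∀ k l : Idx m, ∑ n, christoffel h n k l z • curv a z (dir n) (dir j)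
      = cur a z (gam h z (dir k) (dir l)) (dir j) := by
    intro k l
    rw [← sum_christoffel_smul_dir, bc.sum_left]
    rfl
  have h2 : ∀ k l : Idx m, ∑ n, christoffel h n k j z • curv a z (dir l) (dir n)
      = cur a z (dir l) (gam h z (dir k) (dir j)) := by
    intro k l
    rw [← sum_christoffel_smul_dir, bc.sum_right]
    rfl
  have h3 : ∑ k : Idx m, ∑ l : Idx m, ginv h k l z • cur a z (gam h z (dir k) (dir l)) (dir j)
      = 0 := by
    let T : Cn m →ₗ[ℝ] EndF r :=
      { toFun := fun v => cur a z v (dir j)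
        map_add' := fun v w => bc.add_left v w _
        map_smul' := fun c v => bc.smul_left c v _ }
    have := trG_map (h := h) (z := z) T (gam h z)
    rw [H.trG_gam hz, map_zero] at this
    exact this
  rw [dstarCurv]
  simp only [h1, h2, smul_sub, Finset.sum_sub_distrib]
  rw [h3, sub_zero]
  rfl

end Patch

end

/-! ### Overlaps of charts and frames -/

section Overlap

variable {m r : ℕ} {X : Type*} [TopologicalSpace X] [ChartedSpace (Cn m) X]
  [IsManifold 𝓘(ℂ, Cn m) ω X] {ι : Type*} {e e' : OpenPartialHomeomorph X (Cn m)} {i i' : ι}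
  {Z : HermitianBundle m r X ι} {A : UnitaryConnection Z} {φ : ∀ x, Z.E x} {z : Cn m}

theorem IsKahlerOn.mono {h : Cn m → Cn m → Cn m → ℝ} {U V : Set (Cn m)} (H : IsKahlerOn h U)
    (hV : IsOpen V) (hVU : V ⊆ U) : IsKahlerOn h V where
  isOpen := hV
  smooth v w := (H.smooth v w).mono hVU
  bilin z hz := H.bilin z (hVU hz)
  symm z hz := H.symm z (hVU hz)
  pos z hz := H.pos z (hVU hz)
  hermitian z hz := H.hermitian z (hVU hz)
  closed z hz := H.closed z (hVU hz)

theorem isOpen_patch (Z : HermitianBundle m r X ι) (e : OpenPartialHomeomorph X (Cn m)) (i : ι) :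
    IsOpen (Z.patch e i) :=
  e.isOpen_inter_preimage_symm (Z.isOpen_baseSet i)

theorem isKahlerOn_patch (g : RMetric m X) (hg : IsKahler g) (he : e ∈ holCharts m X) (i : ι) :
    IsKahlerOn (metricIn g e) (Z.patch e i) :=
  (isKahlerOn_metricIn g hg he).mono (isOpen_patch Z e i) inter_subset_left

theorem coordChange_mul_coordChange {x : X} (hi : x ∈ Z.baseSet i) (hi' : x ∈ Z.baseSet i') :
    Z.coordChange i' i x * Z.coordChange i i' x = 1 := by
  ext1 v
  rw [mul_apply_eq_comp, Z.coordChange_comp i i' i x ⟨⟨hi, hi'⟩, hi⟩,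
    Z.coordChange_self i x hi]
  rfl

theorem adjoint_coordChange_mul_self {x : X} (hi : x ∈ Z.baseSet i) (hi' : x ∈ Z.baseSet i') :
    ContinuousLinearMap.adjoint (Z.coordChange i i' x) * Z.coordChange i i' x = 1 :=
  (ContinuousLinearMap.norm_map_iff_adjoint_comp_self _).1 (Z.unitary_coordChange i i' x ⟨hi, hi'⟩)

theorem coordChange_mul_adjoint_self {x : X} (hi : x ∈ Z.baseSet i) (hi' : x ∈ Z.baseSet i') :
    Z.coordChange i i' x * ContinuousLinearMap.adjoint (Z.coordChange i i' x) = 1 := by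
  have h1 := coordChange_mul_coordChange hi' hi
  have h2 := adjoint_coordChange_mul_self hi hi'
  rwa [left_inv_eq_right_inv h2 h1]

theorem secIn_eq_of_symm_eq {x : X} {w : Cn m} (hx : e.symm w = x) :
    secIn Z φ e i w = Z.coordChange (Z.indexAt x) i x (φ x) := by
  subst hx; rfl

theorem metricIn_eq_of_symm_eq (g : RMetric m X) {x : X} {w : Cn m} (hx : e.symm w = x)
    (u v : Cn m) : metricIn g e w u v = g.inner x (chartVec e w u : Cn m) (chartVec e w v : Cn m) := by
  subst hx; rfl

theorem formIn_eq_of_symm_eq (α : ∀ x : X, TangentSpace 𝓘(ℝ, Cn m) x →L[ℝ] EndF r) {x : X}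
    {w : Cn m} (hx : e.symm w = x) (v : Cn m) :
    formIn α e w v = α x (chartVec e w v : Cn m) := by
  subst hx; rfl

/-- The part of a patch which meets a second patch. -/
def overlap (Z : HermitianBundle m r X ι) (e e' : OpenPartialHomeomorph X (Cn m)) (i i' : ι) : Set (Cn m) := Z.patch e' i' ∩ e'.symm ⁻¹' (e.source ∩ Z.baseSet i)

theorem isOpen_overlap : IsOpen (overlap Z e e' i i') := by
  have : overlap Z e e' i i'
      = e'.target ∩ e'.symm ⁻¹' (Z.baseSet i' ∩ (e.source ∩ Z.baseSet i)) := by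
    rw [overlap, HermitianBundle.patch, preimage_inter, inter_assoc]
    rfl
  rw [this]
  exact e'.isOpen_inter_preimage_symm
    ((Z.isOpen_baseSet i').inter (e.open_source.inter (Z.isOpen_baseSet i)))

/-- Connects the local calculus with `X`: chart changes are holomorphic, frame changes are unitary,
and the chain rule turns the gauge law on `X` into the coordinate law. -/
theorem isTransition_overlap (g : RMetric m X) (he : e ∈ holCharts m X) (he' : e' ∈ holCharts m X)
    (i i' : ι) (A : UnitaryConnection Z) (φ : ∀ x, Z.E x) :
    IsTransition (evalL r) (adjL r) (Z.patch e i) (overlap Z e e' i i') (metricIn g e) (metricIn g e')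
      (A.formAt e i) (A.formAt e' i') (secIn Z φ e i) (secIn Z φ e' i')
      (fun y => e (e'.symm y)) (fun y => Z.coordChange i i' (e'.symm y)) := by
  have hc := contDiffOn_transition he he'
  have hsub : overlap Z e e' i i' ⊆ e'.target ∩ e'.symm ⁻¹' e.source :=
    fun z hz => ⟨hz.1.1, hz.2.1⟩
  have hsm : ContMDiffOn 𝓘(ℝ, Cn m) 𝓘(ℝ, Cn m) ∞ e'.symm e'.target :=
    contMDiffOn_symm_of_mem_maximalAtlas (mem_maximalAtlas_of_holCharts he')
  refine ⟨isOpen_overlap, ?_, ?_, ?_, ?_, ?_, ?_, ?_, ?_, ?_⟩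
  · intro z hz
    refine ⟨e.map_source hz.2.1, ?_⟩
    rw [mem_preimage, e.left_inv hz.2.1]
    exact hz.2.2
  · exact ((hc.restrict_scalars ℝ).of_le (by exact_mod_cast le_top)).mono hsub
  · intro z hz v
    have h1 : DifferentiableAt ℂ (fun y => e (e'.symm y)) z :=
      ((hc.mono hsub).differentiableOn (by simp) z hz).differentiableAt
        (isOpen_overlap.mem_nhds hz)
    rw [h1.fderiv_restrictScalars ℝ]
    simp
  · exact ((Z.smooth_coordChange i i').comp (hsm.mono fun z hz => hz.1.1)
      fun z hz => ⟨hz.2.2, hz.1.2⟩).contDiffOn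
  · intro z hz
    exact adjoint_coordChange_mul_self hz.2.2 hz.1.2
  · intro z hz
    exact coordChange_mul_adjoint_self hz.2.2 hz.1.2
  · intro z hz v w
    rw [metricIn_eq_of_symm_eq g (e.left_inv hz.2.1), ← chartVec_transition he he' hz.1.1 hz.2.1,
      ← chartVec_transition he he' hz.1.1 hz.2.1]
    rfl
  · intro z hz v
    have hd : MDifferentiableAt 𝓘(ℝ, Cn m) 𝓘(ℝ, EndF r) (Z.coordChange i i') (e'.symm z) :=
      ((Z.smooth_coordChange i i').contMDiffAt (((Z.isOpen_baseSet i).inter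
        (Z.isOpen_baseSet i')).mem_nhds ⟨hz.2.2, hz.1.2⟩)).mdifferentiableAt (by simp)
    have h1 := mfderiv_comp (I := 𝓘(ℝ, Cn m)) (I' := 𝓘(ℝ, Cn m)) (I'' := 𝓘(ℝ, EndF r)) z
      (f := e'.symm) hd (mdifferentiableAt_symm he' hz.1.1)
    rw [mfderiv_eq_fderiv] at h1
    have h2 : fderiv ℝ (fun y => Z.coordChange i i' (e'.symm y)) z v
        = mvfderiv 𝓘(ℝ, Cn m) (Z.coordChange i i') (e'.symm z) (chartVec e' z v) :=
      congrArg (fun L : Cn m →L[ℝ] EndF r => L v) h1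
    rw [h2]
    have h3 := A.gauge i i' (e'.symm z) ⟨hz.2.2, hz.1.2⟩ (chartVec e' z v)
    have h4 : A.formAt e i (e (e'.symm z)) (fderiv ℝ (fun y => e (e'.symm y)) z v)
        = A.form i (e'.symm z) (chartVec e' z v) := by
      rw [UnitaryConnection.formAt, formIn_eq_of_symm_eq _ (e.left_inv hz.2.1),
        ← chartVec_transition he he' hz.1.1 hz.2.1]
    rw [h4]
    exact h3
  · intro z hz
    rw [secIn_eq_of_symm_eq (e.left_inv hz.2.1)]
    exact (Z.coordChange_comp _ i i' (e'.symm z) ⟨⟨Z.mem_baseSet_at _, hz.2.2⟩, hz.1.2⟩ _).symm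

end Overlap

section

variable {m : ℕ}

/-! ### The evolution of the energy density in a patch -/

section

variable {𝔄 : Type*} [NormedRing 𝔄] [NormedSpace ℂ 𝔄] [NormedSpace ℝ 𝔄] [IsScalarTower ℝ ℂ 𝔄]
  [IsScalarTower ℂ 𝔄 𝔄] [SMulCommClass ℂ 𝔄 𝔄] [IsScalarTower ℝ 𝔄 𝔄] [SMulCommClass ℝ 𝔄 𝔄]
  {W : Type*} [NormedAddCommGroup W] [NormedSpace ℂ W] [NormedSpace ℝ W] [IsScalarTower ℝ ℂ W]
  {ρ : 𝔄 →L[ℝ] W →L[ℝ] W} {U : Set (Cn m)} {z : Cn m}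
  {h : Cn m → Cn m → Cn m → ℝ} {ts : W →L[ℝ] W →L[ℝ] 𝔄} {st : 𝔄 →L[ℝ] 𝔄}
  {hs : 𝔄 →L[ℝ] 𝔄 →L[ℝ] ℝ} {ip : W →L[ℝ] W →L[ℝ] ℝ} {I : Set ℝ} {t : ℝ} {τ : ℝ}

/-- A real linear map is determined by its values on the coordinate vectors. -/
theorem eq_sum_crd_smul {V : Type*} [AddCommGroup V] [Module ℝ V] {B : Cn m → V}
    (hadd : ∀ v w, B (v + w) = B v + B w) (hsmul : ∀ (c : ℝ) v, B (c • v) = c • B v) (v : Cn m) :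
    B v = ∑ k, crd k v • B (dir k) := by
  let T : Cn m →ₗ[ℝ] V := { toFun := B, map_add' := hadd, map_smul' := hsmul }
  have h1 : T v = ∑ k, crd k v • T (dir k) := by
    conv_lhs => rw [← sum_crd_smul_dir v]
    simp only [map_sum, map_smul]
  exact h1

section

variable {a : Cn m → Cn m →L[ℝ] 𝔄} {p : Cn m → W}

theorem divF_add (H : IsMetricOn h U) (ha : ContDiffOn ℝ ∞ a U) (hz : z ∈ U) (v w : Cn m) :
    divF h a z (v + w) = divF h a z v + divF h a z w := by
  have hd := fun v w => (contDiffOn_cur H.isOpen ha v w).differentiableAt_of_isOpen H.isOpen hz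
  have h1 : ∀ k l, cD (endA a) (fun y => cur a y l (v + w)) z k
      = cD (endA a) (fun y => cur a y l v) z k + cD (endA a) (fun y => cur a y l w) z k := by
    intro k l
    simp only [bilin_cur.add_right]
    exact cD_add (hd _ _) (hd _ _) _
  have h2 : trG h z (fun k l => cur a z l (gam h z k (v + w)))
      = trG h z (fun k l => cur a z l (gam h z k v)) + trG h z (fun k l => cur a z l (gam h z k w)) := by
    simp only [(H.bilin_gam hz).add_right, bilin_cur.add_right, trG_add]
  have h3 : trG h z (fun k l => cD (endA a) (fun y => cur a y l (v + w)) z k)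
      = trG h z (fun k l => cD (endA a) (fun y => cur a y l v) z k)
        + trG h z (fun k l => cD (endA a) (fun y => cur a y l w) z k) :=
    (trG_congr fun k l => h1 _ _).trans (trG_add _ _)
  rw [divF, h3, h2, divF, divF]
  abel

theorem divF_smul (H : IsMetricOn h U) (ha : ContDiffOn ℝ ∞ a U) (hz : z ∈ U) (c : ℝ) (v : Cn m) :
    divF h a z (c • v) = c • divF h a z v := by
  have hd := fun v w => (contDiffOn_cur H.isOpen ha v w).differentiableAt_of_isOpen H.isOpen hz
  have h0 : ∀ B : Cn m → Cn m → 𝔄, trG h z (fun v w => c • B v w) = c • trG h z B := fun B => by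
    simp only [trG, Finset.smul_sum, smul_comm c]
  have h1 : ∀ k l, cD (endA a) (fun y => cur a y l (c • v)) z k
      = c • cD (endA a) (fun y => cur a y l v) z k := by
    intro k l
    have h2 : (fun y => cur a y l (c • v)) = fun y => c • cur a y l v :=
      funext fun y => bilin_cur.smul_right c l v
    rw [h2, cD, cD, fderiv_fun_const_smul (hd l v), map_smul, smul_add]
    rfl
  have h3 : trG h z (fun k l => cur a z l (gam h z k (c • v)))
      = c • trG h z (fun k l => cur a z l (gam h z k v)) := by
    rw [← h0]
    exact trG_congr fun k l => by rw [(H.bilin_gam hz).smul_right, bilin_cur.smul_right]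
  have h4 : trG h z (fun k l => cD (endA a) (fun y => cur a y l (c • v)) z k)
      = c • trG h z (fun k l => cD (endA a) (fun y => cur a y l v) z k) :=
    (trG_congr fun k l => h1 _ _).trans (h0 _)
  rw [divF, h4, h3, divF, smul_sub]

theorem curr_add (v w : Cn m) : curr ρ ts a p z (v + w) = curr ρ ts a p z v + curr ρ ts a p z w := by
  simp only [curr, cD_add_right, map_add, add_apply]
  module

theorem curr_smul (c : ℝ) (v : Cn m) : curr ρ ts a p z (c • v) = c • curr ρ ts a p z v := by
  simp only [curr, cD_smul_right, map_smul, smul_apply]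
  module

/-- The constant multiples of the identity are parallel. -/
theorem cD_mom_eq (v : Cn m) : cD (endA a) (mom h ts τ a p) z v
    = cD (endA a) (fun y => lam h a y - (Complex.I / 2) • ts (p y) (p y)) z v := by
  have h1 : mom h ts τ a p = fun y => (lam h a y - (Complex.I / 2) • ts (p y) (p y))
      + (Complex.I / 2 * τ) • (1 : 𝔄) := by
    funext y
    rw [mom]
    module
  simp only [h1, cD, fderiv_add_const, endA, ContinuousLinearMap.comp_apply, adL_apply, mul_add,
    add_mul, mul_smul_comm, smul_mul_assoc, mul_one, one_mul]
  abel

end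

variable {a : ℝ → Cn m → Cn m →L[ℝ] 𝔄} {p : ℝ → Cn m → W}

/-- The equation for the connection is given in coordinate directions only. Both sides are real
linear in the direction, so it extends to all vectors. -/
theorem isLocalFlow_of_dir (H : IsMetricOn h U) (ha : SmoothIn I U a) (hp : SmoothIn I U p)
    (hsk : ∀ t ∈ I, IsSkewOn st (a t) U)
    (eq_conn : ∀ t ∈ I, ∀ z ∈ U, ∀ k, HasDerivWithinAt (fun s => a s z (dir k))
      (divF h (a t) z (dir k) - curr ρ ts (a t) (p t) z (dir k)) I t)
    (eq_sec : ∀ t ∈ I, ∀ z ∈ U, HasDerivWithinAt (fun s => p s z)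
    (trG h z (fun k l => cD (secA ρ (a t)) (fun x => cD (secA ρ (a t)) (p t) x l) z k)
      + (1 / 2 : ℂ) • ((τ : ℂ) • p t z - ρ (ts (p t z) (p t z)) (p t z))) I t) :
    IsLocalFlow h ρ ts st τ I U a p where
  smooth_conn := ha
  smooth_sec := hp
  skew := hsk
  eq_sec := eq_sec
  eq_conn := by
    intro t ht z hz v
    have h1 : divF h (a t) z v - curr ρ ts (a t) (p t) z v = ∑ k, crd k v •
        (divF h (a t) z (dir k) - curr ρ ts (a t) (p t) z (dir k)) :=
      eq_sum_crd_smul (B := fun v => divF h (a t) z v - curr ρ ts (a t) (p t) z v)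
        (fun v w => by
          beta_reduce
          rw [divF_add H (ha.slice ht) hz, curr_add]; abel)
        (fun c v => by
          beta_reduce
          rw [divF_smul H (ha.slice ht) hz, curr_smul, smul_sub]) v
    have h2 : ∀ s, a s z v = ∑ k, crd k v • a s z (dir k) := fun s =>
      eq_sum_crd_smul (map_add _) (map_smul _) v
    simp only [h1, h2]
    exact HasDerivWithinAt.fun_sum fun k _ => (eq_conn t ht z hz k).const_smul _

/-- The evolution equation of the energy density along a local solution of type `(1,1)`. -/
theorem IsLocalFlow.exists_energy_eq (hI : IsTimeDomain I) (H : IsKahlerOn h U)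
    (hρ : IsHermRep ρ ts st) (hi : IsHermInner ρ ts st hs ip)
    (hf : IsLocalFlow h ρ ts st τ I U a p) (ht : t ∈ I)
    (h02 : ∀ y ∈ U, ∀ v w, cur02 (a t) y v w = 0)
    (h01 : ∀ y ∈ U, ∀ v, dM (secA ρ (a t)) (p t) y v = 0) (hz : z ∈ U) :
    ∃ d, HasDerivWithinAt
        (fun s => hs (mom h ts τ (a s) (p s) z) (mom h ts τ (a s) (p s) z)) d I t ∧
      d + laplacian h (fun y => hs (mom h ts τ (a t) (p t) y) (mom h ts τ (a t) (p t) y)) z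
      = -2 * trG h z (fun k l =>
          hs (cD (endA (a t)) (fun y => lam h (a t) y - (Complex.I / 2) • ts (p t y) (p t y)) z k)
            (cD (endA (a t)) (fun y => lam h (a t) y - (Complex.I / 2) • ts (p t y) (p t y)) z l))
        - 2 * ip (ρ (mom h ts τ (a t) (p t) z) (p t z)) (ρ (mom h ts τ (a t) (p t) z) (p t z)) := by
  have hU := H.isOpen
  let b : Cn m → Cn m →L[ℝ] 𝔄 := fun y => derivWithin (fun s => a s y) I t
  have hbd : ∀ y ∈ U, ∀ v, HasDerivWithinAt (fun s => a s y v) (b y v) I t := fun y hy v => by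
    simpa using (hf.smooth_conn.hasDerivWithinAt hI hU ht hy).clm_apply
      (hasDerivWithinAt_const t I v)
  have hb : ContDiffOn ℝ ∞ b U := (hf.smooth_conn.derivWithin_smooth hI hU).slice ht
  have hbs : IsSkewOn st b U := by
    intro y hy v
    have h1 : HasDerivWithinAt (fun s => st (a s y v)) (st (b y v)) I t :=
      st.hasFDerivAt.comp_hasDerivWithinAt t (hbd y hy v)
    have h2 : HasDerivWithinAt (fun s => st (a s y v)) (-b y v) I t :=
      (hbd y hy v).fun_neg.congr (fun s hs => hf.skew s hs y hy v) (hf.skew t ht y hy v)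
    exact (hI.uniqueDiffOn t ht).eq_deriv _ h1 h2
  obtain ⟨q, hq⟩ : ∃ q, q = trG h z (fun k l => cD (secA ρ (a t))
      (fun x => cD (secA ρ (a t)) (p t) x l) z k)
      + (1 / 2 : ℂ) • ((τ : ℂ) • p t z - ρ (ts (p t z) (p t z)) (p t z)) := ⟨_, rfl⟩
  have hdq : HasDerivWithinAt (fun s => p s z) q I t := hq ▸ hf.eq_sec t ht z hz
  have hlam : HasDerivWithinAt (fun s => lam h (a s) z)
      ((1 / 2 : ℝ) • trG h z (fun k l => dcur (a t) b z k (Complex.I • l))) I t := by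
    refine HasDerivWithinAt.fun_const_smul (c := (1 / 2 : ℝ)) ?_
    exact HasDerivWithinAt.fun_sum fun k _ => HasDerivWithinAt.fun_sum fun l _ =>
      (hf.smooth_conn.hasDerivWithinAt_cur hI hU ht (fun y _ => rfl) hz _ _).fun_const_smul _
  have hts : HasDerivWithinAt (fun s => ts (p s z) (p s z)) (ts (p t z) q + ts q (p t z)) I t :=
    ts.hasDerivWithinAt_of_bilinear hdq hdq
  have hmom : HasDerivWithinAt (fun s => mom h ts τ (a s) (p s) z)
      ((1 / 2 : ℝ) • trG h z (fun k l => dcur (a t) b z k (Complex.I • l))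
        - (Complex.I / 2) • (ts q (p t z) + ts (p t z) q)) I t := by
    rw [add_comm (ts q (p t z))]
    exact hlam.fun_sub ((hts.sub_const _).fun_const_smul _)
  refine ⟨_, hs.hasDerivWithinAt_of_bilinear hmom hmom, ?_⟩
  have key := energy_identity H hρ (hf.smooth_conn.slice ht) (hf.skew t ht) (hf.smooth_sec.slice ht)
    hb hbs (fun y hy v => hf.derivWithin_conn hI hU ht hy v) h02 h01 hi τ hz hq
  rw [hi.hs_symm (mom h ts τ (a t) (p t) z), ← two_mul, key]
  simp only [cD_mom_eq]

end

end

section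

variable {m : ℕ}

theorem laplacian_congr {h : Cn m → Cn m → Cn m → ℝ} {f f' : Cn m → ℝ} {z : Cn m}
    (hf : f =ᶠ[𝓝 z] f') : laplacian h f z = laplacian h f' z := by
  have h1 : ∀ k l, pd k (fun y => pd l f y) z = pd k (fun y => pd l f' y) z := by
    intro k l
    have : (fun y => pd l f y) =ᶠ[𝓝 z] fun y => pd l f' y := by
      filter_upwards [hf.eventuallyEq_nhds] with y hy
      rw [pd, pd, hy.fderiv_eq]
    rw [pd, pd, this.fderiv_eq]
  have h2 : ∀ n, pd n f z = pd n f' z := fun n => by rw [pd, pd, hf.fderiv_eq]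
  simp only [laplacian, h1, h2]

end

/-! ### Regularity and vanishing of the local densities -/

section

variable {m : ℕ}
  {𝔄 : Type*} [NormedRing 𝔄] [NormedSpace ℂ 𝔄] [NormedSpace ℝ 𝔄] [IsScalarTower ℝ ℂ 𝔄]
  [IsScalarTower ℂ 𝔄 𝔄] [SMulCommClass ℂ 𝔄 𝔄] [IsScalarTower ℝ 𝔄 𝔄] [SMulCommClass ℝ 𝔄 𝔄]
  {W : Type*} [NormedAddCommGroup W] [NormedSpace ℂ W] [NormedSpace ℝ W] [IsScalarTower ℝ ℂ W]
  {ρ : 𝔄 →L[ℝ] W →L[ℝ] W} {U : Set (Cn m)} {z : Cn m}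
  {h : Cn m → Cn m → Cn m → ℝ} {ts : W →L[ℝ] W →L[ℝ] 𝔄}
  {hs : 𝔄 →L[ℝ] 𝔄 →L[ℝ] ℝ} {ip : W →L[ℝ] W →L[ℝ] ℝ} {I : Set ℝ} {τ : ℝ}
  {a : ℝ → Cn m → Cn m →L[ℝ] 𝔄} {p : ℝ → Cn m → W}

theorem SmoothIn.obstrNorm (hI : IsTimeDomain I) (H : IsMetricOn h U) (ha : SmoothIn I U a)
    (hp : SmoothIn I U p) : SmoothIn I U (fun t => obstrNorm h hs ip ρ (a t) (p t)) := by
  have hα := ha.cur02 hI H.isOpen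
  have hS : SmoothIn I U (fun t => YMH.secA ρ (a t)) := ha.secA
  have hβ := hS.dM hI H.isOpen hp
  have hT : ∀ {B : ℝ → Cn m → Cn m → Cn m → ℝ}, (∀ v w, SmoothIn I U (fun t z => B t z v w)) →
      SmoothIn I U (fun t z => YMH.trG h z (B t z)) := fun hB =>
    SmoothIn.sum _ fun k _ => SmoothIn.sum _ fun l _ =>
      (SmoothIn.const_time (H.contDiffOn_ginv k l)).smul (hB _ _)
  exact (hT fun k l => hT fun k' l' => (hα _ _).bilin hs (hα _ _)).add
    (hT fun k l => (hβ _).bilin ip (hβ _))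

theorem SmoothIn.energy (hI : IsTimeDomain I) (H : IsMetricOn h U) (ha : SmoothIn I U a)
    (hp : SmoothIn I U p) :
    SmoothIn I U (fun t z => hs (YMH.mom h ts τ (a t) (p t) z) (YMH.mom h ts τ (a t) (p t) z)) :=
  (ha.mom hI H.isOpen H hp).bilin hs (ha.mom hI H.isOpen H hp)

variable {a : Cn m → Cn m →L[ℝ] 𝔄} {p : Cn m → W}

theorem obstrNorm_nonneg (H : IsMetricOn h U) (hz : z ∈ U)
    (hhs : ∃ c > (0 : ℝ), ∀ B, c * ‖B‖ ^ 2 ≤ hs B B) (hip : ∃ c > (0 : ℝ), ∀ x, c * ‖x‖ ^ 2 ≤ ip x x) :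
    0 ≤ obstrNorm h hs ip ρ a p z := by
  obtain ⟨c, hc, hlow⟩ := exists_obstrForm_lower H hz hhs hip
  rw [← obstrForm_obstr]
  exact le_trans (by positivity) (hlow.self_of_nhds _)

/-- The form is positive definite, so all coordinate components vanish; real linearity in the
directions gives the rest. -/
theorem obstr_eq_zero (H : IsMetricOn h U) (hz : z ∈ U)
    (hhs : ∃ c > (0 : ℝ), ∀ B, c * ‖B‖ ^ 2 ≤ hs B B) (hip : ∃ c > (0 : ℝ), ∀ x, c * ‖x‖ ^ 2 ≤ ip x x)
    (h0 : obstrNorm h hs ip ρ a p z ≤ 0) :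
    (∀ v w, cur02 a z v w = 0) ∧ ∀ v, dM (secA ρ a) p z v = 0 := by
  obtain ⟨c, hc, hlow⟩ := exists_obstrForm_lower H hz hhs hip
  have h1 := (hlow.self_of_nhds (obstr ρ a p z)).trans ((obstrForm_obstr a p).trans_le h0)
  have h2 : obstr ρ a p z = 0 := by
    by_contra hne
    have : 0 < c * ‖obstr ρ a p z‖ ^ 2 := by positivity
    linarith
  have h3 : ∀ k l, cur02 a z (dir k) (dir l) = 0 := fun k l =>
    congrFun (congrArg Prod.fst h2) (k, l)
  have h4 : ∀ k, dM (secA ρ a) p z (dir k) = 0 := fun k => congrFun (congrArg Prod.snd h2) k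
  refine ⟨fun v w => ?_, fun v => ?_⟩
  · rw [bilin_cur02.eq_sum]
    simp only [h3, smul_zero, Finset.sum_const_zero]
  · rw [eq_sum_crd_smul (B := dM (secA ρ a) p z) _ _ v]
    · simp only [h4, smul_zero, Finset.sum_const_zero]
    · intro v w
      simp only [dM, smul_add, cD_add_right]
      abel
    · intro c v
      simp only [dM, smul_comm _ c, cD_smul_right, ← smul_add]

theorem obstrNorm_eq_zero (h02 : ∀ v w, cur02 a z v w = 0) (h01 : ∀ v, dM (secA ρ a) p z v = 0) :
    obstrNorm h hs ip ρ a p z = 0 := by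
  simp [obstrNorm, h02, h01, trG]

end

/-! ### From patches to functions on `X` -/

section Global

variable {m r : ℕ} {X : Type*} [TopologicalSpace X] [ChartedSpace (Cn m) X]
  [IsManifold 𝓘(ℂ, Cn m) ω X] {ι : Type*} {e : OpenPartialHomeomorph X (Cn m)} {i : ι}
  {Z : HermitianBundle m r X ι} {z : Cn m} {g : RMetric m X} {τ : ℝ} {T : EReal}

theorem isSkewOn_formAt (A : UnitaryConnection Z) (e : OpenPartialHomeomorph X (Cn m)) (i : ι) :
    IsSkewOn (adjL r) (A.formAt e i) (Z.patch e i) :=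
  fun _ hz v => A.skew i _ hz.2 (chartVec e _ v)

theorem half_smul_sub_tensorStar (τ : ℝ) (p : Fib r) :
    (1 / 2 : ℂ) • ((τ : ℂ) • p - tensorStar p p p) = (1 / 2 * (τ - ‖p‖ ^ 2) : ℝ) • p := by
  rw [tensorStar, InnerProductSpace.rankOne_apply, inner_self_eq_norm_sq_to_K, ← sub_smul,
    smul_smul, ← algebraMap_smul ℂ (1 / 2 * (τ - ‖p‖ ^ 2) : ℝ) p]
  congr 1
  push_cast
  simp

theorem IsFlow.isLocalFlow {A : ℝ → UnitaryConnection Z} {φ : ℝ → ∀ x, Z.E x} (hg : IsKahler g)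
    (hflow : IsFlow g Z τ T A φ) (he : e ∈ holCharts m X) (i : ι) :
    IsLocalFlow (metricIn g e) (evalL r) (tensorL r) (adjL r) τ (timeInterval T) (Z.patch e i)
      (fun t => (A t).formAt e i) (fun t => secIn Z (φ t) e i) := by
  have H : IsKahlerOn (metricIn g e) (Z.patch e i) := isKahlerOn_patch g hg he i
  refine isLocalFlow_of_dir H.toIsMetricOn (hflow.smooth_conn e he i) (hflow.smooth_sec e he i)
    (fun t _ => isSkewOn_formAt (A t) e i) ?_ ?_
  · intro t ht z hz k
    have h1 := hflow.eq_conn t ht e he i z hz k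
    rw [dstarCurv_eq H hz, neg_neg, current_eq] at h1
    exact h1
  · intro t ht z hz
    have h1 := hflow.eq_sec t ht e he i z hz
    rw [dstarD_eq H hz, neg_neg] at h1
    exact h1.congr_deriv (congrArg _ (half_smul_sub_tensorStar τ _).symm)

theorem mem_overlap_chartAt (hz : z ∈ Z.patch e i) :
    z ∈ overlap Z (chartAt (Cn m) (e.symm z)) e (Z.indexAt (e.symm z)) i :=
  ⟨hz, mem_chart_source _ _, Z.mem_baseSet_at _⟩

theorem chartAt_mem_holCharts (x : X) : chartAt (Cn m) x ∈ holCharts m X :=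
  IsManifold.chart_mem_maximalAtlas x

/-- The norm of the obstruction as a function on `X`. -/
def obstruction (g : RMetric m X) (A : UnitaryConnection Z) (φ : ∀ x, Z.E x) (x : X) : ℝ :=
  obstrNorm (metricIn g (chartAt (Cn m) x)) (hsL r) (reInnerL r) (evalL r)
    (A.formAt (chartAt (Cn m) x) (Z.indexAt x)) (secIn Z φ (chartAt (Cn m) x) (Z.indexAt x))
    (chartAt (Cn m) x x)

/-- The definition uses a chart and frame chosen separately at each point, with no continuity in the
choice. Invariance under transitions lets one fixed patch compute the function on its whole domain,
and smoothness is read off there. -/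
theorem obstruction_symm_eq (hg : IsKahler g) (A : UnitaryConnection Z) {φ : ∀ x, Z.E x}
    (hφ : ∀ e ∈ holCharts m X, ∀ i, ContDiffOn ℝ ∞ (secIn Z φ e i) (Z.patch e i))
    (he : e ∈ holCharts m X) (hz : z ∈ Z.patch e i) :
    obstruction g A φ (e.symm z) = obstrNorm (metricIn g e) (hsL r) (reInnerL r) (evalL r)
      (A.formAt e i) (secIn Z φ e i) z := by
  have hx := chartAt_mem_holCharts (m := m) (e.symm z)
  have H : IsKahlerOn (metricIn g (chartAt (Cn m) (e.symm z)))
    (Z.patch (chartAt (Cn m) (e.symm z)) (Z.indexAt (e.symm z))) := isKahlerOn_patch g hg hx _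
  have H' : IsKahlerOn (metricIn g e)
      (overlap Z (chartAt (Cn m) (e.symm z)) e (Z.indexAt (e.symm z)) i) :=
    (isKahlerOn_patch g hg he i).mono isOpen_overlap inter_subset_left
  exact ((isTransition_overlap g hx he _ i A φ).obstrNorm_eq (mem_overlap_chartAt hz)
    (isOpen_patch Z _ _) (isHermInner_hsL r) (isHermRep_evalL r) H.toIsMetricOn H'.toIsMetricOn
    (A.smooth _ _ hx) ((A.smooth _ _ he).mono inter_subset_left) (hφ _ hx _)).symm

/-- Invariance again replaces the pointwise choice of chart and frame by a single patch. -/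
theorem energyDensity_symm_eq (hg : IsKahler g) (τ : ℝ) (A : UnitaryConnection Z) (φ : ∀ x, Z.E x)
    (he : e ∈ holCharts m X) (hz : z ∈ Z.patch e i) :
    energyDensity g τ A φ (e.symm z)
      = hsL r (mom (metricIn g e) (tensorL r) τ (A.formAt e i) (secIn Z φ e i) z)
        (mom (metricIn g e) (tensorL r) τ (A.formAt e i) (secIn Z φ e i) z) := by
  have hx := chartAt_mem_holCharts (m := m) (e.symm z)
  have H : IsKahlerOn (metricIn g (chartAt (Cn m) (e.symm z)))
    (Z.patch (chartAt (Cn m) (e.symm z)) (Z.indexAt (e.symm z))) := isKahlerOn_patch g hg hx _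
  have H' : IsKahlerOn (metricIn g e)
      (overlap Z (chartAt (Cn m) (e.symm z)) e (Z.indexAt (e.symm z)) i) :=
    (isKahlerOn_patch g hg he i).mono isOpen_overlap inter_subset_left
  have hT := isTransition_overlap g hx he (Z.indexAt (e.symm z)) i A φ
  rw [hT.energy_eq (mem_overlap_chartAt hz) (isOpen_patch Z _ _) (isHermInner_hsL r)
    (isHermRep_evalL r) H.toIsMetricOn H'.toIsMetricOn (A.smooth _ _ hx)
    ((A.smooth _ _ he).mono inter_subset_left), energyDensity,
    moment_eq H (hT.mapsTo (mem_overlap_chartAt hz))]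
  rfl

theorem mem_patch_chartAt (x : X) : chartAt (Cn m) x x ∈ Z.patch (chartAt (Cn m) x) (Z.indexAt x) := by
  refine ⟨mem_chart_target _ _, ?_⟩
  rw [mem_preimage, (chartAt (Cn m) x).left_inv (mem_chart_source _ _)]
  exact Z.mem_baseSet_at x

theorem continuousOn_of_patches {I : Set ℝ} {u : ℝ → X → ℝ} {f : OpenPartialHomeomorph X (Cn m) → ι → ℝ → Cn m → ℝ}
    (hf : ∀ e ∈ holCharts m X, ∀ i, SmoothIn I (Z.patch e i) (f e i))
    (hu : ∀ t ∈ I, ∀ e ∈ holCharts m X, ∀ i, ∀ z ∈ Z.patch e i, u t (e.symm z) = f e i t z) :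
    ContinuousOn (fun q : ℝ × X => u q.1 q.2) (I ×ˢ univ) := by
  rintro ⟨t, x⟩ ⟨ht, -⟩
  have he := chartAt_mem_holCharts (m := m) x
  set e := chartAt (Cn m) x
  set i := Z.indexAt x
  have hz : e x ∈ Z.patch e i := mem_patch_chartAt x
  have hxs : x ∈ e.source := mem_chart_source _ _
  have hV : e.source ∩ e ⁻¹' Z.patch e i ∈ 𝓝 x :=
    (e.isOpen_inter_preimage (isOpen_patch Z e i)).mem_nhds ⟨hxs, hz⟩
  have h1 : ContinuousWithinAt (fun q : ℝ × X => ((q.1, e q.2) : ℝ × Cn m))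
      (I ×ˢ (e.source ∩ e ⁻¹' Z.patch e i)) (t, x) :=
    (continuousAt_fst.prodMk ((e.continuousAt hxs).comp continuousAt_snd)).continuousWithinAt
  have h2 : ContinuousWithinAt (fun q : ℝ × X => f e i q.1 (e q.2))
      (I ×ˢ (e.source ∩ e ⁻¹' Z.patch e i)) (t, x) :=
    ContinuousWithinAt.comp (g := fun q : ℝ × Cn m => f e i q.1 q.2)
      (f := fun q : ℝ × X => (q.1, e q.2)) (x := (t, x))
      (ContDiffOn.continuousOn (hf e he i) (t, e x) ⟨ht, hz⟩) h1 fun q hq => ⟨hq.1, hq.2.2⟩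
  have h3 : ContinuousWithinAt (fun q : ℝ × X => u q.1 q.2)
      (I ×ˢ (e.source ∩ e ⁻¹' Z.patch e i)) (t, x) := by
    refine h2.congr (fun q hq => ?_) ?_
    · rw [← hu _ hq.1 e he i _ hq.2.2, e.left_inv hq.2.1]
    · rw [← hu _ ht e he i _ hz, e.left_inv hxs]
  refine h3.mono_of_mem_nhdsWithin ?_
  rw [nhdsWithin_prod_eq, nhdsWithin_univ]
  exact prod_mem_prod self_mem_nhdsWithin hV

end Global

/-! ### Preservation of holomorphic type and the conclusions on `X` -/

section Global

variable {m r : ℕ} {X : Type*} [TopologicalSpace X] [ChartedSpace (Cn m) X]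
  [IsManifold 𝓘(ℂ, Cn m) ω X] {ι : Type*} {e : OpenPartialHomeomorph X (Cn m)} {i : ι}
  {Z : HermitianBundle m r X ι} {z : Cn m} {g : RMetric m X} {τ : ℝ} {T : EReal}

/-- A nonnegative function which satisfies a parabolic inequality, with a constant which is locally
uniform, vanishes if it vanishes initially. -/
theorem le_zero_of_local_deriv_add_laplacian_le [CompactSpace X] {a b : ℝ} {u : ℝ → X → ℝ}
    (hu : ContinuousOn (fun q : ℝ × X => u q.1 q.2) (Icc a b ×ˢ univ))
    (hu0 : ∀ t ∈ Icc a b, ∀ x, 0 ≤ u t x)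
    (hloc : ∀ t ∈ Icc a b, ∀ x, ∃ C : ℝ, ∀ᶠ q : ℝ × X in 𝓝[Icc a b ×ˢ univ] (t, x),
      ∃ (e : OpenPartialHomeomorph X (Cn m))
      (h : Cn m → Cn m → Cn m → ℝ) (U : Set (Cn m)), q.2 ∈ e.source ∧ e q.2 ∈ U ∧ IsKahlerOn h U ∧
      ContDiffOn ℝ ∞ (fun z => u q.1 (e.symm z)) U ∧
      ∃ d, HasDerivWithinAt (fun s => u s q.2) d (Icc a b) q.1 ∧
        d + laplacian h (fun z => u q.1 (e.symm z)) (e q.2) ≤ C * u q.1 q.2)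
    (ha : ∀ x, u a x ≤ 0) {t : ℝ} (ht : t ∈ Icc a b) (x : X) : u t x ≤ 0 := by
  let good : ℝ → ℝ × X → Prop := fun C q => ∃ (e : OpenPartialHomeomorph X (Cn m))
      (h : Cn m → Cn m → Cn m → ℝ) (U : Set (Cn m)), q.2 ∈ e.source ∧ e q.2 ∈ U ∧ IsKahlerOn h U ∧
      ContDiffOn ℝ ∞ (fun z => u q.1 (e.symm z)) U ∧
      ∃ d, HasDerivWithinAt (fun s => u s q.2) d (Icc a b) q.1 ∧
        d + laplacian h (fun z => u q.1 (e.symm z)) (e q.2) ≤ C * u q.1 q.2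
  -- Since `u ≥ 0`, the constant may be enlarged. Finitely many local constants then combine into
  -- one, as needed for the induction over compact sets.
  have hmono : ∀ C C', C ≤ C' → ∀ q ∈ Icc a b ×ˢ (univ : Set X), good C q → good C' q := by
    rintro C C' hC q hq ⟨e, h, U, h1, h2, h3, h4, d, h5, h6⟩
    exact ⟨e, h, U, h1, h2, h3, h4, d, h5,
      h6.trans (mul_le_mul_of_nonneg_right hC (hu0 _ hq.1 _))⟩
  obtain ⟨C, hC⟩ : ∃ C, ∀ q ∈ Icc a b ×ˢ (univ : Set X), q ∈ Icc a b ×ˢ (univ : Set X) → good C q := by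
    refine (isCompact_Icc.prod isCompact_univ).induction_on
      (p := fun S => ∃ C, ∀ q ∈ S, q ∈ Icc a b ×ˢ (univ : Set X) → good C q)
      ⟨0, fun q hq => hq.elim⟩ ?_ ?_ ?_
    · rintro S S' hS ⟨C, hC⟩
      exact ⟨C, fun q hq => hC q (hS hq)⟩
    · rintro S S' ⟨C, hC⟩ ⟨C', hC'⟩
      refine ⟨max C C', fun q hq hq' => hq.elim (fun h => ?_) fun h => ?_⟩
      · exact hmono _ _ (le_max_left _ _) q hq' (hC q h hq')
      · exact hmono _ _ (le_max_right _ _) q hq' (hC' q h hq')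
    · rintro ⟨s, y⟩ hq
      obtain ⟨C, hC⟩ := hloc s hq.1 y
      exact ⟨_, hC, C, fun q h _ => h⟩
  have := le_mul_exp_of_deriv_add_laplacian_le (C := C) (M := 0) hu
    (fun s hs y => hC (s, y) ⟨Ioc_subset_Icc_self hs, mem_univ _⟩
      ⟨Ioc_subset_Icc_self hs, mem_univ _⟩) ha ht x
  simpa using this

theorem Icc_subset_timeInterval {s t : ℝ} (hs : s ∈ timeInterval T) (ht : t ∈ timeInterval T) :
    Icc s t ⊆ timeInterval T := fun _ hu =>
  ⟨hs.1.trans hu.1, lt_of_le_of_lt (EReal.coe_le_coe_iff.2 hu.2) ht.2⟩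

variable {A : ℝ → UnitaryConnection Z} {φ : ℝ → ∀ x, Z.E x}

theorem IsFlow.contDiffOn_secIn (hflow : IsFlow g Z τ T A φ) {t : ℝ} (ht : t ∈ timeInterval T) :
    ∀ e ∈ holCharts m X, ∀ i, ContDiffOn ℝ ∞ (secIn Z (φ t) e i) (Z.patch e i) := fun e he i =>
  have h1 : SmoothIn (timeInterval T) (Z.patch e i) (fun t => secIn Z (φ t) e i) :=
    hflow.smooth_sec e he i
  h1.slice ht

theorem IsFlow.obstruction_symm_eq (hg : IsKahler g) (hflow : IsFlow g Z τ T A φ) {t : ℝ}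
    (ht : t ∈ timeInterval T) (he : e ∈ holCharts m X) (hz : z ∈ Z.patch e i) :
    obstruction g (A t) (φ t) (e.symm z) = obstrNorm (metricIn g e) (hsL r) (reInnerL r) (evalL r)
      ((A t).formAt e i) (secIn Z (φ t) e i) z :=
  YMH.obstruction_symm_eq hg (A t) (hflow.contDiffOn_secIn ht) he hz

theorem IsFlow.smoothIn_obstrNorm (hg : IsKahler g) (hflow : IsFlow g Z τ T A φ)
    (he : e ∈ holCharts m X) (i : ι) : SmoothIn (timeInterval T) (Z.patch e i) (fun t =>
      obstrNorm (metricIn g e) (hsL r) (reInnerL r) (evalL r)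
        ((A t).formAt e i) (secIn Z (φ t) e i)) :=
  have H : IsKahlerOn (metricIn g e) (Z.patch e i) := isKahlerOn_patch g hg he i
  SmoothIn.obstrNorm (isTimeDomain_timeInterval T) H.toIsMetricOn
    (hflow.smooth_conn e he i) (hflow.smooth_sec e he i)

theorem IsFlow.eventually_obstruction_le (hg : IsKahler g) (hflow : IsFlow g Z τ T A φ) {s t : ℝ}
    (ht : t ∈ timeInterval T) (hs : s ∈ Icc 0 t) (x : X) :
    ∃ C : ℝ, ∀ᶠ q : ℝ × X in 𝓝[Icc 0 t ×ˢ univ] (s, x),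
      ∃ (e : OpenPartialHomeomorph X (Cn m))
      (h : Cn m → Cn m → Cn m → ℝ) (U : Set (Cn m)), q.2 ∈ e.source ∧ e q.2 ∈ U ∧ IsKahlerOn h U ∧
      ContDiffOn ℝ ∞ (fun z => obstruction g (A q.1) (φ q.1) (e.symm z)) U ∧
      ∃ d, HasDerivWithinAt (fun s => obstruction g (A s) (φ s) q.2) d (Icc 0 t) q.1 ∧
        d + laplacian h (fun z => obstruction g (A q.1) (φ q.1) (e.symm z)) (e q.2)
          ≤ C * obstruction g (A q.1) (φ q.1) q.2 := by
  have h0 : (0 : ℝ) ∈ timeInterval T := ⟨le_rfl, lt_of_le_of_lt (EReal.coe_le_coe_iff.2 ht.1) ht.2⟩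
  have hsub := Icc_subset_timeInterval h0 ht
  have he := chartAt_mem_holCharts (m := m) x
  set e := chartAt (Cn m) x
  set i := Z.indexAt x
  have hz : e x ∈ Z.patch e i := mem_patch_chartAt x
  have hxs : x ∈ e.source := mem_chart_source _ _
  have H : IsKahlerOn (metricIn g e) (Z.patch e i) := isKahlerOn_patch g hg he i
  obtain ⟨C, hC⟩ := (hflow.isLocalFlow hg he i).exists_obstrNorm_le
    (isTimeDomain_timeInterval T) H (isHermRep_evalL r) (isHermInner_hsL r).hs_symm
    reInnerL_symm (exists_hsL_lower r) (exists_reInnerL_lower r) (hsub hs) hz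
  refine ⟨C, ?_⟩
  have hV : ∀ᶠ q : ℝ × X in 𝓝[Icc 0 t ×ˢ univ] (s, x), q.1 ∈ Icc 0 t ∧
      q.2 ∈ e.source ∩ e ⁻¹' Z.patch e i := by
    have h1 : e.source ∩ e ⁻¹' Z.patch e i ∈ 𝓝 x :=
      (e.isOpen_inter_preimage (isOpen_patch Z e i)).mem_nhds ⟨hxs, hz⟩
    rw [nhdsWithin_prod_eq, nhdsWithin_univ]
    exact prod_mem_prod self_mem_nhdsWithin h1
  have ht' : Tendsto (fun q : ℝ × X => ((q.1, e q.2) : ℝ × Cn m)) (𝓝[Icc 0 t ×ˢ univ] (s, x))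
      (𝓝[timeInterval T ×ˢ Z.patch e i] (s, e x)) := by
    refine tendsto_nhdsWithin_iff.2 ⟨?_, ?_⟩
    · exact ((continuousAt_fst (p := (s, x))).prodMk
        (ContinuousAt.comp (x := (s, x)) (e.continuousAt hxs) continuousAt_snd)).tendsto.mono_left
          nhdsWithin_le_nhds
    · filter_upwards [hV] with q hq using ⟨hsub hq.1, hq.2.2⟩
  filter_upwards [hV, ht'.eventually hC] with q hq hCq
  obtain ⟨d, hd, hle⟩ := hCq
  have hqI := hsub hq.1
  have e1 : ∀ s ∈ timeInterval T, ∀ y ∈ Z.patch e i, obstruction g (A s) (φ s) (e.symm y)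
      = obstrNorm (metricIn g e) (hsL r) (reInnerL r) (evalL r) ((A s).formAt e i)
        (secIn Z (φ s) e i) y := fun s hs y hy => hflow.obstruction_symm_eq hg hs he hy
  have e2 : ∀ s ∈ timeInterval T, obstruction g (A s) (φ s) q.2
      = obstrNorm (metricIn g e) (hsL r) (reInnerL r) (evalL r) ((A s).formAt e i)
        (secIn Z (φ s) e i) (e q.2) := fun s hs => by
    rw [← e1 s hs _ hq.2.2, e.left_inv hq.2.1]
  refine ⟨e, metricIn g e, Z.patch e i, hq.2.1, hq.2.2, H,
    ((hflow.smoothIn_obstrNorm hg he i).slice hqI).congr fun y hy => e1 _ hqI y hy, d,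
    (hd.mono hsub).congr (fun s hs => e2 s (hsub hs)) (e2 _ hqI), ?_⟩
  rw [e2 _ hqI]
  refine le_trans (le_of_eq ?_) hle
  congr 1
  apply laplacian_congr
  filter_upwards [(isOpen_patch Z e i).mem_nhds hq.2.2] with y hy using e1 _ hqI y hy

theorem obstruction_nonneg (hg : IsKahler g) (A : UnitaryConnection Z) (φ : ∀ x, Z.E x) (x : X) :
    0 ≤ obstruction g A φ x :=
  have H : IsKahlerOn (metricIn g (chartAt (Cn m) x)) (Z.patch (chartAt (Cn m) x) (Z.indexAt x)) :=
    isKahlerOn_patch g hg (chartAt_mem_holCharts x) _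
  obstrNorm_nonneg H.toIsMetricOn (mem_patch_chartAt x) (exists_hsL_lower r)
    (exists_reInnerL_lower r)

theorem IsGaugedHolomorphic.obstruction_eq_zero {A : UnitaryConnection Z} {φ : ∀ x, Z.E x}
    (h0 : IsGaugedHolomorphic A φ) (x : X) : obstruction g A φ x = 0 := by
  have h02 := h0.curv02_eq _ (chartAt_mem_holCharts (m := m) x) _ _ (mem_patch_chartAt x)
  have h01 := h0.dbar_eq _ (chartAt_mem_holCharts (m := m) x) _ _ (mem_patch_chartAt x)
  simp only [dbarSec_eq] at h01
  exact obstrNorm_eq_zero h02 h01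

/-- The gradient flow preserves gauged holomorphic maps. -/
theorem IsFlow.eq_zero_of_isGaugedHolomorphic [CompactSpace X] (hg : IsKahler g)
    (hflow : IsFlow g Z τ T A φ) (h0 : IsGaugedHolomorphic (A 0) (φ 0)) {t : ℝ}
    (ht : t ∈ timeInterval T) (he : e ∈ holCharts m X) (hz : z ∈ Z.patch e i) :
    (∀ v w, cur02 ((A t).formAt e i) z v w = 0) ∧
      ∀ v, dM (secA (evalL r) ((A t).formAt e i)) (secIn Z (φ t) e i) z v = 0 := by
  have h0I : (0 : ℝ) ∈ timeInterval T := ⟨le_rfl, lt_of_le_of_lt (EReal.coe_le_coe_iff.2 ht.1) ht.2⟩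
  have hsub := Icc_subset_timeInterval h0I ht
  have key : ∀ x : X, obstruction g (A t) (φ t) x ≤ 0 := by
    refine le_zero_of_local_deriv_add_laplacian_le (m := m) (a := 0) (b := t)
      (u := fun s => obstruction g (A s) (φ s)) ?_ ?_ ?_ ?_ (right_mem_Icc.2 ht.1)
    · exact (continuousOn_of_patches (fun e he i => hflow.smoothIn_obstrNorm hg he i)
        fun s hs e he i y hy => hflow.obstruction_symm_eq hg hs he hy).mono
          (prod_mono_left hsub)
    · exact fun s _ x => obstruction_nonneg hg (A s) (φ s) x
    · exact fun s hs x => hflow.eventually_obstruction_le hg ht hs x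
    · exact fun x => (h0.obstruction_eq_zero x).le
  have H' : IsKahlerOn (metricIn g e) (Z.patch e i) := isKahlerOn_patch g hg he i
  refine obstr_eq_zero H'.toIsMetricOn hz (exists_hsL_lower r) (exists_reInnerL_lower r) ?_
  rw [← hflow.obstruction_symm_eq hg ht he hz]
  exact key _

theorem IsFlow.smoothIn_energy (hg : IsKahler g) (hflow : IsFlow g Z τ T A φ)
    (he : e ∈ holCharts m X) (i : ι) : SmoothIn (timeInterval T) (Z.patch e i) (fun t z =>
      hsL r (mom (metricIn g e) (tensorL r) τ ((A t).formAt e i) (secIn Z (φ t) e i) z)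
        (mom (metricIn g e) (tensorL r) τ ((A t).formAt e i) (secIn Z (φ t) e i) z)) :=
  have H : IsKahlerOn (metricIn g e) (Z.patch e i) := isKahlerOn_patch g hg he i
  SmoothIn.energy (isTimeDomain_timeInterval T) H.toIsMetricOn
    (hflow.smooth_conn e he i) (hflow.smooth_sec e he i)

theorem IsFlow.contMDiff_energyDensity (hg : IsKahler g) (hflow : IsFlow g Z τ T A φ) {t : ℝ}
    (ht : t ∈ timeInterval T) :
    ContMDiff 𝓘(ℝ, Cn m) 𝓘(ℝ, ℝ) ∞ (energyDensity g τ (A t) (φ t)) := by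
  intro x
  have he := chartAt_mem_holCharts (m := m) x
  set e := chartAt (Cn m) x
  set i := Z.indexAt x
  have hz : e x ∈ Z.patch e i := mem_patch_chartAt x
  have hxs : x ∈ e.source := mem_chart_source _ _
  have h1 := ((hflow.smoothIn_energy hg he i).slice ht).contDiffAt
    ((isOpen_patch Z e i).mem_nhds hz)
  have h2 := h1.contMDiffAt.comp x
    (contMDiffAt_of_mem_maximalAtlas (mem_maximalAtlas_of_holCharts he) hxs)
  refine h2.congr_of_eventuallyEq ?_
  filter_upwards [(e.isOpen_inter_preimage (isOpen_patch Z e i)).mem_nhds ⟨hxs, hz⟩] with y hy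
  rw [Function.comp_apply, ← energyDensity_symm_eq hg τ (A t) (φ t) he hy.2, e.left_inv hy.1]

theorem covEnd_congr {a : Cn m → Cn m →L[ℝ] EndF r} {B B' : Cn m → EndF r} (hB : B =ᶠ[𝓝 z] B')
    (v : Cn m) : covEnd a B z v = covEnd a B' z v := by
  rw [covEnd, covEnd, hB.fderiv_eq, hB.eq_of_nhds]

theorem mom_apply_section (h : Cn m → Cn m → Cn m → ℝ) (a : Cn m → Cn m →L[ℝ] EndF r)
    (p : Cn m → Fib r) : evalL r (mom h (tensorL r) τ a p z) (p z)
      = -((Complex.I / 2 * ((‖p z‖ ^ 2 - τ : ℝ) : ℂ)) • p z - lam h a z (p z)) := by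
  have h1 : tensorStar (p z) (p z) (p z) = ((‖p z‖ ^ 2 : ℝ) : ℂ) • p z := by
    rw [tensorStar, InnerProductSpace.rankOne_apply, inner_self_eq_norm_sq_to_K]
    norm_cast
  have h2 : evalL r (mom h (tensorL r) τ a p z) (p z) = lam h a z (p z)
      - (Complex.I / 2) • (tensorStar (p z) (p z) (p z) - (τ : ℂ) • p z) := rfl
  rw [h2, h1]
  push_cast
  module

theorem IsFlow.exists_energyDensity_eq [CompactSpace X] (hg : IsKahler g)
    (hflow : IsFlow g Z τ T A φ) (h0 : IsGaugedHolomorphic (A 0) (φ 0)) {t : ℝ}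
    (ht : t ∈ timeInterval T) (he : e ∈ holCharts m X) (hz : z ∈ Z.patch e i) :
    ∃ dt : ℝ,
      HasDerivWithinAt (fun s => energyDensity g τ (A s) (φ s) (e.symm z)) dt (timeInterval T) t ∧
      dt + laplacian (metricIn g e) (fun y => energyDensity g τ (A t) (φ t) (e.symm y)) z =
        -2 * normSqCovEnd (metricIn g e) ((A t).formAt e i)
            (fun y => lamCurv (metricIn g e) ((A t).formAt e i) y
              - (Complex.I / 2) • tensorStar (secIn Z (φ t) e i y) (secIn Z (φ t) e i y)) z
        - 2 * ‖(Complex.I / 2 * ((‖secIn Z (φ t) e i z‖ ^ 2 - τ : ℝ) : ℂ)) • secIn Z (φ t) e i z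
            - lamCurv (metricIn g e) ((A t).formAt e i) z (secIn Z (φ t) e i z)‖ ^ 2 := by
  have H : IsKahlerOn (metricIn g e) (Z.patch e i) := isKahlerOn_patch g hg he i
  obtain ⟨d, hd, hde⟩ := (hflow.isLocalFlow hg he i).exists_energy_eq (isTimeDomain_timeInterval T) H
    (isHermRep_evalL r) (isHermInner_hsL r) ht
    (fun y hy => (hflow.eq_zero_of_isGaugedHolomorphic hg h0 ht he hy).1)
    (fun y hy => (hflow.eq_zero_of_isGaugedHolomorphic hg h0 ht he hy).2) hz
  refine ⟨d, hd.congr (fun s _ => energyDensity_symm_eq hg τ (A s) (φ s) he hz)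
    (energyDensity_symm_eq hg τ (A t) (φ t) he hz), ?_⟩
  have e1 : laplacian (metricIn g e) (fun y => energyDensity g τ (A t) (φ t) (e.symm y)) z
      = laplacian (metricIn g e) (fun y =>
        hsL r (mom (metricIn g e) (tensorL r) τ ((A t).formAt e i) (secIn Z (φ t) e i) y)
          (mom (metricIn g e) (tensorL r) τ ((A t).formAt e i) (secIn Z (φ t) e i) y)) z := by
    apply laplacian_congr
    filter_upwards [(isOpen_patch Z e i).mem_nhds hz] with y hy
      using energyDensity_symm_eq hg τ (A t) (φ t) he hy
  have e2 : (fun y => lamCurv (metricIn g e) ((A t).formAt e i) y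
        - (Complex.I / 2) • tensorStar (secIn Z (φ t) e i y) (secIn Z (φ t) e i y))
      =ᶠ[𝓝 z] (fun y => lam (metricIn g e) ((A t).formAt e i) y
        - (Complex.I / 2) • tensorL r (secIn Z (φ t) e i y) (secIn Z (φ t) e i y)) := by
    filter_upwards [(isOpen_patch Z e i).mem_nhds hz] with y hy
    rw [lamCurv_eq H hy]
    rfl
  rw [e1, hde, mom_apply_section, reInnerL_apply, reInner_self, norm_neg, lamCurv_eq H hz]
  simp only [normSqCovEnd, covEnd_congr e2]
  rfl

theorem normSqCovEnd_nonneg {U : Set (Cn m)} {h : Cn m → Cn m → Cn m → ℝ} (H : IsMetricOn h U)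
    (hz : z ∈ U) (a : Cn m → Cn m →L[ℝ] EndF r) (B : Cn m → EndF r) : 0 ≤ normSqCovEnd h a B z :=
  sum_ginv_nonneg H hz (hsL r) (fun B => (sq_nonneg _).trans (norm_sq_le_hsInner B))
    fun k => covEnd a B z (dir k)

/-- The right side of the evolution equation is nonpositive, so the maximum principle applies on
`[s, t]` with `C = 0` and with the supremum at time `s` as initial bound. -/
theorem IsFlow.antitoneOn_iSup [CompactSpace X] (hg : IsKahler g)
    (hflow : IsFlow g Z τ T A φ) (h0 : IsGaugedHolomorphic (A 0) (φ 0)) :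
    AntitoneOn (fun t => ⨆ x, energyDensity g τ (A t) (φ t) x) (timeInterval T) := by
  intro s hs t ht hst
  have hsub := Icc_subset_timeInterval hs ht
  -- If `X` is empty, both suprema take the default value `0`.
  rcases isEmpty_or_nonempty X with hX | hX
  · simp [Real.iSup_of_isEmpty]
  have hbdd : BddAbove (range (energyDensity g τ (A s) (φ s))) :=
    (isCompact_range (hflow.contMDiff_energyDensity hg hs).continuous).bddAbove
  refine ciSup_le fun x => ?_
  have := le_mul_exp_of_deriv_add_laplacian_le (m := m) (a := s) (b := t) (C := 0)
    (M := ⨆ x, energyDensity g τ (A s) (φ s) x) (u := fun s => energyDensity g τ (A s) (φ s))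
    ?_ ?_ (fun x => le_ciSup hbdd x) (right_mem_Icc.2 hst) x
  · simpa using this
  · exact (continuousOn_of_patches (fun e he i => hflow.smoothIn_energy hg he i)
        fun s _ e he i y hy => energyDensity_symm_eq hg τ (A s) (φ s) he hy).mono
          (prod_mono_left hsub)
  · intro u hu x
    have huI := hsub (Ioc_subset_Icc_self hu)
    have he := chartAt_mem_holCharts (m := m) x
    have hz : chartAt (Cn m) x x ∈ Z.patch (chartAt (Cn m) x) (Z.indexAt x) := mem_patch_chartAt x
    have H : IsKahlerOn (metricIn g (chartAt (Cn m) x))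
      (Z.patch (chartAt (Cn m) x) (Z.indexAt x)) := isKahlerOn_patch g hg he _
    obtain ⟨d, hd, hde⟩ := hflow.exists_energyDensity_eq hg h0 huI he hz
    refine ⟨chartAt (Cn m) x, _, _, mem_chart_source _ _, hz, H,
      ((hflow.smoothIn_energy hg he _).slice huI).congr
        fun y hy => energyDensity_symm_eq hg τ (A u) (φ u) he hy, d, ?_, ?_⟩
    · rw [(chartAt (Cn m) x).left_inv (mem_chart_source _ _)] at hd
      exact hd.mono hsub
    · rw [hde, zero_mul]
      have h1 := normSqCovEnd_nonneg H.toIsMetricOn hz ((A u).formAt (chartAt (Cn m) x) (Z.indexAt x))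
        (fun y => lamCurv (metricIn g (chartAt (Cn m) x))
            ((A u).formAt (chartAt (Cn m) x) (Z.indexAt x)) y
          - (Complex.I / 2) • tensorStar (secIn Z (φ u) (chartAt (Cn m) x) (Z.indexAt x) y)
            (secIn Z (φ u) (chartAt (Cn m) x) (Z.indexAt x) y))
      have h2 : ∀ c : ℝ, 0 ≤ c ^ 2 := sq_nonneg
      linarith [h2 ‖(Complex.I / 2 *
        ((‖secIn Z (φ u) (chartAt (Cn m) x) (Z.indexAt x) (chartAt (Cn m) x x)‖ ^ 2 - τ : ℝ) : ℂ)) •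
          secIn Z (φ u) (chartAt (Cn m) x) (Z.indexAt x) (chartAt (Cn m) x x)
            - lamCurv (metricIn g (chartAt (Cn m) x))
            ((A u).formAt (chartAt (Cn m) x) (Z.indexAt x)) (chartAt (Cn m) x x)
              (secIn Z (φ u) (chartAt (Cn m) x) (Z.indexAt x) (chartAt (Cn m) x x))‖]

end Global

end YMH

end

theorem lemma2p6 {m r : ℕ} {X : Type*} [TopologicalSpace X] [T2Space X] [CompactSpace X]
    [ChartedSpace (YMH.Cn m) X] [IsManifold 𝓘(ℂ, YMH.Cn m) ω X]
    (g : YMH.RMetric m X) (hg : YMH.IsKahler g)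
    {ι : Type*} (Z : YMH.HermitianBundle m r X ι) (τ : ℝ) (T : EReal)
    (A : ℝ → YMH.UnitaryConnection Z) (φ : ℝ → ∀ x, Z.E x)
    (hflow : YMH.IsFlow g Z τ T A φ) (h0 : YMH.IsGaugedHolomorphic (A 0) (φ 0)) :
    (∀ t ∈ YMH.timeInterval T,
      ContMDiff 𝓘(ℝ, YMH.Cn m) 𝓘(ℝ, ℝ) ∞ (YMH.energyDensity g τ (A t) (φ t))) ∧
    (∀ t ∈ YMH.timeInterval T, ∀ e ∈ YMH.holCharts m X, ∀ i, ∀ z ∈ Z.patch e i,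
      ∃ dt : ℝ,
        HasDerivWithinAt (fun s => YMH.energyDensity g τ (A s) (φ s) (e.symm z)) dt
          (YMH.timeInterval T) t ∧
        dt + YMH.laplacian (YMH.metricIn g e)
            (fun y => YMH.energyDensity g τ (A t) (φ t) (e.symm y)) z =
          -2 * YMH.normSqCovEnd (YMH.metricIn g e) ((A t).formAt e i)
              (fun y => YMH.lamCurv (YMH.metricIn g e) ((A t).formAt e i) y
                - (Complex.I / 2) • YMH.tensorStar (YMH.secIn Z (φ t) e i y)
                    (YMH.secIn Z (φ t) e i y)) z
          - 2 * ‖(Complex.I / 2 * ((‖YMH.secIn Z (φ t) e i z‖ ^ 2 - τ : ℝ) : ℂ)) •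
                YMH.secIn Z (φ t) e i z
              - YMH.lamCurv (YMH.metricIn g e) ((A t).formAt e i) z
                  (YMH.secIn Z (φ t) e i z)‖ ^ 2) ∧
    AntitoneOn (fun t => ⨆ x, YMH.energyDensity g τ (A t) (φ t) x) (YMH.timeInterval T) := by
  exact ⟨fun t ht => hflow.contMDiff_energyDensity hg ht,
    fun t ht e he i z hz => hflow.exists_energyDensity_eq hg h0 ht he hz,
    hflow.antitoneOn_iSup hg h0⟩
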